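/- **Setting.** Let $F$ be a probability distribution on $\mathbb R$ (identified with its CDF), $F^{-1}(\alpha)=\inf\{x: F(x)\ge\alpha\}$ for $\alpha\in(0,1]$ and $F^{-1}(0)=\inf\{x:F(x)>0\}$ (values in $[-\infty,\infty]$). For $0\le\alpha_1\le\alpha_2\le1$ put $S=S(F)=\{x\in\mathbb R: F^{-1}(\alpha_1)\le x\le F^{-1}(\alpha_2)\}$ and $g(F)=\mathbb E[X\mid X\in S]$, $X\sim F$, read as $F^{-1}(\alpha_1)$ if $\alpha_1=\alpha_2$. Unobserved points $X_1,\dots,X_n\sim F$ are i.i.d.; an observation of $X_i$ is $X_i$ plus independent $\mathcal N(0,1)$ noise. For $v\in\mathbb R^n$ let $v_{(k)}$ be its $k$-th smallest entry, $v_{(0)}:=v_{(1)}$, $q_a(v)=v_{(\lfloor\alpha_a n\rfloor)}$ for $a=1,2$, and $S_n(v)=\{i:q_1(v)\le v_i\le q_2(v)\}$. An estimator $\hat G$ is $(\varepsilon,\delta)$-PAC for $g(F)$ if $\mathbb P(|\hat G-g(F)|>\varepsilon)\le\delta$. **Offline estimator.** $G_{n,m}=|S_n(\mu)|^{-1}\sum_{i\in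 S_n(\mu)}\mu_i$, where $\mu_i$ is the mean of $m$ observations of $X_i$. **Algorithm (inputs $n,m,\delta,\alpha_1,\alpha_2$).** Let $A_1=\{1,\dots,n\}$, $t_0=0$. In round $r=1,2,\dots$ let $b_r=2^{-r}$ and $t_r=\min(m,\lceil 8b_r^{-2}\log(16n\log(m)/\delta)\rceil)$ ($t_r=1$ if $m=1$); pull each $i\in A_r$ another $t_r-t_{r-1}$ times; let $\hat\mu_i$ be the mean of all observations of $X_i$ so far; let $A_{r+1}$ be the set of $i\in A_r$ with $|\hat\mu_i-q_1(\hat\mu)|\le b_r$ or $|\hat\mu_i-q_2(\hat\mu)|\le b_r$; stop after the first round with $t_r=m$. Put $\hat S_n=S_n(\hat\mu)$. If $\alpha_1=\alpha_2$ return the average of $\hat\mu_i$ over $i\in\hat S_n$; otherwise take one fresh observation of each $X_i$, $i\in\hat S_n$, and return their average. $M$ is the total number of observations taken. **Assumptions**, with constants $t_0,c_0,c_1,c_2,\beta>0$. *Mean* ($\alpha_1=0,\alpha_2=1$): $\mathrm{Var}(X)\le c_0$. *Otherwise*: $\eta=F^{-1}(\alpha)$ is finite for $\alpha\in\{\alpha_1,\alpha_2\}$;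 if $0<\alpha<1$, then $F$ is twice differentiable with $F'\ge c_1$, $|F''|\le c_2$ on $(\eta-t_0,\eta+t_0)$; if $\alpha=1$, then $c_1t^\beta\le \mathbb P(X>\eta-t)\le c_2t^\beta$ for $0\le t\le t_0$; if $\alpha=0$, then $c_1t^\beta\le\mathbb P(X<\eta+t)\le c_2t^\beta$ for $0\le t\le t_0$; and $\mathbb E X^2\le c_0$ if $\alpha_1\ne\alpha_2$. **Choice of $n,m$**, with constants $A\le B$; write $x\sim s$ for $As\le x\le Bs$. Mean: $n\sim\delta^{-1}\varepsilon^{-2}$, $1\le m\le B$. Quantile ($\alpha_1=\alpha_2\in(0,1)$): $n\sim\varepsilon^{-2}\log(2/\delta)$, $m\sim\varepsilon^{-1}$. Maximum or minimum ($\alpha_1=\alpha_2\in\{0,1\}$): $n\sim\varepsilon^{-\beta}\log(2/\delta)$, $m\sim\varepsilon^{-2}\log(2n/\delta)$. All other $\alpha_1<\alpha_2$: $n\sim\delta^{-1}\varepsilon^{-2}$, $m\sim\varepsilon^{-1}\log\varepsilon^{-1}$. **Theorem.** Let $0\le\alpha_1\le\alpha_2\le1$ and fix the constants $t_0,c_0,c_1,c_2,\beta$.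 There is $A>0$ such that for every $B\ge A$ there are $C>0$, $\varepsilon_0\in(0,1)$ and $D:\mathbb R\to\mathbb R$ such that, for every $F$ satisfying the assumptions, every $0<\varepsilon<\varepsilon_0$, $0<\delta<1$ and every $n,m$ chosen as above: 1. $G_{n,m}$ is $(\varepsilon/2,\delta/2)$-PAC for $g(F)$, and the output of the algorithm is $(\varepsilon,\delta)$-PAC for $g(F)$. 2. If $(\alpha_1,\alpha_2)\ne(0,1)$, then $$\mathbb E[M]\le C\,n\,\mathbb E\Big[\min\Big(m,\frac{\log(n/\delta)}{\mathrm{dist}(X,\partial S)^2}\Big)\Big].$$ If $(\alpha_1,\alpha_2)=(0,1)$, then $\mathbb E[M]\le C\,n$; and if moreover $\partial S\neq\emptyset$, the displayed bound holds with $C$ replaced by a constant $K$ that may also depend on $F$ (but not on $\varepsilon,\delta,n,m$). 3. $\mathbb E[M]\le D(\delta)\,\varepsilon^{-2}$ for the mean; $\mathbb E[M]\le D(\delta)\,\varepsilon^{-2.5}\log(1/\varepsilon)$ for $\alpha_1=\alpha_2\in(0,1)$ (median, quantiles); $\mathbb E[M]\le D(\delta)\,\varepsilon^{-\max(\beta,2)}\log(1/\varepsilon)^{k}$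 for the maximum and minimum, with $k=1$ if $\beta\neq2$ and $k=2$ if $\beta=2$; and $\mathbb E[M]\le D(\delta)\,\varepsilon^{-2.5}\log^2(1/\varepsilon)$ for the trimmed mean ($0<\alpha_1<\alpha_2<1$). -/

import Mathlib

open MeasureTheory ProbabilityTheory
open scoped ENNReal

noncomputable section

/-! ### Indicator-based functionals of a distribution on the real line -/

/-- The quantile `F⁻¹(α) = inf {x : F(x) ≥ α}` of the distribution `F`, in `[-∞, ∞]`.  The condition
`0 < F(x)` only matters for `α = 0`, where it makes `F⁻¹(0)` the left end of the support (the
essential infimum).  `F⁻¹(1)` is the right end of the support. -/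
def quantile (F : Measure ℝ) (α : ℝ) : EReal :=
  sInf ((fun x : ℝ => (x : EReal)) '' {x : ℝ | 0 < cdf F x ∧ α ≤ cdf F x})

/-- The set `S(F) = [F⁻¹(α₁), F⁻¹(α₂)]`. -/
def relevantSet (F : Measure ℝ) (α₁ α₂ : ℝ) : Set ℝ :=
  {x : ℝ | quantile F α₁ ≤ (x : EReal) ∧ (x : EReal) ≤ quantile F α₂}

open Classical in
/-- The indicator-based functional `g(F) = E[X | X ∈ S(F)]`.  If `α₁ = α₂` then `S(F)` is the single
point `F⁻¹(α₁)`, and `g(F)` is that point. -/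
def functional (F : Measure ℝ) (α₁ α₂ : ℝ) : ℝ :=
  if α₁ = α₂ then (quantile F α₁).toReal else ∫ x, x ∂(cond F (relevantSet F α₁ α₂))

/-! ### The observation model -/

/-- The randomness: the latent points `X i`, the noise `Z i j` of the `j`-th observation of point
`i` (`j < m`), and the noise `W i` of one additional fresh observation of point `i`. -/
abbrev SampleSpace (n m : ℕ) : Type :=
  (Fin n → ℝ) × (Fin n → Fin m → ℝ) × (Fin n → ℝ)

/-- All coordinates are independent; `X i ∼ F`, and all noise variables are standard normal. -/
def sampleLaw (F : Measure ℝ) (n m : ℕ) : Measure (SampleSpace n m) :=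
  (Measure.pi fun _ : Fin n => F).prod
    ((Measure.pi fun _ : Fin n => Measure.pi fun _ : Fin m => gaussianReal 0 1).prod
      (Measure.pi fun _ : Fin n => gaussianReal 0 1))

/-- The noisy observations `Y i j = X i + Z i j`. -/
def observation {n m : ℕ} (ω : SampleSpace n m) (i : Fin n) (j : Fin m) : ℝ :=
  ω.1 i + ω.2.1 i j

/-- The fresh observation of point `i`. -/
def freshObservation {n m : ℕ} (ω : SampleSpace n m) (i : Fin n) : ℝ :=
  ω.1 i + ω.2.2 i

/-- An estimator `G` is an `(ε, δ)`-PAC approximation of the number `g`. -/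
def IsPAC {Ω : Type*} [MeasurableSpace Ω] (P : Measure Ω) (G : Ω → ℝ) (g ε δ : ℝ) : Prop :=
  P {ω | ε < |G ω - g|} ≤ ENNReal.ofReal δ

/-! ### Order statistics, empirical means and the offline estimator -/

open Classical in
/-- The `k`-th smallest entry of `v` (`k = 1, …, n`), with the convention that the `0`-th one is the
smallest one. -/
def orderStat {n : ℕ} (v : Fin n → ℝ) (k : ℕ) : ℝ :=
  sInf {x : ℝ | max 1 k ≤ (Finset.univ.filter fun i => v i ≤ x).card}

/-- The empirical `α`-quantile `v_(⌊α n⌋)`. -/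
def empQuantile {n : ℕ} (v : Fin n → ℝ) (α : ℝ) : ℝ :=
  orderStat v ⌊α * (n : ℝ)⌋₊

open Classical in
/-- The indices `i` with `v_(⌊α₁ n⌋) ≤ v i ≤ v_(⌊α₂ n⌋)`. -/
def relevantIndices {n : ℕ} (v : Fin n → ℝ) (α₁ α₂ : ℝ) : Finset (Fin n) :=
  Finset.univ.filter fun i => empQuantile v α₁ ≤ v i ∧ v i ≤ empQuantile v α₂

/-- The average of `v` over a set of indices. -/
def average {n : ℕ} (s : Finset (Fin n)) (v : Fin n → ℝ) : ℝ :=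
  (∑ i ∈ s, v i) / (s.card : ℝ)

open Classical in
/-- The mean of the first `N i` observations of each point `i`. -/
def empMean {n m : ℕ} (Y : Fin n → Fin m → ℝ) (N : Fin n → ℕ) (i : Fin n) : ℝ :=
  (∑ j ∈ Finset.univ.filter (fun j : Fin m => (j : ℕ) < N i), Y i j) / (N i : ℝ)

/-- The offline estimator `G_{n,m}`: every point is observed `m` times. -/
def offlineEstimator (α₁ α₂ : ℝ) {n m : ℕ} (Y : Fin n → Fin m → ℝ) : ℝ :=
  average (relevantIndices (empMean Y fun _ => m) α₁ α₂) (empMean Y fun _ => m)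

/-! ### The elimination algorithm -/

/-- The confidence width `b_r = 2⁻ʳ`. -/
def width (r : ℕ) : ℝ := 2⁻¹ ^ r

/-- The cumulative number `t_r = min(m, ⌈8 b_r⁻² log(16 n log(m) / δ)⌉)` of pulls of a point that is
still active in round `r ≥ 1`, and `t_0 = 0`.  For `m ≥ 2` the ceiling is at least `1`, so that the
`max` has no effect; for `m = 1` it makes the single allowed pull happen in round `1`. -/
def pullTarget (n m : ℕ) (δ : ℝ) (r : ℕ) : ℕ :=
  if r = 0 then 0
  else min m (max 1 ⌈8 * ((width r) ^ 2)⁻¹ * Real.log (16 * (n : ℝ) * Real.log (m : ℝ) / δ)⌉₊)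

/-- The state after a round `r`: the set `A_{r+1}` of points that are still active, and the number
of pulls of each point so far. -/
structure RoundState (n : ℕ) where
  active : Finset (Fin n)
  pulls : Fin n → ℕ

open Classical in
/-- One round after the other: `run r` is the state after round `r`.  In round `r + 1` every active
point is pulled `t_{r+1} - t_r` times; then only those active points are kept whose empirical mean
is within `b_{r+1}` of one of the two empirical quantiles. -/
def run (α₁ α₂ δ : ℝ) {n m : ℕ} (Y : Fin n → Fin m → ℝ) : ℕ → RoundState n
  | 0 => { active := Finset.univ, pulls := fun _ => 0 }
  | r + 1 =>
    let s := run α₁ α₂ δ Y r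
    let N : Fin n → ℕ := fun i =>
      if i ∈ s.active then s.pulls i + (pullTarget n m δ (r + 1) - pullTarget n m δ r)
      else s.pulls i
    let v : Fin n → ℝ := empMean Y N
    { active := s.active.filter fun i =>
        |v i - empQuantile v α₁| ≤ width (r + 1) ∨ |v i - empQuantile v α₂| ≤ width (r + 1)
      pulls := N }

/-- The last round: the first `r ≥ 1` with `t_r = m`. -/
def lastRound (n m : ℕ) (δ : ℝ) : ℕ := sInf {r : ℕ | 1 ≤ r ∧ pullTarget n m δ r = m}

/-- The number of pulls of each point during the rounds of the algorithm. -/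
def finalPulls (α₁ α₂ δ : ℝ) {n m : ℕ} (Y : Fin n → Fin m → ℝ) : Fin n → ℕ :=
  (run α₁ α₂ δ Y (lastRound n m δ)).pulls

/-- The final estimates of the points. -/
def finalMeans (α₁ α₂ δ : ℝ) {n m : ℕ} (Y : Fin n → Fin m → ℝ) : Fin n → ℝ :=
  empMean Y (finalPulls α₁ α₂ δ Y)

/-- The index set `Ŝ_n` that the algorithm finds. -/
def selected (α₁ α₂ δ : ℝ) {n m : ℕ} (Y : Fin n → Fin m → ℝ) : Finset (Fin n) :=
  relevantIndices (finalMeans α₁ α₂ δ Y) α₁ α₂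

open Classical in
/-- The output of the algorithm: for `α₁ = α₂` the average of the final estimates over `Ŝ_n`, and
otherwise the average over `Ŝ_n` of one fresh observation of each point. -/
def onlineEstimator (α₁ α₂ δ : ℝ) {n m : ℕ} (ω : SampleSpace n m) : ℝ :=
  if α₁ = α₂ then
    average (selected α₁ α₂ δ (observation ω)) (finalMeans α₁ α₂ δ (observation ω))
  else average (selected α₁ α₂ δ (observation ω)) (freshObservation ω)

open Classical in
/-- The total number `M` of observations that the algorithm takes. -/
def sampleCount (α₁ α₂ δ : ℝ) {n m : ℕ} (ω : SampleSpace n m) : ℕ :=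
  (∑ i, finalPulls α₁ α₂ δ (observation ω) i) +
    if α₁ = α₂ then 0 else (selected α₁ α₂ δ (observation ω)).card

/-- The expected number `E[M]` of observations, for latent points drawn from `F`. -/
def expectedSamples (F : Measure ℝ) (α₁ α₂ δ : ℝ) (n m : ℕ) : ℝ≥0∞ :=
  ∫⁻ ω : SampleSpace n m, (sampleCount α₁ α₂ δ ω : ℝ≥0∞) ∂(sampleLaw F n m)

/-- `E[min(m, log(n/δ) / dist(X, ∂S)²)]` for `X ∼ F`.  Here `dist(x, ∅) = ∞`, and the quotient is `∞`
where the distance is `0`. -/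
def gapExpectation (F : Measure ℝ) (α₁ α₂ δ : ℝ) (n m : ℕ) : ℝ≥0∞ :=
  ∫⁻ x, min (m : ℝ≥0∞)
    (ENNReal.ofReal (Real.log ((n : ℝ) / δ)) /
      Metric.infEDist x (frontier (relevantSet F α₁ α₂)) ^ 2) ∂F

/-! ### Assumptions on the distribution, and the offline choice of `n` and `m` -/

/-- Near `η` the distribution function is twice differentiable, with `F' ≥ c₁` and `|F''| ≤ c₂`. -/
def DensityRegular (F : Measure ℝ) (η t₀ c₁ c₂ : ℝ) : Prop :=
  ∀ x : ℝ, |x - η| < t₀ →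
    DifferentiableAt ℝ (fun y => cdf F y) x ∧ c₁ ≤ deriv (fun y => cdf F y) x ∧
    DifferentiableAt ℝ (deriv fun y => cdf F y) x ∧ |deriv (deriv fun y => cdf F y) x| ≤ c₂

/-- `β`-regularity of the upper tail: `1 - F(η - t) ∈ [c₁ t^β, c₂ t^β]` for small `t`. -/
def UpperTailRegular (F : Measure ℝ) (η t₀ c₁ c₂ β : ℝ) : Prop :=
  ∀ t : ℝ, 0 ≤ t → t ≤ t₀ →
    c₁ * t ^ β ≤ 1 - cdf F (η - t) ∧ 1 - cdf F (η - t) ≤ c₂ * t ^ β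

/-- `β`-regularity of the lower tail, that is of the upper tail of `-X`. -/
def LowerTailRegular (F : Measure ℝ) (η t₀ c₁ c₂ β : ℝ) : Prop :=
  ∀ t : ℝ, 0 ≤ t → t ≤ t₀ →
    c₁ * t ^ β ≤ F.real (Set.Iio (η + t)) ∧ F.real (Set.Iio (η + t)) ≤ c₂ * t ^ β

/-- Regularity of `F` at its `α`-quantile: a density condition for `0 < α < 1`, and `β`-regularity of
the tail for `α = 1` (maximum) and `α = 0` (minimum). -/
def QuantileRegular (F : Measure ℝ) (α t₀ c₁ c₂ β : ℝ) : Prop :=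
  ∃ η : ℝ, quantile F α = (η : EReal) ∧
    (0 < α → α < 1 → DensityRegular F η t₀ c₁ c₂) ∧
    (α = 1 → UpperTailRegular F η t₀ c₁ c₂ β) ∧
    (α = 0 → LowerTailRegular F η t₀ c₁ c₂ β)

/-- The assumption on `F` for the functional with parameters `α₁ ≤ α₂`.  Mean: bounded variance.
Otherwise: regularity at the two quantiles and, if they differ, a bounded second moment. -/
def RegularFor (F : Measure ℝ) (α₁ α₂ t₀ c₀ c₁ c₂ β : ℝ) : Prop :=
  (α₁ = 0 ∧ α₂ = 1 → MemLp id 2 F ∧ variance id F ≤ c₀) ∧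
  (¬ (α₁ = 0 ∧ α₂ = 1) →
    QuantileRegular F α₁ t₀ c₁ c₂ β ∧ QuantileRegular F α₂ t₀ c₁ c₂ β ∧
    (α₁ ≠ α₂ → Integrable (fun x : ℝ => x ^ 2) F ∧ ∫ x, x ^ 2 ∂F ≤ c₀))

/-- `x` is of the order of `s`, with constants `A` and `B`. -/
def InBand (A B s x : ℝ) : Prop := A * s ≤ x ∧ x ≤ B * s

/-- The numbers `n` of points and `m` of observations per point of the offline analysis, with
constants `A` (lower) and `B` (upper). -/
structure OfflineChoice (A B α₁ α₂ β ε δ : ℝ) (n m : ℕ) : Prop where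
  /-- mean -/
  mean : α₁ = 0 → α₂ = 1 →
    InBand A B (δ⁻¹ * ε⁻¹ ^ 2) n ∧ 1 ≤ m ∧ (m : ℝ) ≤ B
  /-- median and other quantiles -/
  quantile : α₁ = α₂ → 0 < α₁ → α₁ < 1 →
    InBand A B (Real.log (2 / δ) * ε⁻¹ ^ 2) n ∧ InBand A B ε⁻¹ m
  /-- minimum and maximum -/
  extremum : α₁ = α₂ → (α₁ = 0 ∨ α₁ = 1) →
    InBand A B (Real.log (2 / δ) * ε ^ (-β)) n ∧
      InBand A B (Real.log (2 * (n : ℝ) / δ) * ε⁻¹ ^ 2) m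
  /-- trimmed mean -/
  trimmed : α₁ ≠ α₂ → ¬ (α₁ = 0 ∧ α₂ = 1) →
    InBand A B (δ⁻¹ * ε⁻¹ ^ 2) n ∧ InBand A B (ε⁻¹ * Real.log ε⁻¹) m

end

/-! Correctness rests on a deterministic coupling with the offline estimator. Let `q` be an
empirical quantile of the means `μ i` over all `m` observations, and suppose that in every round `r`
before the last each running mean is within `b_r / 2` of `μ i`. By induction on the rounds, the
empirical quantile of round `r` is within `b_r / 2` of `q`; hence a point dropped in round `ρ` has
its frozen estimate more than `b_ρ / 2` away from `q`, and `μ i` lies on the same side. All ranks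
relative to `q` are preserved, and the algorithm selects exactly the offline index set
(`empQuantile_finalMeans_eq`, `selected_eq_relevantIndices`). A running mean minus the final mean
has variance `1/t - 1/m ≤ 1/t`, and the factor `16 n log m / δ` in the schedule pays for the union
over `n` points and at most `log m` rounds, so the coupling fails with probability at most `δ / 8`
(`mul_noiseLaw_badDeviation_le`).

Offline accuracy. The noise is symmetric, so its first-order effect on a distribution function or a
truncated moment cancels and only the variance `1/m` remains (`abs_integral_sub_le_of_symm`); this
is why `m` of order `1/ε` is enough at interior quantiles. Hoeffding's inequality then gives the
quantiles (`pi_interior_error_le`). For trimmed means the random index set is replaced by fixed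
half-lines at the true quantiles, at the price of a band of width `O(ε)` whose contribution is
`O(ε)`, and Chebyshev's inequality controls the sums (`pi_trimmed_error_le`). For an extremum it
suffices that all noises are below `ε/2` and that some point within `ε/4` of the end has noise of
the favourable sign (`pi_extreme_error_le`). For the mean all indices are selected and Chebyshev
suffices.

Cost. A point that last survives round `r` is pulled about `4^r log(n/δ)` times. If survival forces
distance at most `2 b_r` to `∂S`, this is `log(n/δ) / dist²` up to a constant (`finalPulls_le`).
Survival of a distant point is charged to a bad event belonging to that point, at cost at most `m`.
Near an interior quantile a small proportion of badly estimated points moves the empirical quantile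
little, so besides a few counting events only the point's own noise matters (`exists_bad_interior`),
and the bad event has probability `O(1/m)`. Near an end of the support a single point can move the
empirical extreme; there, under weak control of all points, a distant survivor is at most 40 times
as far from the end as every well-estimated point, which has probability `O(1/n)`
(`dist_le_of_keptBy_extreme`, `pi_extreme_le`). The remaining terms are dominated by the gap
expectation because some mass lies near the boundary (`expectedSamples_le_gap`).

Rates. If the mass within `s` of the boundary is at most `C s^γ`, dyadic shells turn the gap
expectation into a geometric sum of ratio `2^(2-γ)` (`gapExpectation_le_sum`). Interior quantiles
have `γ = 1`, hence a factor `√m` and the power `5/2`; extrema have `γ = β`, with an extra logarithm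
at `β = 2`. -/

/-! ### Order statistics -/

section OrderStatistics

variable {n : ℕ} {v : Fin n → ℝ}

/-- The `k`-th order statistic is an entry `v i`, and it is characterized by its rank. -/
theorem exists_orderStat_eq {k : ℕ} (hk : max 1 k ≤ n) :
    ∃ i, orderStat v k = v i ∧
      ∀ x, max 1 k ≤ (Finset.univ.filter fun j => v j ≤ x).card ↔ v i ≤ x := by
  classical
  -- The order statistic will be the least entry whose own rank reaches `max 1 k`; the largest entry
  -- shows that such entries exist.
  let good : Finset (Fin n) := Finset.univ.filter fun i =>
    max 1 k ≤ (Finset.univ.filter fun j => v j ≤ v i).card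
  have hn : 0 < n := lt_of_lt_of_le one_pos ((le_max_left _ _).trans hk)
  have : Nonempty (Fin n) := ⟨⟨0, hn⟩⟩
  obtain ⟨imax, -, himax⟩ := Finset.exists_max_image Finset.univ v Finset.univ_nonempty
  have hgood : good.Nonempty := by
    refine ⟨imax, Finset.mem_filter.2 ⟨Finset.mem_univ _, ?_⟩⟩
    rw [Finset.filter_true_of_mem fun j _ => himax j (Finset.mem_univ _)]
    simpa using hk
  obtain ⟨i, hi, hmin⟩ := Finset.exists_min_image good v hgood
  have key : ∀ x, max 1 k ≤ (Finset.univ.filter fun j => v j ≤ x).card ↔ v i ≤ x := by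
    intro x
    constructor
    · intro hx
      have hne : (Finset.univ.filter fun j => v j ≤ x).Nonempty :=
        Finset.card_pos.1 (lt_of_lt_of_le one_pos ((le_max_left _ _).trans hx))
      obtain ⟨j, hj, hjmax⟩ := Finset.exists_max_image _ v hne
      have hjx : v j ≤ x := (Finset.mem_filter.1 hj).2
      refine (hmin j (Finset.mem_filter.2 ⟨Finset.mem_univ _, hx.trans ?_⟩)).trans hjx
      refine Finset.card_le_card fun l hl => ?_
      exact Finset.mem_filter.2 ⟨Finset.mem_univ _, hjmax l hl⟩
    · intro hx
      refine (Finset.mem_filter.1 hi).2.trans (Finset.card_le_card fun l hl => ?_)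
      exact Finset.mem_filter.2 ⟨Finset.mem_univ _, (Finset.mem_filter.1 hl).2.trans hx⟩
  refine ⟨i, ?_, key⟩
  have hset : {x : ℝ | max 1 k ≤ (Finset.univ.filter fun i => v i ≤ x).card} = Set.Ici (v i) := by
    ext x; exact key x
  unfold orderStat
  exact (congrArg sInf hset).trans csInf_Ici

variable {α : ℝ}

/-- The rank of the empirical `α`-quantile. -/
noncomputable def orderRank (n : ℕ) (α : ℝ) : ℕ := max 1 ⌊α * (n : ℝ)⌋₊

theorem orderRank_le (hn : 1 ≤ n) (hα : α ≤ 1) : orderRank n α ≤ n := by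
  refine max_le hn (Nat.floor_le_of_le ?_)
  nlinarith [(Nat.cast_nonneg n : (0 : ℝ) ≤ n)]

theorem exists_empQuantile_eq (hn : 1 ≤ n) (hα : α ≤ 1) :
    ∃ i, empQuantile v α = v i ∧
      ∀ x, orderRank n α ≤ (Finset.univ.filter fun j => v j ≤ x).card ↔ v i ≤ x :=
  exists_orderStat_eq (orderRank_le hn hα)

theorem empQuantile_le_iff (hn : 1 ≤ n) (hα : α ≤ 1) {x : ℝ} :
    empQuantile v α ≤ x ↔ orderRank n α ≤ (Finset.univ.filter fun j => v j ≤ x).card := by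
  obtain ⟨i, hi, h⟩ := exists_empQuantile_eq (v := v) hn hα
  rw [hi, h]

/-- The largest of the entries below `x` bounds the quantile strictly. Negated at `x` equal to the
quantile, this says that fewer than `orderRank` entries lie strictly below it. -/
theorem empQuantile_lt_iff (hn : 1 ≤ n) (hα : α ≤ 1) {x : ℝ} :
    empQuantile v α < x ↔ orderRank n α ≤ (Finset.univ.filter fun j => v j < x).card := by
  constructor
  · intro h
    refine ((empQuantile_le_iff (v := v) hn hα).1 le_rfl).trans (Finset.card_le_card fun l hl => ?_)
    exact Finset.mem_filter.2 ⟨Finset.mem_univ _, (Finset.mem_filter.1 hl).2.trans_lt h⟩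
  · intro h
    have hne : (Finset.univ.filter fun j => v j < x).Nonempty :=
      Finset.card_pos.1 (lt_of_lt_of_le one_pos ((le_max_left _ _).trans h))
    obtain ⟨j, hj, hjmax⟩ := Finset.exists_max_image _ v hne
    refine lt_of_le_of_lt ((empQuantile_le_iff hn hα).2 (h.trans (Finset.card_le_card ?_)))
      (Finset.mem_filter.1 hj).2
    intro l hl
    exact Finset.mem_filter.2 ⟨Finset.mem_univ _, hjmax l hl⟩

theorem le_empQuantile_one (hn : 1 ≤ n) (i : Fin n) : v i ≤ empQuantile v 1 := by
  have h := (empQuantile_le_iff (v := v) hn le_rfl).1 le_rfl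
  have hr : orderRank n 1 = n := by simp [orderRank, hn]
  rw [hr] at h
  have h2 : (Finset.univ.filter fun j => v j ≤ empQuantile v 1) = Finset.univ :=
    Finset.eq_univ_of_card _ (le_antisymm (Finset.card_le_univ _) (by simpa using h))
  have hi : i ∈ Finset.univ.filter fun j => v j ≤ empQuantile v 1 := by
    rw [h2]; exact Finset.mem_univ i
  exact (Finset.mem_filter.1 hi).2

theorem empQuantile_zero_le (hn : 1 ≤ n) (i : Fin n) : empQuantile v 0 ≤ v i := by
  rw [empQuantile_le_iff hn zero_le_one]
  have : orderRank n 0 = 1 := by simp [orderRank]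
  rw [this]
  exact Finset.card_pos.2 ⟨i, by simp⟩

/-- The number of relevant indices is at least the difference of the ranks. -/
theorem orderRank_sub_le_card (hn : 1 ≤ n) {α₁ α₂ : ℝ} (h1 : α₁ ≤ 1) (h2 : α₂ ≤ 1) :
    orderRank n α₂ < orderRank n α₁ + (relevantIndices v α₁ α₂).card + 1 := by
  classical
  have hlt : (Finset.univ.filter fun j => v j < empQuantile v α₁).card < orderRank n α₁ := by
    by_contra hcon
    exact lt_irrefl _ ((empQuantile_lt_iff hn h1).2 (not_lt.1 hcon))
  have hle := (empQuantile_le_iff (v := v) hn h2).1 le_rfl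
  have hsub : (Finset.univ.filter fun j => v j ≤ empQuantile v α₂) ⊆
      (Finset.univ.filter fun j => v j < empQuantile v α₁) ∪ relevantIndices v α₁ α₂ := by
    intro j hj
    have hj := (Finset.mem_filter.1 hj).2
    rcases lt_or_ge (v j) (empQuantile v α₁) with h | h
    · exact Finset.mem_union_left _ (Finset.mem_filter.2 ⟨Finset.mem_univ _, h⟩)
    · exact Finset.mem_union_right _ (Finset.mem_filter.2 ⟨Finset.mem_univ _, h, hj⟩)
  have := (Finset.card_le_card hsub).trans (Finset.card_union_le _ _)
  omega

/-- The selected indices are the ties at the quantile, and there is at least one because the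
quantile is attained. -/
theorem average_relevantIndices_self (hn : 1 ≤ n) (hα : α ≤ 1) :
    _root_.average (relevantIndices v α α) v = empQuantile v α := by
  classical
  obtain ⟨i, hi, -⟩ := exists_empQuantile_eq (v := v) hn hα
  have hmem : i ∈ relevantIndices v α α :=
    Finset.mem_filter.2 ⟨Finset.mem_univ _, hi.le, hi.ge⟩
  have hsum : ∑ j ∈ relevantIndices v α α, v j
      = ∑ j ∈ relevantIndices v α α, empQuantile v α :=
    Finset.sum_congr rfl fun j hj =>
      le_antisymm (Finset.mem_filter.1 hj).2.2 (Finset.mem_filter.1 hj).2.1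
  unfold _root_.average
  rw [hsum, Finset.sum_const, nsmul_eq_mul]
  have : ((relevantIndices v α α).card : ℝ) ≠ 0 :=
    Nat.cast_ne_zero.2 (Finset.card_pos.2 ⟨i, hmem⟩).ne'
  field_simp

end OrderStatistics

/-! ### The schedule of the algorithm -/

section Schedule

variable {n m : ℕ} {δ : ℝ}

theorem width_pos (r : ℕ) : 0 < width r := by unfold width; positivity

theorem width_anti {r s : ℕ} (h : r ≤ s) : width s ≤ width r :=
  pow_le_pow_of_le_one (by norm_num) (by norm_num) h

theorem width_lt {r s : ℕ} (h : r < s) : width s < width r :=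
  pow_lt_pow_right_of_lt_one₀ (by norm_num) (by norm_num) h

theorem width_le_half {r : ℕ} (h : 1 ≤ r) : width r ≤ 1 / 2 :=
  (width_anti h).trans (by norm_num [width])

theorem width_sq_inv (r : ℕ) : ((width r) ^ 2)⁻¹ = 4 ^ r := by
  unfold width; rw [← pow_mul, mul_comm, pow_mul, ← inv_pow]; norm_num

/-- The logarithmic factor of the confidence radius. -/
noncomputable def confLog (n m : ℕ) (δ : ℝ) : ℝ := Real.log (16 * (n : ℝ) * Real.log (m : ℝ) / δ)

theorem pullTarget_succ (r : ℕ) : pullTarget n m δ (r + 1) =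
    min m (max 1 ⌈8 * 4 ^ (r + 1) * confLog n m δ⌉₊) := by
  simp only [pullTarget, Nat.succ_ne_zero, if_false, width_sq_inv, confLog]

theorem pullTarget_le (r : ℕ) : pullTarget n m δ r ≤ m := by
  cases r with
  | zero => simp [pullTarget]
  | succ r => rw [pullTarget_succ]; exact min_le_left _ _

theorem pullTarget_mono (hL : 0 ≤ confLog n m δ) : Monotone (pullTarget n m δ) := by
  refine monotone_nat_of_le_succ fun r => ?_
  cases r with
  | zero => simp [pullTarget]
  | succ r =>
    rw [pullTarget_succ, pullTarget_succ]
    refine min_le_min le_rfl (max_le_max le_rfl (Nat.ceil_mono ?_))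
    gcongr <;> norm_num

theorem one_le_pullTarget (hm : 1 ≤ m) (r : ℕ) : 1 ≤ pullTarget n m δ (r + 1) := by
  rw [pullTarget_succ]; exact le_min hm (le_max_left _ _)

theorem exists_pullTarget_eq (hL : 1 ≤ confLog n m δ) : ∃ r, 1 ≤ r ∧ pullTarget n m δ r = m := by
  obtain ⟨k, hk⟩ := pow_unbounded_of_one_lt (m : ℝ) (show (1 : ℝ) < 4 by norm_num)
  refine ⟨k + 1, by omega, ?_⟩
  rw [pullTarget_succ]
  refine min_eq_left (le_max_of_le_right ?_)
  rw [← Nat.cast_le (α := ℝ)]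
  refine le_trans ?_ (Nat.le_ceil _)
  have h4 : (0 : ℝ) < 4 ^ k := by positivity
  calc (m : ℝ) ≤ 4 ^ k := hk.le
    _ ≤ 8 * 4 ^ (k + 1) * 1 := by rw [pow_succ]; linarith
    _ ≤ _ := by gcongr

theorem lastRound_spec (hL : 1 ≤ confLog n m δ) :
    1 ≤ lastRound n m δ ∧ pullTarget n m δ (lastRound n m δ) = m :=
  Nat.sInf_mem (s := {r : ℕ | 1 ≤ r ∧ pullTarget n m δ r = m}) (exists_pullTarget_eq hL)

theorem pullTarget_lt {r : ℕ} (h1 : 1 ≤ r) (h : r < lastRound n m δ) : pullTarget n m δ r < m :=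
  lt_of_le_of_ne (pullTarget_le r) fun he => Nat.notMem_of_lt_sInf h ⟨h1, he⟩

theorem le_pullTarget_of_lt {r : ℕ} (h1 : 1 ≤ r) (h : pullTarget n m δ r < m) :
    8 * 4 ^ r * confLog n m δ ≤ pullTarget n m δ r := by
  obtain ⟨r, rfl⟩ : ∃ k, r = k + 1 := ⟨r - 1, by omega⟩
  rw [pullTarget_succ] at h ⊢
  have : min m (max 1 ⌈8 * 4 ^ (r + 1) * confLog n m δ⌉₊) =
      max 1 ⌈8 * 4 ^ (r + 1) * confLog n m δ⌉₊ :=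
    min_eq_right (by by_contra hc; rw [min_eq_left (by omega)] at h; exact lt_irrefl _ h)
  rw [this]
  exact (Nat.le_ceil _).trans (by exact_mod_cast le_max_right _ _)

/-- The constant is `8 · 4` for the width of round `r + 1`, plus `1` for the ceiling, since `4^r L ≥
1`. -/
theorem pullTarget_succ_le (hL : 1 ≤ confLog n m δ) (r : ℕ) :
    (pullTarget n m δ (r + 1) : ℝ) ≤ 33 * 4 ^ r * confLog n m δ := by
  have h4 : (1 : ℝ) ≤ 4 ^ r := one_le_pow₀ (by norm_num)
  have h5 : (1 : ℝ) ≤ 4 ^ r * confLog n m δ := one_le_mul_of_one_le_of_one_le h4 hL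
  have h1 : (pullTarget n m δ (r + 1) : ℝ) ≤
      ((max 1 ⌈8 * 4 ^ (r + 1) * confLog n m δ⌉₊ : ℕ) : ℝ) := by
    rw [pullTarget_succ]; exact_mod_cast min_le_right _ _
  refine h1.trans ?_
  push_cast
  refine max_le (by linarith) ((Nat.ceil_lt_add_one (by positivity)).le.trans ?_)
  rw [pow_succ]; linarith

/-- The targets before the last round are not truncated at `m`, so the last of them is at least `8 ·
4^r L` and yet at most `m`. This logarithmic number of rounds is what `log m` inside `confLog` pays
for. -/
theorem lastRound_sub_one_mul_log (hL : 1 ≤ confLog n m δ) (hm : 1 ≤ m) :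
    ((lastRound n m δ - 1 : ℕ) : ℝ) * Real.log 4 ≤ Real.log m := by
  have hm' : (1 : ℝ) ≤ m := by exact_mod_cast hm
  rcases Nat.lt_or_ge 1 (lastRound n m δ) with h | h
  · have h1 := le_pullTarget_of_lt (by omega)
      (pullTarget_lt (n := n) (m := m) (δ := δ) (r := lastRound n m δ - 1) (by omega) (by omega))
    have h2 : (pullTarget n m δ (lastRound n m δ - 1) : ℝ) ≤ m := by
      exact_mod_cast pullTarget_le _
    rw [← Real.log_pow]
    refine Real.log_le_log (by positivity) ?_
    have h4 : (0 : ℝ) < 4 ^ (lastRound n m δ - 1) := by positivity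
    nlinarith
  · have : lastRound n m δ - 1 = 0 := by omega
    rw [this]; simpa using Real.log_nonneg hm'

/-- Already `16 log 2` exceeds `e`. The case `m = 1` is excluded because then the argument of the
outer logarithm is `0`. -/
theorem one_le_confLog (hn : 1 ≤ n) (hm : 2 ≤ m) (hδ : 0 < δ) (hδ1 : δ < 1) :
    1 ≤ confLog n m δ := by
  have hn' : (1 : ℝ) ≤ n := by exact_mod_cast hn
  have hm' : (2 : ℝ) ≤ m := by exact_mod_cast hm
  have hlog : 0.69 ≤ Real.log m :=
    (by linarith [Real.log_two_gt_d9] : (0.69 : ℝ) ≤ Real.log 2).trans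
      (Real.log_le_log (by norm_num) hm')
  unfold confLog
  rw [Real.le_log_iff_exp_le (by positivity), le_div_iff₀ hδ]
  have := Real.exp_one_lt_d9
  nlinarith [Real.exp_pos 1]

end Schedule

/-! ### Deterministic analysis of the elimination rounds -/

section Rounds

variable {n m : ℕ} {α₁ α₂ δ : ℝ} {Y : Fin n → Fin m → ℝ}

/-- The mean of the first `t` observations of a point. -/
noncomputable def prefixMean {m : ℕ} (y : Fin m → ℝ) (t : ℕ) : ℝ :=
  (∑ j ∈ Finset.univ.filter (fun j : Fin m => (j : ℕ) < t), y j) / (t : ℝ)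

/-- The estimates of all points in round `r`. -/
noncomputable def roundMeans (α₁ α₂ δ : ℝ) {n m : ℕ} (Y : Fin n → Fin m → ℝ) (r : ℕ) : Fin n → ℝ :=
  empMean Y (run α₁ α₂ δ Y r).pulls

theorem empMean_eq_prefixMean (Y : Fin n → Fin m → ℝ) (N : Fin n → ℕ) (i : Fin n) :
    empMean Y N i = prefixMean (Y i) (N i) := by
  unfold empMean prefixMean; congr!

theorem mem_active_succ_iff (r : ℕ) (i : Fin n) :
    i ∈ (run α₁ α₂ δ Y (r + 1)).active ↔ i ∈ (run α₁ α₂ δ Y r).active ∧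
      (|roundMeans α₁ α₂ δ Y (r + 1) i - empQuantile (roundMeans α₁ α₂ δ Y (r + 1)) α₁|
          ≤ width (r + 1) ∨
        |roundMeans α₁ α₂ δ Y (r + 1) i - empQuantile (roundMeans α₁ α₂ δ Y (r + 1)) α₂|
          ≤ width (r + 1)) := by
  simp only [run, Finset.mem_filter, roundMeans]

theorem pulls_succ_of_notMem {r : ℕ} {i : Fin n} (h : i ∉ (run α₁ α₂ δ Y r).active) :
    (run α₁ α₂ δ Y (r + 1)).pulls i = (run α₁ α₂ δ Y r).pulls i := by
  simp only [run, if_neg h]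

theorem pulls_of_mem (hmono : Monotone (pullTarget n m δ)) {r : ℕ} {i : Fin n}
    (h : i ∈ (run α₁ α₂ δ Y r).active) :
    (run α₁ α₂ δ Y r).pulls i = pullTarget n m δ r := by
  induction r with
  | zero => simp [run, pullTarget]
  | succ r ih =>
    have h' := ((mem_active_succ_iff r i).1 h).1
    have := ih h'
    have hm := hmono (show r ≤ r + 1 by omega)
    simp only [run, if_pos h', this]
    omega

theorem pulls_succ_of_mem (hmono : Monotone (pullTarget n m δ)) {r : ℕ} {i : Fin n}
    (h : i ∈ (run α₁ α₂ δ Y r).active) :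
    (run α₁ α₂ δ Y (r + 1)).pulls i = pullTarget n m δ (r + 1) := by
  have := pulls_of_mem hmono h
  have hm := hmono (show r ≤ r + 1 by omega)
  simp only [run, if_pos h, this]
  omega

/-- In every round, the estimate of a point stems from the last round in which it was active. -/
theorem exists_freeze (hmono : Monotone (pullTarget n m δ)) (r : ℕ) (i : Fin n) :
    ∃ r' ≤ r, i ∈ (run α₁ α₂ δ Y r').active ∧
      (run α₁ α₂ δ Y (r + 1)).pulls i = pullTarget n m δ (r' + 1) ∧
      (r' = r ∨ i ∉ (run α₁ α₂ δ Y (r' + 1)).active) := by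
  induction r with
  | zero =>
    have h0 : i ∈ (run α₁ α₂ δ Y 0).active := by simp [run]
    exact ⟨0, le_rfl, h0, pulls_succ_of_mem hmono h0, Or.inl rfl⟩
  | succ r ih =>
    by_cases h : i ∈ (run α₁ α₂ δ Y (r + 1)).active
    · exact ⟨r + 1, le_rfl, h, pulls_succ_of_mem hmono h, Or.inl rfl⟩
    · obtain ⟨r', hr', hmem, hp, hor⟩ := ih
      refine ⟨r', by omega, hmem, by rw [pulls_succ_of_notMem h, hp], Or.inr ?_⟩
      rcases hor with rfl | h'
      exacts [h, h']

/-- The estimate of a point in round `r` is its mean over the first `t` pulls of some round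
`ρ ≤ r`, and if `ρ < r`, then in round `ρ` it was far from both empirical quantiles. -/
theorem roundMeans_cases (hmono : Monotone (pullTarget n m δ)) {α : ℝ} (hα : α = α₁ ∨ α = α₂)
    {r : ℕ} (hr : 1 ≤ r) (i : Fin n) :
    roundMeans α₁ α₂ δ Y r i = prefixMean (Y i) (pullTarget n m δ r) ∨
    ∃ ρ, 1 ≤ ρ ∧ ρ < r ∧ roundMeans α₁ α₂ δ Y r i = prefixMean (Y i) (pullTarget n m δ ρ) ∧
      roundMeans α₁ α₂ δ Y ρ i = prefixMean (Y i) (pullTarget n m δ ρ) ∧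
      width ρ < |prefixMean (Y i) (pullTarget n m δ ρ)
        - empQuantile (roundMeans α₁ α₂ δ Y ρ) α| := by
  obtain ⟨r, rfl⟩ : ∃ k, r = k + 1 := ⟨r - 1, by omega⟩
  obtain ⟨r', hr', hmem, hp, hor⟩ := exists_freeze (α₁ := α₁) (α₂ := α₂) (Y := Y) hmono r i
  have hval : roundMeans α₁ α₂ δ Y (r + 1) i
      = prefixMean (Y i) (pullTarget n m δ (r' + 1)) := by
    rw [roundMeans, empMean_eq_prefixMean, hp]
  by_cases hrr : r' = r
  · subst hrr; exact Or.inl hval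
  · have hnot := hor.resolve_left hrr
    rw [mem_active_succ_iff] at hnot
    have hval' : roundMeans α₁ α₂ δ Y (r' + 1) i
        = prefixMean (Y i) (pullTarget n m δ (r' + 1)) := by
      rw [roundMeans, empMean_eq_prefixMean, pulls_succ_of_mem hmono hmem]
    refine Or.inr ⟨r' + 1, by omega, by omega, hval, hval', ?_⟩
    rw [hval'] at hnot
    push Not at hnot
    obtain ⟨h1, h2⟩ := hnot hmem
    rcases hα with rfl | rfl
    exacts [h1, h2]

theorem roundMeans_of_mem (hmono : Monotone (pullTarget n m δ)) {r : ℕ} {i : Fin n}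
    (h : i ∈ (run α₁ α₂ δ Y r).active) :
    roundMeans α₁ α₂ δ Y r i = prefixMean (Y i) (pullTarget n m δ r) := by
  rw [roundMeans, empMean_eq_prefixMean, pulls_of_mem hmono h]

/-- If all but a few points are estimated with precision `θ b_r`, then the empirical quantiles of
the algorithm stay close to a reference value. -/
theorem abs_empQuantile_roundMeans_sub_le (hn : 1 ≤ n) (hmono : Monotone (pullTarget n m δ))
    {α : ℝ} (hα : α = α₁ ∨ α = α₂) (hα1 : α ≤ 1) {x : Fin n → ℝ} {good : Fin n → Prop}
    {θ ζ η : ℝ} (hζ : 0 ≤ ζ) (hθζ : θ + ζ ≤ 1 / 2) {R : ℕ}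
    (hnoise : ∀ i, good i → ∀ r, 1 ≤ r → r < R →
      |prefixMean (Y i) (pullTarget n m δ r) - x i| ≤ θ * width r)
    (hup : ∀ r, 1 ≤ r → r < R → ∃ s : Finset (Fin n), orderRank n α ≤ s.card ∧
      ∀ i ∈ s, good i ∧ x i ≤ η + ζ * width r)
    (hlow : ∀ r, 1 ≤ r → r < R → ∃ s : Finset (Fin n), s.card < orderRank n α ∧
      ∀ i ∉ s, good i ∧ η - ζ * width r ≤ x i) :
    ∀ r, 1 ≤ r → r < R →
      |empQuantile (roundMeans α₁ α₂ δ Y r) α - η| ≤ (θ + ζ) * width r := by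
  intro r
  induction r using Nat.strong_induction_on with
  | _ r ih =>
  intro hr1 hrR
  have hb := width_pos r
  rw [abs_le]
  constructor
  · obtain ⟨s, hs, hsx⟩ := hlow r hr1 hrR
    by_contra hcon
    have hlt : empQuantile (roundMeans α₁ α₂ δ Y r) α < η - (θ + ζ) * width r := by linarith
    rw [empQuantile_lt_iff hn hα1] at hlt
    refine absurd hs (not_lt.2 (hlt.trans (Finset.card_le_card fun i hi => ?_)))
    by_contra his
    obtain ⟨hg, hx⟩ := hsx i his
    have hi := (Finset.mem_filter.1 hi).2
    rcases roundMeans_cases (α₁ := α₁) (α₂ := α₂) (Y := Y) hmono hα hr1 i with h | ⟨ρ, h1, h2, h3, -, h4⟩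
    · have := (abs_le.1 (hnoise i hg r hr1 hrR)).1
      rw [h] at hi; linarith
    -- The point was frozen in an earlier round `ρ`, more than `b_ρ` away from a quantile that is
    -- within `(θ + ζ) b_ρ ≤ b_ρ / 2` of `η`. Lying below would put its estimate below `η - b_ρ /
    -- 2`, which the noise `θ b_ρ` and the lower bound on `x i` exclude; so it lies above `η`.
    · have hw := width_lt h2
      have e1 := abs_le.1 (hnoise i hg ρ h1 (h2.trans hrR))
      have e2 := abs_le.1 (ih ρ h2 h1 (h2.trans hrR))
      rw [h3] at hi
      rcases lt_abs.1 h4 with h | h <;> nlinarith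
  · obtain ⟨s, hs, hsx⟩ := hup r hr1 hrR
    rw [sub_le_iff_le_add, empQuantile_le_iff hn hα1]
    refine hs.trans (Finset.card_le_card fun i hi => Finset.mem_filter.2 ⟨Finset.mem_univ _, ?_⟩)
    obtain ⟨hg, hx⟩ := hsx i hi
    rcases roundMeans_cases (α₁ := α₁) (α₂ := α₂) (Y := Y) hmono hα hr1 i with h | ⟨ρ, h1, h2, h3, -, h4⟩
    · have := (abs_le.1 (hnoise i hg r hr1 hrR)).2
      rw [h]; linarith
    · have hw := width_lt h2
      have e1 := abs_le.1 (hnoise i hg ρ h1 (h2.trans hrR))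
      have e2 := abs_le.1 (ih ρ h2 h1 (h2.trans hrR))
      rw [h3]
      rcases lt_abs.1 h4 with h | h <;> nlinarith

end Rounds

/-! ### Exact agreement with the offline selection -/

section Coupling

variable {n m : ℕ} {α₁ α₂ δ : ℝ} {Y : Fin n → Fin m → ℝ}

/-- If all round estimates are within `b_r / 2` of the means of all `m` observations, then the
algorithm finds the empirical quantile of these means, and every point lies on the correct side. -/
theorem empQuantile_finalMeans_eq (hn : 1 ≤ n) (hL : 1 ≤ confLog n m δ)
    {α : ℝ} (hα : α = α₁ ∨ α = α₂) (hα1 : α ≤ 1)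
    (hnoise : ∀ i, ∀ r, 1 ≤ r → r < lastRound n m δ →
      |prefixMean (Y i) (pullTarget n m δ r) - prefixMean (Y i) m| ≤ 1 / 2 * width r) :
    empQuantile (finalMeans α₁ α₂ δ Y) α = empQuantile (empMean Y fun _ => m) α ∧
    ∀ i, (finalMeans α₁ α₂ δ Y i ≤ empQuantile (empMean Y fun _ => m) α ↔
        empMean Y (fun _ => m) i ≤ empQuantile (empMean Y fun _ => m) α) ∧
      (finalMeans α₁ α₂ δ Y i < empQuantile (empMean Y fun _ => m) α ↔
        empMean Y (fun _ => m) i < empQuantile (empMean Y fun _ => m) α) := by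
  classical
  have hmono := pullTarget_mono (n := n) (m := m) (δ := δ) (zero_le_one.trans hL)
  obtain ⟨hR1, hRm⟩ := lastRound_spec (n := n) (m := m) (δ := δ) hL
  set μ := empMean Y fun _ => m with hμ
  set q := empQuantile μ α with hq
  have hμi : ∀ i, μ i = prefixMean (Y i) m := fun i => empMean_eq_prefixMean _ _ _
  -- The reference points are the offline means themselves: every point is good, the counting
  -- conditions hold by the definition of `q`, and no slack `ζ` is needed.
  have htrack := abs_empQuantile_roundMeans_sub_le (α₁ := α₁) (α₂ := α₂) (Y := Y) hn hmono hα hα1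
    (x := μ) (good := fun _ => True) (θ := 1 / 2) (ζ := 0) (η := q) le_rfl (by norm_num)
    (R := lastRound n m δ)
    (fun i _ r h1 h2 => by rw [hμi]; exact hnoise i r h1 h2)
    (fun r h1 h2 => ⟨Finset.univ.filter fun i => μ i ≤ q,
      (empQuantile_le_iff hn hα1).1 le_rfl, fun i hi => ⟨trivial, by
        simpa using (Finset.mem_filter.1 hi).2⟩⟩)
    (fun r h1 h2 => ⟨Finset.univ.filter fun i => μ i < q, by
        by_contra hcon
        exact lt_irrefl _ ((empQuantile_lt_iff hn hα1).2 (not_lt.1 hcon)), fun i hi => ⟨trivial, by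
        simpa using hi⟩⟩)
  have hside : ∀ i, (finalMeans α₁ α₂ δ Y i ≤ q ↔ μ i ≤ q) ∧
      (finalMeans α₁ α₂ δ Y i < q ↔ μ i < q) := by
    intro i
    change (roundMeans α₁ α₂ δ Y (lastRound n m δ) i ≤ q ↔ _) ∧
      (roundMeans α₁ α₂ δ Y (lastRound n m δ) i < q ↔ _)
    rcases roundMeans_cases (α₁ := α₁) (α₂ := α₂) (Y := Y) hmono hα hR1 i with
      h | ⟨ρ, h1, h2, h3, -, h4⟩
    · rw [h, hRm, hμi]; exact ⟨Iff.rfl, Iff.rfl⟩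
    -- The frozen estimate is more than `b_ρ - b_ρ / 2` away from `q`, and `μ i` is within `b_ρ / 2`
    -- of it, so both lie strictly on the same side of `q`.
    · have e1 := abs_le.1 (hnoise i ρ h1 h2)
      have e2 := abs_le.1 (htrack ρ h1 h2)
      rw [← hμi] at e1
      rw [h3]
      have hw := width_pos ρ
      rcases lt_abs.1 h4 with h | h
      · exact ⟨⟨fun _ => by linarith, fun _ => by linarith⟩,
          ⟨fun _ => by linarith, fun _ => by linarith⟩⟩
      · exact ⟨⟨fun _ => by linarith, fun _ => by linarith⟩,
          ⟨fun _ => by linarith, fun _ => by linarith⟩⟩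
  refine ⟨le_antisymm ?_ ?_, hside⟩
  · rw [empQuantile_le_iff hn hα1]
    refine ((empQuantile_le_iff (v := μ) hn hα1).1 hq.ge).trans (Finset.card_le_card fun i hi => ?_)
    exact Finset.mem_filter.2 ⟨Finset.mem_univ _, (hside i).1.2 (Finset.mem_filter.1 hi).2⟩
  · by_contra hcon
    rw [not_le, empQuantile_lt_iff hn hα1] at hcon
    refine lt_irrefl q (hq.trans_lt ((empQuantile_lt_iff hn hα1).2
      (hcon.trans (Finset.card_le_card fun i hi => ?_))))
    exact Finset.mem_filter.2 ⟨Finset.mem_univ _, (hside i).2.1 (Finset.mem_filter.1 hi).2⟩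

/-- Selection depends only on the sides of the points relative to the two thresholds; the values of
eliminated points may well differ from the offline means. -/
theorem selected_eq_relevantIndices (hn : 1 ≤ n) (hL : 1 ≤ confLog n m δ)
    (hα1 : α₁ ≤ 1) (hα2 : α₂ ≤ 1)
    (hnoise : ∀ i, ∀ r, 1 ≤ r → r < lastRound n m δ →
      |prefixMean (Y i) (pullTarget n m δ r) - prefixMean (Y i) m| ≤ 1 / 2 * width r) :
    selected α₁ α₂ δ Y = relevantIndices (empMean Y fun _ => m) α₁ α₂ := by
  classical
  obtain ⟨h1, h1'⟩ := empQuantile_finalMeans_eq (α₁ := α₁) (α₂ := α₂) hn hL (Or.inl rfl) hα1 hnoise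
  obtain ⟨h2, h2'⟩ := empQuantile_finalMeans_eq (α₁ := α₁) (α₂ := α₂) hn hL (Or.inr rfl) hα2 hnoise
  unfold selected relevantIndices
  rw [h1, h2]
  refine Finset.filter_congr fun i _ => ?_
  rw [← not_lt, (h1' i).2, not_lt, (h2' i).1]

theorem average_selected_eq_offlineEstimator {α : ℝ} (hn : 1 ≤ n) (hL : 1 ≤ confLog n m δ)
    (hα1 : α ≤ 1)
    (hnoise : ∀ i, ∀ r, 1 ≤ r → r < lastRound n m δ →
      |prefixMean (Y i) (pullTarget n m δ r) - prefixMean (Y i) m| ≤ 1 / 2 * width r) :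
    _root_.average (selected α α δ Y) (finalMeans α α δ Y) = offlineEstimator α α Y := by
  unfold selected offlineEstimator
  rw [average_relevantIndices_self hn hα1, average_relevantIndices_self hn hα1]
  exact (empQuantile_finalMeans_eq (α₁ := α) (α₂ := α) hn hL (Or.inl rfl) hα1 hnoise).1

end Coupling

/-! ### Location of the surviving points -/

section Survivors

variable {n m : ℕ} {α₁ α₂ δ : ℝ} {Y : Fin n → Fin m → ℝ}

/-- Point `i` is kept in round `r` because of its distance to the empirical `α`-quantile. -/
def KeptBy (α₁ α₂ δ : ℝ) {n m : ℕ} (Y : Fin n → Fin m → ℝ) (α : ℝ) (r : ℕ) (i : Fin n) : Prop :=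
  i ∈ (run α₁ α₂ δ Y r).active ∧
    |roundMeans α₁ α₂ δ Y r i - empQuantile (roundMeans α₁ α₂ δ Y r) α| ≤ width r

theorem keptBy_or_of_mem {r : ℕ} (hr : 1 ≤ r) {i : Fin n}
    (h : i ∈ (run α₁ α₂ δ Y r).active) :
    KeptBy α₁ α₂ δ Y α₁ r i ∨ KeptBy α₁ α₂ δ Y α₂ r i := by
  obtain ⟨r, rfl⟩ : ∃ k, r = k + 1 := ⟨r - 1, by omega⟩
  rcases ((mem_active_succ_iff r i).1 h).2 with h' | h'
  exacts [Or.inl ⟨h, h'⟩, Or.inr ⟨h, h'⟩]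

/-- Points that survive a round near an interior quantile really are near it. -/
theorem abs_sub_le_of_keptBy (hmono : Monotone (pullTarget n m δ)) {α : ℝ} {x : Fin n → ℝ} {η : ℝ}
    {r : ℕ} {i : Fin n} (hkept : KeptBy α₁ α₂ δ Y α r i)
    (hnoise : |prefixMean (Y i) (pullTarget n m δ r) - x i| ≤ 1 / 2 * width r)
    (hq : |empQuantile (roundMeans α₁ α₂ δ Y r) α - η| ≤ 1 / 2 * width r) :
    |x i - η| ≤ 2 * width r := by
  have h := abs_le.1 hkept.2
  rw [roundMeans_of_mem hmono hkept.1] at h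
  have h1 := abs_le.1 hnoise
  have h2 := abs_le.1 hq
  rw [abs_le]
  constructor <;> linarith

/-- Points that survive a round near an extreme empirical quantile are almost as close to the end of
the support as the well-estimated points. -/
theorem dist_le_of_keptBy_extreme (hn : 1 ≤ n) (hmono : Monotone (pullTarget n m δ))
    {α : ℝ} (hα : α = α₁ ∨ α = α₂) (hα1 : α ≤ 1) {s η : ℝ} (hs : s = 1 ∨ s = -1)
    (hext : ∀ (v : Fin n → ℝ) i, s * v i ≤ s * empQuantile v α)
    {x : Fin n → ℝ} (hx : ∀ i, 0 ≤ s * (η - x i)) {R : ℕ}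
    (hnoise : ∀ i, ∀ r, 1 ≤ r → r < R →
      |prefixMean (Y i) (pullTarget n m δ r) - x i| ≤ 3 / 4 * width r)
    {r : ℕ} (hr1 : 1 ≤ r) (hrR : r < R) {i : Fin n} (hkept : KeptBy α₁ α₂ δ Y α r i)
    {j : Fin n} (hj : ∀ r, 1 ≤ r → r < R →
      |prefixMean (Y j) (pullTarget n m δ r) - x j| ≤ 1 / 5 * width r) :
    s * (η - x i) ≤ 2 * width r ∨ s * (η - x i) ≤ 40 * (s * (η - x j)) := by
  have habs : ∀ {a b : ℝ}, |a| ≤ b → -b ≤ s * a ∧ s * a ≤ b := by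
    intro a b h
    have := abs_le.1 h
    rcases hs with rfl | rfl <;> constructor <;> linarith
  have habs' : ∀ {a b c : ℝ}, b < |a - c| → s * a ≤ s * c → s * a < s * c - b := by
    intro a b c h h2
    rcases hs with rfl | rfl <;> rcases lt_abs.1 h with h | h <;> linarith
  -- The empirical extreme overshoots the end by at most the current noise: an estimate frozen in
  -- round `σ` is more than `b_σ` inside an extreme that overshoots by at most `3/4 b_σ`, hence does
  -- not overshoot at all.
  have hbase : ∀ ρ, 1 ≤ ρ → ρ < R →
      s * empQuantile (roundMeans α₁ α₂ δ Y ρ) α ≤ s * η + 3 / 4 * width ρ := by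
    intro ρ
    induction ρ using Nat.strong_induction_on with
    | _ ρ ih =>
    intro h1 hR
    obtain ⟨k, hk, -⟩ := exists_empQuantile_eq (v := roundMeans α₁ α₂ δ Y ρ) hn hα1
    rw [hk]
    have hxk := hx k
    rcases roundMeans_cases (α₁ := α₁) (α₂ := α₂) (Y := Y) hmono hα h1 k with
      h | ⟨σ, h1', h2, h3, h3', h4⟩
    · have := (habs (hnoise k ρ h1 hR)).2
      rw [h]; linarith
    · have e := ih σ h2 h1' (h2.trans hR)
      have hw := width_pos ρ
      have hwσ := width_pos σ
      have := habs' h4 (h3' ▸ hext _ k)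
      rw [h3]
      linarith
  have hi := habs hkept.2
  rw [roundMeans_of_mem hmono hkept.1] at hi
  have hni := habs (hnoise i r hr1 hrR)
  have hwr := width_pos r
  have hmax := hext (roundMeans α₁ α₂ δ Y r) j
  have hnj := habs (hj r hr1 hrR)
  by_contra hcon
  push Not at hcon
  rcases roundMeans_cases (α₁ := α₁) (α₂ := α₂) (Y := Y) hmono hα hr1 j with
    h | ⟨ρ, h1, h2, h3, h3', h4⟩
  -- With `d = s (η - x)`, width, noise of `i` and noise of `j` give `d_i ≤ (1 + 3/4 + 1/5) b_r +
  -- d_j`. If `b_r < d_i / 2`, then `d_i / 40 ≤ d_j`.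
  · rw [h] at hmax
    nlinarith
  -- A comparison point frozen in round `ρ` is at least `(1 - 3/4 - 1/5) b_ρ = b_ρ / 20` away from
  -- the end, so its noise `b_ρ / 5` is at most `4 d_j`. Then `d_i ≤ (7/4) b_r + 5 d_j`, which again
  -- yields the factor 40.
  · rw [h3] at hmax
    have hmρ := hbase ρ h1 (h2.trans hrR)
    have hnjρ := habs (hj ρ h1 (h2.trans hrR))
    have := habs' h4 (h3' ▸ hext _ j)
    nlinarith

/-- Every point is pulled `t_{r+1}` times, where `r` is the last round that it survives. -/
theorem exists_finalPulls_eq (hL : 1 ≤ confLog n m δ) (i : Fin n) :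
    ∃ r < lastRound n m δ, i ∈ (run α₁ α₂ δ Y r).active ∧
      finalPulls α₁ α₂ δ Y i = pullTarget n m δ (r + 1) := by
  have hmono := pullTarget_mono (n := n) (m := m) (δ := δ) (zero_le_one.trans hL)
  have hR1 := (lastRound_spec (n := n) (m := m) (δ := δ) hL).1
  obtain ⟨r, hr, hmem, hp, -⟩ := exists_freeze (α₁ := α₁) (α₂ := α₂) (Y := Y) hmono
    (lastRound n m δ - 1) i
  refine ⟨r, by omega, hmem, ?_⟩
  rw [← hp, finalPulls, Nat.sub_add_cancel hR1]

theorem run_pulls_le (hL : 0 ≤ confLog n m δ) (r : ℕ) (i : Fin n) :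
    (run α₁ α₂ δ Y r).pulls i ≤ m := by
  have hmono := pullTarget_mono (n := n) (m := m) (δ := δ) hL
  cases r with
  | zero => simp [run]
  | succ r =>
    obtain ⟨r', -, -, hp, -⟩ := exists_freeze (α₁ := α₁) (α₂ := α₂) (Y := Y) hmono r i
    rw [hp]; exact pullTarget_le _

end Survivors

/-! ### The law of a single point with its observations -/

section Law

variable {n m : ℕ} {F : Measure ℝ}

/-- A latent point, the noise of its `m` observations, and the noise of its fresh observation. -/
abbrev Point (m : ℕ) : Type := ℝ × (Fin m → ℝ) × ℝ

/-- The law of the noise of `m` observations. -/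
noncomputable def noiseLaw (m : ℕ) : Measure (Fin m → ℝ) :=
  Measure.pi fun _ => gaussianReal 0 1

noncomputable def pointLaw (F : Measure ℝ) (m : ℕ) : Measure (Point m) :=
  F.prod ((noiseLaw m).prod (gaussianReal 0 1))

instance : IsProbabilityMeasure (noiseLaw m) := by unfold noiseLaw; infer_instance

instance [IsProbabilityMeasure F] : IsProbabilityMeasure (pointLaw F m) := by
  unfold pointLaw; infer_instance

/-- Independent copies of `pointLaw`, rearranged, give `sampleLaw`. -/
noncomputable def toSample (n m : ℕ) : (Fin n → Point m) ≃ᵐ SampleSpace n m :=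
  (MeasurableEquiv.arrowProdEquivProdArrow ℝ ((Fin m → ℝ) × ℝ) (Fin n)).trans
    ((MeasurableEquiv.refl _).prodCongr
      (MeasurableEquiv.arrowProdEquivProdArrow (Fin m → ℝ) ℝ (Fin n)))

theorem measurePreserving_toSample [IsProbabilityMeasure F] :
    MeasurePreserving (toSample n m) (Measure.pi fun _ : Fin n => pointLaw F m)
      (sampleLaw F n m) := by
  have h1 := measurePreserving_arrowProdEquivProdArrow ℝ ((Fin m → ℝ) × ℝ) (Fin n)
    (fun _ => F) (fun _ => (noiseLaw m).prod (gaussianReal 0 1))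
  have h2 := measurePreserving_arrowProdEquivProdArrow (Fin m → ℝ) ℝ (Fin n)
    (fun _ => noiseLaw m) (fun _ => gaussianReal 0 1)
  exact ((MeasurePreserving.id (Measure.pi fun _ : Fin n => F)).prod h2).comp h1

/-- As `toSample` is a measurable equivalence, no measurability of the event is needed; events
defined through the algorithm never have to be shown measurable. -/
theorem sampleLaw_apply [IsProbabilityMeasure F] (s : Set (SampleSpace n m)) :
    sampleLaw F n m s = (Measure.pi fun _ : Fin n => pointLaw F m) (toSample n m ⁻¹' s) :=
  (measurePreserving_toSample.measure_preimage_equiv s).symm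

theorem lintegral_sampleLaw [IsProbabilityMeasure F] (f : SampleSpace n m → ℝ≥0∞) :
    ∫⁻ ω, f ω ∂sampleLaw F n m
      = ∫⁻ p, f (toSample n m p) ∂(Measure.pi fun _ : Fin n => pointLaw F m) :=
  (measurePreserving_toSample.lintegral_comp_emb (toSample n m).measurableEmbedding f).symm

theorem prefixMean_add {m t : ℕ} (x : ℝ) (z : Fin m → ℝ) (ht : 1 ≤ t) (htm : t ≤ m) :
    prefixMean (fun j => x + z j) t = x + prefixMean z t := by
  unfold prefixMean
  have hcard : (Finset.univ.filter fun j : Fin m => (j : ℕ) < t).card = t := by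
    rw [Fin.card_filter_val_lt]; exact min_eq_right htm
  have ht' : (t : ℝ) ≠ 0 := by positivity
  rw [Finset.sum_add_distrib, Finset.sum_const, hcard, nsmul_eq_mul]
  field_simp

theorem prefixMean_observation {t : ℕ} (p : Fin n → Point m) (i : Fin n) (ht : 1 ≤ t)
    (htm : t ≤ m) : prefixMean (observation (toSample n m p) i) t
      = (p i).1 + prefixMean (p i).2.1 t :=
  prefixMean_add _ _ ht htm

theorem measurable_prefixMean (m t : ℕ) : Measurable fun z : Fin m → ℝ => prefixMean z t := by
  unfold prefixMean; fun_prop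

end Law

/-! ### Concentration of the Gaussian noise -/

theorem ProbabilityTheory.HasSubgaussianMGF.comp_measurePreserving {Ω Ω' : Type*} [MeasurableSpace Ω]
    [MeasurableSpace Ω'] {μ : Measure Ω} {ν : Measure Ω'} {X : Ω → ℝ} {c : NNReal} {f : Ω' → Ω}
    (h : HasSubgaussianMGF X c μ) (hf : MeasurePreserving f ν μ) :
    HasSubgaussianMGF (fun ω => X (f ω)) c ν :=
  HasSubgaussianMGF.of_map hf.measurable.aemeasurable (by rw [hf.map_eq]; exact h)

section Noise

variable {m : ℕ}

theorem hasSubgaussianMGF_sum_mul {c : Fin m → ℝ} :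
    HasSubgaussianMGF (fun z : Fin m → ℝ => ∑ j, c j * z j)
      (∑ j, (c j ^ 2).toNNReal) (noiseLaw m) := by
  have hid : HasSubgaussianMGF (id : ℝ → ℝ) 1 (gaussianReal 0 1) :=
    ⟨fun t => integrable_exp_mul_gaussianReal t, fun t => by
      rw [mgf_id_gaussianReal]; simp⟩
  have hind : iIndepFun (fun j (z : Fin m → ℝ) => c j * z j) (noiseLaw m) :=
    iIndepFun_pi (X := fun j (x : ℝ) => c j * x) fun j => by fun_prop
  refine HasSubgaussianMGF.sum_of_iIndepFun hind fun j _ => ?_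
  have hj := hid.comp_measurePreserving
    (measurePreserving_eval (fun _ : Fin m => gaussianReal 0 1) j)
  have e : (c j ^ 2).toNNReal = NNReal.mk (c j ^ 2) (sq_nonneg _) * 1 := by
    rw [Real.toNNReal_of_nonneg (sq_nonneg _), mul_one]
  rw [e]
  exact hj.const_mul (c j)

theorem noiseLaw_abs_sum_gt {c : Fin m → ℝ} {t s : ℝ} (ht : 0 < t) (hc : ∑ j, c j ^ 2 ≤ 1 / t)
    (hs : 0 ≤ s) :
    (noiseLaw m).real {z | s < |∑ j, c j * z j|} ≤ 2 * Real.exp (-(t * s ^ 2) / 2) := by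
  have h := hasSubgaussianMGF_sum_mul (c := c)
  have hv : (((∑ j, (c j ^ 2).toNNReal : NNReal)) : ℝ) = ∑ j, c j ^ 2 := by
    rw [NNReal.coe_sum]; exact Finset.sum_congr rfl fun j _ => Real.coe_toNNReal _ (sq_nonneg _)
  -- If all coefficients vanish, the sub-Gaussian exponent is a division by zero and gives nothing,
  -- but then the sum itself is zero.
  have hbound : Real.exp (-s ^ 2 / (2 * ∑ j, c j ^ 2)) ≤ Real.exp (-(t * s ^ 2) / 2) ∨
      ∑ j, c j ^ 2 = 0 := by
    rcases (Finset.sum_nonneg fun j _ => sq_nonneg (c j)).eq_or_lt with h0 | h0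
    · exact Or.inr h0.symm
    · left
      refine Real.exp_le_exp.2 ?_
      rw [div_le_div_iff₀ (by positivity) (by norm_num)]
      rw [le_div_iff₀ ht] at hc
      nlinarith [sq_nonneg s]
  rcases hbound with hb | h0
  · have h1 := h.measure_ge_le hs
    have h2 := h.neg.measure_ge_le hs
    rw [hv] at h1 h2
    have hsub : {z : Fin m → ℝ | s < |∑ j, c j * z j|} ⊆
        {z | s ≤ ∑ j, c j * z j} ∪ {z | s ≤ (-fun z : Fin m → ℝ => ∑ j, c j * z j) z} := by
      intro z hz
      rcases lt_abs.1 (show s < |∑ j, c j * z j| from hz) with h | h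
      exacts [Or.inl h.le, Or.inr h.le]
    refine (measureReal_mono hsub).trans ((measureReal_union_le _ _).trans ?_)
    linarith
  · have hzero : ∀ j, c j = 0 := fun j => by
      have := (Finset.sum_eq_zero_iff_of_nonneg fun j _ => sq_nonneg (c j)).1 h0 j
        (Finset.mem_univ _)
      exact pow_eq_zero_iff two_ne_zero |>.1 this
    simp only [hzero, zero_mul, Finset.sum_const_zero, abs_zero, not_lt.2 hs, Set.ofPred_false,
      measureReal_empty]
    positivity

theorem prefixMean_eq_sum {t : ℕ} (z : Fin m → ℝ) :
    prefixMean z t = ∑ j : Fin m, (if (j : ℕ) < t then (t : ℝ)⁻¹ else 0) * z j := by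
  unfold prefixMean
  rw [Finset.sum_filter, div_eq_inv_mul, Finset.mul_sum]
  refine Finset.sum_congr rfl fun j _ => ?_
  split_ifs <;> simp

theorem sum_prefix_ite {t : ℕ} (htm : t ≤ m) (a b : ℝ) :
    ∑ j : Fin m, (if (j : ℕ) < t then a else b) = t * a + (m - t) * b := by
  have hcard : (Finset.univ.filter fun j : Fin m => (j : ℕ) < t).card = t := by
    rw [Fin.card_filter_val_lt]; exact min_eq_right htm
  have hcard' : (Finset.univ.filter fun j : Fin m => ¬ (j : ℕ) < t).card = m - t := by
    have := Finset.card_filter_add_card_filter_not (s := Finset.univ) fun j : Fin m => (j : ℕ) < t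
    rw [hcard, Finset.card_univ, Fintype.card_fin] at this
    omega
  rw [Finset.sum_ite, Finset.sum_const, Finset.sum_const, hcard, hcard', nsmul_eq_mul,
    nsmul_eq_mul, Nat.cast_sub htm]

theorem noiseLaw_abs_prefixMean_gt {t : ℕ} (ht : 1 ≤ t) (htm : t ≤ m) {s : ℝ} (hs : 0 ≤ s) :
    (noiseLaw m).real {z | s < |prefixMean z t|} ≤ 2 * Real.exp (-(t * s ^ 2) / 2) := by
  simp_rw [prefixMean_eq_sum]
  refine noiseLaw_abs_sum_gt (by positivity) ?_ hs
  simp_rw [apply_ite (· ^ 2)]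
  rw [sum_prefix_ite htm]
  have : (t : ℝ) ≠ 0 := by positivity
  apply le_of_eq; field_simp; ring

/-- The squared coefficients of the difference add up to `1/t - 1/m`, so comparing with the final
mean is no harder than comparing with the latent point. -/
theorem noiseLaw_abs_prefixMean_sub_gt {t : ℕ} (ht : 1 ≤ t) (htm : t ≤ m) {s : ℝ} (hs : 0 ≤ s) :
    (noiseLaw m).real {z | s < |prefixMean z t - prefixMean z m|}
      ≤ 2 * Real.exp (-(t * s ^ 2) / 2) := by
  have : ∀ z : Fin m → ℝ, prefixMean z t - prefixMean z m =
      ∑ j : Fin m, (if (j : ℕ) < t then (t : ℝ)⁻¹ - (m : ℝ)⁻¹ else -(m : ℝ)⁻¹) * z j := by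
    intro z
    rw [prefixMean_eq_sum, prefixMean_eq_sum, ← Finset.sum_sub_distrib]
    refine Finset.sum_congr rfl fun j _ => ?_
    rw [if_pos j.2]
    split_ifs <;> ring
  simp_rw [this]
  refine noiseLaw_abs_sum_gt (by positivity) ?_ hs
  simp_rw [apply_ite (· ^ 2)]
  rw [sum_prefix_ite htm]
  have h1 : (t : ℝ) ≠ 0 := by positivity
  have h2 : (m : ℝ) ≠ 0 := by have := ht.trans htm; positivity
  have : (t : ℝ) * ((t : ℝ)⁻¹ - (m : ℝ)⁻¹) ^ 2 + (m - t) * (-(m : ℝ)⁻¹) ^ 2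
      = 1 / t - 1 / m := by field_simp; ring
  rw [this]
  have : (0 : ℝ) ≤ 1 / m := by positivity
  linarith

/-- This symmetry yields the zero mean of the noise, the probability `1/2` of a favourable sign, and
the cancellation of the first-order bias. -/
theorem map_neg_noiseLaw : MeasurePreserving (fun z : Fin m → ℝ => -z) (noiseLaw m) (noiseLaw m) :=
  measurePreserving_pi _ _ fun _ =>
    ⟨measurable_neg, gaussianReal_map_neg.trans (by rw [neg_zero])⟩

theorem prefixMean_neg (z : Fin m → ℝ) (t : ℕ) : prefixMean (-z) t = -prefixMean z t := by
  simp [prefixMean, neg_div]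

theorem memLp_prefixMean (t : ℕ) : MemLp (fun z : Fin m → ℝ => prefixMean z t) 2 (noiseLaw m) := by
  simp_rw [prefixMean_eq_sum]
  exact (hasSubgaussianMGF_sum_mul).memLp 2

theorem integral_prefixMean (t : ℕ) : ∫ z : Fin m → ℝ, prefixMean z t ∂noiseLaw m = 0 := by
  have h := (map_neg_noiseLaw (m := m)).integral_comp (MeasurableEquiv.neg _).measurableEmbedding
    fun z => prefixMean z t
  simp_rw [prefixMean_neg, integral_neg] at h
  linarith

theorem integral_prefixMean_sq {t : ℕ} (ht : 1 ≤ t) (htm : t ≤ m) :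
    ∫ z : Fin m → ℝ, prefixMean z t ^ 2 ∂noiseLaw m = 1 / t := by
  have h1 : Var[fun z : Fin m → ℝ => prefixMean z t; noiseLaw m] = 1 / t := by
    have h := variance_sum_pi (μ := fun _ : Fin m => gaussianReal 0 1)
      (X := fun (j : Fin m) (x : ℝ) => (if (j : ℕ) < t then (t : ℝ)⁻¹ else 0) * x)
      (fun j => (memLp_id_gaussianReal 2).const_mul _)
    have e : (fun z : Fin m → ℝ => prefixMean z t) = ∑ j : Fin m, fun z : Fin m → ℝ =>
        (if (j : ℕ) < t then (t : ℝ)⁻¹ else 0) * z j := by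
      ext z; rw [prefixMean_eq_sum, Finset.sum_apply]
    rw [e]
    refine h.trans ?_
    have e2 : ∀ j : Fin m, Var[fun x : ℝ => (if (j : ℕ) < t then (t : ℝ)⁻¹ else 0) * x;
        gaussianReal 0 1] = if (j : ℕ) < t then (t : ℝ)⁻¹ ^ 2 else 0 ^ 2 := fun j => by
      rw [variance_const_mul, variance_fun_id_gaussianReal]; split_ifs <;> simp
    simp_rw [e2]
    rw [sum_prefix_ite htm]
    have : (t : ℝ) ≠ 0 := by positivity
    simp; field_simp
  rw [variance_eq_sub (memLp_prefixMean t), integral_prefixMean] at h1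
  simpa using h1

end Noise

/-! ### Concentration of empirical counts and sums -/

section Concentration

variable {Ω : Type*} [MeasurableSpace Ω] {μ : Measure Ω} [IsProbabilityMeasure μ] {n : ℕ}

/-- Hoeffding's inequality: a centred indicator is sub-Gaussian with variance proxy `1/4`. -/
theorem pi_sum_indicator_ge {E : Set Ω} (hE : MeasurableSet E) {s : ℝ} (hs : 0 ≤ s) :
    (Measure.pi fun _ : Fin n => μ).real
      {ω | n * (μ.real E + s) ≤ ∑ i, E.indicator 1 (ω i)} ≤ Real.exp (-2 * n * s ^ 2) := by
  have hb : ∀ᵐ x ∂μ, E.indicator (1 : Ω → ℝ) x ∈ Set.Icc (0 : ℝ) 1 :=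
    ae_of_all _ fun x => by by_cases h : x ∈ E <;> simp [h]
  have hsub := hasSubgaussianMGF_of_mem_Icc (μ := μ) (X := E.indicator (1 : Ω → ℝ))
    (measurable_one.indicator hE).aemeasurable hb
  rw [integral_indicator_one hE] at hsub
  have hind : iIndepFun (fun i (ω : Fin n → Ω) => E.indicator (1 : Ω → ℝ) (ω i) - μ.real E)
      (Measure.pi fun _ : Fin n => μ) :=
    iIndepFun_pi (X := fun _ (x : Ω) => E.indicator (1 : Ω → ℝ) x - μ.real E)
      fun i => ((measurable_one.indicator hE).sub_const _).aemeasurable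
  have h := HasSubgaussianMGF.measure_sum_ge_le_of_iIndepFun hind (s := Finset.univ)
    (c := fun _ => (‖(1 : ℝ) - 0‖₊ / 2) ^ 2) (fun i _ =>
      hsub.comp_measurePreserving (measurePreserving_eval (fun _ : Fin n => μ) i)) (ε := n * s) (by positivity)
  refine (measureReal_mono fun ω hω => ?_).trans (h.trans (Real.exp_le_exp.2 ?_))
  · simp only [Set.mem_ofPred_eq, Finset.sum_sub_distrib, Finset.sum_const, Finset.card_univ,
      Fintype.card_fin, nsmul_eq_mul] at hω ⊢
    linarith
  · rcases Nat.eq_zero_or_pos n with rfl | hn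
    · simp
    · have : (n : ℝ) ≠ 0 := by positivity
      simp
      apply le_of_eq; field_simp

omit [MeasurableSpace Ω] in
theorem sum_indicator_eq_card (E : Set Ω) [DecidablePred (· ∈ E)] (ω : Fin n → Ω) :
    ∑ i, E.indicator (1 : Ω → ℝ) (ω i) = ((Finset.univ.filter fun i => ω i ∈ E).card : ℝ) := by
  simp [Set.indicator_apply]

theorem pi_sum_indicator_le {E : Set Ω} (hE : MeasurableSet E) {s : ℝ} (hs : 0 ≤ s) :
    (Measure.pi fun _ : Fin n => μ).real
      {ω | ∑ i, E.indicator 1 (ω i) ≤ n * (μ.real E - s)} ≤ Real.exp (-2 * n * s ^ 2) := by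
  refine (measureReal_mono fun ω hω => ?_).trans (pi_sum_indicator_ge (n := n) (μ := μ) hE.compl hs)
  simp only [Set.mem_ofPred_eq, probReal_compl_eq_one_sub hE] at hω ⊢
  have : ∀ i, Eᶜ.indicator (1 : Ω → ℝ) (ω i) = 1 - E.indicator (1 : Ω → ℝ) (ω i) := fun i => by
    by_cases h : ω i ∈ E <;> simp [h]
  simp_rw [this, Finset.sum_sub_distrib]
  simp only [Finset.sum_const, Finset.card_univ, Fintype.card_fin, nsmul_eq_mul]
  linarith

/-- Chebyshev's inequality for sums of i.i.d. random variables. -/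
theorem pi_abs_sum_sub_ge {f : Ω → ℝ} (hf : MemLp f 2 μ) {V s : ℝ} (hV : ∫ x, f x ^ 2 ∂μ ≤ V)
    (hn : 1 ≤ n) (hs : 0 < s) :
    (Measure.pi fun _ : Fin n => μ).real {ω | n * s ≤ |∑ i, f (ω i) - n * ∫ x, f x ∂μ|}
      ≤ V / (n * s ^ 2) := by
  have hmp := fun i : Fin n => measurePreserving_eval (fun _ : Fin n => μ) i
  have hfi : ∀ i : Fin n, MemLp (fun ω : Fin n → Ω => f (ω i)) 2 (Measure.pi fun _ => μ) :=
    fun i => hf.comp_measurePreserving (hmp i)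
  have hsum : MemLp (fun ω : Fin n → Ω => ∑ i, f (ω i)) 2 (Measure.pi fun _ => μ) :=
    memLp_finsetSum _ fun i _ => hfi i
  have hint : ∫ ω : Fin n → Ω, ∑ i, f (ω i) ∂(Measure.pi fun _ => μ) = n * ∫ x, f x ∂μ := by
    rw [integral_finsetSum _ fun i _ => (hfi i).integrable one_le_two]
    have : ∀ i : Fin n, ∫ ω : Fin n → Ω, f (ω i) ∂(Measure.pi fun _ => μ) = ∫ x, f x ∂μ := by
      intro i
      have hae : AEStronglyMeasurable f ((Measure.pi fun _ : Fin n => μ).map (Function.eval i)) := by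
        rw [(hmp i).map_eq]; exact hf.1
      have := integral_map (hmp i).measurable.aemeasurable hae
      rw [(hmp i).map_eq] at this
      exact this.symm
    simp_rw [this]
    simp
  have hn' : (0 : ℝ) < n := by positivity
  have hvar : Var[fun ω : Fin n → Ω => ∑ i, f (ω i); Measure.pi fun _ => μ] ≤ n * V := by
    have h := variance_sum_pi (μ := fun _ : Fin n => μ) (X := fun _ => f) (fun _ => hf)
    have e : (fun ω : Fin n → Ω => ∑ i, f (ω i)) = ∑ i, fun ω : Fin n → Ω => f (ω i) := by
      ext; simp
    rw [e]
    refine h.le.trans ?_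
    simp only [Finset.sum_const, Finset.card_univ, Fintype.card_fin, nsmul_eq_mul]
    gcongr
    refine (variance_le_expectation_sq hf.1).trans ?_
    simpa using hV
  have h := meas_ge_le_variance_div_sq hsum (c := n * s) (by positivity)
  rw [hint] at h
  have hV0 : 0 ≤ V := (integral_nonneg fun x => sq_nonneg (f x)).trans hV
  refine (ENNReal.toReal_mono ENNReal.ofReal_ne_top h).trans ?_
  rw [ENNReal.toReal_ofReal (div_nonneg (variance_nonneg _ _) (by positivity))]
  rw [div_le_div_iff₀ (by positivity) (by positivity)]
  nlinarith [mul_le_mul_of_nonneg_right hvar (show 0 ≤ n * s ^ 2 by positivity)]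

/-- Union bound over the coordinates. -/
theorem pi_exists_mem_le (E : Set Ω) (hE : MeasurableSet E) :
    (Measure.pi fun _ : Fin n => μ).real {ω | ∃ i, ω i ∈ E} ≤ n * μ.real E := by
  have : {ω : Fin n → Ω | ∃ i, ω i ∈ E} = ⋃ i, {ω | ω i ∈ E} := by ext; simp
  rw [this]
  refine (measureReal_iUnion_fintype_le _).trans ?_
  have : ∀ i : Fin n, (Measure.pi fun _ : Fin n => μ).real {ω | ω i ∈ E} = μ.real E := fun i =>
    (measurePreserving_eval (fun _ : Fin n => μ) i).measureReal_preimage hE.nullMeasurableSet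
  simp_rw [this]
  simp

end Concentration

/-! ### Points that are estimated badly -/

section BadNoise

variable {n m : ℕ} {δ : ℝ}

/-- In some round before the last one the empirical noise exceeds `θ b_r`. -/
def badNoise (n m : ℕ) (δ θ : ℝ) : Set (Fin m → ℝ) :=
  {z | ∃ r ∈ Finset.Ico 1 (lastRound n m δ), θ * width r < |prefixMean z (pullTarget n m δ r)|}

/-- In some round before the last one the empirical mean is not within `b_r / 2` of the final one. -/
def badDeviation (n m : ℕ) (δ : ℝ) : Set (Fin m → ℝ) :=
  {z | ∃ r ∈ Finset.Ico 1 (lastRound n m δ),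
    1 / 2 * width r < |prefixMean z (pullTarget n m δ r) - prefixMean z m|}

theorem measurableSet_badNoise (θ : ℝ) : MeasurableSet (badNoise n m δ θ) := by
  have : badNoise n m δ θ = ⋃ r ∈ Finset.Ico 1 (lastRound n m δ),
      {z | θ * width r < |prefixMean z (pullTarget n m δ r)|} := by
    ext; simp [badNoise]
  rw [this]
  exact Finset.measurableSet_biUnion _ fun r _ =>
    measurableSet_lt measurable_const (measurable_prefixMean _ _).abs

theorem measurableSet_badDeviation : MeasurableSet (badDeviation n m δ) := by
  have : badDeviation n m δ = ⋃ r ∈ Finset.Ico 1 (lastRound n m δ),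
      {z | 1 / 2 * width r < |prefixMean z (pullTarget n m δ r) - prefixMean z m|} := by
    ext; simp [badDeviation]
  rw [this]
  exact Finset.measurableSet_biUnion _ fun r _ =>
    measurableSet_lt measurable_const
      ((measurable_prefixMean _ _).sub (measurable_prefixMean _ _)).abs

/-- Before the last round the pull target is not cut off at `m`. This product is the quantity that
enters every Gaussian tail exponent below. -/
theorem eight_mul_confLog_le {r : ℕ} (hr : r ∈ Finset.Ico 1 (lastRound n m δ)) :
    8 * confLog n m δ ≤ pullTarget n m δ r * width r ^ 2 := by
  obtain ⟨h1, h2⟩ := Finset.mem_Ico.1 hr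
  have h := le_pullTarget_of_lt h1 (pullTarget_lt h1 h2)
  have hw : (0 : ℝ) < width r ^ 2 := pow_pos (width_pos r) 2
  have hw' := hw.ne'
  rw [← width_sq_inv] at h
  calc 8 * confLog n m δ = 8 * (width r ^ 2)⁻¹ * confLog n m δ * width r ^ 2 := by
        rw [mul_right_comm, mul_assoc 8, inv_mul_cancel₀ hw', mul_one]
    _ ≤ _ := by gcongr

theorem noiseLaw_iUnion_rounds_le {S : ℕ → Set (Fin m → ℝ)} {b : ℝ}
    (hS : ∀ r ∈ Finset.Ico 1 (lastRound n m δ), (noiseLaw m).real (S r) ≤ b) :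
    (noiseLaw m).real {z | ∃ r ∈ Finset.Ico 1 (lastRound n m δ), z ∈ S r}
      ≤ ((lastRound n m δ - 1 : ℕ) : ℝ) * b := by
  have : {z | ∃ r ∈ Finset.Ico 1 (lastRound n m δ), z ∈ S r} =
      ⋃ r ∈ Finset.Ico 1 (lastRound n m δ), S r := by ext; simp
  rw [this]
  refine (measureReal_biUnion_finset_le _ _).trans ((Finset.sum_le_sum hS).trans ?_)
  simp

/-- The tail exponent is `t_r (θ b_r)² / 2 ≥ 4 θ² L`, so precision is traded against probability.
The values used are `7/16` for interior quantiles, `3/4` for all points and `1/5` for comparison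
points at an extreme. -/
theorem noiseLaw_badNoise_le (hm : 1 ≤ m) {θ : ℝ} (hθ : 0 ≤ θ) :
    (noiseLaw m).real (badNoise n m δ θ) ≤
      ((lastRound n m δ - 1 : ℕ) : ℝ) * (2 * Real.exp (-(4 * θ ^ 2 * confLog n m δ))) := by
  refine noiseLaw_iUnion_rounds_le
    (S := fun r => {z | θ * width r < |prefixMean z (pullTarget n m δ r)|}) fun r hr => ?_
  obtain ⟨h1, h2⟩ := Finset.mem_Ico.1 hr
  obtain ⟨k, rfl⟩ : ∃ k, r = k + 1 := ⟨r - 1, by omega⟩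
  refine (noiseLaw_abs_prefixMean_gt (one_le_pullTarget hm k) (pullTarget_le _)
    (mul_nonneg hθ (width_pos _).le)).trans ?_
  gcongr
  have := eight_mul_confLog_le hr
  nlinarith [sq_nonneg θ]

theorem noiseLaw_badDeviation_le (hm : 1 ≤ m) :
    (noiseLaw m).real (badDeviation n m δ) ≤
      ((lastRound n m δ - 1 : ℕ) : ℝ) * (2 * Real.exp (-confLog n m δ)) := by
  refine noiseLaw_iUnion_rounds_le
    (S := fun r => {z | 1 / 2 * width r < |prefixMean z (pullTarget n m δ r) - prefixMean z m|})
    fun r hr => ?_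
  obtain ⟨h1, h2⟩ := Finset.mem_Ico.1 hr
  obtain ⟨k, rfl⟩ : ∃ k, r = k + 1 := ⟨r - 1, by omega⟩
  refine (noiseLaw_abs_prefixMean_sub_gt (one_le_pullTarget hm k) (pullTarget_le _)
    (mul_nonneg (by norm_num) (width_pos _).le)).trans ?_
  gcongr
  have := eight_mul_confLog_le hr
  nlinarith

theorem log_pos_of_two_le (hm : 2 ≤ m) : 0 < Real.log m :=
  Real.log_pos (by exact_mod_cast hm)

theorem exp_neg_confLog (hn : 1 ≤ n) (hm : 2 ≤ m) (hδ : 0 < δ) :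
    Real.exp (-confLog n m δ) = δ / (16 * n * Real.log m) := by
  have := log_pos_of_two_le hm
  rw [Real.exp_neg, confLog, Real.exp_log (by positivity), inv_div]

theorem one_le_log_four : 1 ≤ Real.log 4 := by
  have : Real.log 4 = 2 * Real.log 2 := by
    rw [show (4 : ℝ) = 2 ^ 2 by norm_num, Real.log_pow]; norm_num
  rw [this]; linarith [Real.log_two_gt_d9]

theorem lastRound_sub_one_le_log (hn : 1 ≤ n) (hm : 2 ≤ m) (hδ : 0 < δ) (hδ1 : δ < 1) :
    ((lastRound n m δ - 1 : ℕ) : ℝ) ≤ Real.log m := by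
  have h := lastRound_sub_one_mul_log (one_le_confLog hn hm hδ hδ1) (by omega)
  refine le_trans ?_ h
  exact le_mul_of_one_le_right (Nat.cast_nonneg _) one_le_log_four

/-- Each of at most `log m` rounds fails with probability at most `2 δ / (16 n log m)`; the argument
of the logarithm in the schedule is made for this union bound. -/
theorem mul_noiseLaw_badDeviation_le (hn : 1 ≤ n) (hm : 2 ≤ m) (hδ : 0 < δ) (hδ1 : δ < 1) :
    n * (noiseLaw m).real (badDeviation n m δ) ≤ δ / 8 := by
  have hl := log_pos_of_two_le hm
  have h1 := noiseLaw_badDeviation_le (n := n) (m := m) (δ := δ) (by omega)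
  have h2 := lastRound_sub_one_le_log hn hm hδ hδ1
  rw [exp_neg_confLog hn hm hδ] at h1
  have hn' : (0 : ℝ) < n := by positivity
  calc n * (noiseLaw m).real (badDeviation n m δ)
      ≤ n * (Real.log m * (2 * (δ / (16 * n * Real.log m)))) := by gcongr; exact h1.trans (by gcongr)
    _ = δ / 8 := by field_simp; norm_num

variable {F : Measure ℝ} [IsProbabilityMeasure F]

omit [IsProbabilityMeasure F] in
theorem pointLaw_fst_noise (A : Set ℝ) (B : Set (Fin m → ℝ)) :
    (pointLaw F m).real {p | p.1 ∈ A ∧ p.2.1 ∈ B} = F.real A * (noiseLaw m).real B := by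
  have : {p : Point m | p.1 ∈ A ∧ p.2.1 ∈ B} = A ×ˢ (B ×ˢ Set.univ) := by
    ext; simp
  rw [this, pointLaw, measureReal_prod_prod, measureReal_prod_prod]
  simp

theorem pointLaw_noise (B : Set (Fin m → ℝ)) :
    (pointLaw F m).real {p | p.2.1 ∈ B} = (noiseLaw m).real B := by
  have := pointLaw_fst_noise (F := F) Set.univ B
  simpa using this

omit [IsProbabilityMeasure F] in
theorem pointLaw_fst (A : Set ℝ) :
    (pointLaw F m).real {p | p.1 ∈ A} = F.real A := by
  have := pointLaw_fst_noise (F := F) (m := m) A Set.univ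
  simpa using this

/-- The event that some point has a bad deviation. -/
def deviationEvent (n m : ℕ) (δ : ℝ) : Set (Fin n → Point m) :=
  {p | ∃ i, (p i).2.1 ∈ badDeviation n m δ}

theorem pi_deviationEvent_le (hn : 1 ≤ n) (hm : 2 ≤ m) (hδ : 0 < δ) (hδ1 : δ < 1) :
    (Measure.pi fun _ : Fin n => pointLaw F m).real (deviationEvent n m δ) ≤ δ / 8 := by
  refine (pi_exists_mem_le {p : Point m | p.2.1 ∈ badDeviation n m δ}
    (measurableSet_badDeviation.preimage (by fun_prop))).trans ?_
  rw [pointLaw_noise]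
  exact mul_noiseLaw_badDeviation_le hn hm hδ hδ1

omit F in
theorem abs_prefixMean_sub_le_of_notMem (hm : 1 ≤ m) {p : Fin n → Point m}
    (hp : p ∉ deviationEvent n m δ) (i : Fin n) (r : ℕ) (h1 : 1 ≤ r) (h2 : r < lastRound n m δ) :
    |prefixMean (observation (toSample n m p) i) (pullTarget n m δ r)
      - prefixMean (observation (toSample n m p) i) m| ≤ 1 / 2 * width r := by
  obtain ⟨k, rfl⟩ : ∃ k, r = k + 1 := ⟨r - 1, by omega⟩
  rw [prefixMean_observation _ _ (one_le_pullTarget hm k) (pullTarget_le _),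
    prefixMean_observation _ _ hm le_rfl, add_sub_add_left_eq_sub]
  by_contra hcon
  exact hp ⟨i, k + 1, Finset.mem_Ico.2 ⟨h1, h2⟩, not_le.1 hcon⟩

end BadNoise

/-! ### Regularity of the distribution near a quantile -/

section Regularity

/-- What the density condition provides near an interior quantile. -/
structure InteriorRegular (F : Measure ℝ) (α η c τ C : ℝ) : Prop where
  cdf_eq : F.real (Set.Iic η) = α
  up : ∀ s, 0 ≤ s → α + c * min s τ ≤ F.real (Set.Iic (η + s))
  low : ∀ s, 0 ≤ s → F.real (Set.Iio (η - s)) ≤ α - c * min s τ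
  mass : ∀ s, 0 ≤ s → F.real {x | |x - η| ≤ s} ≤ C * s
  smooth : ∀ a, |a - η| ≤ τ → ∀ y,
    |F.real (Set.Iic (a + y)) + F.real (Set.Iic (a - y)) - 2 * F.real (Set.Iic a)| ≤ C * y ^ 2

/-- What tail regularity provides near the right (`s = 1`) or left (`s = -1`) end of the support. -/
structure ExtremeRegular (F : Measure ℝ) (s η t₀ c C β : ℝ) : Prop where
  ae_nonneg : ∀ᵐ x ∂F, 0 ≤ s * (η - x)
  lower : ∀ t, 0 ≤ t → t ≤ t₀ → c * t ^ β ≤ F.real {x | s * (η - x) < t}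
  upper : ∀ t, 0 < t → F.real {x | s * (η - x) ≤ t} ≤ C * t ^ β

variable {F : Measure ℝ} [IsProbabilityMeasure F] {α η t₀ c₁ c₂ β : ℝ}

omit [IsProbabilityMeasure F] in
theorem quantile_le_of_le_cdf {x : ℝ} (h0 : 0 < cdf F x) (h : α ≤ cdf F x) :
    quantile F α ≤ x :=
  sInf_le ⟨x, ⟨h0, h⟩, rfl⟩

omit [IsProbabilityMeasure F] in
theorem exists_cdf_of_quantile_lt {x : ℝ} (h : quantile F α < x) :
    0 < cdf F x ∧ α ≤ cdf F x := by
  obtain ⟨_, ⟨y, hy, rfl⟩, hyx⟩ := sInf_lt_iff.1 h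
  have hyx' : y ≤ x := (EReal.coe_lt_coe_iff.1 hyx).le
  exact ⟨hy.1.trans_le (monotone_cdf F hyx'), hy.2.trans (monotone_cdf F hyx')⟩

omit [IsProbabilityMeasure F] in
theorem cdf_quantile_eq (hα : 0 < α) (hq : quantile F α = (η : EReal))
    (hc : ContinuousAt (fun y => cdf F y) η) : cdf F η = α := by
  apply le_antisymm
  · have hlim : Filter.Tendsto (fun y => cdf F y) (nhdsWithin η (Set.Iio η)) (nhds (cdf F η)) :=
      hc.tendsto.mono_left nhdsWithin_le_nhds
    refine le_of_tendsto hlim (Filter.eventually_of_mem self_mem_nhdsWithin fun y hy => ?_)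
    by_contra hcon
    rw [not_le] at hcon
    have := quantile_le_of_le_cdf (hα.trans hcon) hcon.le
    rw [hq, EReal.coe_le_coe_iff] at this
    exact absurd hy (not_lt.2 this)
  · have hlim : Filter.Tendsto (fun y => cdf F y) (nhdsWithin η (Set.Ioi η)) (nhds (cdf F η)) :=
      hc.tendsto.mono_left nhdsWithin_le_nhds
    refine ge_of_tendsto hlim (Filter.eventually_of_mem self_mem_nhdsWithin fun y hy => ?_)
    exact (exists_cdf_of_quantile_lt (by rw [hq]; exact EReal.coe_lt_coe_iff.2 hy)).2

/-- The constant of `InteriorRegular` that is obtained from `DensityRegular`. -/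
noncomputable def interiorConst (t₀ c₂ : ℝ) : ℝ :=
  3 * (2 / t₀ + c₂ * (2 * t₀)) + 4 / t₀ + 2 * c₂ + 2 / (t₀ / 2) ^ 2

/-- The window is halved so that `a ± y` stays inside the original one when `|a - η| ≤ t₀ / 2` and
`|y| < t₀ / 2`. -/
theorem DensityRegular.interiorRegular (ht₀ : 0 < t₀) (hc₁ : 0 < c₁) (hc₂ : 0 < c₂)
    (hα : 0 < α) (hq : quantile F α = (η : EReal)) (h : DensityRegular F η t₀ c₁ c₂) :
    InteriorRegular F α η c₁ (t₀ / 2) (interiorConst t₀ c₂) := by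
  set f : ℝ → ℝ := fun y => cdf F y with hf
  have hfr : ∀ x, F.real (Set.Iic x) = f x := fun x => (cdf_eq_real F x).symm
  have hmono : Monotone f := monotone_cdf F
  have hf0 : ∀ x, 0 ≤ f x := cdf_nonneg F
  have hf1 : ∀ x, f x ≤ 1 := cdf_le_one F
  set I := Set.Ioo (η - t₀) (η + t₀) with hI
  have hmem : ∀ x, x ∈ I ↔ |x - η| < t₀ := fun x => by
    rw [abs_lt, hI, Set.mem_Ioo]; constructor <;> rintro ⟨h1, h2⟩ <;> constructor <;> linarith
  have hconv : Convex ℝ I := convex_Ioo _ _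
  have hopen : IsOpen I := isOpen_Ioo
  have hd : ∀ x ∈ I, DifferentiableAt ℝ f x := fun x hx => (h x ((hmem x).1 hx)).1
  have hd1 : ∀ x ∈ I, c₁ ≤ deriv f x := fun x hx => (h x ((hmem x).1 hx)).2.1
  have hd2 : ∀ x ∈ I, DifferentiableAt ℝ (deriv f) x := fun x hx => (h x ((hmem x).1 hx)).2.2.1
  have hd3 : ∀ x ∈ I, |deriv (deriv f) x| ≤ c₂ := fun x hx => (h x ((hmem x).1 hx)).2.2.2
  have hηI : η ∈ I := (hmem η).2 (by simpa using ht₀)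
  have hfη : f η = α := cdf_quantile_eq hα hq (hd η hηI).continuousAt
  have hLip : ∀ x ∈ I, ∀ y ∈ I, |deriv f y - deriv f x| ≤ c₂ * |y - x| := fun x hx y hy =>
    hconv.norm_image_sub_le_of_norm_deriv_le (fun z hz => hd2 z hz) (fun z hz => hd3 z hz) hx hy
  set D := 2 / t₀ + c₂ * (2 * t₀) with hD
  have hD0 : 0 < D := by positivity
  -- An upper bound on the density is not assumed. As `f` grows by at most `1` over length `t₀ / 2`,
  -- the mean value theorem gives a point with derivative at most `2 / t₀`, and the bound on the
  -- second derivative carries this through the window.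
  have hderivD : ∀ x ∈ I, |deriv f x| ≤ D := by
    have hlt : η < η + t₀ / 2 := by linarith
    have hsub : Set.Icc η (η + t₀ / 2) ⊆ I := fun x hx => by
      rw [hmem, abs_lt]; constructor <;> linarith [hx.1, hx.2]
    obtain ⟨ξ, hξ, hslope⟩ := exists_deriv_eq_slope f hlt
      (fun x hx => (hd x (hsub hx)).continuousAt.continuousWithinAt)
      (fun x hx => (hd x (hsub (Set.Ioo_subset_Icc_self hx))).differentiableWithinAt)
    have hξI : ξ ∈ I := hsub (Set.Ioo_subset_Icc_self hξ)
    have hb : deriv f ξ ≤ 2 / t₀ := by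
      rw [hslope, add_sub_cancel_left, div_le_div_iff₀ (by positivity) ht₀]
      nlinarith [hf0 η, hf1 (η + t₀ / 2)]
    intro x hx
    have h1 := hd1 x hx
    rw [abs_of_nonneg (hc₁.le.trans h1)]
    have h2 := (abs_le.1 (hLip ξ hξI x hx)).2
    have h3 : |x - ξ| ≤ 2 * t₀ := by
      have := abs_lt.1 ((hmem x).1 hx); have := abs_lt.1 ((hmem ξ).1 hξI)
      rw [abs_le]; constructor <;> linarith
    have : c₂ * |x - ξ| ≤ c₂ * (2 * t₀) := by gcongr
    linarith
  have hgrow : ∀ x ∈ I, ∀ y ∈ I, |f y - f x| ≤ D * |y - x| := fun x hx y hy =>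
    hconv.norm_image_sub_le_of_norm_deriv_le (fun z hz => hd z hz) (fun z hz => hderivD z hz) hx hy
  have hlow : ∀ x ∈ I, ∀ y ∈ I, x ≤ y → c₁ * (y - x) ≤ f y - f x :=
    hconv.mul_sub_le_image_sub_of_le_deriv
      (fun z hz => (hd z hz).continuousAt.continuousWithinAt)
      (fun z hz => (hd z (interior_subset hz)).differentiableWithinAt)
      (fun z hz => hd1 z (interior_subset hz))
  have hpos1 : 0 < 4 / t₀ := by positivity
  have hpos2 : 0 < 2 / (t₀ / 2) ^ 2 := by positivity
  have hC1 : 3 * D ≤ interiorConst t₀ c₂ := by unfold interiorConst; rw [← hD]; linarith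
  have hC2 : 4 / t₀ ≤ interiorConst t₀ c₂ := by unfold interiorConst; rw [← hD]; linarith
  have hC3 : 2 * c₂ ≤ interiorConst t₀ c₂ := by unfold interiorConst; rw [← hD]; linarith
  have hC4 : 2 / (t₀ / 2) ^ 2 ≤ interiorConst t₀ c₂ := by
    unfold interiorConst; rw [← hD]; linarith
  have hmassI : ∀ s, 0 < s → F.real {x | |x - η| ≤ s} ≤ interiorConst t₀ c₂ * s := by
    intro s hs
    rcases lt_or_ge (2 * s) t₀ with hst | hst
    -- A half-open interval has mass equal to a difference of two values of `f`; starting at `η - 2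
    -- s` it contains the closed interval and has length `3 s`.
    · have hsub : {x | |x - η| ≤ s} ⊆ Set.Ioc (η - 2 * s) (η + s) := fun x hx => by
        have := abs_le.1 (show |x - η| ≤ s from hx)
        constructor <;> linarith
      refine (measureReal_mono hsub).trans ?_
      have e : F.real (Set.Ioc (η - 2 * s) (η + s)) = f (η + s) - f (η - 2 * s) := by
        have hu := measureReal_union (μ := F) (s₁ := Set.Iic (η - 2 * s))
          (s₂ := Set.Ioc (η - 2 * s) (η + s)) (Set.disjoint_left.2 fun x h1 h2 =>
            not_lt.2 h1 h2.1) measurableSet_Ioc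
        rw [Set.Iic_union_Ioc_eq_Iic (by linarith), hfr, hfr] at hu
        linarith
      rw [e]
      have h1 : η - 2 * s ∈ I := by rw [hmem, abs_lt]; constructor <;> linarith
      have h2 : η + s ∈ I := by rw [hmem, abs_lt]; constructor <;> linarith
      have := (abs_le.1 (hgrow _ h1 _ h2)).2
      rw [show η + s - (η - 2 * s) = 3 * s by ring, abs_of_pos (by positivity)] at this
      nlinarith
    · refine measureReal_le_one.trans ?_
      calc (1 : ℝ) ≤ 4 / t₀ * s := by rw [div_mul_eq_mul_div, le_div_iff₀ ht₀]; linarith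
        _ ≤ _ := by gcongr
  refine ⟨by rw [hfr, hfη], ?_, ?_, ?_, ?_⟩
  · intro s hs
    rw [hfr, ← hfη]
    have hm : 0 ≤ min s (t₀ / 2) := le_min hs (by positivity)
    have hm2 : min s (t₀ / 2) ≤ t₀ / 2 := min_le_right _ _
    have h2 : η + min s (t₀ / 2) ∈ I := by rw [hmem, abs_lt]; constructor <;> linarith
    have h1 := hlow η hηI _ h2 (by linarith)
    have h3 := hmono (show η + min s (t₀ / 2) ≤ η + s by linarith [min_le_left s (t₀ / 2)])
    linarith
  · intro s hs
    refine (measureReal_mono Set.Iio_subset_Iic_self).trans ?_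
    rw [hfr, ← hfη]
    have hm : 0 ≤ min s (t₀ / 2) := le_min hs (by positivity)
    have hm2 : min s (t₀ / 2) ≤ t₀ / 2 := min_le_right _ _
    have h2 : η - min s (t₀ / 2) ∈ I := by rw [hmem, abs_lt]; constructor <;> linarith
    have h1 := hlow _ h2 η hηI (by linarith)
    have h3 := hmono (show η - s ≤ η - min s (t₀ / 2) by linarith [min_le_left s (t₀ / 2)])
    linarith
  · intro s hs
    rcases hs.eq_or_lt with rfl | hs
    -- At `s = 0` the claim is that `η` is not an atom, which follows by letting the radius tend to
    -- zero.
    · have hlim : Filter.Tendsto (fun u : ℝ => interiorConst t₀ c₂ * u)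
          (nhdsWithin 0 (Set.Ioi 0)) (nhds (interiorConst t₀ c₂ * 0)) :=
        ((continuous_const.mul continuous_id).tendsto 0).mono_left nhdsWithin_le_nhds
      refine ge_of_tendsto hlim (Filter.eventually_of_mem self_mem_nhdsWithin fun u hu => ?_)
      refine (measureReal_mono fun x hx => ?_).trans (hmassI u hu)
      exact le_trans (show |x - η| ≤ 0 from hx) (le_of_lt hu)
    · exact hmassI s hs
  · intro a ha y
    simp only [hfr]
    rcases lt_or_ge |y| (t₀ / 2) with hy | hy
    · have hpt : ∀ u, |u| ≤ |y| → a + u ∈ I := fun u hu => by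
        rw [hmem]
        calc |a + u - η| = |(a - η) + u| := by ring_nf
          _ ≤ |a - η| + |u| := abs_add_le _ _
          _ < t₀ := by linarith
      -- The derivative in `u` of the symmetric second difference is `f' (a + u) - f' (a - u)`, at
      -- most `2 c₂ |y|` because `f'` is Lipschitz; the mean value inequality supplies the second
      -- factor `|y|`.
      have hder : ∀ u ∈ Set.Icc (-|y|) |y|, HasDerivWithinAt
          (fun u => f (a + u) + f (a - u) - 2 * f a)
          (deriv f (a + u) - deriv f (a - u)) (Set.Icc (-|y|) |y|) u := by
        intro u hu
        have hu' : |u| ≤ |y| := abs_le.2 hu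
        have e1 := (hd _ (hpt u hu')).hasDerivAt.comp_const_add a u
        have e2 := HasDerivAt.comp_const_sub a u
          (hd _ (by have := hpt (-u) (by rwa [abs_neg]); rwa [← sub_eq_add_neg] at this)).hasDerivAt
        exact (((e1.add e2).sub_const (2 * f a)).congr_deriv (by ring)).hasDerivWithinAt
      have hbd : ∀ u ∈ Set.Icc (-|y|) |y|, ‖deriv f (a + u) - deriv f (a - u)‖ ≤ 2 * c₂ * |y| := by
        intro u hu
        have hu' : |u| ≤ |y| := abs_le.2 hu
        have := hLip (a - u) (by
          have := hpt (-u) (by rwa [abs_neg]); rwa [← sub_eq_add_neg] at this) (a + u) (hpt u hu')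
        rw [Real.norm_eq_abs]
        refine this.trans ?_
        rw [show a + u - (a - u) = 2 * u by ring, abs_mul, abs_of_pos (by norm_num : (0 : ℝ) < 2)]
        nlinarith
      have hres := (convex_Icc (-|y|) |y|).norm_image_sub_le_of_norm_hasDerivWithin_le hder hbd
        (x := 0) (y := y) ⟨by simp, by simp⟩ ⟨neg_abs_le y, le_abs_self y⟩
      simp only [add_zero, sub_zero, Real.norm_eq_abs] at hres
      rw [show f (a + y) + f (a - y) - 2 * f a - (f a + f a - 2 * f a)
        = f (a + y) + f (a - y) - 2 * f a by ring] at hres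
      refine hres.trans ?_
      rw [mul_assoc, abs_mul_abs_self, ← pow_two]
      gcongr
    -- For large `|y|` the trivial bound `2` is below a multiple of `y²`, which explains the last
    -- summand of `interiorConst`.
    · have h1 : |f (a + y) + f (a - y) - 2 * f a| ≤ 2 := by
        rw [abs_le]
        constructor <;> linarith [hf0 (a + y), hf0 (a - y), hf0 a, hf1 (a + y), hf1 (a - y), hf1 a]
      have h2 : (t₀ / 2) ^ 2 ≤ y ^ 2 := by rw [← sq_abs y]; gcongr
      refine h1.trans ?_
      calc (2 : ℝ) = 2 / (t₀ / 2) ^ 2 * (t₀ / 2) ^ 2 := by field_simp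
        _ ≤ _ := mul_le_mul hC4 h2 (by positivity) (hpos2.le.trans hC4)

/-- The constant of the upper bound in `ExtremeRegular`. -/
noncomputable def extremeConst (t₀ c₂ β : ℝ) : ℝ := c₂ * 2 ^ β + (2 / t₀) ^ β

/-- The upper bound at `t = 0` says that no mass lies beyond `η`. Doubling `t` turns the strict
inequality into a weak one, and beyond `t₀ / 2` the term `(2 t / t₀)^β ≥ 1` makes the bound trivial.
-/
theorem extremeRegular_of_tail {s : ℝ} (ht₀ : 0 < t₀) (hc₂ : 0 < c₂) (hβ : 0 < β)
    (h : ∀ t, 0 ≤ t → t ≤ t₀ → c₁ * t ^ β ≤ F.real {x | s * (η - x) < t} ∧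
      F.real {x | s * (η - x) < t} ≤ c₂ * t ^ β) :
    ExtremeRegular F s η t₀ c₁ (extremeConst t₀ c₂ β) β := by
  refine ⟨?_, fun t h0 h1 => (h t h0 h1).1, fun t ht => ?_⟩
  · have h0 := (h 0 le_rfl ht₀.le).2
    rw [Real.zero_rpow hβ.ne', mul_zero] at h0
    have h0' := le_antisymm h0 measureReal_nonneg
    rw [measureReal_eq_zero_iff] at h0'
    rw [ae_iff]
    simpa using h0'
  · have hp : (0 : ℝ) < t ^ β := Real.rpow_pos_of_pos ht _
    have hq : (0 : ℝ) < (2 / t₀) ^ β := Real.rpow_pos_of_pos (by positivity) _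
    rcases le_or_gt (2 * t) t₀ with ht2 | ht2
    · refine (measureReal_mono fun x hx => ?_).trans
        (((h (2 * t) (by positivity) ht2).2).trans ?_)
      · exact lt_of_le_of_lt (show s * (η - x) ≤ t from hx) (by linarith)
      · rw [Real.mul_rpow (by norm_num) ht.le, extremeConst]
        nlinarith
    · refine measureReal_le_one.trans ?_
      have h1 : (1 : ℝ) ≤ (2 / t₀) ^ β * t ^ β := by
        rw [← Real.mul_rpow (by positivity) ht.le]
        refine Real.one_le_rpow ?_ hβ.le
        rw [div_mul_eq_mul_div, le_div_iff₀ ht₀]; linarith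
      have h2 : (0 : ℝ) < 2 ^ β := Real.rpow_pos_of_pos (by norm_num) _
      rw [extremeConst, add_mul]
      have : 0 < c₂ * 2 ^ β * t ^ β := by positivity
      linarith

theorem UpperTailRegular.extremeRegular (ht₀ : 0 < t₀) (hc₂ : 0 < c₂) (hβ : 0 < β)
    (h : UpperTailRegular F η t₀ c₁ c₂ β) :
    ExtremeRegular F 1 η t₀ c₁ (extremeConst t₀ c₂ β) β := by
  refine extremeRegular_of_tail ht₀ hc₂ hβ fun t h0 h1 => ?_
  have : F.real {x | 1 * (η - x) < t} = 1 - cdf F (η - t) := by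
    rw [cdf_eq_real, ← probReal_compl_eq_one_sub measurableSet_Iic, Set.compl_Iic]
    congr 1; ext x; simp only [Set.mem_ofPred_eq, Set.mem_Ioi]
    constructor <;> intro h <;> linarith
  rw [this]
  exact h t h0 h1

theorem LowerTailRegular.extremeRegular (ht₀ : 0 < t₀) (hc₂ : 0 < c₂) (hβ : 0 < β)
    (h : LowerTailRegular F η t₀ c₁ c₂ β) :
    ExtremeRegular F (-1) η t₀ c₁ (extremeConst t₀ c₂ β) β := by
  refine extremeRegular_of_tail ht₀ hc₂ hβ fun t h0 h1 => ?_
  have : {x | -1 * (η - x) < t} = Set.Iio (η + t) := by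
    ext x; simp only [Set.mem_ofPred_eq, Set.mem_Iio]
    constructor <;> intro h <;> linarith
  rw [this]
  exact h t h0 h1

end Regularity

/-! ### Probability that a distant point has no closer competitor -/

section ExtremeProbability

variable {n m : ℕ} {F : Measure ℝ} [IsProbabilityMeasure F]

theorem pi_single_and_others {Ω : Type*} [MeasurableSpace Ω] {μ : Measure Ω}
    [IsProbabilityMeasure μ] (A B : Set Ω) (i : Fin n) :
    (Measure.pi fun _ : Fin n => μ).real {ω | ω i ∈ A ∧ ∀ j, j ≠ i → ω j ∈ B}
      = μ.real A * μ.real B ^ (n - 1) := by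
  classical
  have : {ω : Fin n → Ω | ω i ∈ A ∧ ∀ j, j ≠ i → ω j ∈ B}
      = Set.pi Set.univ fun j => if j = i then A else B := by
    ext ω
    simp only [Set.mem_ofPred_eq, Set.mem_pi, Set.mem_univ, true_implies]
    constructor
    · rintro ⟨h1, h2⟩ j
      by_cases hj : j = i
      · subst hj; simpa using h1
      · simpa [hj] using h2 j hj
    · intro h
      exact ⟨by simpa using h i, fun j hj => by simpa [hj] using h j⟩
  rw [measureReal_def, this, Measure.pi_pi, ENNReal.toReal_prod,
    ← Finset.mul_prod_erase _ _ (Finset.mem_univ i)]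
  have h2 : ∀ j ∈ Finset.univ.erase i, (μ (if j = i then A else B)).toReal = μ.real B :=
    fun j hj => by rw [if_neg (Finset.ne_of_mem_erase hj), measureReal_def]
  rw [Finset.prod_congr rfl h2, Finset.prod_const, Finset.card_erase_of_mem (Finset.mem_univ i)]
  simp [measureReal_def]

theorem summable_succ_mul_exp {c : ℝ} (hc : 0 < c) :
    Summable fun k : ℕ => ((k : ℝ) + 1) * Real.exp (-(c * k)) := by
  have hr : ‖Real.exp (-c)‖ < 1 := by
    rw [Real.norm_eq_abs, abs_of_pos (Real.exp_pos _)]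
    exact Real.exp_lt_one_iff.2 (by linarith)
  have h1 := summable_pow_mul_geometric_of_norm_lt_one 1 hr
  have h0 := summable_pow_mul_geometric_of_norm_lt_one 0 hr
  refine (h1.add h0).congr fun k => ?_
  rw [← Real.exp_nat_mul, pow_one, pow_zero]
  ring_nf

/-- The constant in `pi_extreme_le`. -/
noncomputable def gapConst (t₀ c C β : ℝ) : ℝ :=
  C * (∑' k : ℕ, ((k : ℝ) + 1) * Real.exp (-(c / 4 * (40 : ℝ)⁻¹ ^ β * k)))
    + 4 / (c * t₀ ^ β)

theorem pow_le_exp_of_le {x y : ℝ} (hx : 0 ≤ x) (h : x ≤ 1 - y) (k : ℕ) :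
    x ^ k ≤ Real.exp (-(y * k)) := by
  calc x ^ k ≤ Real.exp (-y) ^ k := by
        gcongr; linarith [Real.add_one_le_exp (-y)]
    _ = _ := by rw [← Real.exp_nat_mul]; ring_nf

/-- It is unlikely that a point is much farther from the end of the support than no
well-estimated other point is. -/
theorem pi_extreme_le {s η t₀ c C β : ℝ} (ht₀ : 0 < t₀) (hc : 0 < c) (hC : 0 < C) (hβ : 0 < β)
    (hF : ExtremeRegular F s η t₀ c C β) (hn : 2 ≤ n) {G : Set (Fin m → ℝ)}
    (hG : MeasurableSet G) (hGp : 1 / 2 ≤ (noiseLaw m).real G) (i : Fin n) :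
    (Measure.pi fun _ : Fin n => pointLaw F m).real
      {p | 0 ≤ s * (η - (p i).1) ∧
        ∀ j, j ≠ i → (p j).2.1 ∈ G → s * (η - (p i).1) ≤ 40 * (s * (η - (p j).1))}
      ≤ gapConst t₀ c C β / n := by
  set ν := (Measure.pi fun _ : Fin n => pointLaw F m)
  have hn' : (0 : ℝ) < n := by positivity
  have hn1 : (n : ℝ) / 2 ≤ ((n - 1 : ℕ) : ℝ) := by
    rw [Nat.cast_sub (by omega)]; push_cast
    have : (2 : ℝ) ≤ n := by exact_mod_cast hn
    linarith
  set d : Point m → ℝ := fun q => s * (η - q.1) with hd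
  have hdm : Measurable d := by fun_prop
  -- the probability that another point gives no information at scale `u`
  have hother : ∀ u, 0 ≤ u → u ≤ t₀ →
      (pointLaw F m).real {q | q.2.1 ∈ G → u ≤ d q} ≤ 1 - c / 2 * u ^ β := by
    intro u hu hut
    have hcompl : {q : Point m | q.2.1 ∈ G → u ≤ d q} =
        {q | q.1 ∈ {x | s * (η - x) < u} ∧ q.2.1 ∈ G}ᶜ := by
      ext q; simp only [Set.mem_ofPred_eq, Set.mem_compl_iff, not_and, hd]
      constructor
      · exact fun h h1 h2 => absurd (h h2) (not_le.2 h1)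
      · exact fun h h2 => not_lt.1 fun h1 => h h1 h2
    have hmeas : MeasurableSet {q : Point m | q.1 ∈ {x | s * (η - x) < u} ∧ q.2.1 ∈ G} :=
      (measurableSet_lt hdm measurable_const).inter
        (hG.preimage (measurable_fst.comp measurable_snd))
    rw [hcompl, probReal_compl_eq_one_sub hmeas, pointLaw_fst_noise]
    have h1 := hF.lower u hu hut
    have h0 : 0 ≤ c * u ^ β := by positivity
    nlinarith
  -- Distances up to `40 t₀` are sorted into shells between `u k` and `u (k + 1)`, where `u k ^ β =
  -- k / n`. The mass up to the outer radius is then at most `C (k + 1) / n`, and `u k / 40 ≤ t₀` is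
  -- in the range of the lower tail bound.
  set K := ⌊n * (40 * t₀) ^ β⌋₊ with hK
  set u : ℕ → ℝ := fun k => ((k : ℝ) / n) ^ β⁻¹ with hu
  have hu0 : ∀ k, 0 ≤ u k := fun k => by positivity
  have huβ : ∀ k, u k ^ β = k / n := fun k => Real.rpow_inv_rpow (by positivity) hβ.ne'
  let A : ℕ → Set (Point m) := fun k => {q | d q ≤ u (k + 1)}
  let B : ℕ → Set (Point m) := fun k => {q | q.2.1 ∈ G → u k / 40 ≤ d q}
  let B' : Set (Point m) := {q | q.2.1 ∈ G → t₀ ≤ d q}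
  have hsub : {p : Fin n → Point m | 0 ≤ d (p i) ∧
        ∀ j, j ≠ i → (p j).2.1 ∈ G → d (p i) ≤ 40 * d (p j)} ⊆
      (⋃ k ∈ Finset.range (K + 1), {p | p i ∈ A k ∧ ∀ j, j ≠ i → p j ∈ B k}) ∪
        {p | p i ∈ Set.univ ∧ ∀ j, j ≠ i → p j ∈ B'} := by
    rintro p ⟨hp0, hp⟩
    rcases le_or_gt (d (p i)) (40 * t₀) with hle | hgt
    · left
      set k := ⌊n * d (p i) ^ β⌋₊ with hk
      have hnd : 0 ≤ n * d (p i) ^ β := by positivity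
      have hk1 : (k : ℝ) ≤ n * d (p i) ^ β := Nat.floor_le hnd
      have hk2 : n * d (p i) ^ β < k + 1 := Nat.lt_floor_add_one _
      have hkK : k ≤ K := Nat.floor_mono (by gcongr)
      have huk : u k ≤ d (p i) := by
        rw [← Real.rpow_le_rpow_iff (hu0 k) hp0 hβ, huβ, div_le_iff₀ hn']; linarith
      have huk1 : d (p i) ≤ u (k + 1) := by
        rw [← Real.rpow_le_rpow_iff hp0 (hu0 _) hβ, huβ, le_div_iff₀ hn']; push_cast; linarith
      refine Set.mem_biUnion (Finset.mem_coe.2 (Finset.mem_range.2 (Nat.lt_succ_of_le hkK)))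
        ⟨huk1, fun j hj hjG => ?_⟩
      have := hp j hj hjG
      linarith
    · right
      refine ⟨trivial, fun j hj hjG => ?_⟩
      have := hp j hj hjG
      linarith
  have hA : ∀ k, (pointLaw F m).real (A k) ≤ C * ((k + 1 : ℕ) / n) := by
    intro k
    have h1 : A k = {q | q.1 ∈ {x | s * (η - x) ≤ u (k + 1)}} := rfl
    rw [h1, pointLaw_fst, ← huβ]
    exact hF.upper _ (Real.rpow_pos_of_pos (by positivity) _)
  -- One factor `1/2` is the probability of good noise, the other comes from `n - 1 ≥ n / 2`.
  set c' := c / 4 * (40 : ℝ)⁻¹ ^ β with hc'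
  have hc'0 : 0 < c' := by positivity
  have hterm : ∀ k ∈ Finset.range (K + 1),
      ν.real {p | p i ∈ A k ∧ ∀ j, j ≠ i → p j ∈ B k}
        ≤ C / n * (((k : ℝ) + 1) * Real.exp (-(c' * k))) := by
    intro k hk
    have hkK : k ≤ K := Nat.lt_succ_iff.1 (Finset.mem_range.1 hk)
    rw [pi_single_and_others]
    have hkn : (k : ℝ) ≤ n * (40 * t₀) ^ β :=
      (Nat.cast_le.2 hkK).trans (Nat.floor_le (by positivity))
    have huk : u k / 40 ≤ t₀ := by
      rw [div_le_iff₀ (by norm_num), ← Real.rpow_le_rpow_iff (hu0 k) (by positivity) hβ, huβ,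
        div_le_iff₀ hn', mul_comm t₀]
      linarith
    have hB := hother (u k / 40) (by have := hu0 k; positivity) huk
    have he : c / 2 * (u k / 40) ^ β = 2 * c' * (k / n) := by
      rw [div_eq_mul_inv (u k), Real.mul_rpow (hu0 k) (by norm_num), huβ, hc']; ring
    rw [he] at hB
    have hBk := pow_le_exp_of_le measureReal_nonneg hB (n - 1)
    have hexp : Real.exp (-(2 * c' * (k / n) * ((n - 1 : ℕ) : ℝ))) ≤ Real.exp (-(c' * k)) := by
      refine Real.exp_le_exp.2 (neg_le_neg ?_)
      calc c' * k = 2 * c' * (k / n) * (n / 2) := by field_simp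
        _ ≤ _ := by gcongr
    calc (pointLaw F m).real (A k) * (pointLaw F m).real (B k) ^ (n - 1)
        ≤ (C * ((k + 1 : ℕ) / n)) * Real.exp (-(c' * k)) :=
          mul_le_mul (hA k) (hBk.trans hexp) (by positivity) (by positivity)
      _ = _ := by push_cast; ring
  -- Beyond `40 t₀` every well-estimated competitor is at least `t₀` away from the end. This is
  -- exponentially unlikely in `n`, and `1 / n` is all that is kept of it.
  have hfar : ν.real {p | p i ∈ Set.univ ∧ ∀ j, j ≠ i → p j ∈ B'} ≤ 4 / (c * t₀ ^ β) / n := by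
    rw [pi_single_and_others]
    have hB := pow_le_exp_of_le measureReal_nonneg (hother t₀ ht₀.le le_rfl) (n - 1)
    have hy : 0 < c / 2 * t₀ ^ β * (n / 2) := by positivity
    have hexp : Real.exp (-(c / 2 * t₀ ^ β * ((n - 1 : ℕ) : ℝ)))
        ≤ 1 / (c / 2 * t₀ ^ β * (n / 2)) := by
      rw [Real.exp_neg, ← one_div]
      refine one_div_le_one_div_of_le hy ?_
      have h1 : c / 2 * t₀ ^ β * (n / 2) ≤ c / 2 * t₀ ^ β * ((n - 1 : ℕ) : ℝ) := by gcongr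
      linarith [Real.add_one_le_exp (c / 2 * t₀ ^ β * ((n - 1 : ℕ) : ℝ))]
    refine le_trans (mul_le_mul measureReal_le_one (hB.trans hexp) (by positivity) zero_le_one) ?_
    apply le_of_eq
    have : t₀ ^ β ≠ 0 := by positivity
    field_simp; norm_num
  have hsum : ∑ k ∈ Finset.range (K + 1), ((k : ℝ) + 1) * Real.exp (-(c' * k))
      ≤ ∑' k : ℕ, ((k : ℝ) + 1) * Real.exp (-(c' * k)) :=
    (summable_succ_mul_exp hc'0).sum_le_tsum _ fun k _ => by positivity
  refine (measureReal_mono hsub).trans ((measureReal_union_le _ _).trans ?_)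
  refine (add_le_add ((measureReal_biUnion_finset_le _ _).trans (Finset.sum_le_sum hterm))
    hfar).trans ?_
  rw [← Finset.mul_sum, gapConst, add_div]
  gcongr
  rw [div_mul_eq_mul_div]
  gcongr

end ExtremeProbability

/-! ### Bad events for the survival of distant points -/

section SurvivalProbability

variable {n m : ℕ} {α₁ α₂ δ : ℝ} {F : Measure ℝ} [IsProbabilityMeasure F]

theorem eight_mul_confLog_div_lt {r : ℕ} (hr : r ∈ Finset.Ico 1 (lastRound n m δ)) :
    8 * confLog n m δ ≤ m * width r ^ 2 := by
  refine (eight_mul_confLog_le hr).trans ?_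
  have : (pullTarget n m δ r : ℝ) ≤ m := by exact_mod_cast pullTarget_le r
  have := sq_nonneg (width r)
  gcongr

/-- Near an interior quantile, only points close to the quantile survive a round, outside of a small
event. -/
theorem exists_bad_interior {α η c τ C : ℝ} (hα : α = α₁ ∨ α = α₂) (hα1 : α ≤ 1)
    (hF : InteriorRegular F α η c τ C) (hc : 0 < c) (hτ : 0 < τ)
    (hn : 1 ≤ n) (hm : 2 ≤ m) (hδ : 0 < δ) (hδ1 : δ < 1)
    (hlarge : ∀ r ∈ Finset.Ico 1 (lastRound n m δ),
      (noiseLaw m).real (badNoise n m δ (7 / 16)) + 1 / n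
        ≤ c * (min (1 / 16) (2 * τ) * width r) / 2)
    (hratio : m ≤ 2 * (c * min (1 / 16) (2 * τ)) ^ 2 * n) :
    ∃ Bad : Fin n → Set (Fin n → Point m),
      (∀ i, (Measure.pi fun _ : Fin n => pointLaw F m).real (Bad i)
        ≤ (noiseLaw m).real (badNoise n m δ (7 / 16)) +
          ((lastRound n m δ - 1 : ℕ) : ℝ) * (2 * Real.exp (-(2 * confLog n m δ)))) ∧
      ∀ p i r, 1 ≤ r → r < lastRound n m δ →
        KeptBy α₁ α₂ δ (observation (toSample n m p)) α r i → p ∉ Bad i →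
        |(p i).1 - η| ≤ 2 * width r := by
  classical
  have hL := one_le_confLog hn hm hδ hδ1
  set N := badNoise n m δ (7 / 16) with hN
  have hNm : MeasurableSet N := measurableSet_badNoise _
  set κ := min (1 / 16) (2 * τ) with hκ
  have hκ0 : 0 < κ := lt_min (by norm_num) (by positivity)
  set ν := (Measure.pi fun _ : Fin n => pointLaw F m) with hν
  have hn' : (0 : ℝ) < n := by positivity
  have hmin : ∀ r, 1 ≤ r → κ * width r ≤ min (1 / 16 * width r) τ := by
    intro r hr
    have h1 := width_le_half hr
    have h2 := width_pos r
    have h3 : κ ≤ 1 / 16 := min_le_left _ _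
    have h4 : κ ≤ 2 * τ := min_le_right _ _
    refine le_min (by gcongr) ?_
    nlinarith
  -- `U r` collects well-estimated points that are certainly not much above `η`, and `U' r` all
  -- points that may lie below, counting every badly estimated point against the claim. Enough of
  -- the former and few of the latter keep the empirical quantile near `η`.
  let U : ℕ → Set (Point m) := fun r => {q | q.1 ∈ Set.Iic (η + 1 / 16 * width r) ∧ q.2.1 ∈ Nᶜ}
  let U' : ℕ → Set (Point m) := fun r =>
    {q | q.1 ∈ Set.Iio (η - 1 / 16 * width r)} ∪ {q | q.2.1 ∈ N}
  have hmz : Measurable fun q : Point m => q.2.1 := measurable_fst.comp measurable_snd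
  have hUm : ∀ r, MeasurableSet (U r) := fun r =>
    (measurable_fst measurableSet_Iic).inter (hmz hNm.compl)
  have hU'm : ∀ r, MeasurableSet (U' r) := fun r =>
    (measurable_fst measurableSet_Iio).union (hmz hNm)
  set pb := (noiseLaw m).real N with hpb
  have hpb0 : 0 ≤ pb := measureReal_nonneg
  have hUp : ∀ r, 1 ≤ r → α + c * (κ * width r) - pb ≤ (pointLaw F m).real (U r) := by
    intro r hr
    have h1 := hF.up (1 / 16 * width r) (by have := width_pos r; positivity)
    rw [pointLaw_fst_noise, probReal_compl_eq_one_sub hNm]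
    have h2 : F.real (Set.Iic (η + 1 / 16 * width r)) ≤ 1 := measureReal_le_one
    have h3 := mul_le_mul_of_nonneg_left (hmin r hr) hc.le
    nlinarith
  have hUp' : ∀ r, 1 ≤ r → (pointLaw F m).real (U' r) ≤ α - c * (κ * width r) + pb := by
    intro r hr
    have h1 := hF.low (1 / 16 * width r) (by have := width_pos r; positivity)
    refine (measureReal_union_le _ _).trans ?_
    rw [pointLaw_fst, pointLaw_noise]
    have h3 := mul_le_mul_of_nonneg_left (hmin r hr) hc.le
    linarith
  -- Half of the margin `c κ b_r` is the Hoeffding deviation; by `hlarge` the other half covers the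
  -- badly estimated points and the rounding of the rank.
  let s : ℕ → ℝ := fun r => c * (κ * width r) / 2
  have hs : ∀ r, 0 ≤ s r := fun r => by have := width_pos r; positivity
  let E : ℕ → Set (Fin n → Point m) := fun r =>
    {p | ∑ i, (U r).indicator 1 (p i) ≤ n * ((pointLaw F m).real (U r) - s r)} ∪
    {p | n * ((pointLaw F m).real (U' r) + s r) ≤ ∑ i, (U' r).indicator 1 (p i)}
  have hE : ∀ r ∈ Finset.Ico 1 (lastRound n m δ), ν.real (E r)
      ≤ 2 * Real.exp (-(2 * confLog n m δ)) := by
    intro r hr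
    -- From `hratio` and `8 L ≤ m b_r²` one gets `2 n s_r² ≥ m b_r² / 4 ≥ 2 L`.
    have hexp : Real.exp (-2 * n * s r ^ 2) ≤ Real.exp (-(2 * confLog n m δ)) := by
      refine Real.exp_le_exp.2 ?_
      have h1 := eight_mul_confLog_div_lt hr
      have h2 : 2 * n * s r ^ 2 = (2 * (c * κ) ^ 2 * n) * width r ^ 2 / 4 := by
        simp only [s]; ring
      have h3 := mul_le_mul_of_nonneg_right hratio (sq_nonneg (width r))
      nlinarith
    refine (measureReal_union_le _ _).trans ?_
    have e1 := pi_sum_indicator_le (n := n) (μ := pointLaw F m) (hUm r) (hs r)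
    have e2 := pi_sum_indicator_ge (n := n) (μ := pointLaw F m) (hU'm r) (hs r)
    linarith
  -- Only the noise of point `i` itself enters individually; the other points enter through the
  -- counts. A union bound over all points, too weak at precision `7/16`, is thereby avoided.
  refine ⟨fun i => {p | (p i).2.1 ∈ N} ∪ ⋃ r ∈ Finset.Ico 1 (lastRound n m δ), E r, ?_, ?_⟩
  · intro i
    refine (measureReal_union_le _ _).trans (add_le_add ?_ ?_)
    · have h := (measurePreserving_eval (fun _ : Fin n => pointLaw F m) i).measureReal_preimage
        (s := {q | q.2.1 ∈ N}) (hmz hNm).nullMeasurableSet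
      rw [pointLaw_noise] at h
      exact h.le
    · refine (measureReal_biUnion_finset_le _ _).trans ((Finset.sum_le_sum hE).trans ?_)
      simp
  · intro p i r hr1 hrR hkept hp
    have hpN : (p i).2.1 ∉ N := fun h => hp (Or.inl h)
    have hpE : ∀ r, 1 ≤ r → r < lastRound n m δ → p ∉ E r := fun r h1 h2 h =>
      hp (Or.inr (Set.mem_biUnion (Finset.mem_coe.2 (Finset.mem_Ico.2 ⟨h1, h2⟩)) h))
    have hmono := pullTarget_mono (n := n) (m := m) (δ := δ) (zero_le_one.trans hL)
    have hnoise : ∀ j, (p j).2.1 ∉ N → ∀ r, 1 ≤ r → r < lastRound n m δ →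
        |prefixMean (observation (toSample n m p) j) (pullTarget n m δ r) - (p j).1|
          ≤ 7 / 16 * width r := by
      intro j hj r h1 h2
      obtain ⟨k, rfl⟩ : ∃ k, r = k + 1 := ⟨r - 1, by omega⟩
      rw [prefixMean_observation _ _ (one_le_pullTarget (by omega) k) (pullTarget_le _),
        add_sub_cancel_left]
      by_contra hcon
      exact hj ⟨k + 1, Finset.mem_Ico.2 ⟨h1, h2⟩, not_le.1 hcon⟩
    have htrack := abs_empQuantile_roundMeans_sub_le (α₁ := α₁) (α₂ := α₂)
      (Y := observation (toSample n m p)) hn hmono hα hα1 (x := fun j => (p j).1)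
      (good := fun j => (p j).2.1 ∉ N) (θ := 7 / 16) (ζ := 1 / 16) (η := η) (by norm_num)
      (by norm_num) (R := lastRound n m δ) hnoise ?_ ?_
    · refine abs_sub_le_of_keptBy hmono (x := fun j => (p j).1) hkept ?_ ?_
      · refine (hnoise i hpN r hr1 hrR).trans ?_
        have := width_pos r
        linarith
      · refine (htrack r hr1 hrR).trans ?_
        rw [show (7 : ℝ) / 16 + 1 / 16 = 1 / 2 by norm_num]
    · intro r h1 h2
      refine ⟨Finset.univ.filter fun j => p j ∈ U r, ?_, fun j hj => ?_⟩
      · have h := fun hh => hpE r h1 h2 (Or.inl hh)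
        simp only [Set.mem_ofPred_eq, sum_indicator_eq_card] at h
        replace h := not_le.1 h
        have hl := hlarge r (Finset.mem_Ico.2 ⟨h1, h2⟩)
        have hu := hUp r h1
        have h5 : n * α < ((Finset.univ.filter fun j => p j ∈ U r).card : ℝ) := by
          refine lt_of_le_of_lt (mul_le_mul_of_nonneg_left ?_ hn'.le) h
          have : (0 : ℝ) < 1 / n := by positivity
          simp only [s]
          linarith
        refine max_le ?_ ?_
        · by_contra hc0
          have : (Finset.univ.filter fun j => p j ∈ U r).card = 0 := by omega
          rw [this] at h
          have h0 : 0 ≤ n * ((pointLaw F m).real (U r) - s r) := by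
            refine mul_nonneg hn'.le ?_
            have : (0 : ℝ) < 1 / n := by positivity
            have hα0 : 0 ≤ α := hF.cdf_eq ▸ measureReal_nonneg
            simp only [s]
            linarith
          norm_num at h
          linarith
        · refine Nat.floor_le_of_le ?_
          linarith
      · have hj := (Finset.mem_filter.1 hj).2
        exact ⟨hj.2, hj.1⟩
    · intro r h1 h2
      refine ⟨Finset.univ.filter fun j => p j ∈ U' r, ?_, fun j hj => ?_⟩
      · have h := fun hh => hpE r h1 h2 (Or.inr hh)
        simp only [Set.mem_ofPred_eq, sum_indicator_eq_card] at h
        replace h := not_le.1 h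
        have hl := hlarge r (Finset.mem_Ico.2 ⟨h1, h2⟩)
        have hu := hUp' r h1
        have h5 : ((Finset.univ.filter fun j => p j ∈ U' r).card : ℝ) < α * n - 1 := by
          refine lt_of_lt_of_le h ?_
          calc n * ((pointLaw F m).real (U' r) + s r) ≤ n * (α - 1 / n) := by
                refine mul_le_mul_of_nonneg_left ?_ hn'.le
                simp only [s]; linarith
            _ = α * n - 1 := by field_simp
        have h6 : α * n < ⌊α * (n : ℝ)⌋₊ + 1 := Nat.lt_floor_add_one _
        have h7 : (Finset.univ.filter fun j => p j ∈ U' r).card < ⌊α * (n : ℝ)⌋₊ := by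
          rw [← Nat.cast_lt (α := ℝ)]; linarith
        exact lt_of_lt_of_le h7 (le_max_right _ _)
      · have hj : p j ∉ U' r := fun h => hj (Finset.mem_filter.2 ⟨Finset.mem_univ _, h⟩)
        exact ⟨fun h => hj (Or.inr h), not_lt.1 fun h => hj (Or.inl h)⟩

/-- Near an end of the support, only points close to it survive a round, outside of a small event. -/
theorem exists_bad_extreme {α s η t₀ c C β : ℝ} (hα : α = α₁ ∨ α = α₂)
    (hs : (α = 1 ∧ s = 1) ∨ (α = 0 ∧ s = -1)) (ht₀ : 0 < t₀) (hc : 0 < c) (hC : 0 < C)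
    (hβ : 0 < β) (hF : ExtremeRegular F s η t₀ c C β)
    (hn : 2 ≤ n) (hm : 2 ≤ m) (hδ : 0 < δ) (hδ1 : δ < 1)
    (hgood : (noiseLaw m).real (badNoise n m δ (1 / 5)) ≤ 1 / 2) :
    ∃ Bad : Fin n → Set (Fin n → Point m),
      (∀ i, (Measure.pi fun _ : Fin n => pointLaw F m).real (Bad i)
        ≤ (1 + gapConst t₀ c C β) / n) ∧
      ∀ p i r, 1 ≤ r → r < lastRound n m δ →
        KeptBy α₁ α₂ δ (observation (toSample n m p)) α r i → p ∉ Bad i →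
        |(p i).1 - η| ≤ 2 * width r := by
  have hL := one_le_confLog (n := n) (by omega) hm hδ hδ1
  have hn' : (0 : ℝ) < n := by positivity
  set ν := (Measure.pi fun _ : Fin n => pointLaw F m) with hν
  have hmz : Measurable fun q : Point m => q.2.1 := measurable_fst.comp measurable_snd
  set T := badNoise n m δ (3 / 4)
  set N := badNoise n m δ (1 / 5)
  have hTm : MeasurableSet T := measurableSet_badNoise _
  have hNm : MeasurableSet N := measurableSet_badNoise _
  -- An extreme can be shifted by one point, so all points must be controlled. At precision `3/4`
  -- the exponent `9/4` exceeds `2`, which leaves a factor `1 / n` after the union over `n` points.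
  have hT : ν.real {p | ∃ j, p j ∈ {q : Point m | q.2.1 ∈ T}} ≤ 1 / n := by
    refine (pi_exists_mem_le {q : Point m | q.2.1 ∈ T} (hmz hTm)).trans ?_
    rw [pointLaw_noise]
    have h1 := noiseLaw_badNoise_le (n := n) (m := m) (δ := δ) (by omega)
      (show (0 : ℝ) ≤ 3 / 4 by norm_num)
    have h2 := lastRound_sub_one_le_log (n := n) (by omega) hm hδ hδ1
    have hlog := log_pos_of_two_le hm
    have he := exp_neg_confLog (n := n) (by omega) hm hδ
    have hlog1 : 1 ≤ 16 * Real.log m := by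
      have : Real.log 2 ≤ Real.log m := Real.log_le_log (by norm_num) (by exact_mod_cast hm)
      linarith [Real.log_two_gt_d9]
    have he1 : Real.exp (-confLog n m δ) ≤ 1 / n := by
      rw [he, div_le_div_iff₀ (by positivity) hn']
      nlinarith
    have he2 : Real.exp (-(4 * (3 / 4) ^ 2 * confLog n m δ))
        ≤ Real.exp (-confLog n m δ) * Real.exp (-confLog n m δ) := by
      rw [← Real.exp_add]
      refine Real.exp_le_exp.2 ?_
      nlinarith
    calc n * (noiseLaw m).real T
        ≤ n * (Real.log m * (2 * (Real.exp (-confLog n m δ) * (1 / n)))) := by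
          refine mul_le_mul_of_nonneg_left (h1.trans ?_) hn'.le
          gcongr
          exact he2.trans (by gcongr)
      _ = δ / 8 * (1 / n) := by rw [he]; field_simp; norm_num
      _ ≤ 1 / n := by
          have : (0 : ℝ) < 1 / n := by positivity
          nlinarith
  have hneg : ν.real {p | ∃ j, p j ∈ {q : Point m | q.1 ∈ {x | s * (η - x) < 0}}} ≤ 0 := by
    have hm0 : MeasurableSet {x : ℝ | s * (η - x) < 0} :=
      measurableSet_lt (by fun_prop) measurable_const
    refine (pi_exists_mem_le {q : Point m | q.1 ∈ {x | s * (η - x) < 0}}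
      (measurable_fst hm0)).trans ?_
    rw [pointLaw_fst]
    have : F.real {x | s * (η - x) < 0} = 0 := by
      rw [measureReal_eq_zero_iff]
      simpa [ae_iff] using hF.ae_nonneg
    rw [this, mul_zero]
  -- The finer precision `1/5` is asked only of competitors, and it is enough that each of them has
  -- it with probability `1/2`.
  have hgap := fun i => pi_extreme_le ht₀ hc hC hβ hF hn hNm.compl
    (by rw [probReal_compl_eq_one_sub hNm]; linarith) i
  refine ⟨fun i => ({p | ∃ j, p j ∈ {q : Point m | q.2.1 ∈ T}} ∪
    {p | 0 ≤ s * (η - (p i).1) ∧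
        ∀ j, j ≠ i → (p j).2.1 ∈ Nᶜ → s * (η - (p i).1) ≤ 40 * (s * (η - (p j).1))}) ∪
    {p | ∃ j, p j ∈ {q : Point m | q.1 ∈ {x | s * (η - x) < 0}}}, ?_, ?_⟩
  · intro i
    refine (measureReal_union_le _ _).trans ?_
    refine (add_le_add (measureReal_union_le _ _) hneg).trans ?_
    rw [add_zero, add_div]
    exact add_le_add hT (hgap i)
  · intro p i r hr1 hrR hkept hp
    simp only [Set.mem_union, not_or] at hp
    obtain ⟨⟨hpT, hpG⟩, hp0⟩ := hp
    have hmono := pullTarget_mono (n := n) (m := m) (δ := δ) (zero_le_one.trans hL)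
    have hd0 : ∀ j, 0 ≤ s * (η - (p j).1) := fun j => not_lt.1 fun h => hp0 ⟨j, h⟩
    have hs1 : s = 1 ∨ s = -1 := by rcases hs with h | h; exacts [Or.inl h.2, Or.inr h.2]
    have hα1 : α ≤ 1 := by rcases hs with h | h <;> rw [h.1]; exact zero_le_one
    have hnoise : ∀ (θ : ℝ) j, (p j).2.1 ∉ badNoise n m δ θ → ∀ r, 1 ≤ r → r < lastRound n m δ →
        |prefixMean (observation (toSample n m p) j) (pullTarget n m δ r) - (p j).1|
          ≤ θ * width r := by
      intro θ j hj r h1 h2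
      obtain ⟨k, rfl⟩ : ∃ k, r = k + 1 := ⟨r - 1, by omega⟩
      rw [prefixMean_observation _ _ (one_le_pullTarget (by omega) k) (pullTarget_le _),
        add_sub_cancel_left]
      by_contra hcon
      exact hj ⟨k + 1, Finset.mem_Ico.2 ⟨h1, h2⟩, not_le.1 hcon⟩
    have hext : ∀ (v : Fin n → ℝ) i, s * v i ≤ s * empQuantile v α := by
      intro v i
      rcases hs with ⟨rfl, rfl⟩ | ⟨rfl, rfl⟩
      · rw [one_mul, one_mul]; exact le_empQuantile_one (by omega) i
      · have := empQuantile_zero_le (v := v) (by omega) i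
        linarith
    have habs : |(p i).1 - η| = s * (η - (p i).1) := by
      have := hd0 i
      rcases hs1 with rfl | rfl
      · rw [abs_sub_comm, abs_of_nonneg (by linarith)]; ring
      · rw [abs_of_nonneg (by linarith)]; ring
    rw [habs]
    by_contra hcon
    refine hpG ⟨hd0 i, fun j _ hj => ?_⟩
    exact (dist_le_of_keptBy_extreme (n := n) (by omega) hmono hα hα1 hs1 hext
      (x := fun j => (p j).1) hd0 (R := lastRound n m δ)
      (fun j => hnoise (3 / 4) j fun h => hpT ⟨j, h⟩) hr1 hrR hkept
      (hnoise (1 / 5) j hj)).resolve_left hcon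

end SurvivalProbability

/-! ### Size of the failure probabilities -/

section Numerics

variable {n m : ℕ} {δ : ℝ}

theorem one_le_sixteen_mul_log (hm : 2 ≤ m) : 1 ≤ 16 * Real.log m := by
  have : Real.log 2 ≤ Real.log m := Real.log_le_log (by norm_num) (by exact_mod_cast hm)
  linarith [Real.log_two_gt_d9]

theorem exp_neg_confLog_le (hn : 1 ≤ n) (hm : 2 ≤ m) (hδ : 0 < δ) :
    Real.exp (-confLog n m δ) ≤ (n / δ)⁻¹ := by
  have hn' : (0 : ℝ) < n := by positivity
  have h1 := one_le_sixteen_mul_log hm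
  have hl := log_pos_of_two_le hm
  rw [exp_neg_confLog hn hm hδ, inv_div, div_le_div_iff₀ (by positivity) hn']
  have : 0 < δ * n := by positivity
  nlinarith

theorem exp_neg_confLog_le_inv (hn : 1 ≤ n) (hm : 2 ≤ m) (hδ : 0 < δ) (hδ1 : δ < 1) :
    Real.exp (-confLog n m δ) ≤ (n : ℝ)⁻¹ := by
  have hn' : (0 : ℝ) < n := by positivity
  refine (exp_neg_confLog_le hn hm hδ).trans (inv_anti₀ hn' ?_)
  rw [le_div_iff₀ hδ]; nlinarith

theorem exp_neg_mul_confLog (c : ℝ) :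
    Real.exp (-(c * confLog n m δ)) = Real.exp (-confLog n m δ) ^ c := by
  rw [← Real.exp_mul]; ring_nf

/-- The exponent `4 (7/16)² = 49/64` is at least `3/4`, and the number of rounds is at most `log m ≤
4 m^(1/4)`. -/
theorem noiseLaw_badNoise_interior_le (hn : 1 ≤ n) (hm : 2 ≤ m) (hδ : 0 < δ) (hδ1 : δ < 1) :
    (noiseLaw m).real (badNoise n m δ (7 / 16)) ≤ 8 * ((m : ℝ) ^ (1 / 4 : ℝ) * (n : ℝ)⁻¹ ^ (3 / 4 : ℝ)) := by
  have hL := one_le_confLog hn hm hδ hδ1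
  refine (noiseLaw_badNoise_le (by omega) (by norm_num)).trans ?_
  have h1 : ((lastRound n m δ - 1 : ℕ) : ℝ) ≤ 4 * (m : ℝ) ^ (1 / 4 : ℝ) := by
    refine (lastRound_sub_one_le_log hn hm hδ hδ1).trans ?_
    have := Real.log_le_rpow_div (Nat.cast_nonneg m) (show (0 : ℝ) < 1 / 4 by norm_num)
    linarith
  have h2 : Real.exp (-(4 * (7 / 16) ^ 2 * confLog n m δ)) ≤ (n : ℝ)⁻¹ ^ (3 / 4 : ℝ) := by
    calc Real.exp (-(4 * (7 / 16) ^ 2 * confLog n m δ))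
        ≤ Real.exp (-((3 / 4) * confLog n m δ)) := by gcongr; norm_num
      _ = Real.exp (-confLog n m δ) ^ (3 / 4 : ℝ) := exp_neg_mul_confLog _
      _ ≤ _ := by
        gcongr
        exact exp_neg_confLog_le_inv hn hm hδ hδ1
  calc _ ≤ 4 * (m : ℝ) ^ (1 / 4 : ℝ) * (2 * (n : ℝ)⁻¹ ^ (3 / 4 : ℝ)) := by gcongr
    _ = _ := by ring

/-- Precision `1/5` leaves the power `4/25` of `δ / n`. Half of it beats the number of rounds,
through `log y ≤ (25/2) y^(2/25)`; the other half makes the product small once `n ≥ (50 a)^(25/2)`.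
-/
theorem noiseLaw_badNoise_extreme_le {a : ℝ} (ha : 0 < a) (hn : 2 ≤ n) (hm : 2 ≤ m) (hδ : 0 < δ)
    (hδ1 : δ < 1) (hma : Real.log m ≤ a * Real.log (n / δ))
    (hlarge : (50 * a) ^ (25 / 2 : ℝ) ≤ n) :
    (noiseLaw m).real (badNoise n m δ (1 / 5)) ≤ 1 / 2 := by
  refine (noiseLaw_badNoise_le (by omega) (by norm_num)).trans ?_
  set y := (n : ℝ) / δ with hy
  have hn' : (2 : ℝ) ≤ n := by exact_mod_cast hn
  have hny : (n : ℝ) ≤ y := by rw [hy, le_div_iff₀ hδ]; nlinarith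
  have hy0 : 0 < y := by linarith
  have h1 : ((lastRound n m δ - 1 : ℕ) : ℝ) ≤ a * (y ^ (2 / 25 : ℝ) / (2 / 25)) := by
    refine (lastRound_sub_one_le_log (by omega) hm hδ hδ1).trans (hma.trans ?_)
    gcongr
    exact Real.log_le_rpow_div hy0.le (by norm_num)
  have h2 : Real.exp (-(4 * (1 / 5) ^ 2 * confLog n m δ)) ≤ y⁻¹ ^ (4 / 25 : ℝ) := by
    rw [exp_neg_mul_confLog, show (4 : ℝ) * (1 / 5) ^ 2 = 4 / 25 by norm_num]
    gcongr
    exact exp_neg_confLog_le (by omega) hm hδ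
  have h3 : 50 * a ≤ y ^ (2 / 25 : ℝ) := by
    have : ((50 * a) ^ (25 / 2 : ℝ)) ^ (2 / 25 : ℝ) ≤ y ^ (2 / 25 : ℝ) := by
      gcongr; exact hlarge.trans hny
    rwa [← Real.rpow_mul (by positivity), show (25 / 2 : ℝ) * (2 / 25) = 1 by norm_num,
      Real.rpow_one] at this
  have h4 : y⁻¹ ^ (4 / 25 : ℝ) = (y ^ (2 / 25 : ℝ))⁻¹ * (y ^ (2 / 25 : ℝ))⁻¹ := by
    rw [Real.inv_rpow hy0.le, ← mul_inv, ← Real.rpow_add hy0]; norm_num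
  have h5 : 0 < y ^ (2 / 25 : ℝ) := by positivity
  calc _ ≤ a * (y ^ (2 / 25 : ℝ) / (2 / 25)) *
        (2 * ((y ^ (2 / 25 : ℝ))⁻¹ * (y ^ (2 / 25 : ℝ))⁻¹)) := by
        rw [← h4]; gcongr
    _ = 25 * a * (y ^ (2 / 25 : ℝ))⁻¹ := by field_simp
    _ ≤ 1 / 2 := by
        rw [← div_eq_mul_inv, div_le_iff₀ h5]; linarith

/-- How small `m / n` has to be for the elimination analysis at an interior quantile. -/
noncomputable def ratioBound (c τ : ℝ) : ℝ :=
  min ((c * min (1 / 16) (2 * τ) / 18) ^ (4 / 3 : ℝ)) (2 * (c * min (1 / 16) (2 * τ)) ^ 2)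

theorem ratioBound_pos {c τ : ℝ} (hc : 0 < c) (hτ : 0 < τ) : 0 < ratioBound c τ := by
  have : 0 < min (1 / 16) (2 * τ) := lt_min (by norm_num) (by positivity)
  exact lt_min (by positivity) (by positivity)

variable {α₁ α₂ : ℝ} {F : Measure ℝ} [IsProbabilityMeasure F]

/-- The proportion of badly estimated points is of order `m^(1/4) n^(-3/4)`. Written as `(m/n)^(3/4)
m^(-1/2)`, it is a small multiple of `b_r` by `hratio`, since `b_r ≥ m^(-1/2)` before the last
round; and `m^(5/4) ≤ n^(3/4)`, from `hmn`, makes it `O(1/m)`. -/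
theorem exists_bad_interior_le {α η c τ C : ℝ} (hα : α = α₁ ∨ α = α₂) (hα1 : α ≤ 1)
    (hF : InteriorRegular F α η c τ C) (hc : 0 < c) (hτ : 0 < τ)
    (hn : 1 ≤ n) (hm : 2 ≤ m) (hδ : 0 < δ) (hδ1 : δ < 1)
    (hmn : (m : ℝ) ≤ (n : ℝ) ^ (3 / 5 : ℝ)) (hratio : m ≤ ratioBound c τ * n) :
    ∃ Bad : Fin n → Set (Fin n → Point m),
      (∀ i, (Measure.pi fun _ : Fin n => pointLaw F m).real (Bad i) ≤ 10 / m) ∧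
      ∀ p i r, 1 ≤ r → r < lastRound n m δ →
        KeptBy α₁ α₂ δ (observation (toSample n m p)) α r i → p ∉ Bad i →
        |(p i).1 - η| ≤ 2 * width r := by
  have hn' : (1 : ℝ) ≤ n := by exact_mod_cast hn
  have hm' : (2 : ℝ) ≤ m := by exact_mod_cast hm
  have hL := one_le_confLog hn hm hδ hδ1
  set κ := min (1 / 16) (2 * τ) with hκ
  have hκ0 : 0 < κ := lt_min (by norm_num) (by positivity)
  have hpb := noiseLaw_badNoise_interior_le hn hm hδ hδ1
  set a := (m : ℝ) ^ (1 / 4 : ℝ) with ha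
  set b := (n : ℝ)⁻¹ ^ (3 / 4 : ℝ) with hb
  have ha1 : 1 ≤ a := Real.one_le_rpow (by linarith) (by norm_num)
  have hb0 : 0 < b := by positivity
  have hlarge : ∀ r ∈ Finset.Ico 1 (lastRound n m δ),
      (noiseLaw m).real (badNoise n m δ (7 / 16)) + 1 / n ≤ c * (κ * width r) / 2 := by
    intro r hr
    have hw : (m : ℝ)⁻¹ ^ (1 / 2 : ℝ) ≤ width r := by
      have h8 := eight_mul_confLog_div_lt hr
      have : (m : ℝ)⁻¹ ≤ width r ^ 2 := by
        rw [inv_le_iff_one_le_mul₀ (by linarith)]; linarith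
      calc (m : ℝ)⁻¹ ^ (1 / 2 : ℝ) ≤ (width r ^ 2) ^ (1 / 2 : ℝ) := by gcongr
        _ = width r := by
          rw [← Real.sqrt_eq_rpow, Real.sqrt_sq (width_pos r).le]
    have hnb : 1 / (n : ℝ) ≤ a * b := by
      have : 1 / (n : ℝ) ≤ b := by
        rw [one_div, hb]
        conv_lhs => rw [← Real.rpow_one (n : ℝ)⁻¹]
        exact Real.rpow_le_rpow_of_exponent_ge (by positivity) (inv_le_one_of_one_le₀ hn')
          (by norm_num)
      nlinarith
    have hκb : 18 * ((m : ℝ) / n) ^ (3 / 4 : ℝ) ≤ c * κ := by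
      have h3 : (m : ℝ) / n ≤ (c * κ / 18) ^ (4 / 3 : ℝ) := by
        rw [div_le_iff₀ (by linarith)]
        exact hratio.trans (mul_le_mul_of_nonneg_right (min_le_left _ _) (by linarith))
      have h4 : ((m : ℝ) / n) ^ (3 / 4 : ℝ) ≤ ((c * κ / 18) ^ (4 / 3 : ℝ)) ^ (3 / 4 : ℝ) := by
        gcongr
      rw [← Real.rpow_mul (by positivity), show (4 / 3 : ℝ) * (3 / 4) = 1 by norm_num,
        Real.rpow_one] at h4
      linarith
    have hab : a * b = ((m : ℝ) / n) ^ (3 / 4 : ℝ) * (m : ℝ)⁻¹ ^ (1 / 2 : ℝ) := by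
      have h5 : (m : ℝ) ^ (3 / 4 : ℝ) * (m : ℝ)⁻¹ ^ (1 / 2 : ℝ) = a := by
        rw [Real.inv_rpow (by linarith) (1 / 2), ← Real.rpow_neg (by linarith),
          ← Real.rpow_add (by linarith), ha]
        norm_num
      rw [div_eq_mul_inv, Real.mul_rpow (by linarith) (by positivity), mul_right_comm, h5]
    have h0 : 0 ≤ (m : ℝ)⁻¹ ^ (1 / 2 : ℝ) := by positivity
    calc _ ≤ 8 * (a * b) + a * b := add_le_add hpb hnb
      _ = 9 * ((m : ℝ) / n) ^ (3 / 4 : ℝ) * (m : ℝ)⁻¹ ^ (1 / 2 : ℝ) := by rw [hab]; ring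
      _ ≤ (c * κ / 2) * width r := by
          refine mul_le_mul ?_ hw h0 (by positivity)
          linarith
      _ = _ := by ring
  obtain ⟨Bad, h1, h2⟩ := exists_bad_interior (α₁ := α₁) (α₂ := α₂) (n := n) (m := m) (δ := δ)
    hα hα1 hF hc hτ hn hm hδ hδ1 hlarge
    (hratio.trans (mul_le_mul_of_nonneg_right (min_le_right _ _) (by linarith)))
  refine ⟨Bad, fun i => (h1 i).trans ?_, h2⟩
  have hmn1 : (m : ℝ) ≤ n := by
    refine hmn.trans ?_
    conv_rhs => rw [← Real.rpow_one (n : ℝ)]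
    exact Real.rpow_le_rpow_of_exponent_le hn' (by norm_num)
  have e1 : (noiseLaw m).real (badNoise n m δ (7 / 16)) ≤ 8 / m := by
    refine hpb.trans ?_
    rw [le_div_iff₀ (by linarith)]
    have hab : a * m ≤ (n : ℝ) ^ (3 / 4 : ℝ) := by
      have : a * m = (m : ℝ) ^ (5 / 4 : ℝ) := by
        rw [ha]; nth_rewrite 2 [← Real.rpow_one (m : ℝ)]
        rw [← Real.rpow_add (by linarith)]; norm_num
      rw [this]
      calc (m : ℝ) ^ (5 / 4 : ℝ) ≤ ((n : ℝ) ^ (3 / 5 : ℝ)) ^ (5 / 4 : ℝ) := by gcongr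
        _ = _ := by rw [← Real.rpow_mul (by linarith)]; norm_num
    have hb1 : (n : ℝ) ^ (3 / 4 : ℝ) * b = 1 := by
      rw [hb, Real.inv_rpow (by linarith), mul_inv_cancel₀ (by positivity)]
    nlinarith
  have e2 : ((lastRound n m δ - 1 : ℕ) : ℝ) * (2 * Real.exp (-(2 * confLog n m δ))) ≤ 2 / m := by
    have h3 : ((lastRound n m δ - 1 : ℕ) : ℝ) ≤ m := by
      refine (lastRound_sub_one_le_log hn hm hδ hδ1).trans ?_
      linarith [Real.log_le_sub_one_of_pos (show (0 : ℝ) < m by linarith)]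
    have h4 : Real.exp (-(2 * confLog n m δ)) ≤ (m : ℝ)⁻¹ * (m : ℝ)⁻¹ := by
      have h5 := exp_neg_confLog_le_inv hn hm hδ hδ1
      have h6 : (n : ℝ)⁻¹ ≤ (m : ℝ)⁻¹ := inv_anti₀ (by linarith) hmn1
      have h7 : Real.exp (-(2 * confLog n m δ))
          = Real.exp (-confLog n m δ) * Real.exp (-confLog n m δ) := by
        rw [← Real.exp_add]; ring_nf
      rw [h7]
      have := h5.trans h6
      gcongr
    calc _ ≤ (m : ℝ) * (2 * ((m : ℝ)⁻¹ * (m : ℝ)⁻¹)) := by gcongr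
      _ = 2 / m := by field_simp
  calc _ ≤ (8 : ℝ) / m + 2 / m := add_le_add e1 e2
    _ = 10 / m := by ring

end Numerics

/-! ### The expected number of observations -/

section SampleCount

variable {n m : ℕ} {α₁ α₂ δ : ℝ} {F : Measure ℝ} [IsProbabilityMeasure F]

/-- The cost of a point at distance `d` from the boundary. -/
noncomputable def pointCost (m : ℕ) (l : ℝ) (d : ℝ≥0∞) : ℝ≥0∞ :=
  min (m : ℝ≥0∞) (ENNReal.ofReal l / d ^ 2)

-- A point that last survives round `r` costs `t_{r+1} ≤ 33 · 4^r L`, and distance at most `2 b_r`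
-- turns `4^r` into `4 / dist²`. Round `0` carries no information on the distance and gives the
-- first term; on the bad event the cost is at most `m`.
omit F in
theorem finalPulls_le {C₁ : ℝ} (hC₁ : 1 ≤ C₁) (hn : 1 ≤ n) (hm : 2 ≤ m) (hδ : 0 < δ) (hδ1 : δ < 1)
    (hlog : confLog n m δ ≤ C₁ * Real.log (n / δ)) {Bad : Fin n → Set (Fin n → Point m)}
    {T : Set ℝ}
    (hBad : ∀ p i r, 1 ≤ r → r < lastRound n m δ →
      i ∈ (run α₁ α₂ δ (observation (toSample n m p)) r).active → p ∉ Bad i →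
      Metric.infEDist (p i).1 T ≤ ENNReal.ofReal (2 * width r))
    (p : Fin n → Point m) (i : Fin n) :
    (finalPulls α₁ α₂ δ (observation (toSample n m p)) i : ℝ≥0∞) ≤
      ENNReal.ofReal (33 * C₁) * min (m : ℝ≥0∞) (ENNReal.ofReal (Real.log (n / δ))) +
      ENNReal.ofReal (132 * C₁) *
        pointCost m (Real.log (n / δ)) (Metric.infEDist (p i).1 T) +
      (Bad i).indicator (fun _ => (m : ℝ≥0∞)) p := by
  have hL := one_le_confLog hn hm hδ hδ1
  set l := Real.log (n / δ) with hl
  have hl0 : 0 ≤ l := by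
    by_contra hcon
    nlinarith
  obtain ⟨r, hr, hact, hp⟩ := exists_finalPulls_eq (α₁ := α₁) (α₂ := α₂)
    (Y := observation (toSample n m p)) hL i
  rw [hp]
  have hpm : (pullTarget n m δ (r + 1) : ℝ≥0∞) ≤ m := by exact_mod_cast pullTarget_le _
  have hp2 : (pullTarget n m δ (r + 1) : ℝ≥0∞) ≤ ENNReal.ofReal (33 * 4 ^ r * (C₁ * l)) := by
    rw [← ENNReal.ofReal_natCast]
    refine ENNReal.ofReal_le_ofReal ((pullTarget_succ_le hL r).trans ?_)
    gcongr
  rcases Nat.eq_zero_or_pos r with rfl | hr1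
  · refine le_trans ?_ (le_add_right (le_add_right le_rfl))
    rw [← min_mul_mul_left]
    refine le_min (hpm.trans ?_) (hp2.trans ?_)
    · refine le_mul_of_one_le_left zero_le ?_
      rw [ENNReal.one_le_ofReal]; linarith
    · rw [← ENNReal.ofReal_mul (by positivity)]
      refine ENNReal.ofReal_le_ofReal ?_
      rw [pow_zero]; linarith
  · by_cases hb : p ∈ Bad i
    · refine le_trans ?_ le_add_self
      simpa [hb] using hpm
    · refine le_trans ?_ (le_add_right le_add_self)
      have hd := hBad p i r hr1 hr hact hb
      rw [pointCost, ← min_mul_mul_left]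
      refine le_min (hpm.trans ?_) (hp2.trans ?_)
      · refine le_mul_of_one_le_left zero_le ?_
        rw [ENNReal.one_le_ofReal]; linarith
      · have hw := width_pos r
        have h1 : ENNReal.ofReal (l * 4 ^ r / 4) ≤
            ENNReal.ofReal l / Metric.infEDist (p i).1 T ^ 2 := by
          refine le_trans ?_ (ENNReal.div_le_div_left (pow_le_pow_left' hd 2) _)
          rw [← ENNReal.ofReal_pow (by positivity), ← ENNReal.ofReal_div_of_pos (by positivity)]
          refine ENNReal.ofReal_le_ofReal (le_of_eq ?_)
          rw [← width_sq_inv]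
          field_simp; ring
        refine le_trans ?_ (mul_le_mul_right h1 _)
        rw [← ENNReal.ofReal_mul (by positivity)]
        refine ENNReal.ofReal_le_ofReal (le_of_eq ?_)
        ring

theorem card_selected_le (Y : Fin n → Fin m → ℝ) : (selected α₁ α₂ δ Y).card ≤ n := by
  simpa using Finset.card_le_univ (selected α₁ α₂ δ Y)

theorem expectedSamples_le {C₁ ρ : ℝ} (hC₁ : 1 ≤ C₁) (hn : 1 ≤ n) (hm : 2 ≤ m) (hδ : 0 < δ)
    (hδ1 : δ < 1) (hlog : confLog n m δ ≤ C₁ * Real.log (n / δ))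
    {Bad : Fin n → Set (Fin n → Point m)}
    (hρ : ∀ i, (Measure.pi fun _ : Fin n => pointLaw F m).real (Bad i) ≤ ρ)
    (hBad : ∀ p i r, 1 ≤ r → r < lastRound n m δ →
      i ∈ (run α₁ α₂ δ (observation (toSample n m p)) r).active → p ∉ Bad i →
      Metric.infEDist (p i).1 (frontier (relevantSet F α₁ α₂)) ≤ ENNReal.ofReal (2 * width r)) :
    expectedSamples F α₁ α₂ δ n m ≤ n *
      (ENNReal.ofReal (33 * C₁) * min (m : ℝ≥0∞) (ENNReal.ofReal (Real.log (n / δ))) +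
        ENNReal.ofReal (132 * C₁) * gapExpectation F α₁ α₂ δ n m + m * ENNReal.ofReal ρ +
        if α₁ = α₂ then 0 else 1) := by
  classical
  set ν := (Measure.pi fun _ : Fin n => pointLaw F m) with hν
  set T := frontier (relevantSet F α₁ α₂) with hT
  set l := Real.log (n / δ) with hl
  set k₀ := ENNReal.ofReal (33 * C₁) * min (m : ℝ≥0∞) (ENNReal.ofReal l) with hk₀
  have hcost : Measurable fun x : ℝ => pointCost m l (Metric.infEDist x T) :=
    measurable_const.min (measurable_const.div (measurable_infEDist.pow_const 2))
  -- The bad events are not known to be measurable, so they are replaced by measurable hulls of the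
  -- same measure before integrating.
  have hpt : ∀ p, (sampleCount α₁ α₂ δ (toSample n m p) : ℝ≥0∞) ≤
      (∑ i, (k₀ + ENNReal.ofReal (132 * C₁) * pointCost m l (Metric.infEDist (p i).1 T) +
        (toMeasurable ν (Bad i)).indicator (fun _ => (m : ℝ≥0∞)) p)) +
        n * (if α₁ = α₂ then 0 else 1) := by
    intro p
    unfold sampleCount
    push_cast
    refine add_le_add (Finset.sum_le_sum fun i _ => ?_) ?_
    · refine (finalPulls_le hC₁ hn hm hδ hδ1 hlog hBad p i).trans ?_
      gcongr
      exact subset_toMeasurable _ _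
    · split_ifs
      · simp
      · simpa using card_selected_le _
  rw [expectedSamples, lintegral_sampleLaw]
  refine (lintegral_mono hpt).trans ?_
  rw [lintegral_add_right _ measurable_const, lintegral_const, measure_univ, mul_one,
    lintegral_finsetSum]
  · have hterm : ∀ i : Fin n, ∫⁻ p, (k₀ + ENNReal.ofReal (132 * C₁) *
        pointCost m l (Metric.infEDist (p i).1 T) +
        (toMeasurable ν (Bad i)).indicator (fun _ => (m : ℝ≥0∞)) p) ∂ν ≤
        k₀ + ENNReal.ofReal (132 * C₁) * gapExpectation F α₁ α₂ δ n m
          + m * ENNReal.ofReal ρ := by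
      intro i
      have hmp : MeasurePreserving (fun p : Fin n → Point m => (p i).1) ν F :=
        (measurePreserving_fst (μ := F)
          (ν := (noiseLaw m).prod (gaussianReal 0 1))).comp
          (measurePreserving_eval (fun _ : Fin n => pointLaw F m) i)
      have hm1 : Measurable fun p : Fin n → Point m =>
          pointCost m l (Metric.infEDist (p i).1 T) := hcost.comp hmp.measurable
      rw [lintegral_add_right _ (measurable_const.indicator (measurableSet_toMeasurable _ _)),
        lintegral_add_left measurable_const, lintegral_const, measure_univ, mul_one,
        lintegral_const_mul _ hm1, lintegral_indicator (measurableSet_toMeasurable _ _),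
        setLIntegral_const, measure_toMeasurable]
      refine add_le_add (add_le_add le_rfl ?_) ?_
      · rw [hmp.lintegral_comp hcost]; exact le_rfl
      · gcongr
        rw [← ofReal_measureReal]
        exact ENNReal.ofReal_le_ofReal (hρ i)
    calc _ ≤ (∑ _i : Fin n, (k₀ + ENNReal.ofReal (132 * C₁) * gapExpectation F α₁ α₂ δ n m
          + m * ENNReal.ofReal ρ)) + n * (if α₁ = α₂ then 0 else 1) :=
          add_le_add (Finset.sum_le_sum fun i _ => hterm i) le_rfl
      _ = _ := by
          rw [Finset.sum_const, Finset.card_univ, Fintype.card_fin, nsmul_eq_mul, ← mul_add]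
  · intro i _
    have hmp : Measurable fun p : Fin n → Point m => (p i).1 :=
      measurable_fst.comp (measurable_pi_apply i)
    exact (measurable_const.add (measurable_const.mul (hcost.comp hmp))).add
      (measurable_const.indicator (measurableSet_toMeasurable _ _))

/-- Lower bound on the gap expectation from the mass near a boundary point. -/
theorem mul_min_le_gapExpectation {η s q : ℝ}
    (hη : η ∈ frontier (relevantSet F α₁ α₂)) (hs : 0 < s)
    (hq : q ≤ F.real {x | |x - η| ≤ s}) :
    ENNReal.ofReal q * min (m : ℝ≥0∞) (ENNReal.ofReal (Real.log (n / δ) / s ^ 2))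
      ≤ gapExpectation F α₁ α₂ δ n m := by
  set A := {x : ℝ | |x - η| ≤ s} with hA
  have hAm : MeasurableSet A := measurableSet_le (by fun_prop) measurable_const
  rw [gapExpectation]
  calc _ ≤ min (m : ℝ≥0∞) (ENNReal.ofReal (Real.log (n / δ) / s ^ 2)) * F A := by
        rw [mul_comm]; gcongr
        rw [← ofReal_measureReal]; exact ENNReal.ofReal_le_ofReal hq
    _ = ∫⁻ _ in A, min (m : ℝ≥0∞) (ENNReal.ofReal (Real.log (n / δ) / s ^ 2)) ∂F :=
        (setLIntegral_const _ _).symm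
    _ ≤ ∫⁻ x in A, min (m : ℝ≥0∞) (ENNReal.ofReal (Real.log (n / δ)) /
          Metric.infEDist x (frontier (relevantSet F α₁ α₂)) ^ 2) ∂F := by
        refine setLIntegral_mono' hAm fun x hx => min_le_min le_rfl ?_
        have hd : Metric.infEDist x (frontier (relevantSet F α₁ α₂)) ≤ ENNReal.ofReal s := by
          refine (Metric.infEDist_le_edist_of_mem hη).trans ?_
          rw [edist_dist, Real.dist_eq]
          exact ENNReal.ofReal_le_ofReal hx
        refine le_trans ?_ (ENNReal.div_le_div_left (pow_le_pow_left' hd 2) _)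
        rw [← ENNReal.ofReal_pow hs.le, ← ENNReal.ofReal_div_of_pos (by positivity)]
    _ ≤ _ := setLIntegral_le_lintegral _ _

/-- By `hgap` the gap expectation dominates the cost `min(m, log(n/δ))` of the first round, and this
cost is at least `1`, so the fresh observation is absorbed as well. -/
theorem expectedSamples_le_gap {C₁ ρ g₀ K : ℝ} (hC₁ : 1 ≤ C₁) (hn : 1 ≤ n) (hm : 2 ≤ m)
    (hδ : 0 < δ) (hδ1 : δ < 1) (hlog : confLog n m δ ≤ C₁ * Real.log (n / δ))
    (hl : 1 ≤ Real.log (n / δ)) (hg₀ : 0 < g₀) (hK : 0 ≤ K)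
    {Bad : Fin n → Set (Fin n → Point m)}
    (hρ : ∀ i, (Measure.pi fun _ : Fin n => pointLaw F m).real (Bad i) ≤ ρ)
    (hBad : ∀ p i r, 1 ≤ r → r < lastRound n m δ →
      i ∈ (run α₁ α₂ δ (observation (toSample n m p)) r).active → p ∉ Bad i →
      Metric.infEDist (p i).1 (frontier (relevantSet F α₁ α₂)) ≤ ENNReal.ofReal (2 * width r))
    (hgap : ENNReal.ofReal g₀ * min (m : ℝ≥0∞) (ENNReal.ofReal (Real.log (n / δ)))
      ≤ gapExpectation F α₁ α₂ δ n m)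
    (hmρ : m * ENNReal.ofReal ρ ≤ ENNReal.ofReal K * gapExpectation F α₁ α₂ δ n m) :
    expectedSamples F α₁ α₂ δ n m ≤
      ENNReal.ofReal ((33 * C₁ + 1) / g₀ + 132 * C₁ + K) * n * gapExpectation F α₁ α₂ δ n m := by
  refine (expectedSamples_le hC₁ hn hm hδ hδ1 hlog hρ hBad).trans ?_
  set g := gapExpectation F α₁ α₂ δ n m
  set μ := min (m : ℝ≥0∞) (ENNReal.ofReal (Real.log (n / δ))) with hμ
  have hμ1 : 1 ≤ μ := le_min (by exact_mod_cast (by omega : 1 ≤ m)) (ENNReal.one_le_ofReal.2 hl)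
  have hμg : μ ≤ ENNReal.ofReal (1 / g₀) * g := by
    calc μ = ENNReal.ofReal (1 / g₀) * (ENNReal.ofReal g₀ * μ) := by
          rw [← mul_assoc, ← ENNReal.ofReal_mul (by positivity), one_div_mul_cancel hg₀.ne',
            ENNReal.ofReal_one, one_mul]
      _ ≤ _ := by gcongr
  have hif : (if α₁ = α₂ then 0 else 1 : ℝ≥0∞) ≤ μ := by split_ifs; exacts [zero_le, hμ1]
  have h1 : (33 * C₁ + 1) / g₀ = (33 * C₁ + 1) * (1 / g₀) := by ring
  rw [mul_assoc, mul_left_comm]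
  gcongr
  rw [ENNReal.ofReal_add (by positivity) hK, ENNReal.ofReal_add (by positivity) (by positivity),
    h1, ENNReal.ofReal_mul (p := 33 * C₁ + 1) (by positivity),
    ENNReal.ofReal_add (p := 33 * C₁) (q := 1) (by positivity) zero_le_one, ENNReal.ofReal_one]
  calc _ ≤ ENNReal.ofReal (33 * C₁) * (ENNReal.ofReal (1 / g₀) * g) + ENNReal.ofReal (132 * C₁) * g
        + ENNReal.ofReal K * g + ENNReal.ofReal (1 / g₀) * g := by
        gcongr; exact hif.trans hμg
    _ = _ := by ring

end SampleCount

/-! ### The boundary of the relevant set -/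

section Boundary

variable {α₁ α₂ : ℝ} {F : Measure ℝ}

theorem quantile_mono (h : α₁ ≤ α₂) : quantile F α₁ ≤ quantile F α₂ :=
  sInf_le_sInf (Set.image_mono fun _ hx => ⟨hx.1, h.trans hx.2⟩)

theorem relevantSet_eq_Icc {η₁ η₂ : ℝ} (h1 : quantile F α₁ = η₁) (h2 : quantile F α₂ = η₂) :
    relevantSet F α₁ α₂ = Set.Icc η₁ η₂ := by
  ext x; simp [relevantSet, h1, h2]

theorem frontier_relevantSet {η₁ η₂ : ℝ} (h : α₁ ≤ α₂) (h1 : quantile F α₁ = η₁)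
    (h2 : quantile F α₂ = η₂) : frontier (relevantSet F α₁ α₂) = {η₁, η₂} := by
  rw [relevantSet_eq_Icc h1 h2, frontier_Icc]
  have := quantile_mono (F := F) h
  rw [h1, h2] at this
  exact EReal.coe_le_coe_iff.1 this

theorem infEDist_le_of_abs_le {T : Set ℝ} {η x s : ℝ} (hη : η ∈ T) (h : |x - η| ≤ s) :
    Metric.infEDist x T ≤ ENNReal.ofReal s := by
  refine (Metric.infEDist_le_edist_of_mem hη).trans ?_
  rw [edist_dist, Real.dist_eq]
  exact ENNReal.ofReal_le_ofReal h

end Boundary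

/-! ### Upper bounds on the gap expectation -/

section GapBound

/-- If `d > 2^(-K)`, then `L / d² ≤ 4^K L`, so the cap can be lowered from `4^(K+1) L`; otherwise
the newly added summand already is the cap. -/
theorem min_div_sq_le_sum (L d : ℝ≥0∞) (K : ℕ) :
    min (4 ^ K * L) (L / d ^ 2) ≤ L + ∑ r ∈ Finset.range K,
      4 ^ (r + 1) * L * (if d ≤ ENNReal.ofReal (width r) then 1 else 0) := by
  induction K with
  | zero => simp
  | succ K ih =>
    rw [Finset.sum_range_succ, ← add_assoc]
    by_cases hd : d ≤ ENNReal.ofReal (width K)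
    · rw [if_pos hd, mul_one]
      exact (min_le_left _ _).trans le_add_self
    · rw [if_neg hd, mul_zero, add_zero]
      refine le_trans ?_ ih
      refine le_min ?_ (min_le_right _ _)
      refine (min_le_right _ _).trans ?_
      have h1 : L / d ^ 2 ≤ L / ENNReal.ofReal (width K) ^ 2 :=
        ENNReal.div_le_div_left (pow_le_pow_left' (not_le.1 hd).le 2) _
      refine h1.trans (le_of_eq ?_)
      rw [← ENNReal.ofReal_pow (width_pos K).le, div_eq_mul_inv,
        ← ENNReal.ofReal_inv_of_pos (by have := width_pos K; positivity), width_sq_inv, mul_comm,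
        ENNReal.ofReal_pow (by norm_num)]
      norm_num

variable {n m : ℕ} {α₁ α₂ δ : ℝ} {F : Measure ℝ} [IsProbabilityMeasure F]

/-- Shell `r` costs at most `4^(r+1) log(n/δ)` and has mass at most `C 2^(-γ r)`. For `γ < 2` the
last shell dominates, for `γ > 2` the first, and for `γ = 2` all `K` shells contribute equally. -/
theorem gapExpectation_le_sum {C γ : ℝ} {K : ℕ} (hC : 0 ≤ C)
    (hmass : ∀ s, 0 < s → F {x | Metric.infEDist x (frontier (relevantSet F α₁ α₂)) ≤
      ENNReal.ofReal s} ≤ ENNReal.ofReal (C * s ^ γ))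
    (hl : 0 ≤ Real.log (n / δ)) (hm : (m : ℝ) ≤ 4 ^ K * Real.log (n / δ)) :
    gapExpectation F α₁ α₂ δ n m ≤
      ENNReal.ofReal (Real.log (n / δ) * (1 + 4 * C * ∑ r ∈ Finset.range K,
        ((2 : ℝ) ^ (2 - γ)) ^ r)) := by
  set l := Real.log (n / δ) with hl'
  set T := frontier (relevantSet F α₁ α₂)
  have hmL : (m : ℝ≥0∞) ≤ 4 ^ K * ENNReal.ofReal l := by
    rw [← ENNReal.ofReal_natCast]
    refine (ENNReal.ofReal_le_ofReal hm).trans (le_of_eq ?_)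
    rw [ENNReal.ofReal_mul (by positivity), ENNReal.ofReal_pow (by norm_num)]
    norm_num
  have hset : ∀ r, MeasurableSet {x : ℝ | Metric.infEDist x T ≤ ENNReal.ofReal (width r)} :=
    fun r => measurableSet_le measurable_infEDist measurable_const
  have hind : ∀ r, Measurable fun x : ℝ =>
      (if Metric.infEDist x T ≤ ENNReal.ofReal (width r) then 1 else 0 : ℝ≥0∞) :=
    fun r => Measurable.ite (hset r) measurable_const measurable_const
  calc gapExpectation F α₁ α₂ δ n m
      ≤ ∫⁻ x, (ENNReal.ofReal l + ∑ r ∈ Finset.range K, 4 ^ (r + 1) * ENNReal.ofReal l *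
          (if Metric.infEDist x T ≤ ENNReal.ofReal (width r) then 1 else 0)) ∂F :=
        lintegral_mono fun x => (min_le_min hmL le_rfl).trans (min_div_sq_le_sum _ _ K)
    _ = ENNReal.ofReal l + ∑ r ∈ Finset.range K, 4 ^ (r + 1) * ENNReal.ofReal l *
          F {x | Metric.infEDist x T ≤ ENNReal.ofReal (width r)} := by
        rw [lintegral_add_left measurable_const, lintegral_const, measure_univ, mul_one,
          lintegral_finsetSum _ fun r _ => (hind r).const_mul _]
        congr 1
        refine Finset.sum_congr rfl fun r _ => ?_
        rw [lintegral_const_mul _ (hind r)]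
        congr 1
        rw [← lintegral_indicator_one (hset r)]
        exact lintegral_congr fun x => by simp [Set.indicator_apply]
    _ ≤ ENNReal.ofReal l + ∑ r ∈ Finset.range K,
          ENNReal.ofReal (4 ^ (r + 1) * l * (C * width r ^ γ)) := by
        gcongr with r _
        rw [ENNReal.ofReal_mul (by positivity), ENNReal.ofReal_mul (by positivity),
          ENNReal.ofReal_pow (by norm_num)]
        gcongr
        · norm_num
        · exact hmass _ (width_pos r)
    _ = _ := by
        have hw : ∀ r, 0 ≤ width r ^ γ := fun r => Real.rpow_nonneg (width_pos r).le _
        rw [← ENNReal.ofReal_sum_of_nonneg fun r _ => by have := hw r; positivity,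
          ← ENNReal.ofReal_add hl (Finset.sum_nonneg fun r _ => by have := hw r; positivity),
          mul_add, mul_one, Finset.mul_sum, Finset.mul_sum]
        congr 2
        refine Finset.sum_congr rfl fun r _ => ?_
        have : width r ^ γ * 4 ^ r = ((2 : ℝ) ^ (2 - γ)) ^ r := by
          rw [width, inv_pow, Real.inv_rpow (by positivity), ← Real.rpow_natCast,
            ← Real.rpow_mul (by norm_num), ← Real.rpow_neg (by norm_num),
            show (4 : ℝ) = 2 ^ (2 : ℝ) by norm_num, ← Real.rpow_natCast, ← Real.rpow_mul (by norm_num),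
            ← Real.rpow_add (by norm_num), ← Real.rpow_natCast, ← Real.rpow_mul (by norm_num)]
          ring_nf
        rw [← this]; ring

theorem exists_four_pow_near {y : ℝ} (hy : 1 ≤ y) : ∃ K : ℕ, y ≤ 4 ^ K ∧ (4 : ℝ) ^ K ≤ 4 * y := by
  obtain ⟨k, h1, h2⟩ := exists_nat_pow_near hy (by norm_num : (1 : ℝ) < 4)
  exact ⟨k + 1, h2.le, by rw [pow_succ]; linarith⟩

variable {C γ y : ℝ} (hC : 0 ≤ C)
  (hmass : ∀ s, 0 < s → F {x | Metric.infEDist x (frontier (relevantSet F α₁ α₂)) ≤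
      ENNReal.ofReal s} ≤ ENNReal.ofReal (C * s ^ γ))
  (hl : 0 ≤ Real.log (n / δ)) (hy : 1 ≤ y) (hm : (m : ℝ) ≤ y * Real.log (n / δ))

include hC hmass hl hy hm

theorem gapExpectation_le_of_lt_two (hγ : γ < 2) :
    gapExpectation F α₁ α₂ δ n m ≤ ENNReal.ofReal (Real.log (n / δ) *
      (1 + 4 * C * ((4 * y) ^ (1 - γ / 2) / (2 ^ (2 - γ) - 1)))) := by
  obtain ⟨K, h1, h2⟩ := exists_four_pow_near hy
  refine (gapExpectation_le_sum (K := K) hC hmass hl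
    (hm.trans (mul_le_mul_of_nonneg_right h1 hl))).trans (ENNReal.ofReal_le_ofReal ?_)
  have hq : (1 : ℝ) < 2 ^ (2 - γ) := Real.one_lt_rpow (by norm_num) (by linarith)
  have hq1 : (0 : ℝ) < 2 ^ (2 - γ) - 1 := by linarith
  rw [geom_sum_eq hq.ne']
  gcongr
  have : ((2 : ℝ) ^ (2 - γ)) ^ K = (4 ^ K) ^ (1 - γ / 2) := by
    rw [← Real.rpow_natCast, ← Real.rpow_mul (by norm_num), ← Real.rpow_natCast (4 : ℝ),
      ← Real.rpow_mul (by norm_num), show (4 : ℝ) = 2 ^ (2 : ℝ) by norm_num,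
      ← Real.rpow_mul (by norm_num)]
    ring_nf
  rw [this]
  have : ((4 : ℝ) ^ K) ^ (1 - γ / 2) ≤ (4 * y) ^ (1 - γ / 2) :=
    Real.rpow_le_rpow (by positivity) h2 (by linarith)
  linarith

theorem gapExpectation_le_of_eq_two (hγ : γ = 2) :
    gapExpectation F α₁ α₂ δ n m ≤ ENNReal.ofReal (Real.log (n / δ) *
      (1 + 4 * C * (1 + Real.log y))) := by
  obtain ⟨K, h1, h2⟩ := exists_four_pow_near hy
  refine (gapExpectation_le_sum (K := K) hC hmass hl
    (hm.trans (mul_le_mul_of_nonneg_right h1 hl))).trans (ENNReal.ofReal_le_ofReal ?_)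
  subst hγ
  have h3 := Real.log_le_log (by positivity) h2
  rw [Real.log_pow, Real.log_mul (by norm_num) (by positivity)] at h3
  have h4 : (1 : ℝ) ≤ Real.log 4 := by
    rw [show (4 : ℝ) = 2 ^ 2 by norm_num, Real.log_pow]
    have := Real.log_two_gt_d9; push_cast; linarith
  have hK : (K : ℝ) ≤ 1 + Real.log y := by
    have := Real.log_nonneg hy
    nlinarith
  gcongr
  simpa using hK

theorem gapExpectation_le_of_two_lt (hγ : 2 < γ) :
    gapExpectation F α₁ α₂ δ n m ≤ ENNReal.ofReal (Real.log (n / δ) *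
      (1 + 4 * C * (1 / (1 - 2 ^ (2 - γ))))) := by
  obtain ⟨K, h1, h2⟩ := exists_four_pow_near hy
  refine (gapExpectation_le_sum (K := K) hC hmass hl
    (hm.trans (mul_le_mul_of_nonneg_right h1 hl))).trans (ENNReal.ofReal_le_ofReal ?_)
  have hq : (2 : ℝ) ^ (2 - γ) < 1 := Real.rpow_lt_one_of_one_lt_of_neg (by norm_num) (by linarith)
  have hq1 : (0 : ℝ) < 1 - 2 ^ (2 - γ) := by linarith
  have hq0 : (0 : ℝ) ≤ (2 : ℝ) ^ (2 - γ) := by positivity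
  rw [geom_sum_eq hq.ne, ← neg_div_neg_eq (_ - 1), neg_sub, neg_sub]
  gcongr
  linarith [pow_nonneg hq0 K]

end GapBound

/-! ### The number of observations in terms of the gap expectation -/

section Complexity

/-- The facts about `F` near `η = F⁻¹(α)` that the analysis uses. -/
def RegularAt (F : Measure ℝ) (α η t₀ c₁ c₂ β : ℝ) : Prop :=
  quantile F α = (η : EReal) ∧
    ((0 < α ∧ α < 1 ∧ InteriorRegular F α η c₁ (t₀ / 2) (interiorConst t₀ c₂)) ∨
      ∃ s : ℝ, ((α = 1 ∧ s = 1) ∨ (α = 0 ∧ s = -1)) ∧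
        ExtremeRegular F s η t₀ c₁ (extremeConst t₀ c₂ β) β)

variable {n m : ℕ} {α₁ α₂ δ : ℝ} {F : Measure ℝ} [IsProbabilityMeasure F]
  {α η t₀ c₁ c₂ β : ℝ}

theorem QuantileRegular.exists_regularAt (ht₀ : 0 < t₀) (hc₁ : 0 < c₁) (hc₂ : 0 < c₂) (hβ : 0 < β)
    (hα0 : 0 ≤ α) (hα1 : α ≤ 1) (h : QuantileRegular F α t₀ c₁ c₂ β) :
    ∃ η, RegularAt F α η t₀ c₁ c₂ β := by
  obtain ⟨η, hq, hI, hU, hL⟩ := h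
  refine ⟨η, hq, ?_⟩
  rcases hα0.eq_or_lt with h0 | h0
  · exact Or.inr ⟨-1, Or.inr ⟨h0.symm, rfl⟩, (hL h0.symm).extremeRegular ht₀ hc₂ hβ⟩
  rcases hα1.eq_or_lt with h1 | h1
  · exact Or.inr ⟨1, Or.inl ⟨h1, rfl⟩, (hU h1).extremeRegular ht₀ hc₂ hβ⟩
  · exact Or.inl ⟨h0, h1, (hI h0 h1).interiorRegular ht₀ hc₁ hc₂ h0 hq⟩

/-- A lower bound for the mass within `t₀` of the quantile. -/
noncomputable def nearMass (t₀ c₁ β : ℝ) : ℝ := min (c₁ * t₀) (c₁ * t₀ ^ β)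

theorem nearMass_pos (ht₀ : 0 < t₀) (hc₁ : 0 < c₁) : 0 < nearMass t₀ c₁ β :=
  lt_min (by positivity) (by positivity)

theorem extremeConst_pos (ht₀ : 0 < t₀) (hc₂ : 0 < c₂) : 0 < extremeConst t₀ c₂ β := by
  unfold extremeConst; positivity

theorem interiorConst_pos (ht₀ : 0 < t₀) (hc₂ : 0 < c₂) : 0 < interiorConst t₀ c₂ := by
  unfold interiorConst; positivity

theorem gapConst_nonneg {c C : ℝ} (ht₀ : 0 < t₀) (hc : 0 < c) (hC : 0 < C) :
    0 ≤ gapConst t₀ c C β := by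
  unfold gapConst
  have : 0 ≤ ∑' k : ℕ, ((k : ℝ) + 1) * Real.exp (-(c / 4 * (40 : ℝ)⁻¹ ^ β * k)) :=
    tsum_nonneg fun k => by positivity
  positivity

theorem InteriorRegular.le_mass {c τ C : ℝ} (hτ : 0 ≤ τ) (h : InteriorRegular F α η c τ C) :
    2 * (c * τ) ≤ F.real {x | |x - η| ≤ τ} := by
  have h1 := h.up τ hτ
  have h2 := h.low τ hτ
  rw [min_self] at h1 h2
  have h3 : F.real (Set.Iic (η + τ)) ≤
      F.real (Set.Iio (η - τ)) + F.real {x | |x - η| ≤ τ} := by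
    refine (measureReal_mono fun x hx => ?_).trans (measureReal_union_le _ _)
    by_cases hx' : x < η - τ
    · exact Or.inl hx'
    · refine Or.inr (show |x - η| ≤ τ from abs_le.2 ?_)
      have : x ≤ η + τ := hx
      constructor <;> linarith
  linarith

theorem ExtremeRegular.le_mass {s c C t : ℝ} (hs : s = 1 ∨ s = -1) (h0 : 0 ≤ t) (ht : t ≤ t₀)
    (h : ExtremeRegular F s η t₀ c C β) : c * t ^ β ≤ F.real {x | |x - η| ≤ t} := by
  refine (h.lower t h0 ht).trans ?_
  refine ENNReal.toReal_mono (measure_ne_top _ _) (measure_mono_ae ?_)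
  filter_upwards [h.ae_nonneg] with x hx hx'
  have hx'' : s * (η - x) < t := hx'
  show |x - η| ≤ t
  rcases hs with rfl | rfl <;> exact abs_le.2 ⟨by linarith, by linarith⟩

theorem RegularAt.nearMass_le (ht₀ : 0 < t₀) (h : RegularAt F α η t₀ c₁ c₂ β) :
    nearMass t₀ c₁ β ≤ F.real {x | |x - η| ≤ t₀} := by
  rcases h.2 with ⟨-, -, hI⟩ | ⟨s, hs, hE⟩
  · refine (min_le_left _ _).trans (le_trans (by linarith) ((hI.le_mass (by positivity)).trans ?_))
    refine measureReal_mono fun x hx => ?_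
    exact le_trans (show |x - η| ≤ t₀ / 2 from hx) (by linarith)
  · refine (min_le_right _ _).trans (hE.le_mass ?_ ht₀.le le_rfl)
    rcases hs with ⟨-, h⟩ | ⟨-, h⟩ <;> simp [h]

/-- The probability that a point is estimated badly is at most this constant over `m`. -/
noncomputable def badConst (t₀ c₁ c₂ β : ℝ) : ℝ := 10 + (1 + gapConst t₀ c₁ (extremeConst t₀ c₂ β) β)

/-- Since `m ≤ n`, the bound `O(1/n)` at an extreme is also `O(1/m)`, so trimming at one or two
interior levels is treated uniformly. -/
theorem RegularAt.exists_bad (ht₀ : 0 < t₀) (hc₁ : 0 < c₁) (hc₂ : 0 < c₂) (hβ : 0 < β)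
    (hα : α = α₁ ∨ α = α₂) (hα1 : α ≤ 1) (h : RegularAt F α η t₀ c₁ c₂ β)
    (hn : 2 ≤ n) (hm : 2 ≤ m) (hδ : 0 < δ) (hδ1 : δ < 1)
    (hmn : (m : ℝ) ≤ (n : ℝ) ^ (3 / 5 : ℝ)) (hratio : m ≤ ratioBound c₁ (t₀ / 2) * n)
    (hlarge : (50 : ℝ) ^ (25 / 2 : ℝ) ≤ n) :
    ∃ Bad : Fin n → Set (Fin n → Point m),
      (∀ i, (Measure.pi fun _ : Fin n => pointLaw F m).real (Bad i) ≤ badConst t₀ c₁ c₂ β / m) ∧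
      ∀ p i r, 1 ≤ r → r < lastRound n m δ →
        KeptBy α₁ α₂ δ (observation (toSample n m p)) α r i → p ∉ Bad i →
        |(p i).1 - η| ≤ 2 * width r := by
  have hn' : (2 : ℝ) ≤ n := by exact_mod_cast hn
  have hm' : (2 : ℝ) ≤ m := by exact_mod_cast hm
  have hE0 := extremeConst_pos (β := β) ht₀ hc₂
  have hg0 := gapConst_nonneg (β := β) ht₀ hc₁ hE0
  have hmn1 : (m : ℝ) ≤ n := by
    refine hmn.trans ?_
    conv_rhs => rw [← Real.rpow_one (n : ℝ)]
    exact Real.rpow_le_rpow_of_exponent_le (by linarith) (by norm_num)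
  rcases h.2 with ⟨-, -, hI⟩ | ⟨s, hs, hE⟩
  · obtain ⟨Bad, h1, h2⟩ := exists_bad_interior_le (α₁ := α₁) (α₂ := α₂) hα hα1 hI hc₁
      (by positivity) (by omega) hm hδ hδ1 hmn hratio
    refine ⟨Bad, fun i => (h1 i).trans ?_, h2⟩
    unfold badConst
    gcongr
    linarith
  · obtain ⟨Bad, h1, h2⟩ := exists_bad_extreme (α₁ := α₁) (α₂ := α₂) hα hs ht₀ hc₁ hE0 hβ hE hn hm
      hδ hδ1 (noiseLaw_badNoise_extreme_le one_pos hn hm hδ hδ1 (by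
        rw [one_mul]
        refine Real.log_le_log (by linarith) (hmn1.trans ?_)
        rw [le_div_iff₀ hδ]; nlinarith) (by simpa using hlarge))
    refine ⟨Bad, fun i => (h1 i).trans ?_, h2⟩
    unfold badConst
    refine div_le_div₀ ?_ ?_ ?_ hmn1 <;> linarith

theorem confLog_le {a : ℝ} (hm : 2 ≤ m) (hn : 1 ≤ n) (hδ : 0 < δ)
    (hma : Real.log m ≤ a * Real.log (n / δ)) (hl : 1 ≤ Real.log (n / δ)) :
    confLog n m δ ≤ (4 + a) * Real.log (n / δ) := by
  have hm' : (2 : ℝ) ≤ m := by exact_mod_cast hm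
  have hn' : (1 : ℝ) ≤ n := by exact_mod_cast hn
  have hlm : 0 < Real.log m := Real.log_pos (by linarith)
  have e : 16 * (n : ℝ) * Real.log m / δ = 16 * (n / δ) * Real.log m := by ring
  rw [confLog, e, Real.log_mul (by positivity) hlm.ne', Real.log_mul (by norm_num) (by positivity)]
  have h1 : Real.log 16 ≤ 3 := by
    rw [show (16 : ℝ) = 2 ^ 4 by norm_num, Real.log_pow]
    have := Real.log_two_lt_d9; push_cast; linarith
  have h2 := Real.log_le_sub_one_of_pos hlm
  linarith

/-- The constant in the bound on the number of observations by the gap expectation. -/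
noncomputable def sampleConst (t₀ c₁ c₂ β : ℝ) : ℝ :=
  (33 * 5 + 1) / (nearMass t₀ c₁ β * min 1 (t₀ ^ 2)⁻¹) + 132 * 5 +
    2 * badConst t₀ c₁ c₂ β / (nearMass t₀ c₁ β * min 1 (t₀ ^ 2)⁻¹)

theorem le_gapExpectation_of_mass {q s : ℝ} (hη : η ∈ frontier (relevantSet F α₁ α₂)) (hs : 0 < s)
    (hq : q ≤ F.real {x | |x - η| ≤ s}) (hq0 : 0 ≤ q) :
    ENNReal.ofReal (q * min 1 (s ^ 2)⁻¹) * min (m : ℝ≥0∞) (ENNReal.ofReal (Real.log (n / δ)))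
      ≤ gapExpectation F α₁ α₂ δ n m := by
  refine le_trans ?_ (mul_min_le_gapExpectation hη hs hq)
  rw [ENNReal.ofReal_mul hq0, mul_assoc]
  gcongr
  refine le_min ?_ ?_
  · calc _ ≤ 1 * (m : ℝ≥0∞) := by
          gcongr
          · rw [← ENNReal.ofReal_one]; exact ENNReal.ofReal_le_ofReal (min_le_left _ _)
          · exact min_le_left _ _
      _ = m := one_mul _
  · calc _ ≤ ENNReal.ofReal (s ^ 2)⁻¹ * ENNReal.ofReal (Real.log (n / δ)) := by
          gcongr
          · exact min_le_right _ _
          · exact min_le_right _ _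
      _ = _ := by
          rw [← ENNReal.ofReal_mul (by positivity), mul_comm, ← div_eq_mul_inv]

theorem sampleConst_pos (ht₀ : 0 < t₀) (hc₁ : 0 < c₁) (hc₂ : 0 < c₂) :
    0 < sampleConst t₀ c₁ c₂ β := by
  have h1 := nearMass_pos (β := β) ht₀ hc₁
  have h2 := gapConst_nonneg (β := β) ht₀ hc₁ (extremeConst_pos (β := β) ht₀ hc₂)
  have h3 : 0 < min 1 (t₀ ^ 2)⁻¹ := lt_min one_pos (by positivity)
  unfold sampleConst badConst
  positivity

/-- Sample complexity of the algorithm if `m` is much smaller than `n`. -/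
theorem expectedSamples_le_of_regularAt (ht₀ : 0 < t₀) (hc₁ : 0 < c₁) (hc₂ : 0 < c₂) (hβ : 0 < β)
    (hα : α₁ ≤ α₂) (hα2 : α₂ ≤ 1) {η₁ η₂ : ℝ} (h1 : RegularAt F α₁ η₁ t₀ c₁ c₂ β)
    (h2 : RegularAt F α₂ η₂ t₀ c₁ c₂ β)
    (hn : 2 ≤ n) (hm : 2 ≤ m) (hδ : 0 < δ) (hδ1 : δ < 1)
    (hmn : (m : ℝ) ≤ (n : ℝ) ^ (3 / 5 : ℝ)) (hratio : m ≤ ratioBound c₁ (t₀ / 2) * n)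
    (hlarge : (50 : ℝ) ^ (25 / 2 : ℝ) ≤ n) :
    expectedSamples F α₁ α₂ δ n m ≤
      ENNReal.ofReal (sampleConst t₀ c₁ c₂ β) * n * gapExpectation F α₁ α₂ δ n m := by
  have hn' : (2 : ℝ) ≤ n := by exact_mod_cast hn
  have hm' : (2 : ℝ) ≤ m := by exact_mod_cast hm
  have hmn1 : (m : ℝ) ≤ n / δ := by
    rw [le_div_iff₀ hδ]
    have : (n : ℝ) ^ (3 / 5 : ℝ) ≤ n := by
      conv_rhs => rw [← Real.rpow_one (n : ℝ)]
      exact Real.rpow_le_rpow_of_exponent_le (by linarith) (by norm_num)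
    nlinarith
  have h50 : (50 : ℝ) ≤ n := by
    refine le_trans ?_ hlarge
    conv_lhs => rw [← Real.rpow_one (50 : ℝ)]
    exact Real.rpow_le_rpow_of_exponent_le (by norm_num) (by norm_num)
  have hl : 1 ≤ Real.log (n / δ) := by
    rw [Real.le_log_iff_exp_le (by positivity), le_div_iff₀ hδ]
    have := Real.exp_one_lt_d9
    nlinarith [Real.exp_pos 1]
  have hma : Real.log m ≤ 1 * Real.log (n / δ) := by
    rw [one_mul]; exact Real.log_le_log (by linarith) hmn1
  obtain ⟨Bad₁, hB1, hB1'⟩ := h1.exists_bad (α₁ := α₁) (α₂ := α₂) ht₀ hc₁ hc₂ hβ (Or.inl rfl)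
    (hα.trans hα2) hn hm hδ hδ1 hmn hratio hlarge
  obtain ⟨Bad₂, hB2, hB2'⟩ := h2.exists_bad (α₁ := α₁) (α₂ := α₂) ht₀ hc₁ hc₂ hβ (Or.inr rfl)
    hα2 hn hm hδ hδ1 hmn hratio hlarge
  have hfr := frontier_relevantSet hα h1.1 h2.1
  have hq := nearMass_pos (β := β) ht₀ hc₁
  set g₀ := nearMass t₀ c₁ β * min 1 (t₀ ^ 2)⁻¹ with hg
  have hg₀ : 0 < g₀ := mul_pos hq (lt_min one_pos (by positivity))
  have hb0 : 0 < badConst t₀ c₁ c₂ β := by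
    have := gapConst_nonneg (β := β) ht₀ hc₁ (extremeConst_pos (β := β) ht₀ hc₂)
    unfold badConst; linarith
  have hgap := le_gapExpectation_of_mass (n := n) (m := m) (δ := δ)
    (by rw [hfr]; simp : η₁ ∈ frontier (relevantSet F α₁ α₂)) ht₀ (h1.nearMass_le ht₀) hq.le
  have := expectedSamples_le_gap (K := 2 * badConst t₀ c₁ c₂ β / g₀)
    (ρ := 2 * badConst t₀ c₁ c₂ β / m) (C₁ := 5) (by norm_num)
    (by omega) hm hδ hδ1 ((confLog_le hm (by omega) hδ hma hl).trans (by norm_num)) hl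
    hg₀ (by positivity) (Bad := fun i => Bad₁ i ∪ Bad₂ i)
    (fun i => ((measureReal_union_le _ _).trans (add_le_add (hB1 i) (hB2 i))).trans
      (le_of_eq (by ring))) ?_ hgap ?_
  · exact this
  · intro p i r hr hr' hact hp
    rw [hfr]
    rcases keptBy_or_of_mem hr hact with hk | hk
    · exact infEDist_le_of_abs_le (by simp) (hB1' p i r hr hr' hk fun h => hp (Or.inl h))
    · exact infEDist_le_of_abs_le (by simp) (hB2' p i r hr hr' hk fun h => hp (Or.inr h))
  -- A bad event costs `m` with probability `O(1/m)`, hence a constant, and the gap expectation is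
  -- bounded below by `g₀`.
  · have h3 : ENNReal.ofReal g₀ ≤ gapExpectation F α₁ α₂ δ n m := by
      refine le_trans ?_ hgap
      refine le_mul_of_one_le_right zero_le (le_min ?_ (ENNReal.one_le_ofReal.2 hl))
      exact_mod_cast (by omega : 1 ≤ m)
    calc (m : ℝ≥0∞) * ENNReal.ofReal (2 * badConst t₀ c₁ c₂ β / m)
        = ENNReal.ofReal (2 * badConst t₀ c₁ c₂ β / g₀) * ENNReal.ofReal g₀ := by
          rw [← ENNReal.ofReal_natCast, ← ENNReal.ofReal_mul (by positivity),
            ← ENNReal.ofReal_mul (by positivity)]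
          congr 1; field_simp
      _ ≤ _ := by gcongr

/-- Sample complexity of the algorithm for the minimum and the maximum. -/
theorem expectedSamples_le_of_extremeRegular {s c C : ℝ} (ht₀ : 0 < t₀) (hc : 0 < c) (hC : 0 < C)
    (hβ : 0 < β) (hs : (α = 1 ∧ s = 1) ∨ (α = 0 ∧ s = -1)) (hq : quantile F α = (η : EReal))
    (hF : ExtremeRegular F s η t₀ c C β)
    (hn : 3 ≤ n) (hm : 2 ≤ m) (hδ : 0 < δ) (hδ1 : δ < 1) {a : ℝ} (ha : 0 < a)
    (hma : Real.log m ≤ a * Real.log (n / δ)) (hlarge : (50 * a) ^ (25 / 2 : ℝ) ≤ n)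
    {t κ : ℝ} (ht : 0 < t) (htt : t ≤ t₀) (hmt : m * t ^ 2 ≤ Real.log (n / δ)) (hκ : 0 ≤ κ)
    (hκt : 1 ≤ κ * n * t ^ β) :
    expectedSamples F α α δ n m ≤
      ENNReal.ofReal ((33 * (4 + a) + 1) / (c * t₀ ^ β * min 1 (t₀ ^ 2)⁻¹) + 132 * (4 + a) +
        (1 + gapConst t₀ c C β) * κ / c) * n * gapExpectation F α α δ n m := by
  have hn' : (3 : ℝ) ≤ n := by exact_mod_cast hn
  have hm' : (2 : ℝ) ≤ m := by exact_mod_cast hm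
  have hs' : s = 1 ∨ s = -1 := hs.imp And.right And.right
  have hl : 1 ≤ Real.log (n / δ) := by
    rw [Real.le_log_iff_exp_le (by positivity), le_div_iff₀ hδ]
    have := Real.exp_one_lt_d9
    nlinarith [Real.exp_pos 1]
  obtain ⟨Bad, hB, hB'⟩ := exists_bad_extreme (α₁ := α) (α₂ := α) (Or.inl rfl) hs ht₀ hc hC hβ hF
    (by omega) hm hδ hδ1 (noiseLaw_badNoise_extreme_le ha (by omega) hm hδ hδ1 hma hlarge)
  have hfr := frontier_relevantSet le_rfl hq hq
  have hη : η ∈ frontier (relevantSet F α α) := by rw [hfr]; simp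
  have hG := gapConst_nonneg (β := β) ht₀ hc hC
  refine expectedSamples_le_gap (by linarith) (by omega) hm hδ hδ1
    (confLog_le hm (by omega) hδ hma hl) hl (mul_pos (by positivity)
      (lt_min one_pos (by positivity))) (by positivity) hB ?_
    (le_gapExpectation_of_mass hη ht₀ (hF.le_mass hs' ht₀.le le_rfl) (by positivity))
    ?_
  · intro p i r hr hr' hact hp
    rw [hfr]
    refine infEDist_le_of_abs_le (by simp) (hB' p i r hr hr' ?_ hp)
    rcases keptBy_or_of_mem hr hact with hk | hk <;> exact hk
  -- Here `m` may exceed `n`, and the bad events cost `O(m / n)`. Points within `t` of the end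
  -- contribute `m` each to the gap expectation because `m t² ≤ log(n/δ)`, and their mass `c t^β` is
  -- at least `c / (κ n)`.
  · have h1 := mul_min_le_gapExpectation (n := n) (m := m) (δ := δ) hη ht
      (hF.le_mass hs' ht.le htt)
    rw [min_eq_left] at h1
    · refine le_trans ?_ (mul_le_mul_right h1 _)
      rw [← ENNReal.ofReal_natCast, ← ENNReal.ofReal_mul (by positivity),
        ← ENNReal.ofReal_mul (by positivity), ← ENNReal.ofReal_mul (by positivity)]
      refine ENNReal.ofReal_le_ofReal ?_
      have h2 : (m : ℝ) * ((1 + gapConst t₀ c C β) / n) ≤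
          (m : ℝ) * ((1 + gapConst t₀ c C β) / n) * (κ * n * t ^ β) :=
        le_mul_of_one_le_right (by positivity) hκt
      refine h2.trans (le_of_eq ?_)
      field_simp
    · rw [← ENNReal.ofReal_natCast]
      refine ENNReal.ofReal_le_ofReal ?_
      rw [le_div_iff₀ (by positivity)]
      exact hmt

/-- Mass near the boundary, for interior quantiles. -/
theorem measure_infEDist_le_interior {τ c C η₁ η₂ : ℝ}
    (hfr : frontier (relevantSet F α₁ α₂) = {η₁, η₂})
    (h1 : InteriorRegular F α₁ η₁ c τ C) (h2 : InteriorRegular F α₂ η₂ c τ C) {s : ℝ} (hs : 0 < s) :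
    F {x | Metric.infEDist x (frontier (relevantSet F α₁ α₂)) ≤ ENNReal.ofReal s} ≤
      ENNReal.ofReal (2 * C * s ^ (1 : ℝ)) := by
  rw [← ofReal_measureReal, Real.rpow_one]
  refine ENNReal.ofReal_le_ofReal ?_
  have := add_le_add (h1.mass s hs.le) (h2.mass s hs.le)
  refine (measureReal_mono fun x hx => ?_).trans ((measureReal_union_le _ _).trans
    (this.trans (by linarith)))
  have hx' : Metric.infEDist x (frontier (relevantSet F α₁ α₂)) ≤ ENNReal.ofReal s := hx
  rw [hfr, Set.insert_eq, Metric.infEDist_union, Metric.infEDist_singleton,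
    Metric.infEDist_singleton, inf_le_iff, edist_dist, edist_dist, Real.dist_eq, Real.dist_eq,
    ENNReal.ofReal_le_ofReal_iff hs.le, ENNReal.ofReal_le_ofReal_iff hs.le] at hx'
  exact hx'

/-- Mass near the boundary, for the minimum and the maximum. -/
theorem measure_infEDist_le_extreme {s c C : ℝ} (hs : s = 1 ∨ s = -1)
    (hfr : frontier (relevantSet F α α) = {η, η})
    (h : ExtremeRegular F s η t₀ c C β) {t : ℝ} (ht : 0 < t) :
    F {x | Metric.infEDist x (frontier (relevantSet F α α)) ≤ ENNReal.ofReal t} ≤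
      ENNReal.ofReal (C * t ^ β) := by
  rw [← ofReal_measureReal]
  refine ENNReal.ofReal_le_ofReal ?_
  refine (measureReal_mono fun x hx => ?_).trans (h.upper t ht)
  have hx' : Metric.infEDist x (frontier (relevantSet F α α)) ≤ ENNReal.ofReal t := hx
  rw [hfr, Set.pair_eq_singleton, Metric.infEDist_singleton, edist_dist, Real.dist_eq,
    ENNReal.ofReal_le_ofReal_iff ht.le, abs_le] at hx'
  show s * (η - x) ≤ t
  rcases hs with rfl | rfl <;> linarith [hx'.1, hx'.2]

end Complexity

/-! ### Moments of a noisy point -/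

section PointLaw

variable {n m : ℕ} {F : Measure ℝ} [IsProbabilityMeasure F]

/-- The mean of the `m` observations of a point. -/
noncomputable def pointMean {m : ℕ} (q : Point m) : ℝ := q.1 + prefixMean q.2.1 m

theorem measurable_pointMean : Measurable (pointMean (m := m)) :=
  measurable_fst.add ((measurable_prefixMean m m).comp (measurable_fst.comp measurable_snd))

omit F in
theorem empMean_observation_toSample (hm : 1 ≤ m) (p : Fin n → Point m) :
    (empMean (observation (toSample n m p)) fun _ => m) = fun i => pointMean (p i) := by
  funext i
  rw [empMean_eq_prefixMean, prefixMean_observation p i hm le_rfl, pointMean]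

/-- A centered noise variable of a point. -/
structure IsNoise (m : ℕ) (V : (Fin m → ℝ) × ℝ → ℝ) (v : ℝ) : Prop where
  memLp : MemLp V 2 ((noiseLaw m).prod (gaussianReal 0 1))
  integral : ∫ z, V z ∂(noiseLaw m).prod (gaussianReal 0 1) = 0
  integral_sq : ∫ z, V z ^ 2 ∂(noiseLaw m).prod (gaussianReal 0 1) = v

theorem isNoise_prefixMean (hm : 1 ≤ m) : IsNoise m (fun z => prefixMean z.1 m) (1 / m) := by
  have hmp : MeasurePreserving (Prod.fst : (Fin m → ℝ) × ℝ → (Fin m → ℝ))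
      ((noiseLaw m).prod (gaussianReal 0 1)) (noiseLaw m) := measurePreserving_fst
  have hmeas := measurable_prefixMean m m
  refine ⟨(memLp_prefixMean m).comp_measurePreserving hmp, ?_, ?_⟩
  · have := integral_map (μ := (noiseLaw m).prod (gaussianReal 0 1)) hmp.measurable.aemeasurable
      (f := fun z => prefixMean z m) hmeas.aestronglyMeasurable
    rw [hmp.map_eq, integral_prefixMean] at this
    exact this.symm
  · have := integral_map (μ := (noiseLaw m).prod (gaussianReal 0 1)) hmp.measurable.aemeasurable
      (f := fun z => prefixMean z m ^ 2) (hmeas.pow_const 2).aestronglyMeasurable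
    rw [hmp.map_eq, integral_prefixMean_sq hm le_rfl] at this
    exact this.symm

theorem isNoise_fresh : IsNoise m (fun z => z.2) 1 := by
  have hmp : MeasurePreserving (Prod.snd : (Fin m → ℝ) × ℝ → ℝ)
      ((noiseLaw m).prod (gaussianReal 0 1)) (gaussianReal 0 1) := measurePreserving_snd
  have hL : MemLp (fun x : ℝ => x) 2 (gaussianReal 0 1) := memLp_id_gaussianReal 2
  have h0 : ∫ x : ℝ, x ∂gaussianReal 0 1 = 0 := integral_id_gaussianReal
  refine ⟨hL.comp_measurePreserving hmp, ?_, ?_⟩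
  · have := integral_map (μ := (noiseLaw m).prod (gaussianReal 0 1)) hmp.measurable.aemeasurable
      (f := fun x : ℝ => x) measurable_id.aestronglyMeasurable
    rw [hmp.map_eq, h0] at this
    exact this.symm
  · have := integral_map (μ := (noiseLaw m).prod (gaussianReal 0 1)) hmp.measurable.aemeasurable
      (f := fun x : ℝ => x ^ 2) (measurable_id.pow_const 2).aestronglyMeasurable
    rw [hmp.map_eq] at this
    rw [← this]
    have hv := variance_eq_integral (μ := gaussianReal 0 1) (X := fun x : ℝ => x)
      measurable_id.aemeasurable
    rw [h0, variance_fun_id_gaussianReal] at hv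
    simpa using hv.symm

variable {V : (Fin m → ℝ) × ℝ → ℝ} {v : ℝ}

theorem IsNoise.memLp_add (hV : IsNoise m V v) {h : ℝ → ℝ} (hh : MemLp h 2 F) :
    MemLp (fun q : Point m => h q.1 + V q.2) 2 (pointLaw F m) :=
  (hh.comp_measurePreserving (measurePreserving_fst (μ := F)
    (ν := (noiseLaw m).prod (gaussianReal 0 1)))).add
    (hV.memLp.comp_measurePreserving (measurePreserving_snd (μ := F)
    (ν := (noiseLaw m).prod (gaussianReal 0 1))))

theorem integral_pointLaw_fst (h : ℝ → ℝ) :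
    ∫ q : Point m, h q.1 ∂pointLaw F m = ∫ x, h x ∂F := by
  have := integral_prod_mul (μ := F) (ν := (noiseLaw m).prod (gaussianReal 0 1)) h
    (fun _ => (1 : ℝ))
  simpa [pointLaw] using this

theorem IsNoise.integral_add (hV : IsNoise m V v) {h : ℝ → ℝ} (hh : MemLp h 2 F) :
    ∫ q : Point m, (h q.1 + V q.2) ∂pointLaw F m = ∫ x, h x ∂F := by
  have h1 : Integrable (fun q : Point m => h q.1) (pointLaw F m) :=
    (hh.integrable one_le_two).comp_fst _
  have h2 : Integrable (fun q : Point m => V q.2) (pointLaw F m) :=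
    (hV.memLp.integrable one_le_two).comp_snd _
  rw [MeasureTheory.integral_add h1 h2, integral_pointLaw_fst]
  have := integral_prod_mul (μ := F) (ν := (noiseLaw m).prod (gaussianReal 0 1))
    (fun _ => (1 : ℝ)) V
  rw [hV.integral] at this
  simpa [pointLaw] using this

theorem IsNoise.integral_add_sq (hV : IsNoise m V v) {h : ℝ → ℝ} (hh : MemLp h 2 F) :
    ∫ q : Point m, (h q.1 + V q.2) ^ 2 ∂pointLaw F m = ∫ x, h x ^ 2 ∂F + v := by
  have h1 : Integrable (fun q : Point m => h q.1 ^ 2) (pointLaw F m) := hh.integrable_sq.comp_fst _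
  have h2 : Integrable (fun q : Point m => V q.2 ^ 2) (pointLaw F m) :=
    hV.memLp.integrable_sq.comp_snd _
  have h3 : Integrable (fun q : Point m => h q.1 * V q.2) (pointLaw F m) :=
    (hh.integrable one_le_two).mul_prod (hV.memLp.integrable one_le_two)
  have e : ∀ q : Point m, (h q.1 + V q.2) ^ 2 = h q.1 ^ 2 + V q.2 ^ 2 + 2 * (h q.1 * V q.2) :=
    fun q => by ring
  have h4 : ∫ q : Point m, h q.1 * V q.2 ∂pointLaw F m = 0 := by
    rw [pointLaw, integral_prod_mul, hV.integral, mul_zero]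
  have h5 : ∫ q : Point m, V q.2 ^ 2 ∂pointLaw F m = v := by
    have := integral_prod_mul (μ := F) (ν := (noiseLaw m).prod (gaussianReal 0 1))
      (fun _ => (1 : ℝ)) (fun z => V z ^ 2)
    rw [hV.integral_sq] at this
    simpa [pointLaw] using this
  have h12 : Integrable (fun q : Point m => h q.1 ^ 2 + V q.2 ^ 2) (pointLaw F m) := h1.add h2
  simp_rw [e]
  rw [MeasureTheory.integral_add h12 (h3.const_mul 2), MeasureTheory.integral_add h1 h2, integral_const_mul, h4, h5,
    integral_pointLaw_fst fun x => h x ^ 2]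
  ring

theorem isPAC_sampleLaw {G : SampleSpace n m → ℝ} {g ε δ : ℝ}
    (h : (Measure.pi fun _ : Fin n => pointLaw F m).real
      {p | ε < |G (toSample n m p) - g|} ≤ δ) :
    IsPAC (sampleLaw F n m) G g ε δ := by
  rw [IsPAC, sampleLaw_apply, ← ofReal_measureReal]
  exact ENNReal.ofReal_le_ofReal h

end PointLaw

/-! ### The mean -/

section Mean

variable {n m : ℕ} {F : Measure ℝ} [IsProbabilityMeasure F]

/-- The end quantiles may be infinite. The complement is covered by half-lines with rational
endpoints, countably many and each null by the definition of the quantile. -/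
theorem ae_mem_relevantSet_zero_one : ∀ᵐ x ∂F, x ∈ relevantSet F 0 1 := by
  have h1 : ∀ᵐ x ∂F, ∀ q : ℚ, ((q : ℝ) : EReal) < quantile F 0 → ¬ x ≤ (q : ℝ) := by
    rw [ae_all_iff]
    intro q
    by_cases hq : ((q : ℝ) : EReal) < quantile F 0
    · have hF : F (Set.Iic (q : ℝ)) = 0 := by
        by_contra h0
        have : 0 < cdf F q := by
          rw [cdf_eq_real]; exact ENNReal.toReal_pos h0 (measure_ne_top _ _)
        exact absurd hq (not_lt.2 (quantile_le_of_le_cdf this this.le))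
      filter_upwards [measure_eq_zero_iff_ae_notMem.1 hF] with x hx _ using hx
    · exact ae_of_all _ fun x h => absurd h hq
  have h2 : ∀ᵐ x ∂F, ∀ q : ℚ, quantile F 1 < ((q : ℝ) : EReal) → ¬ (q : ℝ) < x := by
    rw [ae_all_iff]
    intro q
    by_cases hq : quantile F 1 < ((q : ℝ) : EReal)
    · have h3 := (exists_cdf_of_quantile_lt hq).2
      have hF : F (Set.Ioi (q : ℝ)) = 0 := by
        rw [cdf_eq_real] at h3
        have h4 := probReal_compl_eq_one_sub (μ := F) (measurableSet_Iic (a := (q : ℝ)))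
        rw [Set.compl_Iic] at h4
        have h5 : F.real (Set.Ioi (q : ℝ)) = 0 := le_antisymm (by linarith) measureReal_nonneg
        rwa [measureReal_eq_zero_iff] at h5
      filter_upwards [measure_eq_zero_iff_ae_notMem.1 hF] with x hx _ using hx
    · exact ae_of_all _ fun x h => absurd h hq
  filter_upwards [h1, h2] with x hx1 hx2
  constructor
  · by_contra hcon
    obtain ⟨q, hq1, hq2⟩ := EReal.lt_iff_exists_rat_btwn.1 (not_le.1 hcon)
    exact hx1 q hq2 (EReal.coe_lt_coe_iff.1 hq1).le
  · by_contra hcon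
    obtain ⟨q, hq1, hq2⟩ := EReal.lt_iff_exists_rat_btwn.1 (not_le.1 hcon)
    exact hx2 q hq1 (EReal.coe_lt_coe_iff.1 hq2)

theorem functional_zero_one : functional F 0 1 = ∫ x, x ∂F := by
  have h := ae_mem_relevantSet_zero_one (F := F)
  have h1 : F (relevantSet F 0 1) = 1 := by
    rw [← measure_univ (μ := F)]
    exact measure_congr (Filter.eventuallyEq_univ.2 h)
  rw [functional, if_neg zero_ne_one, ProbabilityTheory.cond, h1, Measure.restrict_eq_self_of_ae_mem h]
  simp

theorem relevantIndices_zero_one (hn : 1 ≤ n) (v : Fin n → ℝ) :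
    relevantIndices v 0 1 = Finset.univ := by
  ext i; simp [relevantIndices, empQuantile_zero_le hn, le_empQuantile_one hn]

/-- Chebyshev's inequality for the average of noisy copies of the points. -/
theorem pi_average_gt_le {V : (Fin m → ℝ) × ℝ → ℝ} {v c₀ ε : ℝ} (hV : IsNoise m V v)
    (hF : MemLp id 2 F) (hvar : variance id F ≤ c₀) (hv : v ≤ 1) (hn : 1 ≤ n) (hε : 0 < ε) :
    (Measure.pi fun _ : Fin n => pointLaw F m).real
      {p | ε < |_root_.average Finset.univ (fun i => (p i).1 + V (p i).2) - functional F 0 1|}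
      ≤ (c₀ + 1) / (n * ε ^ 2) := by
  have hn' : (0 : ℝ) < n := by positivity
  rw [functional_zero_one]
  set g := ∫ x, x ∂F with hg
  have hh : MemLp (fun x => x - g) 2 F := hF.sub (memLp_const g)
  have h0 : ∫ x, (x - g) ∂F = 0 := by
    rw [integral_sub (f := fun x => x) (hF.integrable one_le_two) (integrable_const g),
      integral_const]
    simp [hg]
  have hvar' : ∫ x, (x - g) ^ 2 ∂F ≤ c₀ := by
    rw [variance_eq_integral measurable_id.aemeasurable] at hvar
    exact hvar
  refine (measureReal_mono fun p hp => ?_).trans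
    (pi_abs_sum_sub_ge (hV.memLp_add hh) (V := c₀ + 1) ?_ hn hε)
  · have hp' : ε < |(∑ i, ((p i).1 + V (p i).2)) / n - g| := by
      simpa [_root_.average] using (show ε < |_ - g| from hp)
    show n * ε ≤ |_|
    rw [hV.integral_add hh, h0, mul_zero, sub_zero]
    have e : ∑ i : Fin n, ((p i).1 - g + V (p i).2)
        = n * ((∑ i, ((p i).1 + V (p i).2)) / n - g) := by
      rw [mul_sub, mul_div_cancel₀ _ hn'.ne']
      simp only [Finset.sum_add_distrib, Finset.sum_sub_distrib, Finset.sum_const,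
        Finset.card_univ, Fintype.card_fin, nsmul_eq_mul]
      ring
    rw [e, abs_mul, abs_of_pos hn']
    gcongr
  · rw [hV.integral_add_sq hh]; linarith

theorem confLog_nonneg {δ : ℝ} (hn : 1 ≤ n) (hm : 1 ≤ m) (hδ : 0 < δ) (hδ1 : δ < 1) :
    0 ≤ confLog n m δ := by
  rcases hm.eq_or_lt with rfl | hm
  -- For `m = 1` the value is `log 0`, which is `0` by convention.
  · simp [confLog]
  · linarith [one_le_confLog hn hm hδ hδ1]

theorem expectedSamples_le_mul {α₁ α₂ δ : ℝ} (hL : 0 ≤ confLog n m δ) :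
    expectedSamples F α₁ α₂ δ n m ≤ n * (m + 1) := by
  have : ∀ p, (sampleCount α₁ α₂ δ (toSample n m p) : ℝ≥0∞) ≤ n * (m + 1) := by
    intro p
    have : sampleCount α₁ α₂ δ (toSample n m p) ≤ n * m + n := by
      unfold sampleCount
      refine add_le_add ?_ ?_
      · refine (Finset.sum_le_sum fun i _ => run_pulls_le hL _ i).trans ?_
        simp
      · split_ifs
        · exact Nat.zero_le _
        · exact card_selected_le _
    calc _ ≤ ((n * m + n : ℕ) : ℝ≥0∞) := by exact_mod_cast this
      _ = _ := by push_cast; ring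
  rw [expectedSamples, lintegral_sampleLaw]
  refine (lintegral_mono this).trans ?_
  simp

/-- Some bounded neighbourhood of a boundary point has at least half of the mass. -/
theorem exists_half_le_mass (η : ℝ) : ∃ R, 0 < R ∧ 1 / 2 ≤ F.real {x | |x - η| ≤ R} := by
  have h : Filter.Tendsto (fun k : ℕ => F {x | |x - η| ≤ k}) Filter.atTop
      (nhds (F (⋃ k : ℕ, {x | |x - η| ≤ k}))) :=
    tendsto_measure_iUnion_atTop fun a b hab x hx =>
      le_trans (show |x - η| ≤ a from hx) (by exact_mod_cast hab)
  have hU : (⋃ k : ℕ, {x : ℝ | |x - η| ≤ k}) = Set.univ := by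
    ext x
    simp only [Set.mem_iUnion, Set.mem_univ, iff_true]
    exact exists_nat_ge |x - η|
  rw [hU, measure_univ] at h
  have h2 := h.eventually (lt_mem_nhds (by norm_num : (1 / 2 : ℝ≥0∞) < 1))
  obtain ⟨k, hk, hk0⟩ := (h2.and (Filter.eventually_gt_atTop 0)).exists
  refine ⟨k, by exact_mod_cast hk0, ?_⟩
  have := ENNReal.toReal_mono (measure_ne_top _ _) hk.le
  simpa [Measure.real] using this

theorem mean_case {c₀ : ℝ} (hc₀ : 0 < c₀) :
    ∃ A : ℝ, 0 < A ∧ ∀ B : ℝ, A ≤ B → ∃ (C ε₀ : ℝ) (D : ℝ → ℝ), 0 < C ∧ 0 < ε₀ ∧ ε₀ < 1 ∧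
    ∀ F : Measure ℝ, IsProbabilityMeasure F → MemLp id 2 F → variance id F ≤ c₀ →
    ∃ K : ℝ, ∀ (ε δ : ℝ) (n m : ℕ), 0 < ε → ε < ε₀ → 0 < δ → δ < 1 →
      InBand A B (δ⁻¹ * ε⁻¹ ^ 2) n → 1 ≤ m → (m : ℝ) ≤ B →
      IsPAC (sampleLaw F n m) (fun ω => offlineEstimator 0 1 (observation ω))
        (functional F 0 1) (ε / 2) (δ / 2) ∧
      IsPAC (sampleLaw F n m) (fun ω => onlineEstimator 0 1 δ ω) (functional F 0 1) ε δ ∧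
      expectedSamples F 0 1 δ n m ≤ ENNReal.ofReal C * (n : ℝ≥0∞) ∧
      ((frontier (relevantSet F 0 1)).Nonempty → expectedSamples F 0 1 δ n m
        ≤ ENNReal.ofReal K * (n : ℝ≥0∞) * gapExpectation F 0 1 δ n m) ∧
      expectedSamples F 0 1 δ n m ≤ ENNReal.ofReal (D δ * ε ^ (-2 : ℝ)) := by
  classical
  -- Chebyshev with accuracy `ε / 2` and failure probability `δ / 2` asks for `n ε² δ ≥ 8 (c₀ + 1)`.
  refine ⟨8 * (c₀ + 1), by positivity, fun B hB => ⟨B + 1, 1 / 2, fun δ => (B + 1) * (B * δ⁻¹),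
    by linarith, by norm_num, by norm_num, fun F _ hF hvar => ?_⟩⟩
  -- The assumptions do not bound the distance from the boundary to the bulk of the mass, so the
  -- radius depends on `F`; it is fixed before `ε`, `δ`, `n`, `m`.
  have hR : ∃ R : ℝ, (frontier (relevantSet F 0 1)).Nonempty →
      ∃ η ∈ frontier (relevantSet F 0 1), 0 < R ∧ 1 / 2 ≤ F.real {x | |x - η| ≤ R} := by
    by_cases h : (frontier (relevantSet F 0 1)).Nonempty
    · obtain ⟨η, hη⟩ := h
      obtain ⟨R, h1, h2⟩ := exists_half_le_mass (F := F) η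
      exact ⟨R, fun _ => ⟨η, hη, h1, h2⟩⟩
    · exact ⟨0, fun h' => absurd h' h⟩
  obtain ⟨R, hR⟩ := hR
  refine ⟨(B + 1) * (1 / (1 / 2 * min 1 (R ^ 2)⁻¹)), fun ε δ n m hε hε1 hδ hδ1 hn hm hmB => ?_⟩
  have hn0 : (0 : ℝ) < n := lt_of_lt_of_le (by positivity) hn.1
  have hn1 : 1 ≤ n := by exact_mod_cast hn0
  have hA : 8 * (c₀ + 1) ≤ n * ε ^ 2 * δ := by
    have := mul_le_mul_of_nonneg_right hn.1 (show 0 ≤ ε ^ 2 * δ by positivity)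
    have e : 8 * (c₀ + 1) * (δ⁻¹ * ε⁻¹ ^ 2) * (ε ^ 2 * δ) = 8 * (c₀ + 1) := by field_simp
    rw [e] at this; linarith
  have hE : expectedSamples F 0 1 δ n m ≤ ENNReal.ofReal (B + 1) * (n : ℝ≥0∞) := by
    refine (expectedSamples_le_mul (confLog_nonneg hn1 hm hδ hδ1)).trans ?_
    rw [mul_comm]
    gcongr
    rw [ENNReal.ofReal_add (by linarith) zero_le_one, ENNReal.ofReal_one,
      ← ENNReal.ofReal_natCast]
    gcongr
  refine ⟨isPAC_sampleLaw ?_, isPAC_sampleLaw ?_, hE, fun hne => ?_, ?_⟩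
  · have h := pi_average_gt_le (n := n) (isNoise_prefixMean hm) hF hvar
      (by rw [div_le_one (by positivity)]; exact_mod_cast hm) hn1 (half_pos hε)
    simp_rw [offlineEstimator, empMean_observation_toSample hm, relevantIndices_zero_one hn1]
    refine h.trans ?_
    rw [div_le_iff₀ (by positivity)]
    nlinarith
  · have h := pi_average_gt_le (n := n) (m := m) isNoise_fresh hF hvar le_rfl hn1 hε
    simp_rw [onlineEstimator, if_neg (zero_ne_one' ℝ), selected, relevantIndices_zero_one hn1]
    refine h.trans ?_
    rw [div_le_iff₀ (by positivity)]
    nlinarith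
  · obtain ⟨η, hη, hR0, hRF⟩ := hR hne
    have hl : 1 ≤ Real.log (n / δ) := by
      rw [Real.le_log_iff_exp_le (by positivity), le_div_iff₀ hδ]
      have := Real.exp_one_lt_d9
      have h3 : ε ^ 2 ≤ 1 := by nlinarith
      have h4 : n * ε ^ 2 * δ ≤ n := by
        calc n * ε ^ 2 * δ ≤ n * 1 * 1 := by gcongr
          _ = n := by ring
      nlinarith [Real.exp_pos 1]
    have hg := le_gapExpectation_of_mass (n := n) (m := m) (δ := δ) hη hR0 hRF (by norm_num)
    set g₀ := 1 / 2 * min 1 (R ^ 2)⁻¹ with hg₀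
    have hg0 : 0 < g₀ := mul_pos (by norm_num) (lt_min one_pos (by positivity))
    have h1 : ENNReal.ofReal g₀ ≤ gapExpectation F 0 1 δ n m := by
      refine le_trans ?_ hg
      refine le_mul_of_one_le_right zero_le (le_min ?_ (ENNReal.one_le_ofReal.2 hl))
      exact_mod_cast hm
    refine hE.trans ?_
    have h2 : 1 ≤ ENNReal.ofReal (1 / g₀) * gapExpectation F 0 1 δ n m := by
      calc (1 : ℝ≥0∞) = ENNReal.ofReal (1 / g₀) * ENNReal.ofReal g₀ := by
            rw [← ENNReal.ofReal_mul (by positivity), one_div_mul_cancel hg0.ne',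
              ENNReal.ofReal_one]
        _ ≤ _ := by gcongr
    rw [ENNReal.ofReal_mul (by linarith)]
    calc _ = ENNReal.ofReal (B + 1) * n * 1 := (mul_one _).symm
      _ ≤ ENNReal.ofReal (B + 1) * n *
          (ENNReal.ofReal (1 / g₀) * gapExpectation F 0 1 δ n m) := by gcongr
      _ = _ := by ring
  · refine hE.trans ?_
    rw [← ENNReal.ofReal_natCast, ← ENNReal.ofReal_mul (by linarith)]
    refine ENNReal.ofReal_le_ofReal ?_
    rw [mul_assoc]
    refine mul_le_mul_of_nonneg_left (hn.2.trans (le_of_eq ?_)) (by linarith)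
    rw [Real.rpow_neg hε.le, inv_pow, mul_assoc]
    norm_num

end Mean

/-! ### Accuracy for the minimum and the maximum -/

section ExtremeAccuracy

variable {n m : ℕ} {F : Measure ℝ} [IsProbabilityMeasure F] {α s η t₀ c C β : ℝ}

theorem half_le_noiseLaw_sign (s : ℝ) :
    1 / 2 ≤ (noiseLaw m).real {z : Fin m → ℝ | 0 ≤ s * prefixMean z m} := by
  have hmeas : Measurable fun z : Fin m → ℝ => s * prefixMean z m :=
    (measurable_prefixMean m m).const_mul s
  have hE : MeasurableSet {z : Fin m → ℝ | 0 ≤ s * prefixMean z m} :=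
    measurableSet_le measurable_const hmeas
  have h1 := (map_neg_noiseLaw (m := m)).measureReal_preimage hE.nullMeasurableSet
  have h2 : (1 : ℝ) ≤ (noiseLaw m).real {z : Fin m → ℝ | 0 ≤ s * prefixMean z m} +
      (noiseLaw m).real ((fun z => -z) ⁻¹' {z : Fin m → ℝ | 0 ≤ s * prefixMean z m}) := by
    refine le_trans ?_ (measureReal_union_le _ _)
    rw [← probReal_univ (μ := noiseLaw m)]
    refine measureReal_mono fun z _ => ?_
    rcases le_total 0 (s * prefixMean z m) with h | h
    · exact Or.inl h
    · refine Or.inr (show 0 ≤ s * prefixMean (-z) m from ?_)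
      rw [prefixMean_neg]; linarith
  linarith

theorem offlineEstimator_self {α : ℝ} (hn : 1 ≤ n) (hm : 1 ≤ m) (hα : α ≤ 1)
    (p : Fin n → Point m) :
    offlineEstimator α α (observation (toSample n m p)) =
      empQuantile (fun i => pointMean (p i)) α := by
  rw [offlineEstimator, average_relevantIndices_self hn hα, empMean_observation_toSample hm]

/-- No point lies beyond `η`, so an overshoot by more than `2 t` needs noise larger than `2 t`. One
point within `t` of `η` whose noise points outwards excludes an undershoot; such a point has
probability at least `c t^β / 2`. -/
theorem pi_extreme_error_le (hs : (α = 1 ∧ s = 1) ∨ (α = 0 ∧ s = -1))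
    (hF : ExtremeRegular F s η t₀ c C β) (hn : 1 ≤ n) (hm : 1 ≤ m) {t : ℝ} (ht : 0 < t)
    (htt : t ≤ t₀) :
    (Measure.pi fun _ : Fin n => pointLaw F m).real
      {p | 2 * t < |empQuantile (fun i => pointMean (p i)) α - η|} ≤
      n * (2 * Real.exp (-(m * (2 * t) ^ 2) / 2)) + Real.exp (-(n * (c * t ^ β / 2))) := by
  set ν := (Measure.pi fun _ : Fin n => pointLaw F m) with hν
  have hs' : s = 1 ∨ s = -1 := hs.imp And.right And.right
  have hα1 : α ≤ 1 := by rcases hs with ⟨h, -⟩ | ⟨h, -⟩ <;> linarith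
  set E₁ : Set (Point m) := {q | 2 * t < |prefixMean q.2.1 m|} with hE₁
  set E₂ : Set (Point m) := {q | q.1 ∈ {x | s * (η - x) < t} ∧
    q.2.1 ∈ {z : Fin m → ℝ | 0 ≤ s * prefixMean z m}} with hE₂
  have hpm : Measurable fun q : Point m => prefixMean q.2.1 m :=
    (measurable_prefixMean m m).comp (measurable_fst.comp measurable_snd)
  have hE₁m : MeasurableSet E₁ := measurableSet_lt measurable_const hpm.abs
  have hE₂m : MeasurableSet E₂ :=
    (measurableSet_lt (f := fun q : Point m => s * (η - q.1)) (by fun_prop) measurable_const).inter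
      (measurableSet_le measurable_const (hpm.const_mul s))
  have hae : ∀ᵐ p ∂ν, ∀ i, 0 ≤ s * (η - (p i).1) := by
    rw [ae_all_iff]
    intro i
    have hmp : MeasurePreserving (fun p : Fin n → Point m => (p i).1) ν F :=
      (measurePreserving_fst (μ := F) (ν := (noiseLaw m).prod (gaussianReal 0 1))).comp
        (measurePreserving_eval (fun _ : Fin n => pointLaw F m) i)
    exact hmp.quasiMeasurePreserving.ae hF.ae_nonneg
  have hsub : ∀ᵐ p ∂ν, p ∈ {p : Fin n → Point m |
      2 * t < |empQuantile (fun i => pointMean (p i)) α - η|} →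
      p ∈ {p : Fin n → Point m | ∃ i, p i ∈ E₁} ∪ Set.univ.pi fun _ => E₂ᶜ := by
    filter_upwards [hae] with p hp hq
    have hq' : 2 * t < |empQuantile (fun i => pointMean (p i)) α - η| := hq
    obtain ⟨i, hi, -⟩ := exists_empQuantile_eq (v := fun i => pointMean (p i)) hn hα1
    have hmax : ∀ j, s * pointMean (p j) ≤ s * empQuantile (fun i => pointMean (p i)) α := by
      intro j
      rcases hs with ⟨rfl, rfl⟩ | ⟨rfl, rfl⟩
      · simpa using le_empQuantile_one (v := fun i => pointMean (p i)) hn j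
      · have := empQuantile_zero_le (v := fun i => pointMean (p i)) hn j
        linarith
    by_contra hcon
    simp only [Set.mem_union, not_or, Set.mem_pi, not_forall, Set.mem_univ, Set.mem_compl_iff,
      not_not] at hcon
    obtain ⟨hno, j, -, hj⟩ := hcon
    have hV : ∀ k, |prefixMean (p k).2.1 m| ≤ 2 * t := fun k => by
      by_contra h; exact hno ⟨k, not_le.1 h⟩
    have h1 : s * (η - (p j).1) < t := hj.1
    have h2 : 0 ≤ s * prefixMean (p j).2.1 m := hj.2
    have h3 := hmax j
    have h4 := hp i
    have h5 := abs_le.1 (hV i)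
    rw [hi] at h3 hq'
    simp only [pointMean] at h3 hq'
    rcases hs' with rfl | rfl <;> rcases lt_abs.1 hq' with h | h <;> linarith
  have h1 : ν.real {p | ∃ i, p i ∈ E₁} ≤ n * (2 * Real.exp (-(m * (2 * t) ^ 2) / 2)) := by
    refine (pi_exists_mem_le E₁ hE₁m).trans ?_
    gcongr
    have := pointLaw_noise (F := F) {z : Fin m → ℝ | 2 * t < |prefixMean z m|}
    exact this.le.trans (noiseLaw_abs_prefixMean_gt hm le_rfl (by positivity))
  have h2 : ν.real (Set.univ.pi fun _ => E₂ᶜ) ≤ Real.exp (-(n * (c * t ^ β / 2))) := by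
    have h3 : c * t ^ β / 2 ≤ (pointLaw F m).real E₂ := by
      rw [hE₂, pointLaw_fst_noise]
      have := mul_le_mul (hF.lower t ht.le htt) (half_le_noiseLaw_sign (m := m) s)
        (by norm_num) measureReal_nonneg
      linarith
    have h4 : ν.real (Set.univ.pi fun _ => E₂ᶜ) = (pointLaw F m).real E₂ᶜ ^ n := by
      rw [hν, Measure.real, Measure.pi_pi, ENNReal.toReal_prod]
      simp [Measure.real]
    rw [h4, probReal_compl_eq_one_sub hE₂m, mul_comm (n : ℝ)]
    refine pow_le_exp_of_le ?_ (by linarith) n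
    linarith [measureReal_le_one (μ := pointLaw F m) (s := E₂)]
  calc _ ≤ ν.real ({p : Fin n → Point m | ∃ i, p i ∈ E₁} ∪ Set.univ.pi fun _ => E₂ᶜ) :=
        ENNReal.toReal_mono (measure_ne_top _ _) (measure_mono_ae hsub)
    _ ≤ _ := (measureReal_union_le _ _).trans (add_le_add h1 h2)

end ExtremeAccuracy

/-! ### The online estimator for quantiles -/

section OnlineQuantile

variable {n m : ℕ} {F : Measure ℝ} [IsProbabilityMeasure F] {α δ : ℝ}

theorem onlineEstimator_self {p : Fin n → Point m} (hn : 1 ≤ n) (hm : 2 ≤ m) (hδ : 0 < δ)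
    (hδ1 : δ < 1) (hα : α ≤ 1) (hp : p ∉ deviationEvent n m δ) :
    onlineEstimator α α δ (toSample n m p) =
      offlineEstimator α α (observation (toSample n m p)) := by
  rw [onlineEstimator, if_pos rfl]
  exact average_selected_eq_offlineEstimator hn (one_le_confLog hn hm hδ hδ1) hα
    (abs_prefixMean_sub_le_of_notMem (by omega) hp)

/-- Outside the deviation event, of probability at most `δ / 8`, the online and the offline outputs
coincide. -/
theorem isPAC_quantile {g ε : ℝ} (hε : 0 < ε) (hn : 1 ≤ n) (hm : 2 ≤ m) (hδ : 0 < δ)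
    (hδ1 : δ < 1) (hα : α ≤ 1)
    (h : (Measure.pi fun _ : Fin n => pointLaw F m).real
      {p | ε / 2 < |empQuantile (fun i => pointMean (p i)) α - g|} ≤ δ / 2) :
    IsPAC (sampleLaw F n m) (fun ω => offlineEstimator α α (observation ω)) g (ε / 2) (δ / 2) ∧
      IsPAC (sampleLaw F n m) (fun ω => onlineEstimator α α δ ω) g ε δ := by
  refine ⟨isPAC_sampleLaw ?_, isPAC_sampleLaw ?_⟩
  · simpa only [offlineEstimator_self hn (show 1 ≤ m by omega) hα] using h
  · have hd := pi_deviationEvent_le (F := F) (n := n) hn hm hδ hδ1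
    refine (measureReal_mono (fun p hp => ?_)).trans ((measureReal_union_le _ _).trans
      ((add_le_add h hd).trans (by linarith)))
    by_cases hpd : p ∈ deviationEvent n m δ
    · exact Or.inr hpd
    · left
      have hp' : ε < |onlineEstimator α α δ (toSample n m p) - g| := hp
      rw [onlineEstimator_self hn hm hδ hδ1 hα hpd,
        offlineEstimator_self hn (show 1 ≤ m by omega) hα] at hp'
      exact lt_trans (by linarith) hp'

end OnlineQuantile

/-! ### Accuracy for interior quantiles -/

section InteriorAccuracy

variable {n m : ℕ} {F : Measure ℝ} [IsProbabilityMeasure F] {α η c τ C : ℝ}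

/-- The field `low` speaks of open half-lines; it is applied at `t - d` for arbitrarily small `d`.
-/
theorem InteriorRegular.Iic_le (hF : InteriorRegular F α η c τ C) (hc : 0 < c) {t : ℝ}
    (ht : 0 < t) (htt : t ≤ τ) : F.real (Set.Iic (η - t)) ≤ α - c * t := by
  refine le_of_forall_pos_le_add fun e he => ?_
  obtain ⟨d, hd, hdt, hde⟩ : ∃ d, 0 < d ∧ d ≤ t ∧ d ≤ e / c :=
    ⟨min t (e / c), lt_min ht (by positivity), min_le_left _ _, min_le_right _ _⟩
  have h1 := hF.low (t - d) (by linarith)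
  rw [min_eq_left (by linarith)] at h1
  have h2 : F.real (Set.Iic (η - t)) ≤ F.real (Set.Iio (η - (t - d))) :=
    measureReal_mono fun x hx => by
      have : x ≤ η - t := hx
      exact show x < _ by linarith
  have h3 : d * c ≤ e := (le_div_iff₀ hc).1 hde
  nlinarith

/-- An integral over `F` and a symmetric noise can be symmetrized. -/
theorem abs_integral_sub_le_of_symm {ψ : ℝ → ℝ → ℝ} {ψ₀ : ℝ → ℝ} {K : ℝ} (hm : 1 ≤ m)
    (hψ : Integrable (fun w : ℝ × (Fin m → ℝ) => ψ w.1 (prefixMean w.2 m)) (F.prod (noiseLaw m)))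
    (hψi : ∀ y, Integrable (fun x => ψ x y) F) (hψ₀ : Integrable ψ₀ F)
    (hK : ∀ y, |∫ x, (ψ x y + ψ x (-y) - 2 * ψ₀ x) ∂F| ≤ K * y ^ 2) :
    |∫ w, ψ w.1 (prefixMean w.2 m) ∂(F.prod (noiseLaw m)) - ∫ x, ψ₀ x ∂F| ≤ K / 2 / m := by
  have h1 := hψ.integral_prod_right
  have hmp := map_neg_noiseLaw (m := m)
  have h2 : ∫ z, (∫ x, ψ x (prefixMean (-z) m) ∂F) ∂noiseLaw m =
      ∫ z, (∫ x, ψ x (prefixMean z m) ∂F) ∂noiseLaw m :=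
    hmp.integral_comp (MeasurableEquiv.neg _).measurableEmbedding
      fun z => ∫ x, ψ x (prefixMean z m) ∂F
  have h3 : Integrable (fun z => ∫ x, ψ x (prefixMean (-z) m) ∂F) (noiseLaw m) :=
    hmp.integrable_comp_of_integrable h1
  rw [integral_prod_symm _ hψ]
  -- Reversing the noise preserves its law, so twice the error is the mean of a symmetric second
  -- difference; by `hK` that is quadratic in the noise, whose second moment is `1 / m`.
  have e : 2 * (∫ z, (∫ x, ψ x (prefixMean z m) ∂F) ∂noiseLaw m - ∫ x, ψ₀ x ∂F) =
      ∫ z, (∫ x, (ψ x (prefixMean z m) + ψ x (-prefixMean z m) - 2 * ψ₀ x) ∂F) ∂noiseLaw m := by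
    have e1 : ∀ y, ∫ x, (ψ x y + ψ x (-y) - 2 * ψ₀ x) ∂F =
        ∫ x, ψ x y ∂F + ∫ x, ψ x (-y) ∂F - 2 * ∫ x, ψ₀ x ∂F := fun y => by
      have i1 : Integrable (fun x => ψ x y + ψ x (-y)) F := (hψi y).add (hψi (-y))
      rw [integral_sub i1 (hψ₀.const_mul 2), integral_add (hψi y) (hψi (-y)), integral_const_mul]
    simp_rw [e1, ← prefixMean_neg]
    have i2 : Integrable (fun z => ∫ x, ψ x (prefixMean z m) ∂F +
        ∫ x, ψ x (prefixMean (-z) m) ∂F) (noiseLaw m) := h1.add h3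
    rw [integral_sub i2 (integrable_const _), integral_add h1 h3, h2, integral_const]
    simp; ring
  have h4 : |2 * (∫ z, (∫ x, ψ x (prefixMean z m) ∂F) ∂noiseLaw m - ∫ x, ψ₀ x ∂F)| ≤ K * (1 / m) := by
    rw [e, ← integral_prefixMean_sq hm le_rfl, ← integral_const_mul,
      ← Real.norm_eq_abs]
    refine norm_integral_le_of_norm_le ((memLp_prefixMean m).integrable_sq.const_mul K)
      (ae_of_all _ fun z => ?_)
    exact hK (prefixMean z m)
  rw [abs_mul, abs_two] at h4
  have : K / 2 / m = K * (1 / m) / 2 := by ring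
  rw [this]; linarith

theorem measurePreserving_point_mean :
    MeasurePreserving (fun q : Point m => (q.1, q.2.1)) (pointLaw F m) (F.prod (noiseLaw m)) :=
  (MeasurePreserving.id F).prod measurePreserving_fst

/-- The noise changes the distribution function near an interior quantile only by `O(1/m)`. -/
theorem InteriorRegular.abs_pointMean_sub_le (hF : InteriorRegular F α η c τ C) (hm : 1 ≤ m) {a : ℝ}
    (ha : |a - η| ≤ τ) :
    |(pointLaw F m).real {q | pointMean q ≤ a} - F.real (Set.Iic a)| ≤ C / 2 / m := by
  set ψ : ℝ → ℝ → ℝ := fun x y => (Set.Iic a).indicator 1 (x + y) with hψ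
  have hψm : Measurable fun w : ℝ × ℝ => ψ w.1 w.2 :=
    (measurable_one.indicator measurableSet_Iic).comp (measurable_fst.add measurable_snd)
  have hb : ∀ x y, ‖ψ x y‖ ≤ 1 := fun x y => by
    simp only [hψ, Set.indicator_apply]; split_ifs <;> simp
  have hcomp : Measurable fun w : ℝ × (Fin m → ℝ) => ψ w.1 (prefixMean w.2 m) :=
    hψm.comp (measurable_fst.prodMk ((measurable_prefixMean m m).comp measurable_snd))
  have hψy : ∀ y, Measurable fun x => ψ x y := fun y =>
    hψm.comp (measurable_id.prodMk measurable_const)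
  have hint : ∀ y, ∫ x, ψ x y ∂F = F.real (Set.Iic (a - y)) := fun y => by
    rw [← integral_indicator_one measurableSet_Iic]
    refine integral_congr_ae (ae_of_all _ fun x => ?_)
    simp only [hψ, Set.indicator_apply, Set.mem_Iic, le_sub_iff_add_le, Pi.one_apply]
  have hi : ∀ y, Integrable (fun x => ψ x y) F := fun y =>
    Integrable.of_bound (hψy y).aestronglyMeasurable 1 (ae_of_all _ fun x => hb x y)
  have h := abs_integral_sub_le_of_symm (F := F) (ψ := ψ) (ψ₀ := fun x => ψ x 0) (K := C) hm
    (Integrable.of_bound hcomp.aestronglyMeasurable 1 (ae_of_all _ fun w => hb _ _)) hi (hi 0)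
    fun y => by
      have i1 : Integrable (fun x => ψ x y + ψ x (-y)) F := (hi y).add (hi (-y))
      rw [integral_sub i1 ((hi 0).const_mul 2), integral_add (hi y) (hi (-y)), integral_const_mul,
        hint, hint, hint, sub_zero, sub_neg_eq_add, add_comm (F.real _)]
      exact hF.smooth a ha y
  rw [hint, sub_zero] at h
  have e : ∫ w, ψ w.1 (prefixMean w.2 m) ∂(F.prod (noiseLaw m)) =
      (pointLaw F m).real {q | pointMean q ≤ a} := by
    rw [← integral_indicator_one (measurableSet_le measurable_pointMean measurable_const),
      ← (measurePreserving_point_mean (F := F) (m := m)).map_eq,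
      integral_map (measurePreserving_point_mean (F := F)).measurable.aemeasurable hcomp.aestronglyMeasurable]
    rfl
  rwa [e] at h

theorem le_orderRank (n : ℕ) (α : ℝ) : α * n - 1 ≤ orderRank n α := by
  have h1 := Nat.lt_floor_add_one (α * n)
  have h2 : (⌊α * (n : ℝ)⌋₊ : ℝ) ≤ (orderRank n α : ℝ) := by
    exact_mod_cast le_max_right _ _
  linarith

theorem orderRank_le_add_one (n : ℕ) (hα : 0 ≤ α) : (orderRank n α : ℝ) ≤ α * n + 1 := by
  have h : 0 ≤ α * n := by positivity
  have h1 := Nat.floor_le h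
  rw [orderRank, Nat.cast_max]
  exact max_le (by simpa using h) (by linarith)

/-- At `η ± t` the distribution function has a margin `c t`. The bias of the noise takes at most `c
t / 4` by `hCm`, the Hoeffding deviation takes `c t / 2`, and the rounding of the rank at most `c t
/ 4` by `hcn`. -/
theorem pi_interior_error_le (hF : InteriorRegular F α η c τ C) (hc : 0 < c) (hα0 : 0 ≤ α)
    (hα1 : α ≤ 1) (hn : 1 ≤ n) (hm : 1 ≤ m) {t : ℝ} (ht : 0 < t) (htt : t ≤ τ)
    (hCm : 2 * C ≤ c * t * m) (hcn : 4 ≤ c * t * n) :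
    (Measure.pi fun _ : Fin n => pointLaw F m).real
      {p | t < |empQuantile (fun i => pointMean (p i)) α - η|} ≤
      2 * Real.exp (-(n * (c * t) ^ 2 / 2)) := by
  classical
  have hn' : (0 : ℝ) < n := by positivity
  have hm' : (0 : ℝ) < m := by positivity
  have hs : 0 ≤ c * t / 2 := by positivity
  have hCm' : C / 2 / m ≤ c * t / 4 := by
    rw [div_le_iff₀ hm']; linarith
  set E₁ : Set (Point m) := {q | pointMean q ≤ η + t} with hE₁
  set E₂ : Set (Point m) := {q | pointMean q < η - t} with hE₂
  have hE₁m : MeasurableSet E₁ := measurableSet_le measurable_pointMean measurable_const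
  have hE₂m : MeasurableSet E₂ := measurableSet_lt measurable_pointMean measurable_const
  have hp1 : α + c * t / 2 ≤ (pointLaw F m).real E₁ := by
    have h1 := (abs_le.1 (hF.abs_pointMean_sub_le hm (a := η + t)
      (by rw [add_sub_cancel_left, abs_of_pos ht]; exact htt))).1
    have h2 := hF.up t ht.le
    rw [min_eq_left htt] at h2
    linarith
  have hp2 : (pointLaw F m).real E₂ ≤ α - 3 / 4 * (c * t) := by
    have h1 := (abs_le.1 (hF.abs_pointMean_sub_le hm (a := η - t)
      (by rw [sub_sub_cancel_left, abs_neg, abs_of_pos ht]; exact htt))).2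
    have h2 := hF.Iic_le hc ht htt
    have h3 : (pointLaw F m).real E₂ ≤ (pointLaw F m).real {q | pointMean q ≤ η - t} :=
      measureReal_mono fun q hq => le_of_lt (show pointMean q < η - t from hq)
    linarith
  have hexp : Real.exp (-2 * n * (c * t / 2) ^ 2) = Real.exp (-(n * (c * t) ^ 2 / 2)) := by
    congr 1; ring
  have hH1 := pi_sum_indicator_le (n := n) (μ := pointLaw F m) hE₁m hs
  have hH2 := pi_sum_indicator_ge (n := n) (μ := pointLaw F m) hE₂m hs
  rw [hexp] at hH1 hH2
  refine (measureReal_mono (fun p hp => ?_)).trans ((measureReal_union_le _ _).trans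
    ((add_le_add hH1 hH2).trans (le_of_eq (by ring))))
  rcases lt_abs.1 (show t < |empQuantile (fun i => pointMean (p i)) α - η| from hp) with h | h
  · left
    show ∑ i, E₁.indicator 1 (p i) ≤ n * ((pointLaw F m).real E₁ - c * t / 2)
    have h1 : ¬ empQuantile (fun i => pointMean (p i)) α ≤ η + t := by linarith
    rw [empQuantile_le_iff hn hα1, not_le] at h1
    rw [sum_indicator_eq_card]
    have h2 : ((Finset.univ.filter fun i => pointMean (p i) ≤ η + t).card : ℝ) + 1
        ≤ orderRank n α := by exact_mod_cast h1
    have h3 := orderRank_le_add_one n hα0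
    have h4 : (Finset.univ.filter fun i => p i ∈ E₁) =
        Finset.univ.filter fun i => pointMean (p i) ≤ η + t := rfl
    rw [h4]
    nlinarith
  · right
    show n * ((pointLaw F m).real E₂ + c * t / 2) ≤ ∑ i, E₂.indicator 1 (p i)
    have h1 : empQuantile (fun i => pointMean (p i)) α < η - t := by linarith
    rw [empQuantile_lt_iff hn hα1] at h1
    rw [sum_indicator_eq_card]
    have h2 : (orderRank n α : ℝ) ≤
        ((Finset.univ.filter fun i => pointMean (p i) < η - t).card : ℝ) := by exact_mod_cast h1
    have h3 := le_orderRank n α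
    have h4 : (Finset.univ.filter fun i => p i ∈ E₂) =
        Finset.univ.filter fun i => pointMean (p i) < η - t := rfl
    rw [h4]
    nlinarith

end InteriorAccuracy

/-! ### Bias of the trimmed sums -/

section TrimmedBias

variable {n m : ℕ} {F : Measure ℝ} [IsProbabilityMeasure F] {α η c τ C : ℝ}

omit [IsProbabilityMeasure F] in
theorem InteriorRegular.const_nonneg (hF : InteriorRegular F α η c τ C) : 0 ≤ C := by
  have := hF.mass 1 zero_le_one
  linarith [measureReal_nonneg (μ := F) (s := {x | |x - η| ≤ 1})]

/-- The noise of an observation of a point: `a` times the noise of the mean of the `m` observations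
plus `b` times the noise of the fresh observation. -/
noncomputable def mixedNoise (m : ℕ) (a b : ℝ) (z : (Fin m → ℝ) × ℝ) : ℝ :=
  a * prefixMean z.1 m + b * z.2

theorem isNoise_mixedNoise_one_zero (hm : 1 ≤ m) : IsNoise m (mixedNoise m 1 0) (1 / m) := by
  have : mixedNoise m 1 0 = fun z => prefixMean z.1 m := by ext z; simp [mixedNoise]
  rw [this]; exact isNoise_prefixMean hm

theorem isNoise_mixedNoise_zero_one : IsNoise m (mixedNoise m 0 1) 1 := by
  have : mixedNoise m 0 1 = fun z => z.2 := by ext z; simp [mixedNoise]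
  rw [this]; exact isNoise_fresh

theorem memLp_pointNoise : MemLp (fun q : Point m => prefixMean q.2.1 m) 2 (pointLaw F m) :=
  ((memLp_prefixMean m).comp_measurePreserving measurePreserving_fst).comp_measurePreserving
    measurePreserving_snd

theorem memLp_pointFresh : MemLp (fun q : Point m => q.2.2) 2 (pointLaw F m) :=
  (isNoise_fresh (m := m)).memLp.comp_measurePreserving measurePreserving_snd

/-- The fresh noise is independent of the rest. -/
theorem integral_mul_fresh (f : ℝ × (Fin m → ℝ) → ℝ) (h : ℝ → ℝ) :
    ∫ q : Point m, f (q.1, q.2.1) * h q.2.2 ∂pointLaw F m =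
      (∫ w, f w ∂(F.prod (noiseLaw m))) * ∫ x, h x ∂gaussianReal 0 1 := by
  have hmp := measurePreserving_prodAssoc F (noiseLaw m) (gaussianReal 0 1)
  rw [← integral_prod_mul, pointLaw, ← hmp.integral_comp MeasurableEquiv.prodAssoc.measurableEmbedding]
  rfl

theorem integral_pointLaw_prod {f : ℝ × (Fin m → ℝ) → ℝ}
    (hf : AEStronglyMeasurable f (F.prod (noiseLaw m))) :
    ∫ q : Point m, f (q.1, q.2.1) ∂pointLaw F m = ∫ w, f w ∂(F.prod (noiseLaw m)) := by
  have hmp := measurePreserving_point_mean (F := F) (m := m)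
  rw [← hmp.map_eq, integral_map hmp.measurable.aemeasurable (by rw [hmp.map_eq]; exact hf)]

theorem integral_abs_gaussian_le : ∫ x, |x| ∂gaussianReal 0 1 ≤ 1 := by
  have hL : MemLp (fun x : ℝ => x) 2 (gaussianReal 0 1) := memLp_id_gaussianReal 2
  have hsq : ∫ x, x ^ 2 ∂gaussianReal 0 1 = 1 := by
    have hv := variance_eq_integral (μ := gaussianReal 0 1) (X := fun x : ℝ => x)
      measurable_id.aemeasurable
    rw [integral_id_gaussianReal, variance_fun_id_gaussianReal] at hv
    simpa using hv.symm
  calc ∫ x, |x| ∂gaussianReal 0 1 ≤ ∫ x, (1 + x ^ 2) / 2 ∂gaussianReal 0 1 := by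
        refine integral_mono (hL.integrable one_le_two).abs
          (((integrable_const 1).add hL.integrable_sq).div_const 2) fun x => ?_
        have := sq_nonneg (|x| - 1)
        rw [sub_sq, sq_abs] at this
        show |x| ≤ (1 + x ^ 2) / 2
        linarith
    _ = 1 := by
        rw [integral_div, integral_add (integrable_const 1) hL.integrable_sq, hsq]; simp

theorem integral_abs_prefixMean_le (hm : 1 ≤ m) :
    ∫ z : Fin m → ℝ, |prefixMean z m| ∂noiseLaw m ≤ 1 := by
  have hL := memLp_prefixMean (m := m) m
  calc ∫ z : Fin m → ℝ, |prefixMean z m| ∂noiseLaw m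
      ≤ ∫ z : Fin m → ℝ, (1 + prefixMean z m ^ 2) / 2 ∂noiseLaw m := by
        refine integral_mono (hL.integrable one_le_two).abs
          (((integrable_const 1).add hL.integrable_sq).div_const 2) fun z => ?_
        have := sq_nonneg (|prefixMean z m| - 1)
        rw [sub_sq, sq_abs] at this
        show |prefixMean z m| ≤ (1 + prefixMean z m ^ 2) / 2
        linarith
    _ ≤ 1 := by
        rw [integral_div, integral_add (integrable_const 1) hL.integrable_sq,
          integral_prefixMean_sq hm le_rfl]
        have : (1 : ℝ) / m ≤ 1 := by rw [div_le_one (by positivity)]; exact_mod_cast hm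
        simp only [integral_const, probReal_univ, smul_eq_mul, mul_one]
        linarith

/-- For `|x - η| > |y|` the points `x` and `x ± y` lie on the same side of `η`, and the expression
cancels because it is affine there. Otherwise each of its three terms is at most `2 |y|`. -/
theorem abs_symm_diff_le {x y η a : ℝ} (ha0 : 0 ≤ a) (ha1 : a ≤ 1) :
    |((x - η + a * y) * (Set.Iic η).indicator 1 (x + y) +
        (x - η + a * -y) * (Set.Iic η).indicator 1 (x + -y)
        - 2 * ((x - η) * (Set.Iic η).indicator 1 x))|
      ≤ 6 * |y| * {x | |x - η| ≤ |y|}.indicator 1 x := by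
  simp only [Set.indicator_apply, Set.mem_Iic, Pi.one_apply, Set.mem_ofPred_eq]
  by_cases h : |x - η| ≤ |y|
  · rw [if_pos h, mul_one]
    have hay : |a * y| ≤ |y| := by
      rw [abs_mul, abs_of_nonneg ha0]; exact mul_le_of_le_one_left (abs_nonneg _) ha1
    have hi : ∀ (P : Prop) [Decidable P], |(if P then 1 else 0 : ℝ)| ≤ 1 := fun P _ => by
      split_ifs <;> simp
    have h1 : |(x - η + a * y) * (if x + y ≤ η then 1 else 0 : ℝ)| ≤ 2 * |y| := by
      rw [abs_mul]
      calc _ ≤ (|x - η| + |a * y|) * 1 :=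
            mul_le_mul (abs_add_le _ _) (hi _) (abs_nonneg _) (by positivity)
        _ ≤ _ := by linarith
    have h2 : |(x - η + a * -y) * (if x + -y ≤ η then 1 else 0 : ℝ)| ≤ 2 * |y| := by
      rw [abs_mul]
      calc _ ≤ (|x - η| + |a * -y|) * 1 :=
            mul_le_mul (abs_add_le _ _) (hi _) (abs_nonneg _) (by positivity)
        _ ≤ _ := by rw [mul_neg, abs_neg]; linarith
    have h3 : |2 * ((x - η) * (if x ≤ η then 1 else 0 : ℝ))| ≤ 2 * |y| := by
      rw [abs_mul, abs_mul, abs_two]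
      have := mul_le_mul h (hi (x ≤ η)) (abs_nonneg _) (abs_nonneg y)
      linarith
    rw [abs_le] at h1 h2 h3 ⊢
    constructor <;> linarith [h1.1, h1.2, h2.1, h2.2, h3.1, h3.2]
  · rw [if_neg h, mul_zero]
    rw [not_le] at h
    have hy := abs_le.1 (le_refl |y|)
    rcases lt_abs.1 h with h' | h'
    · rw [if_neg (by linarith), if_neg (by linarith), if_neg (by linarith [abs_nonneg y])]; simp
    · rw [if_pos (by linarith), if_pos (by linarith), if_pos (by linarith [abs_nonneg y])]
      ring_nf; simp

theorem measurable_shift_indicator {T : Set ℝ} (hT : MeasurableSet T) (y : ℝ) :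
    Measurable fun x : ℝ => T.indicator (1 : ℝ → ℝ) (x + y) :=
  (measurable_one.indicator hT).comp (measurable_id.add_const y)

theorem integrable_mul_indicator {Ω : Type*} [MeasurableSpace Ω] {μ : Measure Ω} {f : Ω → ℝ}
    {k : Ω → ℝ} {T : Set ℝ} (hT : MeasurableSet T) (hf : Integrable f μ) (hk : Measurable k) :
    Integrable (fun ω => f ω * T.indicator 1 (k ω)) μ := by
  have : (fun ω => f ω * T.indicator 1 (k ω)) = (k ⁻¹' T).indicator f := by
    ext ω; by_cases h : k ω ∈ T <;> simp [h]
  rw [this]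
  exact hf.indicator (hk hT)

/-- With `x - g = (η - g) + (x - η)`, the first part gives a second difference of the distribution
function, `O(y²)` by `smooth`. The second is `O(|y|)` on a set of mass `O(|y|)`, because the factor
`x - η` vanishes at the cut. -/
theorem InteriorRegular.abs_integral_symm_le (hF : InteriorRegular F α η c τ C) (hτ : 0 ≤ τ)
    (hX : Integrable (fun x : ℝ => x) F) {a g : ℝ} (ha0 : 0 ≤ a) (ha1 : a ≤ 1) (y : ℝ) :
    |∫ x, ((x - g + a * y) * (Set.Iic η).indicator 1 (x + y) +
        (x - g + a * -y) * (Set.Iic η).indicator 1 (x + -y)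
        - 2 * ((x - g) * (Set.Iic η).indicator 1 x)) ∂F| ≤ (6 + |η - g|) * C * y ^ 2 := by
  set I : ℝ → ℝ := (Set.Iic η).indicator 1 with hI
  set ρ : ℝ → ℝ := fun x => (x - η + a * y) * I (x + y) + (x - η + a * -y) * I (x + -y)
        - 2 * ((x - η) * I x) with hρ
  set σ : ℝ → ℝ := fun x => I (x + y) + I (x + -y) - 2 * I x with hσ
  have hIm : Measurable I := measurable_one.indicator measurableSet_Iic
  have hII : ∀ y, Integrable (fun x => I (x + y)) F := fun y =>
    Integrable.of_bound (measurable_shift_indicator measurableSet_Iic y).aestronglyMeasurable 1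
      (ae_of_all _ fun x => by simp only [hI, Set.indicator_apply]; split_ifs <;> simp)
  have hI0 : Integrable I F := by simpa using hII 0
  have hIint : ∀ y, ∫ x, I (x + y) ∂F = F.real (Set.Iic (η - y)) := fun y => by
    rw [← integral_indicator_one measurableSet_Iic]
    refine integral_congr_ae (ae_of_all _ fun x => ?_)
    simp only [hI, Set.indicator_apply, Set.mem_Iic, le_sub_iff_add_le, Pi.one_apply]
  have hσi : Integrable σ F := ((hII y).add (hII (-y))).sub (hI0.const_mul 2)
  have hσint : ∫ x, σ x ∂F = F.real (Set.Iic (η - y)) + F.real (Set.Iic (η + y))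
      - 2 * F.real (Set.Iic η) := by
    have i1 : Integrable (fun x => I (x + y) + I (x + -y)) F := (hII y).add (hII (-y))
    have h0 := hIint 0
    simp only [add_zero, sub_zero] at h0
    rw [hσ, integral_sub i1 (hI0.const_mul 2), integral_add (hII y) (hII (-y)),
      integral_const_mul, hIint, hIint, h0, sub_neg_eq_add]
  have hterm : ∀ k b : ℝ, Integrable (fun x => (x - η + b) * I (x + k)) F := fun k b =>
    integrable_mul_indicator measurableSet_Iic ((hX.sub (integrable_const η)).add
      (integrable_const b)) (measurable_id.add_const k)
  have hρi : Integrable ρ F := by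
    have h0 := hterm 0 0
    simp only [add_zero] at h0
    exact ((hterm y (a * y)).add (hterm (-y) (a * -y))).sub (h0.const_mul 2)
  have hmassm : MeasurableSet {x : ℝ | |x - η| ≤ |y|} :=
    measurableSet_le (by fun_prop) measurable_const
  have hρint : |∫ x, ρ x ∂F| ≤ 6 * C * y ^ 2 := by
    rw [← Real.norm_eq_abs]
    refine (norm_integral_le_of_norm_le (g := fun x => 6 * |y| *
      {x | |x - η| ≤ |y|}.indicator 1 x) ?_ (ae_of_all _ fun x => ?_)).trans ?_
    · exact ((integrable_const (1 : ℝ)).indicator hmassm).const_mul _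
    · exact abs_symm_diff_le ha0 ha1
    · rw [integral_const_mul, integral_indicator_one hmassm]
      have := hF.mass |y| (abs_nonneg y)
      calc _ ≤ 6 * |y| * (C * |y|) := by gcongr
        _ = 6 * C * |y| ^ 2 := by ring
        _ = _ := by rw [sq_abs]
  have e : ∀ x, ((x - g + a * y) * I (x + y) + (x - g + a * -y) * I (x + -y)
        - 2 * ((x - g) * I x)) = (η - g) * σ x + ρ x := fun x => by
    simp only [hσ, hρ]; ring
  simp_rw [e]
  rw [integral_add (hσi.const_mul _) hρi, integral_const_mul, hσint]
  have hs := hF.smooth η (by simpa using hτ) y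
  rw [add_comm (F.real _)] at hs
  calc _ ≤ |η - g| * (C * y ^ 2) + 6 * C * y ^ 2 := by
        refine (abs_add_le _ _).trans (add_le_add ?_ hρint)
        rw [abs_mul]; gcongr
    _ = _ := by ring

/-- The bias of a truncated sum at an interior quantile is `O(1/m)`. -/
theorem InteriorRegular.abs_bias_le (hF : InteriorRegular F α η c τ C) (hτ : 0 ≤ τ)
    (hX : Integrable (fun x : ℝ => x) F) (hm : 1 ≤ m) {a b g : ℝ} (ha0 : 0 ≤ a) (ha1 : a ≤ 1) :
    |∫ q : Point m, (q.1 - g + mixedNoise m a b q.2) * (Set.Iic η).indicator 1 (pointMean q)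
        ∂pointLaw F m - ∫ x, (x - g) * (Set.Iic η).indicator 1 x ∂F|
      ≤ (6 + |η - g|) * C / 2 / m := by
  set ψ : ℝ → ℝ → ℝ := fun x y => (x - g + a * y) * (Set.Iic η).indicator 1 (x + y) with hψ
  have hpm := measurable_prefixMean m m
  have hV : Integrable (fun z : Fin m → ℝ => prefixMean z m) (noiseLaw m) :=
    (memLp_prefixMean m).integrable one_le_two
  have hψint : Integrable (fun w : ℝ × (Fin m → ℝ) => ψ w.1 (prefixMean w.2 m))
      (F.prod (noiseLaw m)) :=
    integrable_mul_indicator measurableSet_Iic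
      (((hX.sub (integrable_const g)).comp_fst (noiseLaw m)).add ((hV.const_mul a).comp_snd F))
      (measurable_fst.add (hpm.comp measurable_snd))
  have hψy : ∀ y, Integrable (fun x => ψ x y) F := fun y =>
    integrable_mul_indicator measurableSet_Iic ((hX.sub (integrable_const g)).add
      (integrable_const _)) (measurable_id.add_const y)
  have hψ0 : Integrable (fun x => (x - g) * (Set.Iic η).indicator 1 x) F :=
    integrable_mul_indicator measurableSet_Iic (hX.sub (integrable_const g)) measurable_id
  have h := abs_integral_sub_le_of_symm (F := F) (m := m) hm hψint hψy hψ0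
    (hF.abs_integral_symm_le hτ hX ha0 ha1)
  -- The fresh noise is centred and independent of the mean that decides on the cut, so it drops out
  -- of the expectation.
  have e : ∫ q : Point m, (q.1 - g + mixedNoise m a b q.2) * (Set.Iic η).indicator 1 (pointMean q)
      ∂pointLaw F m = ∫ w, ψ w.1 (prefixMean w.2 m) ∂(F.prod (noiseLaw m)) := by
    have e1 : ∀ q : Point m, (q.1 - g + mixedNoise m a b q.2) *
        (Set.Iic η).indicator 1 (pointMean q) = ψ q.1 (prefixMean q.2.1 m) +
        (b * (Set.Iic η).indicator 1 (q.1 + prefixMean q.2.1 m)) * q.2.2 := fun q => by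
      simp only [hψ, mixedNoise, pointMean]; ring
    have i1 : Integrable (fun q : Point m => ψ q.1 (prefixMean q.2.1 m)) (pointLaw F m) :=
      (measurePreserving_point_mean (F := F)).integrable_comp_of_integrable hψint
    have i2 : Integrable (fun q : Point m =>
        (b * (Set.Iic η).indicator 1 (q.1 + prefixMean q.2.1 m)) * q.2.2) (pointLaw F m) := by
      have := (integrable_mul_indicator (k := pointMean) (measurableSet_Iic (a := η))
        ((memLp_pointFresh (F := F) (m := m)).integrable one_le_two) measurable_pointMean).const_mul b
      refine this.congr (ae_of_all _ fun q => ?_)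
      simp only [pointMean]; ring
    simp_rw [e1]
    rw [integral_add i1 i2, integral_mul_fresh
      (fun w => b * (Set.Iic η).indicator 1 (w.1 + prefixMean w.2 m)) (fun x => x),
      integral_id_gaussianReal, mul_zero, add_zero,
      integral_pointLaw_prod (f := fun w => ψ w.1 (prefixMean w.2 m)) hψint.aestronglyMeasurable]
  rw [e]
  exact h

/-- The noise bias is controlled for closed half-lines, so the band is enclosed between those at `η
+ t` and `η - 2 t`; the extra length keeps the closed band disjoint from the lower one. -/
theorem InteriorRegular.band_le (hF : InteriorRegular F α η c τ C) (hm : 1 ≤ m) {t : ℝ}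
    (ht : 0 < t) (htt : 2 * t ≤ τ) :
    (pointLaw F m).real {q | |pointMean q - η| ≤ t} ≤ 2 * C * t + C / m := by
  have h1 := (abs_le.1 (hF.abs_pointMean_sub_le hm (a := η + t)
    (by rw [add_sub_cancel_left, abs_of_pos ht]; linarith))).2
  have h2 := (abs_le.1 (hF.abs_pointMean_sub_le hm (a := η - 2 * t)
    (by rw [sub_sub_cancel_left, abs_neg, abs_of_pos (by positivity)]; exact htt))).1
  have h3 : (pointLaw F m).real {q | |pointMean q - η| ≤ t} +
      (pointLaw F m).real {q | pointMean q ≤ η - 2 * t} ≤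
      (pointLaw F m).real {q | pointMean q ≤ η + t} := by
    rw [← measureReal_union _ (measurableSet_le measurable_pointMean measurable_const)]
    · refine measureReal_mono fun q hq => ?_
      show pointMean q ≤ η + t
      rcases hq with hq | hq
      · linarith [(abs_le.1 (show |pointMean q - η| ≤ t from hq)).2]
      · linarith [show pointMean q ≤ η - 2 * t from hq]
    · rw [Set.disjoint_left]
      intro q hq hq'
      linarith [(abs_le.1 (show |pointMean q - η| ≤ t from hq)).1,
        show pointMean q ≤ η - 2 * t from hq']
  have h4 : F.real (Set.Iic (η + t)) ≤
      F.real (Set.Iic (η - 2 * t)) + F.real {x | |x - η| ≤ 2 * t} := by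
    refine (measureReal_mono fun x hx => ?_).trans (measureReal_union_le _ _)
    have hx' : x ≤ η + t := hx
    by_cases h : x ≤ η - 2 * t
    · exact Or.inl h
    · exact Or.inr (show |x - η| ≤ 2 * t from abs_le.2 ⟨by linarith, by linarith⟩)
  have h5 := hF.mass (2 * t) (by positivity)
  have h6 : C / 2 / m + C / 2 / m = C / m := by ring
  linarith

/-- The contribution of the points that are observed within `t` of an interior quantile. -/
theorem InteriorRegular.integral_band_le (hF : InteriorRegular F α η c τ C)
    (hX : Integrable (fun x : ℝ => x) F) (hm : 1 ≤ m) {a b g t : ℝ} (ha0 : 0 ≤ a) (ha1 : a ≤ 1)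
    (hb : |b| ≤ 1) (ht : 0 < t) (htt : 2 * t ≤ τ) :
    ∫ q : Point m, |q.1 - g + mixedNoise m a b q.2| *
        {x | |x - η| ≤ t}.indicator 1 (pointMean q) ∂pointLaw F m
      ≤ (t + |η - g| + 1) * (2 * C * t + C / m) + C * (t + 1 / m) := by
  set T : Set ℝ := {x | |x - η| ≤ t} with hT
  have hTm : MeasurableSet T := measurableSet_le (by fun_prop) measurable_const
  have hC := hF.const_nonneg
  have hband := hF.band_le hm ht htt
  set β := (pointLaw F m).real {q | |pointMean q - η| ≤ t} with hβ
  have hTint : ∫ q : Point m, T.indicator (1 : ℝ → ℝ) (pointMean q) ∂pointLaw F m = β := by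
    exact integral_indicator_one (μ := pointLaw F m) (measurable_pointMean hTm)
  have hV := (memLp_pointNoise (F := F) (m := m)).integrable one_le_two
  have hW := (memLp_pointFresh (F := F) (m := m)).integrable one_le_two
  have hXq : Integrable (fun q : Point m => q.1) (pointLaw F m) := hX.comp_fst _
  have i0 : Integrable (fun q : Point m => (t + |η - g|) * T.indicator 1 (pointMean q))
      (pointLaw F m) := integrable_mul_indicator hTm (integrable_const _) measurable_pointMean
  have i1 : Integrable (fun q : Point m => |prefixMean q.2.1 m| * T.indicator 1 (pointMean q))
      (pointLaw F m) := integrable_mul_indicator hTm hV.abs measurable_pointMean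
  have i2 : Integrable (fun q : Point m => T.indicator 1 (pointMean q) * |q.2.2|)
      (pointLaw F m) := by
    simpa only [mul_comm] using integrable_mul_indicator hTm hW.abs measurable_pointMean
  have hWint : ∫ q : Point m, T.indicator 1 (pointMean q) * |q.2.2| ∂pointLaw F m ≤ β := by
    have h1 := integral_mul_fresh (F := F) (m := m)
      (fun w => T.indicator 1 (w.1 + prefixMean w.2 m)) (fun x => |x|)
    have hmeas : Measurable fun w : ℝ × (Fin m → ℝ) =>
        T.indicator (1 : ℝ → ℝ) (w.1 + prefixMean w.2 m) :=
      (measurable_one.indicator hTm).comp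
        (measurable_fst.add ((measurable_prefixMean m m).comp measurable_snd))
    have h2 := integral_pointLaw_prod (F := F) hmeas.aestronglyMeasurable
    have h3 : ∫ q : Point m, T.indicator 1 (pointMean q) * |q.2.2| ∂pointLaw F m = _ := h1
    rw [h3, ← h2]
    have h4 : ∫ q : Point m, T.indicator (1 : ℝ → ℝ) (q.1 + prefixMean q.2.1 m) ∂pointLaw F m = β :=
      hTint
    rw [h4]
    exact mul_le_of_le_one_right measureReal_nonneg integral_abs_gaussian_le
  have hVint : ∫ q : Point m, |prefixMean q.2.1 m| * T.indicator 1 (pointMean q) ∂pointLaw F m ≤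
      C * (t + 1 / m) := by
    set f : ℝ × (Fin m → ℝ) → ℝ := fun w =>
      |prefixMean w.2 m| * T.indicator 1 (w.1 + prefixMean w.2 m) with hf
    have hVn : Integrable (fun z : Fin m → ℝ => prefixMean z m) (noiseLaw m) :=
      (memLp_prefixMean m).integrable one_le_two
    have hfi : Integrable f (F.prod (noiseLaw m)) :=
      integrable_mul_indicator hTm (hVn.abs.comp_snd F)
        (measurable_fst.add ((measurable_prefixMean m m).comp measurable_snd))
    have h1 := integral_pointLaw_prod (F := F) hfi.aestronglyMeasurable
    have h2 : ∫ q : Point m, |prefixMean q.2.1 m| * T.indicator 1 (pointMean q) ∂pointLaw F m =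
        _ := h1
    -- For noise `y`, an observed mean within `t` of `η` forces the latent point within `t + |y|`;
    -- its mass multiplied by `|y|` is linear plus quadratic in `|y|`.
    have hin : ∀ z : Fin m → ℝ, ∫ x, f (x, z) ∂F ≤
        C * t * |prefixMean z m| + C * prefixMean z m ^ 2 := fun z => by
      set y := prefixMean z m with hy
      have hset : MeasurableSet {x : ℝ | |x + y - η| ≤ t} :=
        measurableSet_le (by fun_prop) measurable_const
      have e : ∀ x, f (x, z) = |y| * {x : ℝ | |x + y - η| ≤ t}.indicator 1 x := fun x => rfl
      simp_rw [e]
      rw [integral_const_mul, integral_indicator_one hset]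
      have h4 : F.real {x : ℝ | |x + y - η| ≤ t} ≤ C * (t + |y|) := by
        refine (measureReal_mono fun x hx => ?_).trans (hF.mass (t + |y|) (by positivity))
        have hx' : |x + y - η| ≤ t := hx
        show |x - η| ≤ t + |y|
        have := abs_sub (x + y - η) y
        rw [show x + y - η - y = x - η by ring] at this
        linarith
      calc _ ≤ |y| * (C * (t + |y|)) := by gcongr
        _ = C * t * |y| + C * |y| ^ 2 := by ring
        _ = _ := by rw [sq_abs]
    rw [h2, integral_prod_symm _ hfi]
    have i3 : Integrable (fun z : Fin m → ℝ => C * t * |prefixMean z m|) (noiseLaw m) :=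
      hVn.abs.const_mul _
    have i4 : Integrable (fun z : Fin m → ℝ => C * prefixMean z m ^ 2) (noiseLaw m) :=
      (memLp_prefixMean m).integrable_sq.const_mul _
    refine (integral_mono hfi.integral_prod_right (i3.add i4) hin).trans ?_
    show ∫ z : Fin m → ℝ, (C * t * |prefixMean z m| + C * prefixMean z m ^ 2) ∂noiseLaw m ≤ _
    rw [integral_add i3 i4, integral_const_mul, integral_const_mul,
      integral_prefixMean_sq hm le_rfl, mul_add]
    have := mul_le_mul_of_nonneg_left (integral_abs_prefixMean_le hm) (show 0 ≤ C * t by positivity)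
    linarith
  have hpt : ∀ q : Point m, |q.1 - g + mixedNoise m a b q.2| * T.indicator 1 (pointMean q) ≤
      (t + |η - g|) * T.indicator 1 (pointMean q) +
      |prefixMean q.2.1 m| * T.indicator 1 (pointMean q) + T.indicator 1 (pointMean q) * |q.2.2| := by
    intro q
    by_cases hq : pointMean q ∈ T
    · simp only [Set.indicator_of_mem hq, Pi.one_apply, mul_one, one_mul]
      have h1 : |pointMean q - η| ≤ t := hq
      -- Expanding around the observed mean, which is within `t` of `η`, leaves only bounded terms
      -- and noise; the latent point itself no longer appears.
      have e : q.1 - g + mixedNoise m a b q.2 =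
          (pointMean q - η) + (η - g) + -((1 - a) * prefixMean q.2.1 m) + b * q.2.2 := by
        simp only [pointMean, mixedNoise]; ring
      have h2 : |-((1 - a) * prefixMean q.2.1 m)| ≤ |prefixMean q.2.1 m| := by
        rw [abs_neg, abs_mul, abs_of_nonneg (by linarith)]
        exact mul_le_of_le_one_left (abs_nonneg _) (by linarith)
      have h3 : |b * q.2.2| ≤ |q.2.2| := by
        rw [abs_mul]; exact mul_le_of_le_one_left (abs_nonneg _) hb
      rw [e]
      refine (abs_add_le _ _).trans (add_le_add ((abs_add_le _ _).trans (add_le_add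
        ((abs_add_le _ _).trans (add_le_add h1 le_rfl)) h2)) h3)
    · simp [Set.indicator_of_notMem hq]
  have i01 : Integrable (fun q : Point m => (t + |η - g|) * T.indicator 1 (pointMean q) +
      |prefixMean q.2.1 m| * T.indicator 1 (pointMean q)) (pointLaw F m) := i0.add i1
  have hmix : Integrable (fun q : Point m => q.1 - g + mixedNoise m a b q.2) (pointLaw F m) :=
    (hXq.sub (integrable_const g)).add ((hV.const_mul a).add (hW.const_mul b))
  calc _ ≤ ∫ q : Point m, ((t + |η - g|) * T.indicator 1 (pointMean q) +
      |prefixMean q.2.1 m| * T.indicator 1 (pointMean q) + T.indicator 1 (pointMean q) * |q.2.2|)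
        ∂pointLaw F m :=
        integral_mono (integrable_mul_indicator hTm hmix.abs measurable_pointMean)
          (i01.add i2) hpt
    _ ≤ (t + |η - g|) * β + C * (t + 1 / m) + β := by
        rw [integral_add i01 i2, integral_add i0 i1, integral_const_mul, hTint]
        linarith
    _ = (t + |η - g| + 1) * β + C * (t + 1 / m) := by ring
    _ ≤ _ := by gcongr

end TrimmedBias

/-! ### Accuracy of trimmed means -/

section TrimmedAccuracy

variable {n m : ℕ} {F : Measure ℝ} [IsProbabilityMeasure F] {α η t₀ c₁ c₂ β : ℝ}

open Classical in
/-- The half-line below the `α`-quantile `η`; it is empty for `α = 0` and everything for `α = 1`. -/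
noncomputable def cut (α η : ℝ) : Set ℝ :=
  if α = 0 then ∅ else if α = 1 then Set.univ else Set.Iic η

open Classical in
/-- The points within `t` of an interior quantile. -/
noncomputable def band (α η t : ℝ) : Set ℝ :=
  if 0 < α ∧ α < 1 then {x | |x - η| ≤ t} else ∅

theorem measurableSet_cut : MeasurableSet (cut α η) := by
  unfold cut; split_ifs <;> simp

theorem measurableSet_band {t : ℝ} : MeasurableSet (band α η t) := by
  unfold band
  split_ifs
  · exact measurableSet_le (by fun_prop) measurable_const
  · exact MeasurableSet.empty

theorem cut_of_interior (h0 : 0 < α) (h1 : α < 1) : cut α η = Set.Iic η := by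
  rw [cut, if_neg h0.ne', if_neg h1.ne]

theorem band_of_interior {t : ℝ} (h0 : 0 < α) (h1 : α < 1) :
    band α η t = {x | |x - η| ≤ t} := if_pos ⟨h0, h1⟩

theorem RegularAt.measureReal_cut (h : RegularAt F α η t₀ c₁ c₂ β) : F.real (cut α η) = α := by
  rcases h.2 with ⟨h0, h1, hI⟩ | ⟨s, ⟨rfl, -⟩ | ⟨rfl, -⟩, -⟩
  · rw [cut_of_interior h0 h1, hI.cdf_eq]
  · simp [cut]
  · simp [cut]

omit [IsProbabilityMeasure F] in
theorem RegularAt.ae_le_iff (h : RegularAt F α η t₀ c₁ c₂ β) (hα : 0 < α) :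
    ∀ᵐ x ∂F, x ≤ η ↔ x ∈ cut α η := by
  rcases h.2 with ⟨h0, h1, -⟩ | ⟨s, ⟨rfl, rfl⟩ | ⟨rfl, -⟩, hE⟩
  · rw [cut_of_interior h0 h1]; exact ae_of_all _ fun x => Iff.rfl
  · filter_upwards [hE.ae_nonneg] with x hx
    simp only [cut, one_ne_zero, if_false, if_true, Set.mem_univ, iff_true]
    linarith
  · exact absurd hα (lt_irrefl _)

/-- At an interior level there is no atom at `η`, by `mass` at radius zero, so closed and open
half-lines agree almost everywhere. -/
theorem RegularAt.ae_ge_iff (h : RegularAt F α η t₀ c₁ c₂ β) (hα : α < 1) :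
    ∀ᵐ x ∂F, η ≤ x ↔ x ∉ cut α η := by
  rcases h.2 with ⟨h0, h1, hI⟩ | ⟨s, ⟨rfl, -⟩ | ⟨rfl, rfl⟩, hE⟩
  · rw [cut_of_interior h0 h1]
    have h2 : F.real {x | |x - η| ≤ 0} = 0 :=
      le_antisymm (by simpa using hI.mass 0 le_rfl) measureReal_nonneg
    rw [measureReal_eq_zero_iff] at h2
    filter_upwards [measure_eq_zero_iff_ae_notMem.1 h2] with x hx
    have hne : x ≠ η := fun he => hx (by simp [he])
    rw [Set.mem_Iic, not_le]
    exact ⟨fun h => lt_of_le_of_ne h hne.symm, le_of_lt⟩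
  · exact absurd hα (lt_irrefl _)
  · filter_upwards [hE.ae_nonneg] with x hx
    simp only [cut, if_true, Set.mem_empty_iff_false, not_false_iff, iff_true]
    linarith

variable {α₁ α₂ η₁ η₂ : ℝ}

omit [IsProbabilityMeasure F] in
theorem cut_subset_cut (h1 : RegularAt F α₁ η₁ t₀ c₁ c₂ β) (h2 : RegularAt F α₂ η₂ t₀ c₁ c₂ β)
    (hα0 : 0 ≤ α₁) (hα : α₁ < α₂) (hα2 : α₂ ≤ 1) : cut α₁ η₁ ⊆ cut α₂ η₂ := by
  rcases hα0.eq_or_lt with h | h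
  · simp [cut, ← h]
  rcases hα2.eq_or_lt with h' | h'
  · simp [cut, h']
  · rw [cut_of_interior h (hα.trans h'), cut_of_interior (h.trans hα) h']
    refine Set.Iic_subset_Iic.2 (EReal.coe_le_coe_iff.1 ?_)
    rw [← h1.1, ← h2.1]
    exact quantile_mono hα.le

/-- The functional in terms of the integral over `cut α₂ η₂ \ cut α₁ η₁`. -/
theorem sub_mul_functional (h1 : RegularAt F α₁ η₁ t₀ c₁ c₂ β)
    (h2 : RegularAt F α₂ η₂ t₀ c₁ c₂ β) (hα0 : 0 ≤ α₁) (hα : α₁ < α₂) (hα2 : α₂ ≤ 1) :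
    (α₂ - α₁) * functional F α₁ α₂ = ∫ x in cut α₂ η₂ \ cut α₁ η₁, x ∂F := by
  have hsub := cut_subset_cut h1 h2 hα0 hα hα2
  have hae : relevantSet F α₁ α₂ =ᵐ[F] (cut α₂ η₂ \ cut α₁ η₁ : Set ℝ) := by
    rw [relevantSet_eq_Icc h1.1 h2.1, Filter.eventuallyEq_set]
    filter_upwards [h1.ae_ge_iff (by linarith), h2.ae_le_iff (by linarith)] with x hx1 hx2
    rw [Set.mem_Icc, Set.mem_sdiff, hx1, hx2, and_comm]
  have hJ : F.real (relevantSet F α₁ α₂) = α₂ - α₁ := by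
    rw [measureReal_congr hae, measureReal_sdiff hsub measurableSet_cut,
      h1.measureReal_cut, h2.measureReal_cut]
  rw [functional, if_neg hα.ne, ProbabilityTheory.cond, integral_smul_measure,
    Measure.restrict_congr_set hae, ENNReal.toReal_inv, smul_eq_mul,
    show (F (relevantSet F α₁ α₂)).toReal = F.real (relevantSet F α₁ α₂) from rfl, hJ, ← mul_assoc,
    mul_inv_cancel₀ (by linarith), one_mul]

theorem integral_abs_le_of_sq {c₀ : ℝ} (hX : MemLp (fun x : ℝ => x) 2 F)
    (h2 : ∫ x, x ^ 2 ∂F ≤ c₀) : ∫ x, |x| ∂F ≤ 1 + c₀ := by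
  have hc : 0 ≤ ∫ x, x ^ 2 ∂F := integral_nonneg fun x => sq_nonneg x
  calc ∫ x, |x| ∂F ≤ ∫ x, (1 + x ^ 2) ∂F := by
        refine integral_mono (hX.integrable one_le_two).abs
          ((integrable_const 1).add hX.integrable_sq) fun x => ?_
        have := sq_nonneg (|x| - 1)
        rw [sub_sq, sq_abs] at this
        show |x| ≤ 1 + x ^ 2
        nlinarith [abs_nonneg x]
    _ ≤ 1 + c₀ := by
        rw [integral_add (integrable_const 1) hX.integrable_sq]; simpa using h2

theorem abs_functional_le {c₀ : ℝ} (hX : MemLp (fun x : ℝ => x) 2 F) (hc : ∫ x, x ^ 2 ∂F ≤ c₀)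
    (h1 : RegularAt F α₁ η₁ t₀ c₁ c₂ β) (h2 : RegularAt F α₂ η₂ t₀ c₁ c₂ β) (hα0 : 0 ≤ α₁)
    (hα : α₁ < α₂) (hα2 : α₂ ≤ 1) : |functional F α₁ α₂| ≤ (1 + c₀) / (α₂ - α₁) := by
  have hpos : 0 < α₂ - α₁ := by linarith
  have e : |functional F α₁ α₂| * (α₂ - α₁) = |(α₂ - α₁) * functional F α₁ α₂| := by
    rw [abs_mul, abs_of_pos hpos, mul_comm]
  rw [le_div_iff₀ hpos, e, sub_mul_functional h1 h2 hα0 hα hα2]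
  refine (abs_integral_le_integral_abs).trans
    ((setIntegral_le_integral (hX.integrable one_le_two).abs
      (ae_of_all _ fun x => abs_nonneg x)).trans (integral_abs_le_of_sq hX hc))

/-- Mass at least `c t₀` sits within `t₀ / 2` of `η`, so a large `|η|` would make the first absolute
moment large. -/
theorem InteriorRegular.abs_quantile_le {c₀ c C : ℝ} (hc : 0 < c) (ht₀ : 0 < t₀)
    (hF : InteriorRegular F α η c (t₀ / 2) C)
    (hX : MemLp (fun x : ℝ => x) 2 F) (hc₀ : ∫ x, x ^ 2 ∂F ≤ c₀) :
    |η| ≤ (1 + c₀ + t₀) / (c * t₀) := by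
  have hm := hF.le_mass (by positivity)
  set T := {x : ℝ | |x - η| ≤ t₀ / 2} with hT
  have hTm : MeasurableSet T := measurableSet_le (by fun_prop) measurable_const
  have habs := (hX.integrable one_le_two).abs
  have h1 : |η| * F.real T ≤ ∫ x, (|x| + t₀) ∂F := by
    calc |η| * F.real T = ∫ x, T.indicator (fun _ => |η|) x ∂F := by
          rw [integral_indicator_const _ hTm, smul_eq_mul, mul_comm]
      _ ≤ _ := by
          refine integral_mono ((integrable_const _).indicator hTm)
            (habs.add (integrable_const t₀)) fun x => ?_
          show T.indicator (fun _ => |η|) x ≤ |x| + t₀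
          by_cases hx : x ∈ T
          · rw [Set.indicator_of_mem hx]
            have hx' : |x - η| ≤ t₀ / 2 := hx
            have := abs_sub_abs_le_abs_sub η x
            rw [abs_sub_comm] at this
            linarith
          · rw [Set.indicator_of_notMem hx]; positivity
  rw [integral_add habs (integrable_const t₀)] at h1
  have h2 := integral_abs_le_of_sq hX hc₀
  rw [le_div_iff₀ (by positivity)]
  have h3 : |η| * (c * t₀) ≤ |η| * F.real T := by
    gcongr; linarith
  simp only [integral_const, probReal_univ, smul_eq_mul, one_mul] at h1
  linarith

/-- Replacing the relevant indices by the points in `cut α₂ η₂ \ cut α₁ η₁` only affects points near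
the interior quantiles. -/
theorem abs_sum_relevantIndices_le (hn : 1 ≤ n) {v u : Fin n → ℝ} {t : ℝ} (hα0 : 0 ≤ α₁)
    (hα : α₁ < α₂) (hα2 : α₂ ≤ 1)
    (h1 : 0 < α₁ → α₁ < 1 → |empQuantile v α₁ - η₁| ≤ t)
    (h2 : 0 < α₂ → α₂ < 1 → |empQuantile v α₂ - η₂| ≤ t) :
    |∑ i ∈ relevantIndices v α₁ α₂, u i| ≤
      |∑ i, u i * (cut α₂ η₂ \ cut α₁ η₁).indicator 1 (v i)| +
        ∑ i, |u i| * (band α₁ η₁ t ∪ band α₂ η₂ t).indicator 1 (v i) := by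
  classical
  -- At level `0` the empirical quantile is the minimum and excludes nothing, which matches the
  -- empty cut without any band. At an interior level only points within `t` of `η₁` can be
  -- misplaced.
  have hlow : ∀ i, v i ∉ band α₁ η₁ t → (empQuantile v α₁ ≤ v i ↔ v i ∉ cut α₁ η₁) := by
    intro i hi
    rcases hα0.eq_or_lt with h | h
    · simp [cut, ← h, empQuantile_zero_le hn]
    · have h' : α₁ < 1 := hα.trans_le hα2
      rw [band_of_interior h h'] at hi
      have hi' : t < |v i - η₁| := not_le.1 hi
      have hq := abs_le.1 (h1 h h')
      rw [cut_of_interior h h', Set.mem_Iic, not_le]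
      rcases lt_abs.1 hi' with h3 | h3 <;> constructor <;> intro h4 <;> linarith
  have hup : ∀ i, v i ∉ band α₂ η₂ t → (v i ≤ empQuantile v α₂ ↔ v i ∈ cut α₂ η₂) := by
    intro i hi
    rcases hα2.eq_or_lt with h | h
    · simp [cut, h, le_empQuantile_one hn]
    · have h' : 0 < α₂ := hα0.trans_lt hα
      rw [band_of_interior h' h] at hi
      have hi' : t < |v i - η₂| := not_le.1 hi
      have hq := abs_le.1 (h2 h' h)
      rw [cut_of_interior h' h, Set.mem_Iic]
      rcases lt_abs.1 hi' with h3 | h3 <;> constructor <;> intro h4 <;> linarith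
  rw [relevantIndices, Finset.sum_filter]
  have key : ∀ i, |(if empQuantile v α₁ ≤ v i ∧ v i ≤ empQuantile v α₂ then u i else 0) -
      u i * (cut α₂ η₂ \ cut α₁ η₁).indicator 1 (v i)| ≤
      |u i| * (band α₁ η₁ t ∪ band α₂ η₂ t).indicator 1 (v i) := by
    intro i
    by_cases hb : v i ∈ band α₁ η₁ t ∪ band α₂ η₂ t
    · rw [Set.indicator_of_mem hb, Pi.one_apply, mul_one, Set.indicator_apply]
      split_ifs <;> simp
    · rw [Set.mem_union, not_or] at hb
      have e1 := hlow i hb.1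
      have e2 := hup i hb.2
      have : (empQuantile v α₁ ≤ v i ∧ v i ≤ empQuantile v α₂) ↔ v i ∈ cut α₂ η₂ \ cut α₁ η₁ := by
        rw [e1, e2, Set.mem_sdiff, and_comm]
      have hnn : 0 ≤ |u i| * (band α₁ η₁ t ∪ band α₂ η₂ t).indicator 1 (v i) :=
        mul_nonneg (abs_nonneg _) (Set.indicator_nonneg (fun _ _ => zero_le_one) _)
      rw [Set.indicator_apply, if_congr this rfl rfl]
      refine le_trans (le_of_eq ?_) hnn
      split_ifs <;> simp
  have h3 := (Finset.abs_sum_le_sum_abs _ _).trans (Finset.sum_le_sum fun i (_ : i ∈ Finset.univ) => key i)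
  rw [Finset.sum_sub_distrib] at h3
  have h4 := abs_sub_abs_le_abs_sub
    (∑ i, if empQuantile v α₁ ≤ v i ∧ v i ≤ empQuantile v α₂ then u i else 0)
    (∑ i, u i * (cut α₂ η₂ \ cut α₁ η₁).indicator 1 (v i))
  linarith

theorem half_le_card_relevantIndices (hn : 1 ≤ n) (v : Fin n → ℝ) (hα0 : 0 ≤ α₁)
    (hα : α₁ < α₂) (hα2 : α₂ ≤ 1) (hlarge : 4 ≤ (α₂ - α₁) * n) :
    (α₂ - α₁) / 2 * n ≤ ((relevantIndices v α₁ α₂).card : ℝ) := by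
  have h := orderRank_sub_le_card (v := v) hn (hα.le.trans hα2) hα2
  have h' : (orderRank n α₂ : ℝ) ≤ orderRank n α₁ + (relevantIndices v α₁ α₂).card := by
    exact_mod_cast Nat.lt_succ_iff.1 h
  have h1 := le_orderRank n α₂
  have h2 := orderRank_le_add_one n hα0
  linarith

/-- The bias of the truncation at a quantile. -/
theorem RegularAt.abs_bias_le (ht₀ : 0 < t₀) (hc₂ : 0 < c₂) (h : RegularAt F α η t₀ c₁ c₂ β)
    (hX : MemLp (fun x : ℝ => x) 2 F) (hm : 1 ≤ m) {a b v g P : ℝ} (ha0 : 0 ≤ a) (ha1 : a ≤ 1)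
    (hN : IsNoise m (mixedNoise m a b) v) (hP0 : 0 ≤ P) (hP : 0 < α → α < 1 → |η - g| ≤ P) :
    |∫ q : Point m, (q.1 - g + mixedNoise m a b q.2) * (cut α η).indicator 1 (pointMean q)
        ∂pointLaw F m - ∫ x, (x - g) * (cut α η).indicator 1 x ∂F|
      ≤ (6 + P) * interiorConst t₀ c₂ / 2 / m := by
  have hI0 := interiorConst_pos ht₀ hc₂
  have hpos : 0 ≤ (6 + P) * interiorConst t₀ c₂ / 2 / m := by positivity
  rcases h.2 with ⟨h0, h1, hI⟩ | ⟨s, ⟨rfl, -⟩ | ⟨rfl, -⟩, -⟩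
  · rw [cut_of_interior h0 h1]
    refine (hI.abs_bias_le (by positivity) (hX.integrable one_le_two) hm ha0 ha1).trans ?_
    gcongr
    exact hP h0 h1
  · have hg : MemLp (fun x => x - g) 2 F := hX.sub (memLp_const g)
    have : cut 1 η = Set.univ := by simp [cut]
    simp only [this, Set.indicator_univ, Pi.one_apply, mul_one]
    rw [hN.integral_add hg, sub_self, abs_zero]
    exact hpos
  · have : cut 0 η = ∅ := by simp [cut]
    simp only [this, Set.indicator_empty, mul_zero, integral_zero, sub_zero, abs_zero]
    exact hpos

theorem RegularAt.integral_band_le (ht₀ : 0 < t₀) (hc₂ : 0 < c₂) (h : RegularAt F α η t₀ c₁ c₂ β)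
    (hX : MemLp (fun x : ℝ => x) 2 F) (hm : 1 ≤ m) {a b g P t : ℝ} (ha0 : 0 ≤ a) (ha1 : a ≤ 1)
    (hb : |b| ≤ 1) (hP0 : 0 ≤ P) (hP : 0 < α → α < 1 → |η - g| ≤ P) (ht : 0 < t)
    (htt : 4 * t ≤ t₀) (ht1 : t ≤ 1) (hmt : 1 ≤ t * m) :
    ∫ q : Point m, |q.1 - g + mixedNoise m a b q.2| *
        (band α η t).indicator 1 (pointMean q) ∂pointLaw F m
      ≤ interiorConst t₀ c₂ * (3 * P + 8) * t := by
  have hI0 := interiorConst_pos ht₀ hc₂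
  rcases h.2 with ⟨h0, h1, hI⟩ | ⟨s, ⟨rfl, -⟩ | ⟨rfl, -⟩, -⟩
  · rw [band_of_interior h0 h1]
    refine (hI.integral_band_le (hX.integrable one_le_two) hm ha0 ha1 hb ht (by linarith)).trans ?_
    set C := interiorConst t₀ c₂
    have hm' : 1 / (m : ℝ) ≤ t := by rw [div_le_iff₀ (by positivity)]; exact hmt
    have hCm : C / m ≤ C * t := by rw [div_eq_mul_one_div]; gcongr
    calc _ ≤ (1 + P + 1) * (2 * C * t + C * t) + C * (t + t) := by
          gcongr; exact hP h0 h1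
      _ = _ := by ring
  · have : band 1 η t = ∅ := by simp [band]
    simp only [this, Set.indicator_empty, mul_zero, integral_zero]
    positivity
  · have : band 0 η t = ∅ := by simp [band]
    simp only [this, Set.indicator_empty, mul_zero, integral_zero]
    positivity

/-- The implication makes the event empty at the levels `0` and `1`, where the cut is exact and no
accuracy of the extreme is required. -/
theorem RegularAt.pi_error_le (hc₁ : 0 < c₁) (h : RegularAt F α η t₀ c₁ c₂ β) (hn : 1 ≤ n)
    (hm : 1 ≤ m) {t : ℝ} (ht : 0 < t) (htt : 4 * t ≤ t₀)
    (hCm : 2 * interiorConst t₀ c₂ ≤ c₁ * t * m) (hcn : 4 ≤ c₁ * t * n) :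
    (Measure.pi fun _ : Fin n => pointLaw F m).real
      {p | ¬ (0 < α → α < 1 → |empQuantile (fun i => pointMean (p i)) α - η| ≤ t)} ≤
      2 * Real.exp (-(n * (c₁ * t) ^ 2 / 2)) := by
  rcases h.2 with ⟨h0, h1, hI⟩ | ⟨s, ⟨rfl, -⟩ | ⟨rfl, -⟩, -⟩
  · refine le_trans (measureReal_mono fun p hp => ?_)
      (pi_interior_error_le hI hc₁ h0.le h1.le hn hm ht (by linarith) hCm hcn)
    by_contra hcon
    exact hp fun _ _ => not_lt.1 hcon
  · simp only [lt_irrefl, false_imp_iff, imp_true_iff, not_true_eq_false, Set.ofPred_false,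
      measureReal_empty]
    positivity
  · simp only [lt_irrefl, false_imp_iff, not_true_eq_false, Set.ofPred_false, measureReal_empty]
    positivity

theorem integral_sq_mul_indicator_le {Ω : Type*} [MeasurableSpace Ω] {μ : Measure Ω} {f : Ω → ℝ}
    {k : Ω → ℝ} {T : Set ℝ} (hf : MemLp f 2 μ) :
    ∫ ω, (f ω * T.indicator 1 (k ω)) ^ 2 ∂μ ≤ ∫ ω, f ω ^ 2 ∂μ := by
  refine integral_mono_of_nonneg (ae_of_all _ fun ω => sq_nonneg _) hf.integrable_sq
    (ae_of_all _ fun ω => ?_)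
  show (f ω * T.indicator 1 (k ω)) ^ 2 ≤ f ω ^ 2
  by_cases h : k ω ∈ T
  · simp [h]
  · simp [h]; positivity

theorem memLp_mul_indicator {Ω : Type*} [MeasurableSpace Ω] {μ : Measure Ω} {f : Ω → ℝ}
    {k : Ω → ℝ} {T : Set ℝ} (hT : MeasurableSet T) (hf : MemLp f 2 μ) (hk : Measurable k) :
    MemLp (fun ω => f ω * T.indicator 1 (k ω)) 2 μ := by
  have : (fun ω => f ω * T.indicator 1 (k ω)) = (k ⁻¹' T).indicator f := by
    ext ω; by_cases h : k ω ∈ T <;> simp [h]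
  rw [this]
  exact hf.indicator (hk hT)

/-- Accuracy of the average of `U i = X i + noise` over the relevant indices of the means. -/
theorem pi_trimmed_error_le (ht₀ : 0 < t₀) (hc₁ : 0 < c₁) (hc₂ : 0 < c₂)
    (h1 : RegularAt F α₁ η₁ t₀ c₁ c₂ β) (h2 : RegularAt F α₂ η₂ t₀ c₁ c₂ β)
    (hα0 : 0 ≤ α₁) (hα : α₁ < α₂) (hα2 : α₂ ≤ 1) (hX : MemLp (fun x : ℝ => x) 2 F)
    (hn : 1 ≤ n) (hm : 1 ≤ m) {a b v : ℝ} (ha0 : 0 ≤ a) (ha1 : a ≤ 1) (hb : |b| ≤ 1)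
    (hN : IsNoise m (mixedNoise m a b) v) {P V₀ t s : ℝ} (hP0 : 0 ≤ P)
    (hP1 : 0 < α₁ → α₁ < 1 → |η₁ - functional F α₁ α₂| ≤ P)
    (hP2 : 0 < α₂ → α₂ < 1 → |η₂ - functional F α₁ α₂| ≤ P)
    (hV₀ : ∫ x, (x - functional F α₁ α₂) ^ 2 ∂F + v ≤ V₀)
    (ht : 0 < t) (htt : 4 * t ≤ t₀) (ht1 : t ≤ 1) (hmt : 1 ≤ t * m)
    (hCm : 2 * interiorConst t₀ c₂ ≤ c₁ * t * m) (hcn : 4 ≤ c₁ * t * n)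
    (hlarge : 4 ≤ (α₂ - α₁) * n) (hs : 2 * interiorConst t₀ c₂ * (3 * P + 8) * t ≤ s) :
    (Measure.pi fun _ : Fin n => pointLaw F m).real
      {p | 8 * s / (α₂ - α₁) < |_root_.average
          (relevantIndices (fun i => pointMean (p i)) α₁ α₂)
          (fun i => (p i).1 + mixedNoise m a b (p i).2) - functional F α₁ α₂|}
      ≤ 2 * (V₀ / (n * s ^ 2)) + 4 * Real.exp (-(n * (c₁ * t) ^ 2 / 2)) := by
  set ν := (Measure.pi fun _ : Fin n => pointLaw F m) with hν
  set g := functional F α₁ α₂ with hg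
  set C := interiorConst t₀ c₂ with hC
  have hC0 : 0 < C := interiorConst_pos ht₀ hc₂
  have hn' : (0 : ℝ) < n := by positivity
  have hm' : (0 : ℝ) < m := by positivity
  have hκ : 0 < α₂ - α₁ := by linarith
  have hs0 : 0 < s := lt_of_lt_of_le (by positivity) hs
  have hm1 : 1 / (m : ℝ) ≤ t := by rw [div_le_iff₀ hm']; exact hmt
  set J := cut α₂ η₂ \ cut α₁ η₁ with hJ
  have hJm : MeasurableSet J := measurableSet_cut.diff measurableSet_cut
  set T := band α₁ η₁ t ∪ band α₂ η₂ t with hT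
  have hTm : MeasurableSet T := measurableSet_band.union measurableSet_band
  -- Centring at the target makes the error of the average equal to a sum of `U` over the selection
  -- divided by its size; a lower bound on that size is then enough.
  set U : Point m → ℝ := fun q => q.1 - g + mixedNoise m a b q.2 with hU
  have hXg : MemLp (fun x => x - g) 2 F := hX.sub (memLp_const g)
  have hUL : MemLp U 2 (pointLaw F m) := hN.memLp_add hXg
  have hUi : Integrable U (pointLaw F m) := hUL.integrable one_le_two
  have hU2 : ∫ q, U q ^ 2 ∂pointLaw F m ≤ V₀ := (hN.integral_add_sq hXg).le.trans hV₀
  set f₁ : Point m → ℝ := fun q => U q * J.indicator 1 (pointMean q) with hf₁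
  set f₂ : Point m → ℝ := fun q => |U q| * T.indicator 1 (pointMean q) with hf₂
  have hind : ∀ x, J.indicator (1 : ℝ → ℝ) x =
      (cut α₂ η₂).indicator 1 x - (cut α₁ η₁).indicator 1 x := by
    intro x
    have hsub := cut_subset_cut h1 h2 hα0 hα hα2
    by_cases hx1 : x ∈ cut α₁ η₁
    · have hxJ : x ∉ J := fun h => h.2 hx1
      simp [hxJ, hx1, hsub hx1]
    · by_cases hx2 : x ∈ cut α₂ η₂
      · have hxJ : x ∈ J := ⟨hx2, hx1⟩
        simp [hxJ, hx1, hx2]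
      · have hxJ : x ∉ J := fun h => hx2 h.1
        simp [hxJ, hx1, hx2]
  have hmean1 : |∫ q, f₁ q ∂pointLaw F m| ≤ s := by
    -- Without noise the centred truncated moment vanishes by the definition of the functional, so
    -- the mean of `f₁` is just the difference of the two noise biases.
    have hzero : ∫ x, (x - g) * (cut α₂ η₂).indicator 1 x ∂F -
        ∫ x, (x - g) * (cut α₁ η₁).indicator 1 x ∂F = 0 := by
      have i : ∀ α η, Integrable (fun x => (x - g) * (cut α η).indicator 1 x) F := fun α η =>
        integrable_mul_indicator measurableSet_cut (hXg.integrable one_le_two) measurable_id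
      rw [← integral_sub (i _ _) (i _ _)]
      simp_rw [← mul_sub, ← hind]
      have e : (fun x => (x - g) * J.indicator (1 : ℝ → ℝ) x) = J.indicator fun x => x - g := by
        ext x; by_cases h : x ∈ J <;> simp [h]
      have hsub := cut_subset_cut h1 h2 hα0 hα hα2
      have hJr : F.real J = α₂ - α₁ := by
        rw [hJ, measureReal_sdiff hsub measurableSet_cut, h1.measureReal_cut, h2.measureReal_cut]
      rw [e, integral_indicator hJm, integral_sub (hX.integrable one_le_two).integrableOn
        (integrable_const g), setIntegral_const, hJr, smul_eq_mul,
        ← sub_mul_functional h1 h2 hα0 hα hα2, sub_self]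
    have hb1 := h1.abs_bias_le ht₀ hc₂ hX hm ha0 ha1 hN hP0 hP1
    have hb2 := h2.abs_bias_le ht₀ hc₂ hX hm ha0 ha1 hN hP0 hP2
    have e : ∫ q, f₁ q ∂pointLaw F m = ∫ q, U q * (cut α₂ η₂).indicator 1 (pointMean q) ∂pointLaw F m
        - ∫ q, U q * (cut α₁ η₁).indicator 1 (pointMean q) ∂pointLaw F m := by
      have i : ∀ α η, Integrable (fun q => U q * (cut α η).indicator 1 (pointMean q))
          (pointLaw F m) := fun α η =>
        integrable_mul_indicator measurableSet_cut hUi measurable_pointMean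
      rw [← integral_sub (i _ _) (i _ _)]
      simp_rw [hf₁, hind, mul_sub]
    have h3 : (6 + P) * C / 2 / m ≤ C * (3 * P + 8) * t := by
      calc (6 + P) * C / 2 / m = (6 + P) * C / 2 * (1 / m) := by ring
        _ ≤ (6 + P) * C / 2 * t := by gcongr
        _ ≤ C * (3 * P + 8) * t := by
            gcongr
            nlinarith
    rw [e]
    rw [abs_le] at hb1 hb2 ⊢
    constructor <;> linarith [hb1.1, hb1.2, hb2.1, hb2.2]
  have hmean2 : ∫ q, f₂ q ∂pointLaw F m ≤ s := by
    have hb1 := h1.integral_band_le ht₀ hc₂ hX hm ha0 ha1 hb hP0 hP1 ht htt ht1 hmt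
    have hb2 := h2.integral_band_le ht₀ hc₂ hX hm ha0 ha1 hb hP0 hP2 ht htt ht1 hmt
    have i : ∀ α η, Integrable (fun q => |U q| * (band α η t).indicator 1 (pointMean q))
        (pointLaw F m) := fun α η =>
      integrable_mul_indicator measurableSet_band hUi.abs measurable_pointMean
    have : ∫ q, f₂ q ∂pointLaw F m ≤ ∫ q, (|U q| * (band α₁ η₁ t).indicator 1 (pointMean q) +
        |U q| * (band α₂ η₂ t).indicator 1 (pointMean q)) ∂pointLaw F m := by
      refine integral_mono (integrable_mul_indicator hTm hUi.abs measurable_pointMean)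
        ((i _ _).add (i _ _)) fun q => ?_
      show |U q| * T.indicator 1 (pointMean q) ≤ |U q| * (band α₁ η₁ t).indicator 1 (pointMean q) +
        |U q| * (band α₂ η₂ t).indicator 1 (pointMean q)
      rw [← mul_add]
      gcongr
      by_cases h1 : pointMean q ∈ band α₁ η₁ t <;> by_cases h2 : pointMean q ∈ band α₂ η₂ t <;>
        simp [hT, Set.indicator, h1, h2]
    rw [integral_add (i _ _) (i _ _)] at this
    linarith
  have hUabs : MemLp (fun q => |U q|) 2 (pointLaw F m) := hUL.abs
  have hE1 := pi_abs_sum_sub_ge (n := n) (memLp_mul_indicator hJm hUL measurable_pointMean)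
    ((integral_sq_mul_indicator_le hUL).trans hU2) hn hs0
  have hE2 := pi_abs_sum_sub_ge (n := n) (memLp_mul_indicator hTm hUabs measurable_pointMean)
    ((integral_sq_mul_indicator_le hUabs).trans (by simpa only [sq_abs] using hU2)) hn hs0
  have hE3 := h1.pi_error_le (n := n) hc₁ hn hm ht htt hCm hcn
  have hE4 := h2.pi_error_le (n := n) hc₁ hn hm ht htt hCm hcn
  refine (measureReal_mono fun p hp => ?_).trans ((measureReal_union_le _ _).trans
    ((add_le_add ((measureReal_union_le _ _).trans (add_le_add hE1 hE2))
      ((measureReal_union_le _ _).trans (add_le_add hE3 hE4))).trans (le_of_eq (by ring))))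
  by_contra hcon
  simp only [Set.mem_union, not_or, Set.mem_ofPred_eq, not_le, not_not] at hcon
  obtain ⟨⟨hc1, hc2⟩, hc3, hc4⟩ := hcon
  set S := relevantIndices (fun i => pointMean (p i)) α₁ α₂ with hS
  have hcard := half_le_card_relevantIndices hn (fun i => pointMean (p i)) hα0 hα hα2 hlarge
  have hcard0 : (0 : ℝ) < S.card := lt_of_lt_of_le (by positivity) hcard
  have hsum := abs_sum_relevantIndices_le hn (u := fun i => U (p i)) hα0 hα hα2 hc3 hc4
  have hb1 : |∑ i, f₁ (p i)| ≤ n * (2 * s) := by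
    have h3 : |n * ∫ q, f₁ q ∂pointLaw F m| ≤ n * s := by
      rw [abs_mul, abs_of_pos hn']; gcongr
    have h4 := abs_le.1 h3
    have h5 := abs_lt.1 hc1
    rw [abs_le]; constructor <;> linarith [h4.1, h4.2, h5.1, h5.2]
  have hb2 : ∑ i, f₂ (p i) ≤ n * (2 * s) := by
    have h3 : n * ∫ q, f₂ q ∂pointLaw F m ≤ n * s := by gcongr
    have h5 := abs_lt.1 hc2
    linarith [h5.2]
  have havg : _root_.average S (fun i => (p i).1 + mixedNoise m a b (p i).2) - g =
      (∑ i ∈ S, U (p i)) / S.card := by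
    simp only [_root_.average, hU, Finset.sum_add_distrib, Finset.sum_sub_distrib,
      Finset.sum_const, nsmul_eq_mul]
    field_simp
    ring
  have hp' : 8 * s / (α₂ - α₁) < |_root_.average S
    (fun i => (p i).1 + mixedNoise m a b (p i).2) - g| := hp
  rw [havg, abs_div, abs_of_pos hcard0, lt_div_iff₀ hcard0] at hp'
  -- The sum over the selection is at most `4 n s`, from `2 n s` for the fixed set and `2 n s` for
  -- the bands, and the selection has at least `(α₂ - α₁) n / 2` elements.
  have h6 : 8 * s / (α₂ - α₁) * ((α₂ - α₁) / 2 * n) ≤ 8 * s / (α₂ - α₁) * S.card := by gcongr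
  have h7 : 8 * s / (α₂ - α₁) * ((α₂ - α₁) / 2 * n) = n * (4 * s) := by field_simp; ring
  have h8 : |∑ i ∈ S, U (p i)| ≤ n * (2 * s) + n * (2 * s) := hsum.trans (add_le_add hb1 hb2)
  linarith

end TrimmedAccuracy

/-! ### Choice of `n` and `m` for interior quantiles -/

section InteriorCases

theorem exists_pos_of_eventually {P : ℝ → Prop} (h : ∀ᶠ x in Filter.atTop, P x) :
    ∃ ε₀, 0 < ε₀ ∧ ε₀ < 1 ∧ ∀ ε, 0 < ε → ε < ε₀ → P ε⁻¹ := by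
  obtain ⟨X, hX⟩ := Filter.eventually_atTop.1 h
  refine ⟨(max X 2)⁻¹, by positivity, ?_, fun ε h0 h1 => hX _ ?_⟩
  · rw [inv_lt_one₀ (by positivity)]; exact lt_of_lt_of_le one_lt_two (le_max_right _ _)
  · exact (le_max_left X 2).trans ((le_inv_comm₀ h0 (by positivity)).1 h1.le)

/-- With `n ≥ A x²` and `m ≤ B x log x`, `m` is much smaller than `n` for large `x`. -/
theorem eventually_small {A B r N e : ℝ} (hA : 0 < A) (hB : 0 < B) (hr : 0 < r) :
    ∀ᶠ x : ℝ in Filter.atTop, Real.exp 1 ≤ x ∧ e ≤ x ∧ ∀ n m : ℝ, A * x ^ 2 ≤ n →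
      m ≤ B * (x * Real.log x) → m ≤ n ^ (3 / 5 : ℝ) ∧ m ≤ r * n ∧ N ≤ n := by
  have h1 := (isLittleO_log_rpow_atTop (by norm_num : (0 : ℝ) < 1 / 5)).def
    (by positivity : (0 : ℝ) < A ^ (3 / 5 : ℝ) / B)
  have h2 := (isLittleO_log_rpow_atTop (by norm_num : (0 : ℝ) < 1)).def
    (by positivity : (0 : ℝ) < r * A / B)
  filter_upwards [h1, h2, Filter.eventually_ge_atTop (Real.exp 1), Filter.eventually_ge_atTop e,
    Filter.eventually_ge_atTop 1, Filter.eventually_ge_atTop (N / A)] with x h1 h2 h3 h4 h5 h6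
  refine ⟨h3, h4, fun n m hn hm => ?_⟩
  have hx : 0 < x := by linarith
  have hlog := Real.log_nonneg h5
  rw [Real.norm_of_nonneg hlog, Real.norm_of_nonneg (by positivity)] at h1 h2
  refine ⟨?_, ?_, ?_⟩
  · calc m ≤ B * (x * Real.log x) := hm
      _ ≤ B * (x * (A ^ (3 / 5 : ℝ) / B * x ^ (1 / 5 : ℝ))) := by gcongr
      _ = A ^ (3 / 5 : ℝ) * (x ^ (1 : ℝ) * x ^ (1 / 5 : ℝ)) := by
          rw [Real.rpow_one]; field_simp
      _ = (A * x ^ 2) ^ (3 / 5 : ℝ) := by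
          rw [← Real.rpow_add hx, Real.mul_rpow hA.le (by positivity), ← Real.rpow_natCast x 2,
            ← Real.rpow_mul hx.le]
          norm_num
      _ ≤ _ := by gcongr
  · rw [Real.rpow_one] at h2
    calc m ≤ B * (x * Real.log x) := hm
      _ ≤ B * (x * (r * A / B * x)) := by gcongr
      _ = r * (A * x ^ 2) := by field_simp
      _ ≤ _ := by gcongr
  · rw [div_le_iff₀ hA] at h6
    have : x ≤ x ^ 2 := by nlinarith
    calc N ≤ x * A := h6
      _ ≤ x ^ 2 * A := by gcongr
      _ ≤ n := by linarith

variable {n m : ℕ} {F : Measure ℝ} {α α₁ α₂ δ t₀ c₁ c₂ β η₁ η₂ : ℝ}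

theorem log_div_le {N x k δ : ℝ} (hN : 0 < N) (hδ : 0 < δ) (hx : Real.exp 1 ≤ x) (hn : 1 ≤ n)
    (h : (n : ℝ) ≤ N * x ^ k) :
    Real.log (n / δ) ≤ (|Real.log (N / δ)| + k) * Real.log x := by
  have hx0 : 0 < x := (Real.exp_pos 1).trans_le hx
  have hlx : 1 ≤ Real.log x := (Real.le_log_iff_exp_le hx0).2 hx
  have hn0 : (0 : ℝ) < n := by positivity
  calc Real.log (n / δ) ≤ Real.log (N / δ * x ^ k) := by
        refine Real.log_le_log (by positivity) ?_
        rw [div_mul_eq_mul_div]; gcongr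
    _ = Real.log (N / δ) + k * Real.log x := by
        rw [Real.log_mul (by positivity) (by positivity), Real.log_rpow hx0]
    _ ≤ |Real.log (N / δ)| * Real.log x + k * Real.log x := by
        gcongr
        exact (le_abs_self _).trans (le_mul_of_one_le_right (abs_nonneg _) hlx)
    _ = _ := by ring

variable [IsProbabilityMeasure F]

/-- The rate at interior quantiles. -/
theorem expectedSamples_le_rate_interior {τ c C K B N x L : ℝ}
    (hfr : frontier (relevantSet F α₁ α₂) = {η₁, η₂})
    (h1 : InteriorRegular F α₁ η₁ c τ C) (h2 : InteriorRegular F α₂ η₂ c τ C) (hK : 0 ≤ K)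
    (hB : 0 < B) (hN : 0 < N) (hδ : 0 < δ) (hδ1 : δ < 1) (hx : Real.exp 1 ≤ x) (hL : 1 ≤ L)
    (hn : 3 ≤ n) (hm : 1 ≤ m) (hnx : (n : ℝ) ≤ N * x ^ 2) (hmx : (m : ℝ) ≤ B * (x * L))
    (hE : expectedSamples F α₁ α₂ δ n m ≤
      ENNReal.ofReal K * n * gapExpectation F α₁ α₂ δ n m) :
    expectedSamples F α₁ α₂ δ n m ≤ ENNReal.ofReal (K * N * (|Real.log (N / δ)| + 2) *
      (1 + 8 * C * (4 * B) ^ (1 / 2 : ℝ)) * x ^ (5 / 2 : ℝ) * (L * Real.log x)) := by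
  have hC := h1.const_nonneg
  have hx0 : 0 < x := (Real.exp_pos 1).trans_le hx
  have hx1 : 1 ≤ x := (Real.one_le_exp zero_le_one).trans hx
  have hlx : 1 ≤ Real.log x := (Real.le_log_iff_exp_le hx0).2 hx
  have hn' : (3 : ℝ) ≤ n := by exact_mod_cast hn
  have hm' : (1 : ℝ) ≤ m := by exact_mod_cast hm
  have hl : 1 ≤ Real.log (n / δ) := by
    rw [Real.le_log_iff_exp_le (by positivity), le_div_iff₀ hδ]
    have := Real.exp_one_lt_d9
    nlinarith [Real.exp_pos 1]
  have hl2 := log_div_le (n := n) (k := 2) hN hδ hx (by omega) (by exact_mod_cast hnx)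
  -- Interior quantiles have mass of order `s` near the boundary, hence `γ = 1`. Taking `y = m`
  -- wastes the factor `log(n/δ) ≥ 1`, which only matters for logarithms.
  have hgap := gapExpectation_le_of_lt_two (n := n) (m := m) (δ := δ) (C := 2 * C) (γ := 1)
    (y := m) (by positivity) (fun s hs => measure_infEDist_le_interior hfr h1 h2 hs)
    (by linarith) hm' (le_mul_of_one_le_right (by linarith) hl) (by norm_num)
  have hpow : (4 * (m : ℝ)) ^ (1 - 1 / 2 : ℝ) ≤ (4 * B) ^ (1 / 2 : ℝ) * (x ^ (1 / 2 : ℝ) * L) := by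
    -- The root of the logarithmic factor is bounded crudely; `L = 1` serves the quantiles and `L =
    -- log x` the trimmed means.
    have hLL : L ^ (1 / 2 : ℝ) ≤ L := by
      conv_rhs => rw [← Real.rpow_one L]
      exact Real.rpow_le_rpow_of_exponent_le hL (by norm_num)
    calc (4 * (m : ℝ)) ^ (1 - 1 / 2 : ℝ) = (4 * (m : ℝ)) ^ (1 / 2 : ℝ) := by norm_num
      _ ≤ (4 * (B * (x * L))) ^ (1 / 2 : ℝ) := by gcongr
      _ = (4 * B) ^ (1 / 2 : ℝ) * (x ^ (1 / 2 : ℝ) * L ^ (1 / 2 : ℝ)) := by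
          rw [← mul_assoc, Real.mul_rpow (by positivity) (by positivity),
            Real.mul_rpow hx0.le (by positivity)]
      _ ≤ _ := by gcongr
  refine hE.trans ((mul_le_mul_right hgap _).trans ?_)
  rw [← ENNReal.ofReal_natCast, ← ENNReal.ofReal_mul hK, ← ENNReal.ofReal_mul (by positivity)]
  refine ENNReal.ofReal_le_ofReal ?_
  have hxL : 1 ≤ x ^ (1 / 2 : ℝ) * L :=
    one_le_mul_of_one_le_of_one_le (Real.one_le_rpow hx1 (by norm_num)) hL
  have h3 : 1 + 4 * (2 * C) * ((4 * (m : ℝ)) ^ (1 - 1 / 2 : ℝ) / (2 ^ (2 - 1 : ℝ) - 1)) ≤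
      (1 + 8 * C * (4 * B) ^ (1 / 2 : ℝ)) * (x ^ (1 / 2 : ℝ) * L) := by
    have e : (2 : ℝ) ^ (2 - 1 : ℝ) - 1 = 1 := by norm_num
    rw [e, div_one, add_mul, one_mul]
    refine add_le_add hxL ?_
    calc _ ≤ 4 * (2 * C) * ((4 * B) ^ (1 / 2 : ℝ) * (x ^ (1 / 2 : ℝ) * L)) := by gcongr
      _ = _ := by ring
  have hx52 : x ^ 2 * x ^ (1 / 2 : ℝ) = x ^ (5 / 2 : ℝ) := by
    rw [← Real.rpow_natCast x 2, ← Real.rpow_add hx0]; norm_num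
  have h30 : 0 ≤ 1 + 4 * (2 * C) * ((4 * (m : ℝ)) ^ (1 - 1 / 2 : ℝ) / (2 ^ (2 - 1 : ℝ) - 1)) := by
    have e : (2 : ℝ) ^ (2 - 1 : ℝ) - 1 = 1 := by norm_num
    rw [e]; positivity
  calc _ ≤ K * (N * x ^ 2) * ((|Real.log (N / δ)| + 2) * Real.log x *
        ((1 + 8 * C * (4 * B) ^ (1 / 2 : ℝ)) * (x ^ (1 / 2 : ℝ) * L))) := by gcongr
    _ = K * N * (|Real.log (N / δ)| + 2) * (1 + 8 * C * (4 * B) ^ (1 / 2 : ℝ)) *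
        (x ^ 2 * x ^ (1 / 2 : ℝ)) * (L * Real.log x) := by ring
    _ = _ := by rw [hx52]

omit [IsProbabilityMeasure F] in
theorem functional_self {η : ℝ} (h : quantile F α = (η : EReal)) : functional F α α = η := by
  rw [functional, if_pos rfl, h, EReal.toReal_coe]

theorem exp_neg_two_mul_log {y : ℝ} (hy : 0 < y) : Real.exp (-(2 * Real.log y)) = y⁻¹ ^ 2 := by
  rw [show -(2 * Real.log y) = ((2 : ℕ) : ℝ) * Real.log y⁻¹ by
    rw [Real.log_inv]; push_cast; ring, Real.exp_nat_mul, Real.exp_log (by positivity)]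

theorem half_le_log_two_div (hδ : 0 < δ) (hδ1 : δ < 1) : 1 / 2 ≤ Real.log (2 / δ) := by
  have : Real.log 2 ≤ Real.log (2 / δ) := Real.log_le_log (by norm_num) (by
    rw [le_div_iff₀ hδ]; linarith)
  linarith [Real.log_two_gt_d9]

/-- The three conditions on `A` serve, in this order, the noise bias at `t = ε / 2`, the rounding of
the rank, and an exponent of at least `2 log(2/δ)`, which leaves `2 (δ/2)² ≤ δ/2`. -/
theorem pi_quantile_error_le {η c τ C A ε : ℝ} (hI : InteriorRegular F α η c τ C) (hc : 0 < c)
    (hα0 : 0 ≤ α) (hα1 : α ≤ 1) (hn : 1 ≤ n) (hm : 1 ≤ m) (hε : 0 < ε) (hετ : ε / 2 ≤ τ)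
    (hδ : 0 < δ) (hδ1 : δ < 1) (hx : 2 ≤ ε⁻¹) (hA1 : 4 * C ≤ A * c) (hA2 : 16 ≤ A * c)
    (hA3 : 16 ≤ A * c ^ 2) (hnA : A * (Real.log (2 / δ) * ε⁻¹ ^ 2) ≤ n) (hmA : A * ε⁻¹ ≤ m) :
    (Measure.pi fun _ : Fin n => pointLaw F m).real
      {p | ε / 2 < |empQuantile (fun i => pointMean (p i)) α - η|} ≤ δ / 2 := by
  have hlog2 := half_le_log_two_div hδ hδ1
  set x := ε⁻¹ with hxdef
  set l := Real.log (2 / δ) with hl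
  have hεx : ε * x = 1 := mul_inv_cancel₀ hε.ne'
  have hA0 : 0 < A := by
    by_contra h
    nlinarith
  refine (pi_interior_error_le hI hc hα0 hα1 hn hm (half_pos hε) hετ ?_ ?_).trans ?_
  · have h3 : c * (ε / 2) * (A * x) ≤ c * (ε / 2) * m := by gcongr
    have h4 : c * (ε / 2) * (A * x) = A * c / 2 * (ε * x) := by ring
    rw [h4, hεx] at h3
    linarith
  · have h3 : c * (ε / 2) * (A * (l * x ^ 2)) ≤ c * (ε / 2) * n := by gcongr
    have h4 : c * (ε / 2) * (A * (l * x ^ 2)) = A * c * (l * x) / 2 * (ε * x) := by ring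
    rw [h4, hεx] at h3
    have h5 : 1 / 2 * 2 ≤ l * x := by gcongr
    have h6 : 16 * 1 ≤ A * c * (l * x) := by gcongr; linarith
    linarith
  · have h3 : 2 * l ≤ n * (c * (ε / 2)) ^ 2 / 2 := by
      have h4 : A * (l * x ^ 2) * (c * (ε / 2)) ^ 2 / 2 ≤ n * (c * (ε / 2)) ^ 2 / 2 := by
        gcongr
      have h5 : A * (l * x ^ 2) * (c * (ε / 2)) ^ 2 / 2 = A * c ^ 2 * l / 8 * (ε * x) ^ 2 := by
        ring
      rw [h5, hεx] at h4
      have h6 : 16 * l ≤ A * c ^ 2 * l := by gcongr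
      linarith
    have h6 : Real.exp (-(n * (c * (ε / 2)) ^ 2 / 2)) ≤ (2 / δ)⁻¹ ^ 2 := by
      rw [← exp_neg_two_mul_log (by positivity)]
      gcongr
    rw [inv_div] at h6
    nlinarith

theorem quantile_case (hα0 : 0 < α) (hα1 : α < 1) (ht₀ : 0 < t₀) (hc₁ : 0 < c₁) (hc₂ : 0 < c₂)
    (hβ : 0 < β) :
    ∃ A : ℝ, 0 < A ∧ ∀ B : ℝ, A ≤ B → ∃ (C ε₀ : ℝ) (D : ℝ → ℝ), 0 < C ∧ 0 < ε₀ ∧ ε₀ < 1 ∧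
    ∀ F : Measure ℝ, IsProbabilityMeasure F → QuantileRegular F α t₀ c₁ c₂ β →
    ∀ (ε δ : ℝ) (n m : ℕ), 0 < ε → ε < ε₀ → 0 < δ → δ < 1 →
      InBand A B (Real.log (2 / δ) * ε⁻¹ ^ 2) n → InBand A B ε⁻¹ m →
      IsPAC (sampleLaw F n m) (fun ω => offlineEstimator α α (observation ω))
        (functional F α α) (ε / 2) (δ / 2) ∧
      IsPAC (sampleLaw F n m) (fun ω => onlineEstimator α α δ ω) (functional F α α) ε δ ∧
      expectedSamples F α α δ n m
        ≤ ENNReal.ofReal C * (n : ℝ≥0∞) * gapExpectation F α α δ n m ∧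
      expectedSamples F α α δ n m
        ≤ ENNReal.ofReal (D δ * ε ^ (-(5 / 2) : ℝ) * Real.log (1 / ε)) := by
  have hI0 := interiorConst_pos ht₀ hc₂
  set CI := interiorConst t₀ c₂ with hCI
  set K := sampleConst t₀ c₁ c₂ β with hK
  have hK0 : 0 < K := sampleConst_pos ht₀ hc₁ hc₂
  refine ⟨4 * CI / c₁ + 16 / c₁ + 16 / c₁ ^ 2 + 1, by positivity, fun B hB => ?_⟩
  set A := 4 * CI / c₁ + 16 / c₁ + 16 / c₁ ^ 2 + 1 with hA
  have hA1 : 4 * CI / c₁ ≤ A := by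
    have : 0 < 16 / c₁ ∧ 0 < 16 / c₁ ^ 2 := ⟨by positivity, by positivity⟩
    linarith
  have hA2 : 16 / c₁ ≤ A := by
    have : 0 < 4 * CI / c₁ ∧ 0 < 16 / c₁ ^ 2 := ⟨by positivity, by positivity⟩
    linarith
  have hA3 : 16 / c₁ ^ 2 ≤ A := by
    have : 0 < 4 * CI / c₁ ∧ 0 < 16 / c₁ := ⟨by positivity, by positivity⟩
    linarith
  have hA4 : 1 ≤ A := by
    have : 0 < 4 * CI / c₁ ∧ 0 < 16 / c₁ ∧ 0 < 16 / c₁ ^ 2 :=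
      ⟨by positivity, by positivity, by positivity⟩
    linarith
  have hB0 : 0 < B := by linarith
  -- As `log(2/δ) ≥ 1/2`, half of `A` bounds `n` from below uniformly in `δ`.
  obtain ⟨ε₀, h0, h1, hε₀⟩ := exists_pos_of_eventually (eventually_small (A := A * (1 / 2)) (B := B)
    (r := ratioBound c₁ (t₀ / 2)) (N := (50 : ℝ) ^ (25 / 2 : ℝ)) (e := t₀⁻¹) (by positivity) hB0
    (ratioBound_pos hc₁ (by positivity)))
  refine ⟨K, ε₀, fun δ => K * (B * Real.log (2 / δ)) *
    (|Real.log (B * Real.log (2 / δ) / δ)| + 2) * (1 + 8 * CI * (4 * B) ^ (1 / 2 : ℝ)), hK0, h0, h1,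
    fun F _ hF ε δ n m hε hεε hδ hδ1 hn hm => ?_⟩
  obtain ⟨η, hη⟩ := hF.exists_regularAt ht₀ hc₁ hc₂ hβ hα0.le hα1.le
  obtain ⟨hx, ht, hsmall⟩ := hε₀ ε hε hεε
  set x := ε⁻¹ with hxdef
  have hx0 : 0 < x := by positivity
  have hεx : ε * x = 1 := mul_inv_cancel₀ hε.ne'
  have hlx : 1 ≤ Real.log x := (Real.le_log_iff_exp_le hx0).2 hx
  have hx2 : 2 ≤ x := by linarith [Real.exp_one_gt_d9]
  have hlog2 := half_le_log_two_div hδ hδ1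
  have hnA : A * (1 / 2) * x ^ 2 ≤ n := by
    refine le_trans ?_ hn.1
    rw [mul_assoc]; gcongr
  have hmB : (m : ℝ) ≤ B * (x * Real.log x) := by
    refine hm.2.trans ?_
    gcongr
    exact le_mul_of_one_le_right hx0.le hlx
  obtain ⟨hmn, hratio, hlarge⟩ := hsmall n m hnA hmB
  have h50 : (50 : ℝ) ≤ n := by
    refine le_trans ?_ hlarge
    conv_lhs => rw [← Real.rpow_one (50 : ℝ)]
    exact Real.rpow_le_rpow_of_exponent_le (by norm_num) (by norm_num)
  have hn3 : 50 ≤ n := by exact_mod_cast h50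
  have hmA : A * x ≤ m := hm.1
  have hm2 : 2 ≤ m := by
    have : (2 : ℝ) ≤ m := by nlinarith
    exact_mod_cast this
  have hI : InteriorRegular F α η c₁ (t₀ / 2) CI := by
    rcases hη.2 with ⟨-, -, h⟩ | ⟨s, ⟨h, -⟩ | ⟨h, -⟩, -⟩
    exacts [h, absurd h hα1.ne, absurd h hα0.ne']
  have hE := expectedSamples_le_of_regularAt (n := n) (m := m) ht₀ hc₁ hc₂ hβ le_rfl hα1.le hη hη
    (by omega) hm2 hδ hδ1 hmn hratio hlarge
  have hεt : ε ≤ t₀ := (inv_le_inv₀ ht₀ hε).1 ht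
  have hpac : (Measure.pi fun _ : Fin n => pointLaw F m).real
      {p | ε / 2 < |empQuantile (fun i => pointMean (p i)) α - η|} ≤ δ / 2 := by
    refine pi_quantile_error_le hI hc₁ hα0.le hα1.le (by omega) (by omega) hε (by linarith) hδ
      hδ1 hx2 ((div_le_iff₀ hc₁).1 hA1) ((div_le_iff₀ hc₁).1 hA2)
      ((div_le_iff₀ (by positivity)).1 hA3) hn.1 hm.1
  rw [functional_self hη.1]
  obtain ⟨hp1, hp2⟩ := isPAC_quantile hε (by omega) hm2 hδ hδ1 hα1.le hpac
  refine ⟨hp1, hp2, hE, ?_⟩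
  have hrate := expectedSamples_le_rate_interior (L := 1) (N := B * Real.log (2 / δ))
    (frontier_relevantSet le_rfl hη.1 hη.1) hI hI hK0.le hB0
    (by positivity) hδ hδ1 hx le_rfl (by omega) (by omega)
    (by rw [mul_assoc]; exact hn.2) (by rw [mul_one]; exact hm.2) hE
  refine hrate.trans (le_of_eq ?_)
  rw [Real.rpow_neg hε.le, ← Real.inv_rpow hε.le, one_div ε, one_mul]

end InteriorCases

/-! ### Trimmed means -/

section TrimmedCase

variable {n m : ℕ} {F : Measure ℝ} [IsProbabilityMeasure F] {α₁ α₂ δ t₀ c₀ c₁ c₂ β η₁ η₂ : ℝ}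

/-- Both estimators average `X i` plus noise over the same index set: the observed means offline,
with `(a, b) = (1, 0)`, and the fresh observations online, with `(a, b) = (0, 1)`, outside the
deviation event. -/
theorem isPAC_trimmed {g ε : ℝ} (hα : α₁ < α₂) (hα2 : α₂ ≤ 1) (hε : 0 < ε) (hn : 1 ≤ n)
    (hm : 2 ≤ m) (hδ : 0 < δ) (hδ1 : δ < 1)
    (h : ∀ a b v, (a = 1 ∧ b = 0) ∨ (a = 0 ∧ b = 1) → IsNoise m (mixedNoise m a b) v → v ≤ 1 →
      (Measure.pi fun _ : Fin n => pointLaw F m).real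
        {p | ε / 2 < |_root_.average (relevantIndices (fun i => pointMean (p i)) α₁ α₂)
          (fun i => (p i).1 + mixedNoise m a b (p i).2) - g|} ≤ δ / 2) :
    IsPAC (sampleLaw F n m) (fun ω => offlineEstimator α₁ α₂ (observation ω)) g (ε / 2) (δ / 2) ∧
      IsPAC (sampleLaw F n m) (fun ω => onlineEstimator α₁ α₂ δ ω) g ε δ := by
  refine ⟨isPAC_sampleLaw ?_, isPAC_sampleLaw ?_⟩
  · have h1 := h 1 0 (1 / m) (Or.inl ⟨rfl, rfl⟩) (isNoise_mixedNoise_one_zero (by omega))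
      (by rw [div_le_one (by positivity)]; exact_mod_cast (by omega : 1 ≤ m))
    simp only [offlineEstimator, empMean_observation_toSample (show 1 ≤ m by omega)]
    have e : ∀ p : Fin n → Point m, (fun i => (p i).1 + mixedNoise m 1 0 (p i).2) =
        fun i => pointMean (p i) := fun p => by
      funext i; simp [mixedNoise, pointMean]
    simpa only [e] using h1
  · have h1 := h 0 1 1 (Or.inr ⟨rfl, rfl⟩) isNoise_mixedNoise_zero_one le_rfl
    have hd := pi_deviationEvent_le (F := F) (n := n) hn hm hδ hδ1
    refine (measureReal_mono (fun p hp => ?_)).trans ((measureReal_union_le _ _).trans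
      ((add_le_add h1 hd).trans (by linarith)))
    by_cases hpd : p ∈ deviationEvent n m δ
    · exact Or.inr hpd
    · left
      have hp' : ε < |onlineEstimator α₁ α₂ δ (toSample n m p) - g| := hp
      rw [onlineEstimator, if_neg hα.ne, selected_eq_relevantIndices hn
        (one_le_confLog hn hm hδ hδ1) (hα.le.trans hα2) hα2
        (abs_prefixMean_sub_le_of_notMem (by omega) hpd),
        empMean_observation_toSample (by omega)] at hp'
      have e : (fun i => (p i).1 + mixedNoise m 0 1 (p i).2) =
          freshObservation (toSample n m p) := by
        funext i
        simp only [mixedNoise, zero_mul, one_mul, zero_add]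
        rfl
      show ε / 2 < |_ - g|
      rw [e]
      exact lt_trans (by linarith) hp'

theorem integral_sub_sq_le {g G : ℝ} (hX : MemLp (fun x : ℝ => x) 2 F)
    (hc : ∫ x, x ^ 2 ∂F ≤ c₀) (hg : |g| ≤ G) :
    ∫ x, (x - g) ^ 2 ∂F ≤ 2 * c₀ + 2 * G ^ 2 := by
  have i1 : Integrable (fun x : ℝ => 2 * x ^ 2) F := hX.integrable_sq.const_mul 2
  calc ∫ x, (x - g) ^ 2 ∂F ≤ ∫ x, (2 * x ^ 2 + 2 * g ^ 2) ∂F := by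
        refine integral_mono (hX.sub (memLp_const g)).integrable_sq
          (i1.add (integrable_const _)) fun x => ?_
        show (x - g) ^ 2 ≤ 2 * x ^ 2 + 2 * g ^ 2
        nlinarith [sq_nonneg (x + g)]
    _ = 2 * ∫ x, x ^ 2 ∂F + 2 * g ^ 2 := by
        rw [integral_add i1 (integrable_const _), integral_const_mul]; simp
    _ ≤ _ := by
        have : g ^ 2 ≤ G ^ 2 := sq_le_sq' (by linarith [(abs_le.1 hg).1]) (abs_le.1 hg).2
        linarith

theorem exp_neg_le_inv {y : ℝ} (hy : 0 < y) : Real.exp (-y) ≤ 1 / y := by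
  rw [Real.exp_neg, one_div]
  exact inv_anti₀ hy (by linarith [Real.add_one_le_exp y])

/-- The distance between an interior quantile and the functional is bounded. -/
theorem RegularAt.abs_sub_functional_le (hc₁ : 0 < c₁) (ht₀ : 0 < t₀) {α η g G : ℝ}
    (h : RegularAt F α η t₀ c₁ c₂ β)
    (hX : MemLp (fun x : ℝ => x) 2 F) (hc : ∫ x, x ^ 2 ∂F ≤ c₀) (hg : |g| ≤ G)
    (h0 : 0 < α) (h1 : α < 1) : |η - g| ≤ (1 + c₀ + t₀) / (c₁ * t₀) + G := by
  have hI : InteriorRegular F α η c₁ (t₀ / 2) (interiorConst t₀ c₂) := by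
    rcases h.2 with ⟨-, -, h⟩ | ⟨s, ⟨h, -⟩ | ⟨h, -⟩, -⟩
    exacts [h, absurd h h1.ne, absurd h h0.ne']
  exact (abs_sub _ _).trans (add_le_add (hI.abs_quantile_le hc₁ ht₀ hX hc) hg)

/-- The accuracy of trimmed means for `n ≥ A δ⁻¹ ε⁻²` and `m ≥ A ε⁻¹`. -/
theorem pi_trimmed_error_le_half {κ C P V₀ τ₁ A ε a b v : ℝ} (hκ : κ = α₂ - α₁)
    (hC : C = interiorConst t₀ c₂) (hτ₁ : τ₁ = κ / (32 * C * (3 * P + 8)))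
    (ht₀ : 0 < t₀) (hc₁ : 0 < c₁) (hc₂ : 0 < c₂)
    (h1 : RegularAt F α₁ η₁ t₀ c₁ c₂ β) (h2 : RegularAt F α₂ η₂ t₀ c₁ c₂ β)
    (hα0 : 0 ≤ α₁) (hα : α₁ < α₂) (hα2 : α₂ ≤ 1) (hX : MemLp (fun x : ℝ => x) 2 F)
    (hn : 1 ≤ n) (hm : 1 ≤ m) (hab : (a = 1 ∧ b = 0) ∨ (a = 0 ∧ b = 1))
    (hN : IsNoise m (mixedNoise m a b) v) (hP0 : 0 ≤ P)
    (hP1 : 0 < α₁ → α₁ < 1 → |η₁ - functional F α₁ α₂| ≤ P)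
    (hP2 : 0 < α₂ → α₂ < 1 → |η₂ - functional F α₁ α₂| ≤ P)
    (hV₀ : ∫ x, (x - functional F α₁ α₂) ^ 2 ∂F + v ≤ V₀)
    (hε : 0 < ε) (hε1 : 1 ≤ ε⁻¹) (hετ : 4 * (τ₁ * ε) ≤ t₀) (hετ1 : τ₁ * ε ≤ 1) (hδ : 0 < δ)
    (hδ1 : δ < 1)
    (hA1 : 1 ≤ A * τ₁) (hA2 : 2 * C ≤ A * (c₁ * τ₁)) (hA3 : 4 ≤ A * (c₁ * τ₁)) (hA4 : 4 ≤ A * κ)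
    (hA5 : 2048 * V₀ ≤ A * κ ^ 2) (hA6 : 32 ≤ A * (c₁ * τ₁) ^ 2)
    (hnA : A * (δ⁻¹ * ε⁻¹ ^ 2) ≤ n) (hmA : A * ε⁻¹ ≤ m) :
    (Measure.pi fun _ : Fin n => pointLaw F m).real
        {p | ε / 2 < |_root_.average (relevantIndices (fun i => pointMean (p i)) α₁ α₂)
          (fun i => (p i).1 + mixedNoise m a b (p i).2) - functional F α₁ α₂|} ≤ δ / 2 := by
  have hC0 : 0 < C := hC ▸ interiorConst_pos ht₀ hc₂
  have hκ0 : 0 < κ := by linarith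
  have hτ0 : 0 < τ₁ := by rw [hτ₁]; positivity
  have hn' : (0 : ℝ) < n := by positivity
  have hA0 : 0 < A := by
    by_contra h
    nlinarith
  have hab' : 0 ≤ a ∧ a ≤ 1 ∧ |b| ≤ 1 := by
    rcases hab with ⟨rfl, rfl⟩ | ⟨rfl, rfl⟩ <;> norm_num
  set x := ε⁻¹ with hxdef
  have hεx : ε * x = 1 := mul_inv_cancel₀ hε.ne'
  have hδi : 1 ≤ δ⁻¹ := (one_le_inv₀ hδ).2 hδ1.le
  have hnx : A * x ≤ n := by
    refine le_trans ?_ hnA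
    have : 1 * (x * 1) ≤ δ⁻¹ * (x * x) := by gcongr
    calc A * x = A * (1 * (x * 1)) := by ring
      _ ≤ A * (δ⁻¹ * (x * x)) := by gcongr
      _ = _ := by ring
  have hn1 : A ≤ n := le_trans (le_mul_of_one_le_right hA0.le hε1) hnx
  have hmul : ∀ k : ℝ, ∀ y : ℝ, A * x ≤ y → 0 ≤ k → A * (c₁ * τ₁) ≤ c₁ * (τ₁ * ε) * y := by
    intro k y hy _
    calc A * (c₁ * τ₁) = c₁ * (τ₁ * ε) * (A * x) := by
          rw [show c₁ * (τ₁ * ε) * (A * x) = A * (c₁ * τ₁) * (ε * x) by ring, hεx, mul_one]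
      _ ≤ _ := by gcongr
  have hnδ : A ≤ n * ε ^ 2 * δ := by
    calc A = A * (δ⁻¹ * x ^ 2) * ε ^ 2 * δ := by
          rw [show A * (δ⁻¹ * x ^ 2) * ε ^ 2 * δ = A * (δ⁻¹ * δ) * (ε * x) ^ 2 by ring, hεx,
            inv_mul_cancel₀ hδ.ne']
          ring
      _ ≤ _ := by gcongr
  -- The choice `s = κ ε / 16` makes `8 s / κ = ε / 2`, and `τ₁` is the largest factor for which the
  -- bias at `t = τ₁ ε` stays below this `s`.
  have hmain := pi_trimmed_error_le (n := n) (m := m) (t := τ₁ * ε) (s := κ * ε / 16) ht₀ hc₁ hc₂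
    h1 h2 hα0 hα hα2 hX hn hm hab'.1 hab'.2.1 hab'.2.2 hN hP0 hP1 hP2 hV₀ (by positivity) hετ hετ1
    ?_ ?_ ?_ ?_ ?_
  · rw [← hκ] at hmain
    have e : 8 * (κ * ε / 16) / κ = ε / 2 := by field_simp; ring
    rw [e] at hmain
    refine hmain.trans ?_
    have b1 : V₀ / (n * (κ * ε / 16) ^ 2) ≤ δ / 8 := by
      rw [div_le_iff₀ (by positivity)]
      have : A * κ ^ 2 ≤ n * ε ^ 2 * δ * κ ^ 2 := by gcongr
      calc V₀ ≤ A * κ ^ 2 / 2048 := by linarith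
        _ ≤ n * ε ^ 2 * δ * κ ^ 2 / 2048 := by gcongr
        _ = _ := by ring
    -- Since `n` already grows like `1/δ` for Chebyshev, the crude bound `exp (-y) ≤ 1 / y` is
    -- enough here.
    have b2 : Real.exp (-(n * (c₁ * (τ₁ * ε)) ^ 2 / 2)) ≤ δ / 16 := by
      refine (exp_neg_le_inv (by positivity)).trans ?_
      rw [div_le_iff₀ (by positivity)]
      have : A * (c₁ * τ₁) ^ 2 ≤ n * ε ^ 2 * δ * (c₁ * τ₁) ^ 2 := by gcongr
      calc (1 : ℝ) ≤ A * (c₁ * τ₁) ^ 2 / 32 := by linarith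
        _ ≤ n * ε ^ 2 * δ * (c₁ * τ₁) ^ 2 / 32 := by gcongr
        _ = _ := by ring
    linarith
  · calc (1 : ℝ) ≤ A * τ₁ := hA1
      _ = τ₁ * ε * (A * x) := by
          rw [show τ₁ * ε * (A * x) = A * τ₁ * (ε * x) by ring, hεx, mul_one]
      _ ≤ _ := by gcongr
  · rw [← hC]; exact hA2.trans (hmul 0 m hmA le_rfl)
  · exact hA3.trans (hmul 0 n hnx le_rfl)
  · rw [← hκ, mul_comm]
    exact hA4.trans (by gcongr)
  · rw [← hC, hτ₁]
    refine le_of_eq ?_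
    have : 0 < 3 * P + 8 := by positivity
    field_simp
    norm_num

omit F in
omit [IsProbabilityMeasure F] in
theorem trimmed_case (hα0 : 0 ≤ α₁) (hα : α₁ < α₂) (hα2 : α₂ ≤ 1)
    (ht₀ : 0 < t₀) (hc₀ : 0 < c₀) (hc₁ : 0 < c₁) (hc₂ : 0 < c₂) (hβ : 0 < β) :
    ∃ A : ℝ, 0 < A ∧ ∀ B : ℝ, A ≤ B → ∃ (C ε₀ : ℝ) (D : ℝ → ℝ), 0 < C ∧ 0 < ε₀ ∧ ε₀ < 1 ∧
    ∀ F : Measure ℝ, IsProbabilityMeasure F → QuantileRegular F α₁ t₀ c₁ c₂ β →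
      QuantileRegular F α₂ t₀ c₁ c₂ β → Integrable (fun x : ℝ => x ^ 2) F → ∫ x, x ^ 2 ∂F ≤ c₀ →
    ∀ (ε δ : ℝ) (n m : ℕ), 0 < ε → ε < ε₀ → 0 < δ → δ < 1 →
      InBand A B (δ⁻¹ * ε⁻¹ ^ 2) n → InBand A B (ε⁻¹ * Real.log ε⁻¹) m →
      IsPAC (sampleLaw F n m) (fun ω => offlineEstimator α₁ α₂ (observation ω))
        (functional F α₁ α₂) (ε / 2) (δ / 2) ∧
      IsPAC (sampleLaw F n m) (fun ω => onlineEstimator α₁ α₂ δ ω) (functional F α₁ α₂) ε δ ∧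
      expectedSamples F α₁ α₂ δ n m
        ≤ ENNReal.ofReal C * (n : ℝ≥0∞) * gapExpectation F α₁ α₂ δ n m ∧
      (0 < α₁ → α₂ < 1 → expectedSamples F α₁ α₂ δ n m
        ≤ ENNReal.ofReal (D δ * ε ^ (-(5 / 2) : ℝ) * Real.log (1 / ε) ^ 2)) := by
  have hI0 := interiorConst_pos ht₀ hc₂
  set CI := interiorConst t₀ c₂ with hCI
  set K := sampleConst t₀ c₁ c₂ β with hK
  have hK0 : 0 < K := sampleConst_pos ht₀ hc₁ hc₂
  obtain ⟨κ, hκ⟩ : ∃ κ, κ = α₂ - α₁ := ⟨_, rfl⟩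
  have hκ0 : 0 < κ := by linarith
  obtain ⟨G, hG⟩ : ∃ G, G = (1 + c₀) / κ := ⟨_, rfl⟩
  have hG0 : 0 < G := by rw [hG]; positivity
  obtain ⟨P, hP⟩ : ∃ P, P = (1 + c₀ + t₀) / (c₁ * t₀) + G := ⟨_, rfl⟩
  have hP0 : 0 < P := by rw [hP]; positivity
  obtain ⟨V₀, hV₀⟩ : ∃ V₀, V₀ = 2 * c₀ + 2 * G ^ 2 + 1 := ⟨_, rfl⟩
  obtain ⟨τ₁, hτ₁⟩ : ∃ τ₁, τ₁ = κ / (32 * CI * (3 * P + 8)) := ⟨_, rfl⟩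
  have hτ0 : 0 < τ₁ := by rw [hτ₁]; positivity
  obtain ⟨A, hAall⟩ : ∃ A : ℝ, 1 / τ₁ ≤ A ∧ 2 * CI / (c₁ * τ₁) ≤ A ∧ 4 / (c₁ * τ₁) ≤ A ∧
      4 / κ ≤ A ∧ 2048 * V₀ / κ ^ 2 ≤ A ∧ 32 / (c₁ * τ₁) ^ 2 ≤ A ∧ 1 ≤ A := by
    have := Filter.eventually_atTop.1 (((((((Filter.eventually_ge_atTop (1 / τ₁)).and
      (Filter.eventually_ge_atTop (2 * CI / (c₁ * τ₁)))).and
      (Filter.eventually_ge_atTop (4 / (c₁ * τ₁)))).and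
      (Filter.eventually_ge_atTop (4 / κ))).and
      (Filter.eventually_ge_atTop (2048 * V₀ / κ ^ 2))).and
      (Filter.eventually_ge_atTop (32 / (c₁ * τ₁) ^ 2))).and
      (Filter.eventually_ge_atTop (1 : ℝ)))
    obtain ⟨A, hA⟩ := this
    obtain ⟨⟨⟨⟨⟨⟨h1, h2⟩, h3⟩, h4⟩, h5⟩, h6⟩, h7⟩ := hA A le_rfl
    exact ⟨A, h1, h2, h3, h4, h5, h6, h7⟩
  obtain ⟨hA1, hA2, hA3, hA4, hA5, hA6, hA7⟩ := hAall
  have hA0 : 0 < A := by linarith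
  refine ⟨A, hA0, fun B hB => ?_⟩
  have hB0 : 0 < B := by linarith
  -- The single threshold `e` on `1/ε` encodes both `τ₁ ε ≤ 1` and `4 τ₁ ε ≤ t₀`.
  obtain ⟨ε₀, h0, h1, hε₀⟩ := exists_pos_of_eventually (eventually_small (A := A) (B := B)
    (r := ratioBound c₁ (t₀ / 2)) (N := (50 : ℝ) ^ (25 / 2 : ℝ)) (e := τ₁ + 4 * τ₁ / t₀) hA0 hB0
    (ratioBound_pos hc₁ (by positivity)))
  refine ⟨K, ε₀, fun δ => K * (B * δ⁻¹) *
    (|Real.log (B * δ⁻¹ / δ)| + 2) * (1 + 8 * CI * (4 * B) ^ (1 / 2 : ℝ)), hK0, h0, h1,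
    fun F _ hF1 hF2 hXi hXc ε δ n m hε hεε hδ hδ1 hn hm => ?_⟩
  have hX : MemLp (fun x : ℝ => x) 2 F :=
    (memLp_two_iff_integrable_sq measurable_id.aestronglyMeasurable).2 hXi
  obtain ⟨η₁, hη₁⟩ := hF1.exists_regularAt ht₀ hc₁ hc₂ hβ hα0 (hα.le.trans hα2)
  obtain ⟨η₂, hη₂⟩ := hF2.exists_regularAt ht₀ hc₁ hc₂ hβ (hα0.trans hα.le) hα2
  obtain ⟨hx, ht, hsmall⟩ := hε₀ ε hε hεε
  have hg : |functional F α₁ α₂| ≤ G := by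
    rw [hG, hκ]; exact abs_functional_le hX hXc hη₁ hη₂ hα0 hα hα2
  set x := ε⁻¹ with hxdef
  have hx0 : 0 < x := by positivity
  have hεx : ε * x = 1 := mul_inv_cancel₀ hε.ne'
  have hlx : 1 ≤ Real.log x := (Real.le_log_iff_exp_le hx0).2 hx
  have hx2 : 2 ≤ x := by linarith [Real.exp_one_gt_d9]
  have hδi : 1 ≤ δ⁻¹ := (one_le_inv₀ hδ).2 hδ1.le
  have hnA : A * x ^ 2 ≤ n := by
    refine le_trans ?_ hn.1
    gcongr
    exact le_mul_of_one_le_left (by positivity) hδi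
  obtain ⟨hmn, hratio, hlarge⟩ := hsmall n m hnA hm.2
  have h50 : (50 : ℝ) ≤ n := by
    refine le_trans ?_ hlarge
    conv_lhs => rw [← Real.rpow_one (50 : ℝ)]
    exact Real.rpow_le_rpow_of_exponent_le (by norm_num) (by norm_num)
  have hn3 : 50 ≤ n := by exact_mod_cast h50
  have hmA : A * x ≤ m := by
    refine le_trans ?_ hm.1
    gcongr
    exact le_mul_of_one_le_right hx0.le hlx
  have hm2 : 2 ≤ m := by
    have : (2 : ℝ) ≤ m := by
      calc (2 : ℝ) ≤ x := hx2
        _ ≤ A * x := le_mul_of_one_le_left hx0.le hA7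
        _ ≤ m := hmA
    exact_mod_cast this
  have hE := expectedSamples_le_of_regularAt (n := n) (m := m) ht₀ hc₁ hc₂ hβ hα.le hα2 hη₁ hη₂
    (by omega) hm2 hδ hδ1 hmn hratio hlarge
  have hετ : τ₁ * ε + 4 * τ₁ / t₀ * ε ≤ 1 := by
    calc τ₁ * ε + 4 * τ₁ / t₀ * ε = ε * (τ₁ + 4 * τ₁ / t₀) := by ring
      _ ≤ ε * x := by gcongr
      _ = 1 := hεx
  have hετ1 : τ₁ * ε ≤ 1 := by
    have : 0 < 4 * τ₁ / t₀ * ε := by positivity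
    linarith
  have hετ2 : 4 * (τ₁ * ε) ≤ t₀ := by
    have h3 : 4 * τ₁ / t₀ * ε ≤ 1 := by
      have : 0 < τ₁ * ε := by positivity
      linarith
    have h4 : 4 * τ₁ / t₀ * ε = 4 * (τ₁ * ε) / t₀ := by ring
    rwa [h4, div_le_one ht₀] at h3
  obtain ⟨hp1, hp2⟩ := isPAC_trimmed (F := F) (g := functional F α₁ α₂) hα hα2 hε
    (show 1 ≤ n by omega) hm2 hδ hδ1 fun a b v hab hN hv =>
      pi_trimmed_error_le_half (V₀ := V₀) hκ hCI hτ₁ ht₀ hc₁ hc₂ hη₁ hη₂ hα0 hα hα2 hX (by omega)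
        (by omega) hab hN hP0.le
        (fun h h' => hP ▸ hη₁.abs_sub_functional_le hc₁ ht₀ hX hXc hg h h')
        (fun h h' => hP ▸ hη₂.abs_sub_functional_le hc₁ ht₀ hX hXc hg h h')
        (by have := integral_sub_sq_le hX hXc hg; rw [hV₀]; linarith)
        hε (by linarith) hετ2 hετ1 hδ hδ1 ((div_le_iff₀ hτ0).1 hA1)
        ((div_le_iff₀ (by positivity)).1 hA2) ((div_le_iff₀ (by positivity)).1 hA3)
        ((div_le_iff₀ hκ0).1 hA4) ((div_le_iff₀ (by positivity)).1 hA5)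
        ((div_le_iff₀ (by positivity)).1 hA6) hn.1 hmA
  refine ⟨hp1, hp2, hE, fun hα0' hα2' => ?_⟩
  have hI1 : InteriorRegular F α₁ η₁ c₁ (t₀ / 2) CI := by
    rcases hη₁.2 with ⟨-, -, h⟩ | ⟨s, ⟨h, -⟩ | ⟨h, -⟩, -⟩
    exacts [h, absurd h (hα.trans hα2').ne, absurd h hα0'.ne']
  have hI2 : InteriorRegular F α₂ η₂ c₁ (t₀ / 2) CI := by
    rcases hη₂.2 with ⟨-, -, h⟩ | ⟨s, ⟨h, -⟩ | ⟨h, -⟩, -⟩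
    exacts [h, absurd h hα2'.ne, absurd h (hα0'.trans hα).ne']
  have hrate := expectedSamples_le_rate_interior (L := Real.log x) (N := B * δ⁻¹)
    (frontier_relevantSet hα.le hη₁.1 hη₂.1) hI1 hI2 hK0.le hB0
    (by positivity) hδ hδ1 hx hlx (by omega) (by omega)
    (by rw [mul_assoc]; exact hn.2) hm.2 hE
  refine hrate.trans (le_of_eq ?_)
  rw [Real.rpow_neg hε.le, ← Real.inv_rpow hε.le, one_div ε, ← pow_two]

end TrimmedCase

/-! ### Choice of `n` and `m` for the maximum and the minimum -/

section ExtremeCase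

variable {n m : ℕ} {δ α t₀ c₁ c₂ β : ℝ}

/-- The exponent `max β 2 - β` is `2 - β` below the critical value, where the innermost shell
dominates, and `0` above it, where the sum converges; at `β = 2` the number of shells contributes
`log x`. -/
theorem exists_gapExpectation_rate {C B : ℝ} (β : ℝ) (hC : 0 ≤ C) (hB : 1 ≤ B) :
    ∃ R : ℝ, 0 ≤ R ∧ ∀ (F : Measure ℝ) [IsProbabilityMeasure F] (α δ x : ℝ) (n m : ℕ),
      (∀ s, 0 < s → F {x | Metric.infEDist x (frontier (relevantSet F α α)) ≤
        ENNReal.ofReal s} ≤ ENNReal.ofReal (C * s ^ β)) → Real.exp 1 ≤ x →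
      0 ≤ Real.log (n / δ) → (m : ℝ) ≤ 2 * B * x ^ 2 * Real.log (n / δ) →
      (β ≠ 2 → gapExpectation F α α δ n m ≤
        ENNReal.ofReal (Real.log (n / δ) * (R * x ^ (max β 2 - β)))) ∧
      (β = 2 → gapExpectation F α α δ n m ≤
        ENNReal.ofReal (Real.log (n / δ) * (R * Real.log x))) := by
  have hx0 : ∀ {x : ℝ}, Real.exp 1 ≤ x → 1 ≤ x := fun h => by
    linarith [Real.exp_one_gt_d9]
  have hy : ∀ {x : ℝ}, Real.exp 1 ≤ x → 1 ≤ 2 * B * x ^ 2 := fun h => by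
    have := hx0 h
    exact one_le_mul_of_one_le_of_one_le (by linarith) (one_le_pow₀ this)
  rcases lt_trichotomy β 2 with h | h | h
  · have hq : (0 : ℝ) < 2 ^ (2 - β) - 1 := by
      have : (1 : ℝ) < 2 ^ (2 - β) := Real.one_lt_rpow (by norm_num) (by linarith)
      linarith
    refine ⟨1 + 4 * C * ((8 * B) ^ (1 - β / 2) / (2 ^ (2 - β) - 1)), by positivity,
      fun F _ α δ x n m hmass hx hl hm => ⟨fun _ => ?_, fun h' => absurd h' h.ne⟩⟩
    refine (gapExpectation_le_of_lt_two hC hmass hl (hy hx) hm h).trans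
      (ENNReal.ofReal_le_ofReal (mul_le_mul_of_nonneg_left ?_ hl))
    have h1 := hx0 hx
    have hpow : (4 * (2 * B * x ^ 2)) ^ (1 - β / 2) = (8 * B) ^ (1 - β / 2) * x ^ (2 - β) := by
      rw [show 4 * (2 * B * x ^ 2) = (8 * B) * x ^ (2 : ℝ) by rw [Real.rpow_two]; ring,
        Real.mul_rpow (by positivity) (by positivity), ← Real.rpow_mul (by linarith)]
      congr 2; ring
    have hx1 : 1 ≤ x ^ (2 - β) := Real.one_le_rpow h1 (by linarith)
    rw [hpow, max_eq_right h.le, add_mul, one_mul]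
    refine add_le_add hx1 (le_of_eq ?_)
    ring
  · refine ⟨1 + 4 * C * (3 + |Real.log (2 * B)|), by positivity,
      fun F _ α δ x n m hmass hx hl hm => ⟨fun h' => absurd h h', fun _ => ?_⟩⟩
    refine (gapExpectation_le_of_eq_two hC hmass hl (hy hx) hm h).trans
      (ENNReal.ofReal_le_ofReal (mul_le_mul_of_nonneg_left ?_ hl))
    have hxp : 0 < x := by linarith [hx0 hx]
    have hlx : 1 ≤ Real.log x := (Real.le_log_iff_exp_le hxp).2 hx
    have h1 : 1 + Real.log (2 * B * x ^ 2) ≤ (3 + |Real.log (2 * B)|) * Real.log x := by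
      rw [Real.log_mul (by positivity) (by positivity), Real.log_pow]
      have h2 := le_abs_self (Real.log (2 * B))
      have h3 := le_mul_of_one_le_right (abs_nonneg (Real.log (2 * B))) hlx
      push_cast
      linarith
    calc 1 + 4 * C * (1 + Real.log (2 * B * x ^ 2))
        ≤ Real.log x + 4 * C * ((3 + |Real.log (2 * B)|) * Real.log x) := by gcongr
      _ = _ := by ring
  · have hq : (0 : ℝ) < 1 - 2 ^ (2 - β) := by
      have : (2 : ℝ) ^ (2 - β) < 1 :=
        Real.rpow_lt_one_of_one_lt_of_neg (by norm_num) (by linarith)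
      linarith
    refine ⟨1 + 4 * C * (1 / (1 - 2 ^ (2 - β))), by positivity,
      fun F _ α δ x n m hmass hx hl hm => ⟨fun _ => ?_, fun h' => absurd h' h.ne'⟩⟩
    refine (gapExpectation_le_of_two_lt hC hmass hl (hy hx) hm h).trans (le_of_eq ?_)
    rw [max_eq_left h.le, sub_self, Real.rpow_zero, mul_one]

/-- Up to the factor `log(n/δ)`, `m` is at most quadratic in `x`, whereas `n` is at least a power
`x^β`, so `log x` is controlled by `log(n/δ)`. This bounds the number of rounds even when `m`
exceeds `n`. -/
theorem log_le_mul_log_div {A B x : ℝ} (hA : 0 < A) (hB : 1 ≤ B) (hβ : 0 < β)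
    (hx : Real.exp 1 ≤ x) (hδ : 0 < δ) (hδ1 : δ < 1) (hn : A * x ^ β ≤ n) (hm1 : 1 ≤ m)
    (hl : 1 ≤ Real.log (n / δ)) (hm : (m : ℝ) ≤ 2 * B * x ^ 2 * Real.log (n / δ)) :
    Real.log m ≤ (|Real.log (2 * B)| + 2 / β * (1 + |Real.log A|) + 1) * Real.log (n / δ) := by
  have hx0 : 0 < x := (Real.exp_pos 1).trans_le hx
  set l := Real.log (n / δ) with hldef
  have hn0 : (0 : ℝ) < n := lt_of_lt_of_le (by positivity) hn
  have hm0 : (0 : ℝ) < m := by positivity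
  have h1 : Real.log m ≤ Real.log (2 * B) + 2 * Real.log x + Real.log l := by
    refine (Real.log_le_log hm0 hm).trans (le_of_eq ?_)
    rw [Real.log_mul (by positivity) (by positivity), Real.log_mul (by positivity) (by positivity),
      Real.log_pow]
    push_cast; ring
  have h2 : Real.log A + β * Real.log x ≤ l := by
    rw [← Real.log_rpow hx0, ← Real.log_mul hA.ne' (by positivity)]
    refine Real.log_le_log (by positivity) (hn.trans ?_)
    rw [le_div_iff₀ hδ]
    exact mul_le_of_le_one_right hn0.le hδ1.le
  have h3 : Real.log l ≤ l := by
    linarith [Real.log_le_sub_one_of_pos (show 0 < l by linarith)]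
  have h4 : 2 * Real.log x ≤ 2 / β * (1 + |Real.log A|) * l := by
    rw [div_mul_eq_mul_div, div_mul_eq_mul_div, le_div_iff₀ hβ]
    have := neg_abs_le (Real.log A)
    have := le_mul_of_one_le_right (abs_nonneg (Real.log A)) hl
    linarith
  have h5 : Real.log (2 * B) ≤ |Real.log (2 * B)| * l :=
    (le_abs_self _).trans (le_mul_of_one_le_right (abs_nonneg _) hl)
  linarith

/-- With `t = ε / 4`, the lower bound `16 ≤ A` gives noise exponent `2 log(2n/δ)` and hence total
failure `δ² / (2n) ≤ δ / 4` over all points. The factor `4^β` in `hAc` undoes `(ε/4)^β`, so that no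
close point exists with probability at most `(δ/2)² ≤ δ / 4`. -/
theorem pi_extremum_error_le {F : Measure ℝ} [IsProbabilityMeasure F] {s η c C A ε : ℝ}
    (hs : (α = 1 ∧ s = 1) ∨ (α = 0 ∧ s = -1)) (hF : ExtremeRegular F s η t₀ c C β)
    (hc : 0 < c) (hA : 16 ≤ A) (hAc : 4 * 4 ^ β ≤ A * c) (hn : 3 ≤ n) (hm : 1 ≤ m) (hε : 0 < ε)
    (hεt : ε ≤ t₀) (hδ : 0 < δ) (hδ1 : δ < 1) (hnA : A * (Real.log (2 / δ) * ε ^ (-β)) ≤ n)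
    (hmA : A * (Real.log (2 * n / δ) * ε⁻¹ ^ 2) ≤ m) :
    (Measure.pi fun _ : Fin n => pointLaw F m).real
      {p | ε / 2 < |empQuantile (fun i => pointMean (p i)) α - η|} ≤ δ / 2 := by
  have h := pi_extreme_error_le (n := n) (m := m) hs hF (by omega) hm (t := ε / 4) (by positivity)
    (by linarith)
  rw [show 2 * (ε / 4) = ε / 2 by ring] at h
  refine h.trans ?_
  have hn3 : (3 : ℝ) ≤ n := by exact_mod_cast hn
  have hlog2 := half_le_log_two_div hδ hδ1
  have hlogn : 0 ≤ Real.log (2 * n / δ) := Real.log_nonneg (by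
    rw [le_div_iff₀ hδ]; linarith)
  have h1 : 2 * Real.log (2 * n / δ) ≤ m * (ε / 2) ^ 2 / 2 := by
    have h2 : A * (Real.log (2 * n / δ) * ε⁻¹ ^ 2) * (ε / 2) ^ 2 / 2 ≤ m * (ε / 2) ^ 2 / 2 := by
      gcongr
    have h3 : A * (Real.log (2 * n / δ) * ε⁻¹ ^ 2) * (ε / 2) ^ 2 / 2 =
        A * Real.log (2 * n / δ) / 8 := by
      field_simp; ring
    rw [h3] at h2
    have : 16 * Real.log (2 * n / δ) ≤ A * Real.log (2 * n / δ) := by gcongr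
    linarith
  have h2 : 2 * Real.log (2 / δ) ≤ n * (c * (ε / 4) ^ β / 2) := by
    have h3 : A * (Real.log (2 / δ) * ε ^ (-β)) * (c * (ε / 4) ^ β / 2) ≤
        n * (c * (ε / 4) ^ β / 2) := by gcongr
    have hε' : (ε : ℝ) ^ β ≠ 0 := by positivity
    have h4 : A * (Real.log (2 / δ) * ε ^ (-β)) * (c * (ε / 4) ^ β / 2) =
        A * c * Real.log (2 / δ) / (2 * 4 ^ β) := by
      rw [Real.rpow_neg hε.le, Real.div_rpow hε.le (by norm_num)]
      field_simp
    rw [h4] at h3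
    refine le_trans ?_ h3
    rw [le_div_iff₀ (by positivity)]
    have : 4 * 4 ^ β * Real.log (2 / δ) ≤ A * c * Real.log (2 / δ) := by gcongr
    linarith
  have e1 : Real.exp (-(m * (ε / 2) ^ 2) / 2) ≤ (2 * n / δ)⁻¹ ^ 2 := by
    rw [← exp_neg_two_mul_log (by positivity), neg_div]
    gcongr
  have e2 : Real.exp (-(n * (c * (ε / 4) ^ β / 2))) ≤ (2 / δ)⁻¹ ^ 2 := by
    rw [← exp_neg_two_mul_log (by positivity)]
    gcongr
  have e3 : n * (2 * (2 * n / δ)⁻¹ ^ 2) = δ ^ 2 / (2 * n) := by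
    field_simp
  have e4 : δ ^ 2 / (2 * n) ≤ δ / 4 := by
    rw [div_le_div_iff₀ (by positivity) (by norm_num)]
    nlinarith
  have e5 : (n : ℝ) * (2 * Real.exp (-(m * (ε / 2) ^ 2) / 2)) ≤ n * (2 * (2 * n / δ)⁻¹ ^ 2) := by
    gcongr
  rw [inv_div] at e2
  nlinarith

theorem extremum_case (hα : α = 0 ∨ α = 1) (ht₀ : 0 < t₀) (hc₁ : 0 < c₁) (hc₂ : 0 < c₂)
    (hβ : 0 < β) :
    ∃ A : ℝ, 0 < A ∧ ∀ B : ℝ, A ≤ B → ∃ (C ε₀ : ℝ) (D : ℝ → ℝ), 0 < C ∧ 0 < ε₀ ∧ ε₀ < 1 ∧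
    ∀ F : Measure ℝ, IsProbabilityMeasure F → QuantileRegular F α t₀ c₁ c₂ β →
    ∀ (ε δ : ℝ) (n m : ℕ), 0 < ε → ε < ε₀ → 0 < δ → δ < 1 →
      InBand A B (Real.log (2 / δ) * ε ^ (-β)) n →
      InBand A B (Real.log (2 * (n : ℝ) / δ) * ε⁻¹ ^ 2) m →
      IsPAC (sampleLaw F n m) (fun ω => offlineEstimator α α (observation ω))
        (functional F α α) (ε / 2) (δ / 2) ∧
      IsPAC (sampleLaw F n m) (fun ω => onlineEstimator α α δ ω) (functional F α α) ε δ ∧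
      expectedSamples F α α δ n m
        ≤ ENNReal.ofReal C * (n : ℝ≥0∞) * gapExpectation F α α δ n m ∧
      (β ≠ 2 → expectedSamples F α α δ n m
        ≤ ENNReal.ofReal (D δ * ε ^ (-(max β 2)) * Real.log (1 / ε))) ∧
      (β = 2 → expectedSamples F α α δ n m
        ≤ ENNReal.ofReal (D δ * ε ^ (-(max β 2)) * Real.log (1 / ε) ^ 2)) := by
  have hα0 : 0 ≤ α := by rcases hα with h | h <;> linarith
  have hα1 : α ≤ 1 := by rcases hα with h | h <;> linarith
  have hE0 : 0 < extremeConst t₀ c₂ β := extremeConst_pos ht₀ hc₂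
  set CE := extremeConst t₀ c₂ β with hCE
  have h4 : 0 < 4 * 4 ^ β / c₁ := by positivity
  refine ⟨16 + 4 * 4 ^ β / c₁, by positivity, fun B hB => ?_⟩
  set A := 16 + 4 * 4 ^ β / c₁ with hA
  have hA16 : 16 ≤ A := by linarith
  have hAc : 4 * 4 ^ β ≤ A * c₁ := by rw [← div_le_iff₀ hc₁]; linarith
  have hB1 : 1 ≤ B := by linarith
  obtain ⟨R, hR0, hR⟩ := exists_gapExpectation_rate β hE0.le hB1
  -- This is the constant of `log_le_mul_log_div` for the lower bound `n ≥ (A/2) x^β`; the threshold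
  -- on `x` below depends on it.
  set a := |Real.log (2 * B)| + 2 / β * (1 + |Real.log (A * (1 / 2))|) + 1 with ha
  have ha0 : 0 < a := by positivity
  set κ := (2 * B) ^ (β / 2) / (A * (1 / 2)) with hκ
  have hκ0 : 0 ≤ κ := by positivity
  set K := (33 * (4 + a) + 1) / (c₁ * t₀ ^ β * min 1 (t₀ ^ 2)⁻¹) + 132 * (4 + a) +
    (1 + gapConst t₀ c₁ CE β) * κ / c₁ with hK
  have hK0 : 0 < K := by
    have hG := gapConst_nonneg (β := β) ht₀ hc₁ hE0
    have : 0 < min 1 (t₀ ^ 2)⁻¹ := lt_min one_pos (by positivity)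
    positivity
  have hev : ∀ᶠ x : ℝ in Filter.atTop, Real.exp 1 ≤ x ∧ t₀⁻¹ ≤ x ∧
      max 3 ((50 * a) ^ (25 / 2 : ℝ)) ≤ A * (1 / 2) * x ^ β :=
    (Filter.eventually_ge_atTop _).and ((Filter.eventually_ge_atTop _).and
      (((tendsto_rpow_atTop hβ).const_mul_atTop (show 0 < A * (1 / 2) by positivity)).eventually_ge_atTop
        _))
  obtain ⟨ε₀, h0, h1, hε₀⟩ := exists_pos_of_eventually hev
  refine ⟨K, ε₀, fun δ => K * (B * Real.log (2 / δ)) *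
    (|Real.log (B * Real.log (2 / δ) / δ)| + β) * R, hK0, h0, h1,
    fun F _ hF ε δ n m hε hεε hδ hδ1 hn hm => ?_⟩
  obtain ⟨η, hη⟩ := hF.exists_regularAt ht₀ hc₁ hc₂ hβ hα0 hα1
  obtain ⟨s, hs, hX⟩ : ∃ s : ℝ, ((α = 1 ∧ s = 1) ∨ (α = 0 ∧ s = -1)) ∧
      ExtremeRegular F s η t₀ c₁ CE β := by
    rcases hη.2 with ⟨h, h', -⟩ | h
    · rcases hα with rfl | rfl
      exacts [absurd h (lt_irrefl _), absurd h' (lt_irrefl _)]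
    · exact h
  have hs' : s = 1 ∨ s = -1 := hs.imp And.right And.right
  obtain ⟨hx, ht, hlarge⟩ := hε₀ ε hε hεε
  set x := ε⁻¹ with hxdef
  have hx0 : 0 < x := by positivity
  have hεx : ε * x = 1 := mul_inv_cancel₀ hε.ne'
  have hlx : 1 ≤ Real.log x := (Real.le_log_iff_exp_le hx0).2 hx
  have hεβ : ∀ b : ℝ, ε ^ (-b) = x ^ b := fun b => by
    rw [Real.rpow_neg hε.le, ← Real.inv_rpow hε.le]
  have hεt : ε ≤ t₀ := (inv_le_inv₀ ht₀ hε).1 ht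
  have hlog2 := half_le_log_two_div hδ hδ1
  have hnA : A * (1 / 2) * x ^ β ≤ n := by
    refine le_trans ?_ hn.1
    rw [hεβ, mul_assoc]; gcongr
  have hn3' : (3 : ℝ) ≤ n := (le_max_left _ _).trans (hlarge.trans hnA)
  have hn3 : 3 ≤ n := by exact_mod_cast hn3'
  have hl : 1 ≤ Real.log (n / δ) := by
    rw [Real.le_log_iff_exp_le (by positivity), le_div_iff₀ hδ]
    have := Real.exp_one_lt_d9
    nlinarith [Real.exp_pos 1]
  have hl2 : Real.log (2 * n / δ) = Real.log 2 + Real.log (n / δ) := by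
    rw [mul_div_assoc, Real.log_mul (by norm_num) (by positivity)]
  have hlog2' := Real.log_two_gt_d9
  have hlog2'' := Real.log_two_lt_d9
  have hl3 : 1 ≤ Real.log (2 * n / δ) := by linarith
  have hm2 : 2 ≤ m := by
    have h3 : (2 : ℝ) ≤ m := by
      refine le_trans ?_ hm.1
      have hx1 : 1 ≤ x ^ 2 := one_le_pow₀ (by linarith [Real.exp_one_gt_d9])
      calc (2 : ℝ) ≤ 16 * (1 * 1) := by norm_num
        _ ≤ A * (Real.log (2 * n / δ) * x ^ 2) := by
          gcongr
    exact_mod_cast h3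
  have hmB : (m : ℝ) ≤ 2 * B * x ^ 2 * Real.log (n / δ) := by
    refine hm.2.trans ?_
    calc B * (Real.log (2 * n / δ) * x ^ 2) ≤ B * ((2 * Real.log (n / δ)) * x ^ 2) := by
          gcongr; linarith
      _ = _ := by ring
  have hma : Real.log m ≤ a * Real.log (n / δ) :=
    log_le_mul_log_div (by positivity) hB1 hβ hx hδ hδ1 hnA (by omega) hl hmB
  have hr1 : 1 ≤ √(2 * B) := Real.one_le_sqrt.2 (by linarith)
  have hsq : √(2 * B) ^ 2 = 2 * B := Real.sq_sqrt (by linarith)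
  have hE : expectedSamples F α α δ n m ≤
      ENNReal.ofReal K * (n : ℝ≥0∞) * gapExpectation F α α δ n m := by
    -- This radius is chosen so that `m t² ≤ log(n/δ)`, given `m ≤ 2 B ε⁻² log(n/δ)`. The constant
    -- `κ` is then what `n t^β` needs to reach `1`, given `n ≥ (A/2) ε^(-β)`.
    refine expectedSamples_le_of_extremeRegular (t := ε / √(2 * B)) ht₀ hc₁ hE0 hβ hs hη.1 hX hn3
      hm2 hδ hδ1 ha0 hma ((le_max_right _ _).trans (hlarge.trans hnA)) (by positivity)
      ((div_le_self hε.le hr1).trans hεt) ?_ hκ0 ?_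
    · rw [div_pow, hsq, mul_div_assoc', div_le_iff₀ (by positivity)]
      calc m * ε ^ 2 ≤ 2 * B * x ^ 2 * Real.log (n / δ) * ε ^ 2 := by gcongr
        _ = Real.log (n / δ) * (2 * B) * (ε * x) ^ 2 := by ring
        _ = _ := by rw [hεx]; ring
    · have e1 : (ε / √(2 * B)) ^ β = (x ^ β)⁻¹ * ((2 * B) ^ (β / 2))⁻¹ := by
        rw [Real.div_rpow hε.le (by positivity), Real.sqrt_eq_rpow, ← Real.rpow_mul (by positivity),
          ← Real.inv_rpow hx0.le, hxdef, inv_inv, div_eq_mul_inv]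
        congr 3; ring
      have e2 : 1 = κ * (A * (1 / 2) * x ^ β) * ((x ^ β)⁻¹ * ((2 * B) ^ (β / 2))⁻¹) := by
        rw [hκ]; field_simp
      rw [e1]
      calc (1 : ℝ) = κ * (A * (1 / 2) * x ^ β) * ((x ^ β)⁻¹ * ((2 * B) ^ (β / 2))⁻¹) := e2
        _ ≤ _ := by gcongr
  rw [functional_self hη.1]
  obtain ⟨hp1, hp2⟩ := isPAC_quantile hε (by omega) hm2 hδ hδ1 hα1
    (pi_extremum_error_le hs hX hc₁ hA16 hAc hn3 (by omega) hε hεt hδ hδ1 hn.1 hm.1)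
  have hnN : (n : ℝ) ≤ B * Real.log (2 / δ) * x ^ β := by
    rw [mul_assoc, ← hεβ]; exact hn.2
  have hlN := log_div_le (by positivity) hδ hx (by omega) hnN
  obtain ⟨hr1, hr2⟩ := hR F α δ x n m
    (fun u hu => measure_infEDist_le_extreme hs' (frontier_relevantSet le_rfl hη.1 hη.1) hX hu) hx
    (by linarith) hmB
  have hrate : ∀ g, 0 ≤ g → gapExpectation F α α δ n m ≤
      ENNReal.ofReal (Real.log (n / δ) * (R * g)) → expectedSamples F α α δ n m ≤
      ENNReal.ofReal (K * (B * Real.log (2 / δ)) *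
        (|Real.log (B * Real.log (2 / δ) / δ)| + β) * R * (x ^ β * g) * Real.log x) := by
    intro g hg0 hg
    refine hE.trans ((mul_le_mul_right hg _).trans ?_)
    rw [← ENNReal.ofReal_natCast, ← ENNReal.ofReal_mul hK0.le,
      ← ENNReal.ofReal_mul (by positivity)]
    refine ENNReal.ofReal_le_ofReal ?_
    calc _ ≤ K * (B * Real.log (2 / δ) * x ^ β) *
          ((|Real.log (B * Real.log (2 / δ) / δ)| + β) * Real.log x * (R * g)) := by gcongr
      _ = _ := by ring
  refine ⟨hp1, hp2, hE, fun h => ?_, fun h => ?_⟩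
  · refine (hrate _ (by positivity) (hr1 h)).trans (le_of_eq ?_)
    rw [hεβ, ← Real.rpow_add hx0, one_div, add_sub_cancel]
  · refine (hrate _ (by positivity) (hr2 h)).trans (le_of_eq ?_)
    rw [hεβ, one_div, max_eq_left h.ge]
    congr 1; ring

end ExtremeCase

theorem mainTheorem5 (α₁ α₂ : ℝ) (hα₁ : 0 ≤ α₁) (hα : α₁ ≤ α₂) (hα₂ : α₂ ≤ 1)
    (t₀ c₀ c₁ c₂ β : ℝ) (ht₀ : 0 < t₀) (hc₀ : 0 < c₀) (hc₁ : 0 < c₁) (hc₂ : 0 < c₂)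
    (hβ : 0 < β) :
    ∃ A : ℝ, 0 < A ∧ ∀ B : ℝ, A ≤ B →
    ∃ (C ε₀ : ℝ) (D : ℝ → ℝ), 0 < C ∧ 0 < ε₀ ∧ ε₀ < 1 ∧
    ∀ F : Measure ℝ, IsProbabilityMeasure F → RegularFor F α₁ α₂ t₀ c₀ c₁ c₂ β →
    ∃ K : ℝ,
    ∀ (ε δ : ℝ) (n m : ℕ), 0 < ε → ε < ε₀ → 0 < δ → δ < 1 →
      OfflineChoice A B α₁ α₂ β ε δ n m →
      -- `n` and `m` are admissible inputs
      IsPAC (sampleLaw F n m) (fun ω => offlineEstimator α₁ α₂ (observation ω))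
        (functional F α₁ α₂) (ε / 2) (δ / 2) ∧
      -- correctness of the algorithm
      IsPAC (sampleLaw F n m) (fun ω => onlineEstimator α₁ α₂ δ ω)
        (functional F α₁ α₂) ε δ ∧
      -- expected number of observations
      (¬ (α₁ = 0 ∧ α₂ = 1) →
        expectedSamples F α₁ α₂ δ n m
          ≤ ENNReal.ofReal C * (n : ℝ≥0∞) * gapExpectation F α₁ α₂ δ n m) ∧
      (α₁ = 0 ∧ α₂ = 1 →
        expectedSamples F α₁ α₂ δ n m ≤ ENNReal.ofReal C * (n : ℝ≥0∞) ∧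
        ((frontier (relevantSet F α₁ α₂)).Nonempty →
          expectedSamples F α₁ α₂ δ n m
            ≤ ENNReal.ofReal K * (n : ℝ≥0∞) * gapExpectation F α₁ α₂ δ n m)) ∧
      -- mean
      (α₁ = 0 ∧ α₂ = 1 →
        expectedSamples F α₁ α₂ δ n m ≤ ENNReal.ofReal (D δ * ε ^ (-2 : ℝ))) ∧
      -- median and other quantiles
      (α₁ = α₂ → 0 < α₁ → α₁ < 1 →
        expectedSamples F α₁ α₂ δ n m
          ≤ ENNReal.ofReal (D δ * ε ^ (-(5 / 2) : ℝ) * Real.log (1 / ε))) ∧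
      -- maximum and minimum
      (α₁ = α₂ → (α₁ = 0 ∨ α₁ = 1) →
        (β ≠ 2 → expectedSamples F α₁ α₂ δ n m
          ≤ ENNReal.ofReal (D δ * ε ^ (-(max β 2)) * Real.log (1 / ε))) ∧
        (β = 2 → expectedSamples F α₁ α₂ δ n m
          ≤ ENNReal.ofReal (D δ * ε ^ (-(max β 2)) * Real.log (1 / ε) ^ 2))) ∧
      -- trimmed mean
      (0 < α₁ → α₁ < α₂ → α₂ < 1 →
        expectedSamples F α₁ α₂ δ n m
          ≤ ENNReal.ofReal (D δ * ε ^ (-(5 / 2) : ℝ) * Real.log (1 / ε) ^ 2)) := by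
  by_cases hmean : α₁ = 0 ∧ α₂ = 1
  · obtain ⟨rfl, rfl⟩ := hmean
    obtain ⟨A, hA, h⟩ := mean_case hc₀
    refine ⟨A, hA, fun B hB => ?_⟩
    obtain ⟨C, ε₀, D, hC, h0, h1, hF⟩ := h B hB
    refine ⟨C, ε₀, D, hC, h0, h1, fun F hp hreg => ?_⟩
    obtain ⟨hL, hvar⟩ := hreg.1 ⟨rfl, rfl⟩
    obtain ⟨K, hK⟩ := hF F hp hL hvar
    refine ⟨K, fun ε δ n m hε hεε hδ hδ1 hch => ?_⟩
    obtain ⟨hn, hm1, hmB⟩ := hch.mean rfl rfl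
    obtain ⟨p1, p2, e1, e2, e3⟩ := hK ε δ n m hε hεε hδ hδ1 hn hm1 hmB
    exact ⟨p1, p2, fun h => absurd ⟨rfl, rfl⟩ h, fun _ => ⟨e1, e2⟩, fun _ => e3,
      fun h => absurd h zero_ne_one, fun h => absurd h zero_ne_one,
      fun h => absurd h (lt_irrefl _)⟩
  rcases hα.eq_or_lt with rfl | hlt
  · by_cases hext : α₁ = 0 ∨ α₁ = 1
    · obtain ⟨A, hA, h⟩ := extremum_case hext ht₀ hc₁ hc₂ hβ
      refine ⟨A, hA, fun B hB => ?_⟩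
      obtain ⟨C, ε₀, D, hC, h0, h1, hF⟩ := h B hB
      -- The constant depending on `F` occurs only in the bound for the mean, so any value serves
      -- here.
      refine ⟨C, ε₀, D, hC, h0, h1, fun F hp hreg => ⟨0, fun ε δ n m hε hεε hδ hδ1 hch => ?_⟩⟩
      obtain ⟨hn, hm⟩ := hch.extremum rfl hext
      obtain ⟨p1, p2, e1, e2⟩ := hF F hp (hreg.2 hmean).1 ε δ n m hε hεε hδ hδ1 hn hm
      refine ⟨p1, p2, fun _ => e1, fun h => absurd h hmean, fun h => absurd h hmean,
        fun _ h h' => ?_, fun _ _ => e2, fun _ h => absurd h (lt_irrefl _)⟩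
      rcases hext with hz | hz
      exacts [absurd hz h.ne', absurd hz h'.ne]
    · rw [not_or] at hext
      have hpos : 0 < α₁ := lt_of_le_of_ne hα₁ (Ne.symm hext.1)
      have hlt1 : α₁ < 1 := lt_of_le_of_ne hα₂ hext.2
      obtain ⟨A, hA, h⟩ := quantile_case hpos hlt1 ht₀ hc₁ hc₂ hβ
      refine ⟨A, hA, fun B hB => ?_⟩
      obtain ⟨C, ε₀, D, hC, h0, h1, hF⟩ := h B hB
      refine ⟨C, ε₀, D, hC, h0, h1, fun F hp hreg => ⟨0, fun ε δ n m hε hεε hδ hδ1 hch => ?_⟩⟩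
      obtain ⟨hn, hm⟩ := hch.quantile rfl hpos hlt1
      obtain ⟨p1, p2, e1, e2⟩ := hF F hp (hreg.2 hmean).1 ε δ n m hε hεε hδ hδ1 hn hm
      exact ⟨p1, p2, fun _ => e1, fun h => absurd h hmean, fun h => absurd h hmean,
        fun _ _ _ => e2, fun _ h => absurd h (not_or.2 hext), fun _ h => absurd h (lt_irrefl _)⟩
  · obtain ⟨A, hA, h⟩ := trimmed_case hα₁ hlt hα₂ ht₀ hc₀ hc₁ hc₂ hβ
    refine ⟨A, hA, fun B hB => ?_⟩
    obtain ⟨C, ε₀, D, hC, h0, h1, hF⟩ := h B hB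
    refine ⟨C, ε₀, D, hC, h0, h1, fun F hp hreg => ⟨0, fun ε δ n m hε hεε hδ hδ1 hch => ?_⟩⟩
    obtain ⟨hn, hm⟩ := hch.trimmed hlt.ne hmean
    obtain ⟨hr1, hr2, hr3⟩ := hreg.2 hmean
    obtain ⟨hXi, hXc⟩ := hr3 hlt.ne
    obtain ⟨p1, p2, e1, e2⟩ := hF F hp hr1 hr2 hXi hXc ε δ n m hε hεε hδ hδ1 hn hm
    exact ⟨p1, p2, fun _ => e1, fun h => absurd h hmean, fun h => absurd h hmean,
      fun h => absurd h hlt.ne, fun h => absurd h hlt.ne, fun h _ h' => e2 h h'⟩
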